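/- **Lemma 6.9.** Let $c_1>c_2>0$, let $\kappa>14$ be an integer, and let $g_0,g_1,g_2,h_0,\dots,h_3\in\mathbb R$ with $g_0=g_2=h_0=0$. Write $r=|x|$, $\langle s\rangle=(1+s^2)^{1/2}$, $\nabla=(\partial_1,\partial_2)$, $\nabla^\perp=(\partial_2,-\partial_1)$, $\partial\in\{\partial_t,\partial_1,\partial_2\}$. Let $T>0$ and let $U\in C_c^\infty([0,T]\times\mathbb R^2;\mathbb R^2)$ solve on $[0,T]\times\mathbb R^2$ $$\begin{aligned}&\partial_t^2U-c_2^2\Delta U-(c_1^2-c_2^2)\nabla(\nabla\cdot U)\\&=\nabla\big[g_0(\nabla\cdot U)^2+g_1(\nabla\cdot U)(\nabla^\perp\cdot U)+g_2(\nabla^\perp\cdot U)^2\big]\\&\quad+\nabla\big[h_0(\nabla\cdot U)^3+h_1(\nabla\cdot U)^2(\nabla^\perp\cdot U)+h_2(\nabla\cdot U)(\nabla^\perp\cdot U)^2+h_3(\nabla^\perp\cdot U)^3\big],\end{aligned}$$ with $U(0,\cdot)$ and $\partial_tU(0,\cdot)$ supported in compact subsets of the open disc $\{|x|<1\}$. Let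 $U^{cf}=-\nabla(-\Delta)^{-1}\nabla\cdot U$ and $U^{df}=-\nabla^\perp(-\Delta)^{-1}\nabla^\perp\cdot U$ be the curl-free and divergence-free parts of $U=U^{cf}+U^{df}$, where $(-\Delta)^{-1}f(x)=-\frac1{2\pi}\int_{\mathbb R^2}\log|y|\,f(x-y)\,dy$. For $\alpha\in\mathbb N^5$ let $\Gamma^\alpha=\partial_t^{\alpha_0}\partial_1^{\alpha_1}\partial_2^{\alpha_2}\tilde S^{\alpha_3}\tilde\Omega^{\alpha_4}$, acting on vector fields, where $\tilde S=t\partial_t+r\partial_r-1$, $\tilde\Omega=(x_2\partial_1-x_1\partial_2)I+\begin{pmatrix}0&-1\\1&0\end{pmatrix}$. At each time $t$ put $$E_k(U)=\tfrac12\sum_{|\alpha|\le k-1}\int_{\mathbb R^2}\big[|\partial_t\Gamma^\alpha U|^2+c_2^2|\nabla\Gamma^\alpha U|^2+(c_1^2-c_2^2)|\nabla\cdot\Gamma^\alpha U|^2\big]dx,$$ $$E_k(U^{df})=\tfrac12\sum_{|\alpha|\le k-1}\int_{\mathbb R^2}\big[|\partial_t\Gamma^\alpha U^{df}|^2+c_2^2|\nabla^\perp\cdot\Gamma^\alpha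 U^{df}|^2\big]dx,$$ $$\chi_k(U^{cf})=\sum_{|\alpha|\le k-2}\|\langle c_1t-r\rangle\partial\nabla\Gamma^\alpha U^{cf}\|_{L^2},\qquad\chi_k(U^{df})=\sum_{|\alpha|\le k-2}\|\langle c_2t-r\rangle\partial\nabla\Gamma^\alpha U^{df}\|_{L^2},$$ $\chi_k(U)=\chi_k(U^{cf})+\chi_k(U^{df})$, and, with $$\mathcal M_c(V)=\tfrac12\int_{\mathbb R^2}\Big[\big(t+\tfrac1c+1\big)|\partial_tV|^2+c^2\big(t+\tfrac1c+1\big)|\nabla V|^2+2r\partial_rV\cdot\partial_tV+V\cdot\partial_tV\Big]dx,$$ $$M_k(U^{cf})=\sum_{|\alpha|\le k-1}\mathcal M_{c_1}(\Gamma^\alpha U^{cf}),\qquad M_k(U^{df})=\sum_{|\alpha|\le k-2}\Big[\mathcal M_{c_2}(\Gamma^\alpha U^{df})+\sum_{\partial\in\{\partial_t,\partial_1,\partial_2\}}\mathcal M_{c_2}(\partial\Gamma^\alpha U^{df})\Big].$$ Then there are constants $\delta,C>0$, depending only on $\kappa,c_1,c_2$ and the coefficients $g_i,h_j$ (not on $T$,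 $U$ or $t$), such that at every time $t\in[0,T]$ at which $E_{[\kappa/2]+5}(U)\le\delta$ we have $$\chi_\kappa(U)\le C\Big(E_\kappa^{1/2}(U)+M_\kappa^{1/2}(U^{df})\big[E_{[\kappa/2]+5}^{1/2}(U)+\chi_{[\kappa/2]+5}(U)\big]+E_{[\kappa/2]+5}^{1/2}(U^{df})\,M_\kappa^{1/2}(U^{cf})\Big)$$ and $$\chi_\kappa(U^{df})\le C\,E_\kappa^{1/2}(U^{df}).$$ -/

import Mathlib

open scoped ContDiff

noncomputable section

namespace ElasticWave

/-- The plane `ℝ²` with its Euclidean norm, so that `r = ‖x‖`. -/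
abbrev Plane : Type := EuclideanSpace ℝ (Fin 2)

/-- Time-dependent vector fields `U(t, x) ∈ ℝ²`, for `(t, x) ∈ ℝ × ℝ²`. -/
abbrev VField : Type := ℝ → Plane → Plane

/-- Time-dependent scalar fields. -/
abbrev SField : Type := ℝ → Plane → ℝ

/-! ### Derivatives -/

section Derivatives

variable {F : Type} [NormedAddCommGroup F] [NormedSpace ℝ F]

/-- `∂_t u`. -/
def dt (u : ℝ → Plane → F) : ℝ → Plane → F :=
  fun t x => deriv (fun s => u s x) t

/-- The spatial derivative `∂_{i+1} u` (`i = 0, 1`). -/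
def dx (i : Fin 2) (u : ℝ → Plane → F) : ℝ → Plane → F :=
  fun t x => fderiv ℝ (u t) x (EuclideanSpace.single i 1)

/-- The space-time derivatives: `∂_0 = ∂_t`, `∂_1`, `∂_2`. -/
def d (a : Fin 3) (u : ℝ → Plane → F) : ℝ → Plane → F :=
  Fin.cases (dt u) (fun i => dx i u) a

/-- The Laplacian in the space variables. -/
def lap (u : ℝ → Plane → F) : ℝ → Plane → F :=
  fun t x => ∑ i, dx i (dx i u) t x

/-- `r ∂_r u = x_1 ∂_1 u + x_2 ∂_2 u`. -/
def rdr (u : ℝ → Plane → F) : ℝ → Plane → F :=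
  fun t x => ∑ i, x i • dx i u t x

/-- The scaling field `S = t ∂_t + r ∂_r`. -/
def scal (u : ℝ → Plane → F) : ℝ → Plane → F :=
  fun t x => t • dt u t x + rdr u t x

/-- The rotation field `Ω = x_2 ∂_1 - x_1 ∂_2`. -/
def rot (u : ℝ → Plane → F) : ℝ → Plane → F :=
  fun t x => x 1 • dx 0 u t x - x 0 • dx 1 u t x

end Derivatives

/-- `∇ q = (∂_1 q, ∂_2 q)`. -/
def grad (q : SField) : VField := fun t x => !₂[dx 0 q t x, dx 1 q t x]

/-- `∇^⊥ q = (∂_2 q, -∂_1 q)`. -/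
def gradPerp (q : SField) : VField := fun t x => !₂[dx 1 q t x, -dx 0 q t x]

/-- `∇ · U = ∂_1 U_1 + ∂_2 U_2`. -/
def div (U : VField) : SField := fun t x => dx 0 U t x 0 + dx 1 U t x 1

/-- `∇^⊥ · U = ∂_2 U_1 - ∂_1 U_2`. -/
def curl (U : VField) : SField := fun t x => dx 1 U t x 0 - dx 0 U t x 1

/-! ### The vector fields `Γ = (∂_t, ∂_1, ∂_2, S̃, Ω̃)` acting on vector-valued functions -/

/-- `S̃ = S - 1`. -/
def scalMod (U : VField) : VField := fun t x => scal U t x - U t x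

/-- `Ω̃ = Ω I + O`, where `O (a, b) = (-b, a)`. -/
def rotMod (U : VField) : VField := fun t x => rot U t x + !₂[-(U t x 1), U t x 0]

/-- `Γ^α = ∂_t^{α_0} ∂_1^{α_1} ∂_2^{α_2} S̃^{α_3} Ω̃^{α_4}` for a multi-index `α ∈ ℕ⁵`. -/
def Gam (α : Fin 5 → ℕ) (U : VField) : VField :=
  dt^[α 0] ((dx 0)^[α 1] ((dx 1)^[α 2] (scalMod^[α 3] (rotMod^[α 4] U))))

/-- The multi-indices `α ∈ ℕ⁵` with `|α| ≤ N`. -/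
def multiIndices (N : ℕ) : Finset (Fin 5 → ℕ) :=
  (Fintype.piFinset fun _ => Finset.range (N + 1)).filter fun α => ∑ j, α j ≤ N

/-! ### Helmholtz decomposition -/

/-- `(-Δ)⁻¹ f`, the Newtonian (logarithmic) potential in the plane. -/
def negLapInv (f : Plane → ℝ) : Plane → ℝ :=
  fun x => -(2 * Real.pi)⁻¹ * ∫ y : Plane, Real.log ‖y‖ * f (x - y)

/-- The curl-free part `U^{cf} = -∇ (-Δ)⁻¹ ∇ · U`. -/
def cf (U : VField) : VField :=
  fun t x => -grad (fun s => negLapInv (div U s)) t x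

/-- The divergence-free part `U^{df} = -∇^⊥ (-Δ)⁻¹ ∇^⊥ · U`. -/
def df (U : VField) : VField :=
  fun t x => -gradPerp (fun s => negLapInv (curl U s)) t x

/-! ### Energies -/

/-- The Japanese bracket `⟨s⟩ = (1 + s²)^{1/2}`. -/
def bracket (s : ℝ) : ℝ := Real.sqrt (1 + s ^ 2)

/-- `E_κ(U)` at time `t`. -/
def energy (c₁ c₂ : ℝ) (κ : ℕ) (U : VField) (t : ℝ) : ℝ :=
  (1 / 2) * ∑ α ∈ multiIndices (κ - 1), ∫ x : Plane,
    (‖dt (Gam α U) t x‖ ^ 2 + c₂ ^ 2 * ∑ i, ‖dx i (Gam α U) t x‖ ^ 2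
      + (c₁ ^ 2 - c₂ ^ 2) * (div (Gam α U) t x) ^ 2)

/-- `E_κ(V)` at time `t`, for the divergence-free part `V = U^{df}`. -/
def energyDf (c₂ : ℝ) (κ : ℕ) (V : VField) (t : ℝ) : ℝ :=
  (1 / 2) * ∑ α ∈ multiIndices (κ - 1), ∫ x : Plane,
    (‖dt (Gam α V) t x‖ ^ 2 + c₂ ^ 2 * (curl (Gam α V) t x) ^ 2)

/-- `∑_{|α| ≤ κ - 2} ‖⟨c t - r⟩ ∂ ∇ Γ^α V‖_{L²}` at time `t`. This is `χ_κ(U^{cf})` for `c = c₁`,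
`V = U^{cf}`, and `χ_κ(U^{df})` for `c = c₂`, `V = U^{df}`. -/
def chiPart (c : ℝ) (κ : ℕ) (V : VField) (t : ℝ) : ℝ :=
  ∑ α ∈ multiIndices (κ - 2), Real.sqrt (∫ x : Plane,
    bracket (c * t - ‖x‖) ^ 2 * ∑ a, ∑ i, ‖d a (dx i (Gam α V)) t x‖ ^ 2)

/-- `χ_κ(U) = χ_κ(U^{cf}) + χ_κ(U^{df})` at time `t`. -/
def chi (c₁ c₂ : ℝ) (κ : ℕ) (U : VField) (t : ℝ) : ℝ :=
  chiPart c₁ κ (cf U) t + chiPart c₂ κ (df U) t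

/-- The first-order Morawetz type energy with speed `c`, at time `t`. -/
def morawetz (c : ℝ) (V : VField) (t : ℝ) : ℝ :=
  (1 / 2) * ∫ x : Plane,
    ((t + 1 / c + 1) * ‖dt V t x‖ ^ 2 + c ^ 2 * (t + 1 / c + 1) * ∑ i, ‖dx i V t x‖ ^ 2
      + 2 * inner ℝ (rdr V t x) (dt V t x) + inner ℝ (V t x) (dt V t x))

/-- `M_κ(V)` at time `t`, for the curl-free part `V = U^{cf}`: all `Γ^α` with `|α| ≤ κ - 1`. -/
def morawetzCf (c₁ : ℝ) (κ : ℕ) (V : VField) (t : ℝ) : ℝ :=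
  ∑ α ∈ multiIndices (κ - 1), morawetz c₁ (Gam α V) t

/-- `M_κ(V)` at time `t`, for the divergence-free part `V = U^{df}`: all `Γ^α` and `∂ Γ^α` with
`|α| ≤ κ - 2`, where `∂ ∈ {∂_t, ∂_1, ∂_2}`. -/
def morawetzDf (c₂ : ℝ) (κ : ℕ) (V : VField) (t : ℝ) : ℝ :=
  ∑ α ∈ multiIndices (κ - 2),
    (morawetz c₂ (Gam α V) t + ∑ a, morawetz c₂ (d a (Gam α V)) t)

/-! ### The elastic system -/

/-- The quadratic and cubic nonlinearity, whose gradient is the right-hand side of the system. -/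
def nonlin (g : Fin 3 → ℝ) (h : Fin 4 → ℝ) (U : VField) : SField := fun t x =>
  g 0 * div U t x ^ 2 + g 1 * (div U t x * curl U t x) + g 2 * curl U t x ^ 2
    + (h 0 * div U t x ^ 3 + h 1 * (div U t x ^ 2 * curl U t x)
      + h 2 * (div U t x * curl U t x ^ 2) + h 3 * curl U t x ^ 3)

/-- `U` is a smooth, compactly supported solution on `[0, T] × ℝ²` of the admissible harmonic
elastic wave system with wave speeds `c₁`, `c₂` and coefficients `g`, `h`, whose initial data
`U(0, ·)`, `∂_t U(0, ·)` are supported in a compact subset of the open unit disc. A function of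
class `C_c^∞` on the closed slab `[0, T] × ℝ²` is represented by an extension of it of class
`C_c^∞` on `ℝ × ℝ²`; the equation is imposed on the slab only, and for `0 < T` all derivatives at
times in `[0, T]` depend only on the restriction to the slab. -/
structure IsSolution (c₁ c₂ : ℝ) (g : Fin 3 → ℝ) (h : Fin 4 → ℝ) (T : ℝ) (U : VField) :
    Prop where
  smooth : ContDiff ℝ ∞ fun p : ℝ × Plane => U p.1 p.2
  compact : HasCompactSupport fun p : ℝ × Plane => U p.1 p.2
  eqn : ∀ t ∈ Set.Icc 0 T, ∀ x : Plane,
    dt (dt U) t x - c₂ ^ 2 • lap U t x - (c₁ ^ 2 - c₂ ^ 2) • grad (div U) t x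
      = grad (nonlin g h U) t x
  data_zero : tsupport (U 0) ⊆ Metric.ball 0 1
  data_one : tsupport (dt U 0) ⊆ Metric.ball 0 1

end ElasticWave

end

/-!
The divergence `v = ∇ · U` and the curl `w = ∇^⊥ · U` of a solution satisfy scalar wave equations
with the speeds `c₁` and `c₂`. Since `g₀ = g₂ = h₀ = 0`, every term of the nonlinearity contains a
factor `w`, so that `□₁ v = Δ(w G)` with a polynomial `G` in `v`, `w`, while `□₂ w = 0`. The
curl-free and divergence-free parts of `U` are `-∇φ` and `-∇^⊥ψ`, where `φ = (-Δ)⁻¹ v` and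
`ψ = (-Δ)⁻¹ w` are Newtonian potentials, and the vector fields `Γ^α` acting on `U` become the fields
`Z^α = ∂_t^{α₀} ∂₁^{α₁} ∂₂^{α₂} S^{α₃} Ω^{α₄}` acting on `v` and `w` (`Gam_vec`, `Gam_cfOf`,
`Gam_dfOf`). All quantities of the theorem are therefore expressed by potentials of the functions
`Z^α v`, `Z^α w`. These are divergences of compactly supported fields (`IsDiv`), so that their
potentials decay and all integrations by parts are justified.

The Klainerman-Sideris estimate (`klainerman_sideris`, `XN_le`) bounds the weighted norm
`‖⟨ct - r⟩ ∂∇∇φ‖` by the energy and `t ‖∇□φ‖`. For `ψ` the last term vanishes, which is the second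
claim (`XN_slow_le`). For `φ` one has `□φ = -w G`, and `t ‖∇ Z^α (w G)‖` has to be estimated. As `w`
vanishes for `r > c₂ t + 1` by finite speed of propagation (`finite_speed`), only the interior of
the slow cone matters, where `⟨c₁ t - r⟩` is of size `1 + t`. There the low order factors are
estimated by weighted Sobolev inequalities (`low_order_decay`):
`|w|² ≲ (1 + t)⁻¹ E(w)`, `|v|² ≲ (1 + t)⁻¹ (1 + r)⁻¹ (E + χ²)`. The high order factors carry the
remaining powers of `t`. For `w` this is possible because the Morawetz energy controls
`|w|²` with the weight `(1 + t) / (1 + r)` in the cone (`slow_le_MD`), and for `v` because the Morawetz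
energy of the fast cone controls `|v|²` with the weight `1 + t` inside the slow cone (`fast_le_MD`);
these lower bounds rest on a Hardy inequality with the weight `(c t + 1)² - r²` (`hardy`,
`morawetz_lower`). When the derivative in `∇ Z^α (w G)` falls on a high order factor `v`, the result is
`E(w)` times the weighted norm of `φ` itself (`source_le`), and it is absorbed if the energy is
small (`XN_fast_le`).

Spatially and temporally smooth functions form the ring `Fld`, on which `∂_t`, `∂₁`, `∂₂`, `S` and `Ω`
are derivations; identities between differential operators are identities in this ring.
-/

open scoped ContDiff
open MeasureTheory Set Filter Topology

noncomputable section

set_option linter.unusedSimpArgs false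

namespace ElasticWave

/-! ### The algebra of smooth space-time functions -/

/-- The algebra of smooth real functions on space-time `ℝ × ℝ²`, in curried form. -/
def smoothFields : Subalgebra ℝ (ℝ → Plane → ℝ) where
  carrier := {u | ContDiff ℝ ∞ fun p : ℝ × Plane => u p.1 p.2}
  mul_mem' := fun {a b} (ha : ContDiff ℝ ∞ fun p : ℝ × Plane => a p.1 p.2)
    (hb : ContDiff ℝ ∞ fun p : ℝ × Plane => b p.1 p.2) =>
    show ContDiff ℝ ∞ fun p : ℝ × Plane => a p.1 p.2 * b p.1 p.2 from ha.mul hb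
  add_mem' := fun {a b} (ha : ContDiff ℝ ∞ fun p : ℝ × Plane => a p.1 p.2)
    (hb : ContDiff ℝ ∞ fun p : ℝ × Plane => b p.1 p.2) =>
    show ContDiff ℝ ∞ fun p : ℝ × Plane => a p.1 p.2 + b p.1 p.2 from ha.add hb
  algebraMap_mem' := fun c =>
    show ContDiff ℝ ∞ fun _ : ℝ × Plane => c from contDiff_const

/-- Smooth space-time functions, as a type. -/
def Fld : Type := smoothFields

instance : CommRing Fld := inferInstanceAs (CommRing smoothFields)
instance : Algebra ℝ Fld := inferInstanceAs (Algebra ℝ smoothFields)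

/-- A smooth function as an element of the algebra. -/
def Fld.mk (u : ℝ → Plane → ℝ) (h : ContDiff ℝ ∞ fun p : ℝ × Plane => u p.1 p.2) : Fld :=
  (⟨u, h⟩ : smoothFields)

/-- The underlying function. -/
def Fld.val (u : Fld) : ℝ → Plane → ℝ := Subtype.val (p := (· ∈ smoothFields)) u

instance : CoeFun Fld (fun _ => ℝ → Plane → ℝ) := ⟨Fld.val⟩

theorem Fld.smooth (u : Fld) : ContDiff ℝ ∞ fun p : ℝ × Plane => u p.1 p.2 :=
  Subtype.property (p := (· ∈ smoothFields)) u

@[ext] theorem Fld.ext' {u v : Fld} (h : ∀ t x, u t x = v t x) : u = v :=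
  Subtype.ext (p := (· ∈ smoothFields)) (funext fun t => funext fun x => h t x)

@[simp] theorem add_ap (u v : Fld) (t : ℝ) (x : Plane) : (u + v) t x = u t x + v t x := rfl
@[simp] theorem sub_ap (u v : Fld) (t : ℝ) (x : Plane) : (u - v) t x = u t x - v t x := rfl
@[simp] theorem neg_ap (u : Fld) (t : ℝ) (x : Plane) : (-u) t x = -u t x := rfl
@[simp] theorem mul_ap (u v : Fld) (t : ℝ) (x : Plane) : (u * v) t x = u t x * v t x := rfl
@[simp] theorem smul_ap (c : ℝ) (u : Fld) (t : ℝ) (x : Plane) : (c • u) t x = c * u t x := rfl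
@[simp] theorem pow_ap (u : Fld) (n : ℕ) (t : ℝ) (x : Plane) : (u ^ n) t x = u t x ^ n := rfl
@[simp] theorem zero_ap (t : ℝ) (x : Plane) : (0 : Fld) t x = 0 := rfl
@[simp] theorem one_ap (t : ℝ) (x : Plane) : (1 : Fld) t x = 1 := rfl
@[simp] theorem ofNat_ap (n : ℕ) [n.AtLeastTwo] (t : ℝ) (x : Plane) :
    (ofNat(n) : Fld) t x = OfNat.ofNat n := rfl
@[simp] theorem algebraMap_ap (c : ℝ) (t : ℝ) (x : Plane) :
    (algebraMap ℝ Fld c) t x = c := rfl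
@[simp] theorem mk_ap (u : ℝ → Plane → ℝ) (h : ContDiff ℝ ∞ fun p : ℝ × Plane => u p.1 p.2)
    (t : ℝ) (x : Plane) : Fld.mk u h t x = u t x := rfl
@[simp] theorem sum_ap {ι : Type*} (s : Finset ι) (u : ι → Fld) (t : ℝ) (x : Plane) :
    (∑ i ∈ s, u i) t x = ∑ i ∈ s, u i t x := by
  classical
  induction s using Finset.induction_on with
  | empty => simp
  | insert a s ha ih => rw [Finset.sum_insert ha, Finset.sum_insert ha, add_ap, ih]

/-- The coordinate directions `e_0 = ∂_t`, `e_1`, `e_2` of space-time. -/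
def dir (a : Fin 3) : ℝ × Plane :=
  Fin.cases (1, 0) (fun i => (0, EuclideanSpace.single i 1)) a

theorem d_eq_fderiv {F : Type} [NormedAddCommGroup F] [NormedSpace ℝ F] {u : ℝ → Plane → F}
    (hu : ContDiff ℝ ∞ fun p : ℝ × Plane => u p.1 p.2) (a : Fin 3) (t : ℝ) (x : Plane) :
    d a u t x = fderiv ℝ (fun p : ℝ × Plane => u p.1 p.2) (t, x) (dir a) := by
  have hd : HasFDerivAt (fun p : ℝ × Plane => u p.1 p.2)
      (fderiv ℝ (fun p : ℝ × Plane => u p.1 p.2) (t, x)) (t, x) :=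
    ((hu.differentiable (by simp)) (t, x)).hasFDerivAt
  refine Fin.cases ?_ (fun i => ?_) a
  · have h1 : HasDerivAt (fun s : ℝ => (s, x)) ((1 : ℝ), (0 : Plane)) t :=
      (hasDerivAt_id t).prodMk (hasDerivAt_const t x)
    exact (hd.comp_hasDerivAt t h1).deriv
  · have h1 : HasFDerivAt (fun y : Plane => (t, y)) (ContinuousLinearMap.inr ℝ ℝ Plane) x :=
      hasFDerivAt_prodMk_right t x
    have h2 := (hd.comp x h1).fderiv
    change fderiv ℝ (fun y => u t y) x _ = _
    rw [show (fun y => u t y) = (fun p : ℝ × Plane => u p.1 p.2) ∘ (fun y : Plane => (t, y)) from rfl,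
      h2]
    simp [dir]

theorem contDiff_d {F : Type} [NormedAddCommGroup F] [NormedSpace ℝ F] {u : ℝ → Plane → F}
    (hu : ContDiff ℝ ∞ fun p : ℝ × Plane => u p.1 p.2) (a : Fin 3) :
    ContDiff ℝ ∞ fun p : ℝ × Plane => d a u p.1 p.2 := by
  simp_rw [d_eq_fderiv hu]
  exact (hu.fderiv_right (m := ∞) (by simp)).clm_apply contDiff_const

theorem Fld.diffAt (u : Fld) (p : ℝ × Plane) :
    DifferentiableAt ℝ (fun p : ℝ × Plane => u p.1 p.2) p :=
  (u.smooth.differentiable (by simp)) p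

/-- The derivations `D 0 = ∂_t`, `D 1 = ∂_1`, `D 2 = ∂_2` of the algebra of smooth functions. -/
def D (a : Fin 3) : Derivation ℝ Fld Fld :=
  Derivation.mk'
    { toFun := fun u => Fld.mk (d a u) (contDiff_d u.smooth a)
      map_add' := fun u v => by
        ext t x
        change d a (u + v) t x = d a u t x + d a v t x
        rw [d_eq_fderiv (u + v).smooth, d_eq_fderiv u.smooth, d_eq_fderiv v.smooth]
        exact congrArg (fun L => L (dir a)) (fderiv_add (u.diffAt (t, x)) (v.diffAt (t, x)))
      map_smul' := fun c u => by
        ext t x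
        change d a (c • u) t x = c * d a u t x
        rw [d_eq_fderiv (c • u).smooth, d_eq_fderiv u.smooth]
        exact congrArg (fun L => L (dir a)) (fderiv_const_smul (u.diffAt (t, x)) c) }
    (fun u v => by
      ext t x
      change d a (u * v) t x = u t x * d a v t x + v t x * d a u t x
      rw [d_eq_fderiv (u * v).smooth, d_eq_fderiv u.smooth, d_eq_fderiv v.smooth]
      exact congrArg (fun L => L (dir a)) (fderiv_mul (u.diffAt (t, x)) (v.diffAt (t, x))))

theorem D_ap (a : Fin 3) (u : Fld) (t : ℝ) (x : Plane) :
    D a u t x = fderiv ℝ (fun p : ℝ × Plane => u p.1 p.2) (t, x) (dir a) :=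
  d_eq_fderiv u.smooth a t x

theorem D_comm (a b : Fin 3) (u : Fld) : D a (D b u) = D b (D a u) := by
  have key : ∀ (a b : Fin 3) (t : ℝ) (x : Plane), D a (D b u) t x =
      fderiv ℝ (fderiv ℝ (fun p : ℝ × Plane => u p.1 p.2)) (t, x) (dir a) (dir b) := by
    intro a b t x
    rw [D_ap]
    have : (fun p : ℝ × Plane => D b u p.1 p.2) =
        fun p => fderiv ℝ (fun p : ℝ × Plane => u p.1 p.2) p (dir b) := by
      funext p; rw [D_ap]
    rw [this, fderiv_clm_apply]
    · simp
    · exact ((u.smooth.fderiv_right (m := ∞) (by simp)).differentiable (by simp)) _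
    · exact differentiableAt_const _
  ext t x
  rw [key, key]
  have hs : IsSymmSndFDerivAt ℝ (fun p : ℝ × Plane => u p.1 p.2) (t, x) :=
    u.smooth.contDiffAt.isSymmSndFDerivAt (by
    simp only [minSmoothness_of_isRCLikeNormedField]
    exact WithTop.coe_le_coe.2 (le_top : (2 : ℕ∞) ≤ ⊤))
  exact hs _ _

/-- The time coordinate. -/
def Tm : Fld := Fld.mk (fun t _ => t) contDiff_fst

/-- The space coordinates. -/
def X (i : Fin 2) : Fld := Fld.mk (fun _ x => x i) <| by
  have : ContDiff ℝ ∞ (fun p : ℝ × Plane => (EuclideanSpace.proj i : Plane →L[ℝ] ℝ) p.2) :=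
    (EuclideanSpace.proj i : Plane →L[ℝ] ℝ).contDiff.comp contDiff_snd
  exact this

@[simp] theorem Tm_ap (t : ℝ) (x : Plane) : Tm t x = t := rfl
@[simp] theorem X_ap (i : Fin 2) (t : ℝ) (x : Plane) : X i t x = x i := rfl

theorem D_zero_ap (u : Fld) (t : ℝ) (x : Plane) : D 0 u t x = deriv (fun s => u s x) t := rfl

theorem D_succ_ap (i : Fin 2) (u : Fld) (t : ℝ) (x : Plane) :
    D i.succ u t x = fderiv ℝ (u t) x (EuclideanSpace.single i 1) := rfl

@[simp] theorem D_zero_Tm : D 0 Tm = 1 := by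
  ext t x
  simp [D_zero_ap]

@[simp] theorem D_succ_Tm (i : Fin 2) : D i.succ Tm = 0 := by
  ext t x
  rw [D_succ_ap]
  have : Tm.val t = fun _ => t := rfl
  rw [this]; simp

@[simp] theorem D_one_Tm : D 1 Tm = 0 := D_succ_Tm 0
@[simp] theorem D_two_Tm : D 2 Tm = 0 := D_succ_Tm 1

@[simp] theorem D_zero_X (i : Fin 2) : D 0 (X i) = 0 := by
  ext t x
  simp [D_zero_ap]

theorem D_succ_X (i j : Fin 2) : D i.succ (X j) = if i = j then 1 else 0 := by
  ext t x
  rw [D_succ_ap]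
  have : (X j).val t = (EuclideanSpace.proj j : Plane →L[ℝ] ℝ) := rfl
  rw [this, ContinuousLinearMap.fderiv]
  fin_cases i <;> fin_cases j <;> simp

@[simp] theorem D_one_X_zero : D 1 (X 0) = 1 := D_succ_X 0 0
@[simp] theorem D_one_X_one : D 1 (X 1) = 0 := D_succ_X 0 1
@[simp] theorem D_two_X_zero : D 2 (X 0) = 0 := D_succ_X 1 0
@[simp] theorem D_two_X_one : D 2 (X 1) = 1 := D_succ_X 1 1

theorem D_comm_10 (u : Fld) : D 1 (D 0 u) = D 0 (D 1 u) := D_comm _ _ _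
theorem D_comm_20 (u : Fld) : D 2 (D 0 u) = D 0 (D 2 u) := D_comm _ _ _
theorem D_comm_21 (u : Fld) : D 2 (D 1 u) = D 1 (D 2 u) := D_comm _ _ _

theorem D_mul (a : Fin 3) (u v : Fld) : D a (u * v) = u * D a v + v * D a u := by
  rw [Derivation.leibniz, smul_eq_mul, smul_eq_mul]

@[simp] theorem D_algebraMap (a : Fin 3) (c : ℝ) : D a (algebraMap ℝ Fld c) = 0 :=
  Derivation.map_algebraMap _ _

@[simp] theorem D_ofNat (a : Fin 3) (n : ℕ) [n.AtLeastTwo] : D a (ofNat(n) : Fld) = 0 :=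
  (D a).map_natCast n

/-- The operator `r ∂_r`. -/
def Rd : Derivation ℝ Fld Fld := X 0 • D 1 + X 1 • D 2
/-- The scaling field `S = t ∂_t + r ∂_r` as a derivation. -/
def S : Derivation ℝ Fld Fld := Tm • D 0 + Rd
/-- The rotation field `Ω = x_2 ∂_1 - x_1 ∂_2` as a derivation. -/
def Om : Derivation ℝ Fld Fld := X 1 • D 1 - X 0 • D 2
/-- The Laplacian of smooth space-time functions. -/
def Lap : Fld →ₗ[ℝ] Fld :=
  (D 1 : Fld →ₗ[ℝ] Fld).comp (D 1 : Fld →ₗ[ℝ] Fld) + (D 2 : Fld →ₗ[ℝ] Fld).comp (D 2 : Fld →ₗ[ℝ] Fld)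
/-- The wave operator `∂_t² - c² Δ`. -/
def Box (c : ℝ) : Fld →ₗ[ℝ] Fld :=
  (D 0 : Fld →ₗ[ℝ] Fld).comp (D 0 : Fld →ₗ[ℝ] Fld) - (c ^ 2) • Lap
/-- The square of the radius. -/
def Rsq : Fld := X 0 ^ 2 + X 1 ^ 2

theorem Rd_def (u : Fld) : Rd u = X 0 * D 1 u + X 1 * D 2 u := rfl
theorem S_def (u : Fld) : S u = Tm * D 0 u + (X 0 * D 1 u + X 1 * D 2 u) := rfl
theorem Om_def (u : Fld) : Om u = X 1 * D 1 u - X 0 * D 2 u := rfl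
theorem Lap_def (u : Fld) : Lap u = D 1 (D 1 u) + D 2 (D 2 u) := rfl
theorem Box_def (c : ℝ) (u : Fld) : Box c u = D 0 (D 0 u) - (c ^ 2) • Lap u := rfl

theorem norm_sq_eq (x : Plane) : ‖x‖ ^ 2 = x 0 ^ 2 + x 1 ^ 2 := by
  rw [EuclideanSpace.norm_sq_eq]; simp

@[simp] theorem Rsq_ap (t : ℝ) (x : Plane) : Rsq t x = ‖x‖ ^ 2 := by
  rw [norm_sq_eq]; rfl

theorem D_S (a : Fin 3) (u : Fld) : D a (S u) = S (D a u) + D a u := by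
  fin_cases a <;>
  simp [S_def, D_mul, D_comm_10, D_comm_20, D_comm_21] <;> ring

theorem D_one_Om (u : Fld) : D 1 (Om u) = Om (D 1 u) - D 2 u := by
  simp [Om_def, D_mul, D_comm_10, D_comm_20, D_comm_21]; ring
theorem D_two_Om (u : Fld) : D 2 (Om u) = Om (D 2 u) + D 1 u := by
  simp [Om_def, D_mul, D_comm_10, D_comm_20, D_comm_21]; ring
theorem D_zero_Om (u : Fld) : D 0 (Om u) = Om (D 0 u) := by
  simp [Om_def, D_mul, D_comm_10, D_comm_20, D_comm_21]
theorem S_Om (u : Fld) : S (Om u) = Om (S u) := by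
  simp [Om_def, S_def, D_mul, D_comm_10, D_comm_20, D_comm_21]; ring

theorem Lap_S (u : Fld) : Lap (S u) = S (Lap u) + 2 * Lap u := by
  simp [Lap_def, D_S]; ring
theorem Lap_Rd (u : Fld) : Lap (Rd u) = Rd (Lap u) + 2 * Lap u := by
  simp [Rd_def, Lap_def, D_mul, D_comm_21]; ring
theorem Lap_Om (u : Fld) : Lap (Om u) = Om (Lap u) := by
  simp [Lap_def, D_one_Om, D_two_Om, D_comm_21]
theorem Lap_D (a : Fin 3) (u : Fld) : Lap (D a u) = D a (Lap u) := by
  simp only [Lap_def, map_add, D_comm _ a]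
theorem Box_D (c : ℝ) (a : Fin 3) (u : Fld) : Box c (D a u) = D a (Box c u) := by
  simp only [Box_def, Lap_D, D_comm _ a, map_sub, Derivation.map_smul]
theorem Box_S (c : ℝ) (u : Fld) : Box c (S u) = S (Box c u) + 2 * Box c u := by
  simp only [Box_def, Lap_S, D_S, map_sub, map_add, Derivation.map_smul, smul_add, smul_sub, mul_sub,
    mul_smul_comm]; ring
theorem Box_Om (c : ℝ) (u : Fld) : Box c (Om u) = Om (Box c u) := by
  simp only [Box_def, Lap_Om, D_zero_Om, map_sub, Derivation.map_smul]

/-! ### Spatial decay and integration by parts -/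

/-- `|u(t, x)| ≲ (1 + |x|)^{-k}` at the fixed time `t`, for an integer `k` of either sign. -/
def Dec (t : ℝ) (k : ℤ) (u : Fld) : Prop :=
  ∃ C : ℝ, ∀ x, |u t x| ≤ C * (1 + ‖x‖) ^ (-k)

theorem one_add_norm_pos (x : Plane) : 0 < 1 + ‖x‖ := by positivity

theorem Dec.nonneg {t : ℝ} {k : ℤ} {u : Fld} (h : Dec t k u) :
    ∃ C : ℝ, 0 ≤ C ∧ ∀ x, |u t x| ≤ C * (1 + ‖x‖) ^ (-k) := by
  obtain ⟨C, hC⟩ := h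
  refine ⟨|C|, abs_nonneg _, fun x => (hC x).trans ?_⟩
  have := one_add_norm_pos x
  gcongr
  exact le_abs_self C

theorem Dec.mono {t : ℝ} {k l : ℤ} {u : Fld} (h : Dec t k u) (hl : l ≤ k) : Dec t l u := by
  obtain ⟨C, hC0, hC⟩ := h.nonneg
  refine ⟨C, fun x => (hC x).trans ?_⟩
  gcongr
  linarith [norm_nonneg x]

theorem Dec.mul {t : ℝ} {k l : ℤ} {u v : Fld} (hu : Dec t k u) (hv : Dec t l v) :
    Dec t (k + l) (u * v) := by
  obtain ⟨C, hC0, hC⟩ := hu.nonneg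
  obtain ⟨C', hC0', hC'⟩ := hv.nonneg
  refine ⟨C * C', fun x => ?_⟩
  have := one_add_norm_pos x
  rw [mul_ap, abs_mul, neg_add, zpow_add₀ this.ne']
  calc _ ≤ (C * (1 + ‖x‖) ^ (-k)) * (C' * (1 + ‖x‖) ^ (-l)) := by
        gcongr
        exacts [hC x, hC' x]
    _ = _ := by ring

theorem Dec.mul' {t : ℝ} {k l m : ℤ} {u v : Fld} (hu : Dec t k u) (hv : Dec t l v)
    (h : m ≤ k + l) : Dec t m (u * v) := (hu.mul hv).mono h

theorem Dec.add {t : ℝ} {k : ℤ} {u v : Fld} (hu : Dec t k u) (hv : Dec t k v) :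
    Dec t k (u + v) := by
  obtain ⟨C, hC⟩ := hu
  obtain ⟨C', hC'⟩ := hv
  refine ⟨C + C', fun x => ?_⟩
  rw [add_ap, add_mul]
  exact (abs_add_le _ _).trans (add_le_add (hC x) (hC' x))

theorem Dec.smul {t : ℝ} {k : ℤ} {u : Fld} (c : ℝ) (hu : Dec t k u) : Dec t k (c • u) := by
  obtain ⟨C, hC⟩ := hu
  refine ⟨|c| * C, fun x => ?_⟩
  rw [smul_ap, abs_mul, mul_assoc]
  exact mul_le_mul_of_nonneg_left (hC x) (abs_nonneg c)

theorem Dec.neg {t : ℝ} {k : ℤ} {u : Fld} (hu : Dec t k u) : Dec t k (-u) := by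
  obtain ⟨C, hC⟩ := hu
  exact ⟨C, fun x => by rw [neg_ap, abs_neg]; exact hC x⟩

theorem Dec.sub {t : ℝ} {k : ℤ} {u v : Fld} (hu : Dec t k u) (hv : Dec t k v) :
    Dec t k (u - v) := by
  rw [sub_eq_add_neg]; exact hu.add hv.neg

theorem Dec.pow_two {t : ℝ} {k m : ℤ} {u : Fld} (hu : Dec t k u) (h : m ≤ 2 * k) :
    Dec t m (u ^ 2) := by
  rw [_root_.pow_two]; exact hu.mul' hu (by linarith)

theorem dec_of_bounded {t C : ℝ} {u : Fld} (h : ∀ x, |u t x| ≤ C) : Dec t 0 u :=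
  ⟨C, fun x => by simpa using h x⟩

theorem dec_const (t c : ℝ) : Dec t 0 (algebraMap ℝ Fld c) :=
  dec_of_bounded (C := |c|) fun x => by simp

theorem dec_one (t : ℝ) : Dec t 0 (1 : Fld) := by
  simpa using dec_const t 1

theorem dec_ofNat (t : ℝ) (n : ℕ) [n.AtLeastTwo] : Dec t 0 (OfNat.ofNat n : Fld) :=
  dec_of_bounded (C := |(OfNat.ofNat n : ℝ)|) fun x => by simp

theorem abs_coord_le (x : Plane) (i : Fin 2) : |x i| ≤ ‖x‖ := by
  have := PiLp.norm_apply_le x i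
  simpa using this

theorem dec_X (t : ℝ) (i : Fin 2) : Dec t (-1) (X i) :=
  ⟨1, fun x => by simpa using (abs_coord_le x i).trans (by linarith [norm_nonneg x])⟩

theorem Dec.X_mul {t : ℝ} {k m : ℤ} {u : Fld} (hu : Dec t k u) (i : Fin 2) (h : m + 1 ≤ k) :
    Dec t m (X i * u) := (dec_X t i).mul' hu (by linarith)

theorem Fld.continuous (u : Fld) (t : ℝ) : Continuous (u t) :=
  (u.smooth.continuous).comp (Continuous.prodMk_right t)

theorem Fld.contDiff (u : Fld) (t : ℝ) : ContDiff ℝ ∞ (u t) :=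
  u.smooth.comp (contDiff_prodMk_right t)

/-- The integral over `ℝ²` at time `t`. -/
def I (t : ℝ) (u : Fld) : ℝ := ∫ x : Plane, u t x

/-- Integrability over `ℝ²` at time `t`. -/
def Itg (t : ℝ) (u : Fld) : Prop := Integrable (u t) (volume : Measure Plane)

theorem integrable_one_add_norm_zpow :
    Integrable (fun x : Plane => (1 + ‖x‖) ^ (-3 : ℤ)) := by
  have := integrable_one_add_norm (E := Plane) (μ := volume) (r := 3) (by simp; norm_num)
  refine this.congr (ae_of_all _ fun x => ?_)
  have h := one_add_norm_pos x
  simp only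
  rw [← Real.rpow_intCast]; norm_num

theorem Dec.itg {t : ℝ} {k : ℤ} {u : Fld} (h : Dec t k u) (hk : 3 ≤ k) : Itg t u := by
  obtain ⟨C, hC⟩ := h.mono hk
  refine (integrable_one_add_norm_zpow.const_mul C).mono'
    (u.continuous t).aestronglyMeasurable (ae_of_all _ fun x => ?_)
  exact hC x

theorem I_add {t : ℝ} {u v : Fld} (hu : Itg t u) (hv : Itg t v) : I t (u + v) = I t u + I t v :=
  integral_add hu hv
theorem I_sub {t : ℝ} {u v : Fld} (hu : Itg t u) (hv : Itg t v) : I t (u - v) = I t u - I t v :=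
  integral_sub hu hv
theorem I_neg (t : ℝ) (u : Fld) : I t (-u) = -I t u := integral_neg _
theorem I_smul (t c : ℝ) (u : Fld) : I t (c • u) = c * I t u := integral_const_mul _ _
theorem Itg.add {t : ℝ} {u v : Fld} (hu : Itg t u) (hv : Itg t v) : Itg t (u + v) :=
  Integrable.add hu hv
theorem Itg.sub {t : ℝ} {u v : Fld} (hu : Itg t u) (hv : Itg t v) : Itg t (u - v) :=
  Integrable.sub hu hv
theorem Itg.neg {t : ℝ} {u : Fld} (hu : Itg t u) : Itg t (-u) := Integrable.neg hu
theorem Itg.smul {t : ℝ} {u : Fld} (c : ℝ) (hu : Itg t u) : Itg t (c • u) :=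
  Integrable.const_mul hu c
theorem I_mono {t : ℝ} {u v : Fld} (hu : Itg t u) (hv : Itg t v) (h : ∀ x, u t x ≤ v t x) :
    I t u ≤ I t v := integral_mono hu hv h
theorem I_nonneg {t : ℝ} {u : Fld} (h : ∀ x, 0 ≤ u t x) : 0 ≤ I t u := integral_nonneg h

theorem integral_fderiv_eq_zero {f : Plane → ℝ} {v : Plane} (hf : Differentiable ℝ f)
    (h1 : Integrable f) (h2 : Integrable fun x => fderiv ℝ f x v) : ∫ x, fderiv ℝ f x v = 0 := by
  have := integral_mul_fderiv_eq_neg_fderiv_mul_of_integrable (μ := volume) (f := f)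
    (g := fun _ => (1 : ℝ)) (v := v) (by simpa using h2) (by simp) (by simpa using h1)
    (fun x _ => hf x) (fun x _ => differentiableAt_const _)
  simpa using this.symm

/-- The integral of a spatial derivative vanishes. -/
theorem I_D_eq_zero {t : ℝ} {u : Fld} (i : Fin 2) (h1 : Itg t u) (h2 : Itg t (D i.succ u)) :
    I t (D i.succ u) = 0 :=
  integral_fderiv_eq_zero ((u.contDiff t).differentiable (by simp)) h1 h2

theorem I_div_eq_zero {t : ℝ} {u v : Fld} (hu : Itg t u) (hu' : Itg t (D 1 u))
    (hv : Itg t v) (hv' : Itg t (D 2 v)) : I t (D 1 u + D 2 v) = 0 := by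
  rw [I_add hu' hv']
  have h1 := I_D_eq_zero 0 hu hu'
  have h2 := I_D_eq_zero 1 hv hv'
  change I t (D 1 u) = 0 at h1
  change I t (D 2 v) = 0 at h2
  rw [h1, h2, add_zero]

/-! ### Compactly supported functions -/

/-- Smooth functions with compact support in space-time. -/
def Test (u : Fld) : Prop := HasCompactSupport fun p : ℝ × Plane => u p.1 p.2

theorem test_iff {u : Fld} : Test u ↔
    ∃ R : ℝ, ∀ (t : ℝ) (x : Plane), R < ‖(t, x)‖ → u t x = 0 := by
  constructor
  · intro h
    obtain ⟨R, hR⟩ := h.isCompact.isBounded.subset_closedBall 0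
    refine ⟨R, fun t x hx => ?_⟩
    by_contra hne
    have := hR (subset_tsupport _ (show (t, x) ∈ Function.support
      (fun p : ℝ × Plane => u p.1 p.2) from hne))
    rw [mem_closedBall_zero_iff] at this
    linarith
  · rintro ⟨R, hR⟩
    refine HasCompactSupport.intro (isCompact_closedBall (0 : ℝ × Plane) R) fun p hp => hR _ _ ?_
    simpa using hp

theorem Test.add {u v : Fld} (hu : Test u) (hv : Test v) : Test (u + v) :=
  HasCompactSupport.add hu hv
theorem Test.mul_left {v : Fld} (u : Fld) (hv : Test v) : Test (u * v) :=
  HasCompactSupport.mul_left hv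
theorem Test.neg {u : Fld} (hu : Test u) : Test (-u) := by
  obtain ⟨R, hR⟩ := test_iff.1 hu
  exact test_iff.2 ⟨R, fun t x h => by rw [neg_ap, hR t x h, neg_zero]⟩
theorem Test.sub {u v : Fld} (hu : Test u) (hv : Test v) : Test (u - v) := by
  rw [sub_eq_add_neg]; exact hu.add hv.neg
theorem Test.smul {u : Fld} (c : ℝ) (hu : Test u) : Test (c • u) := by
  have := hu.mul_left (algebraMap ℝ Fld c); rwa [← Algebra.smul_def] at this
theorem Test.D {u : Fld} (hu : Test u) (a : Fin 3) : Test (D a u) := by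
  have : (fun p : ℝ × Plane => ElasticWave.D a u p.1 p.2) =
      fun p => fderiv ℝ (fun p : ℝ × Plane => u p.1 p.2) p (dir a) := by
    funext p; rw [D_ap]
  unfold Test
  rw [this]
  exact (HasCompactSupport.fderiv_apply (𝕜 := ℝ) hu (dir a))
theorem Test.S {u : Fld} (hu : Test u) : Test (S u) := by
  rw [S_def]; exact ((hu.D 0).mul_left _).add (((hu.D 1).mul_left _).add ((hu.D 2).mul_left _))
theorem Test.Om {u : Fld} (hu : Test u) : Test (Om u) := by
  rw [Om_def]; exact ((hu.D 1).mul_left _).sub ((hu.D 2).mul_left _)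
theorem Test.Lap {u : Fld} (hu : Test u) : Test (Lap u) := ((hu.D 1).D 1).add ((hu.D 2).D 2)

theorem Test.exists_radius {u : Fld} (hu : Test u) (t : ℝ) :
    ∃ R : ℝ, 0 < R ∧ ∀ x : Plane, R < ‖x‖ → u t x = 0 := by
  obtain ⟨R, hR⟩ := test_iff.1 hu
  refine ⟨max R 1, by positivity, fun x hx => hR t x ?_⟩
  exact (le_max_left _ _).trans_lt (hx.trans_le (by simp [Prod.norm_def]))

theorem Test.hasCompactSupport {u : Fld} (hu : Test u) (t : ℝ) : HasCompactSupport (u t) := by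
  obtain ⟨R, -, hR⟩ := hu.exists_radius t
  exact HasCompactSupport.intro (isCompact_closedBall (0 : Plane) R) fun x hx => hR x (by simpa using hx)

theorem Test.dec {u : Fld} (hu : Test u) (t : ℝ) (k : ℤ) : Dec t k u := by
  obtain ⟨R, hR0, hR⟩ := hu.exists_radius t
  obtain ⟨M, hM⟩ := (hu.hasCompactSupport t).exists_bound_of_continuous (u.continuous t)
  have hcont : Continuous fun x : Plane => |u t x| * (1 + ‖x‖) ^ k := by
    refine (u.continuous t).abs.mul ?_
    exact Continuous.zpow₀ (by fun_prop) _ fun x => Or.inl (one_add_norm_pos x).ne'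
  obtain ⟨C, hC⟩ := (isCompact_closedBall (0 : Plane) R).exists_bound_of_continuousOn hcont.continuousOn
  have hC0 : 0 ≤ C := (norm_nonneg _).trans (hC 0 (by simpa using hR0.le))
  refine ⟨C, fun x => ?_⟩
  have h1 := one_add_norm_pos x
  rcases le_or_gt ‖x‖ R with h | h
  · have := (le_abs_self _).trans (hC x (by simpa using h))
    rw [zpow_neg]
    exact (le_mul_inv_iff₀ (by positivity)).2 this
  · rw [hR x h]; simp only [abs_zero]; positivity

theorem Test.itg {u : Fld} (hu : Test u) (t : ℝ) : Itg t u := (hu.dec t 3).itg le_rfl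

/-! ### The logarithmic potential -/

theorem locallyIntegrable_log_norm :
    LocallyIntegrable (fun y : Plane => Real.log ‖y‖) := by
  rw [locallyIntegrable_iff]
  intro K hK
  obtain ⟨R, hR⟩ := hK.isBounded.subset_ball 0
  refine IntegrableOn.mono_set ?_ hR
  rw [integrableOn_fun_norm_addHaar volume (f := fun r => Real.log r)]
  have hc : Continuous fun y : ℝ => y ^ (Module.finrank ℝ Plane - 1) • Real.log y := by
    have : Module.finrank ℝ Plane = 2 := by simp
    rw [this]
    simpa [mul_comm] using Real.continuous_mul_log
  exact (hc.integrableOn_Icc (a := 0) (b := R)).mono_set Ioo_subset_Icc_self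

theorem negLapInv_eq_convolution (f : Plane → ℝ) (x : Plane) :
    negLapInv f x = -(2 * Real.pi)⁻¹ *
      (MeasureTheory.convolution (fun y : Plane => Real.log ‖y‖) f
        (ContinuousLinearMap.mul ℝ ℝ) volume) x := rfl

theorem Test.exists_compact {u : Fld} (hu : Test u) :
    ∃ k : Set Plane, IsCompact k ∧ ∀ t x, x ∉ k → u t x = 0 := by
  obtain ⟨R, hR⟩ := test_iff.1 hu
  refine ⟨Metric.closedBall 0 R, isCompact_closedBall _ _, fun t x hx => hR t x ?_⟩
  have : R < ‖x‖ := by simpa using hx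
  exact this.trans_le (by simp [Prod.norm_def])

theorem contDiff_negLapInv {u : Fld} (hu : Test u) :
    ContDiff ℝ ∞ fun p : ℝ × Plane => negLapInv (u p.1) p.2 := by
  obtain ⟨k, hk, hku⟩ := hu.exists_compact
  have := contDiffOn_convolution_right_with_param (μ := (volume : Measure Plane))
    (n := (⊤ : ℕ∞))
    (ContinuousLinearMap.mul ℝ ℝ) (g := u.val) (s := univ) isOpen_univ hk
    (fun p x _ hx => hku p x hx) locallyIntegrable_log_norm u.smooth.contDiffOn
  rw [univ_prod_univ, contDiffOn_univ] at this
  simp_rw [negLapInv_eq_convolution]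
  exact contDiff_const.mul this

open Classical in
/-- The potential `(-Δ)⁻¹ u` of a compactly supported smooth function (and `0` for other `u`). -/
def Pot (u : Fld) : Fld :=
  if h : Test u then Fld.mk (fun t => negLapInv (u t)) (contDiff_negLapInv h) else 0

theorem Pot_ap {u : Fld} (hu : Test u) (t : ℝ) (x : Plane) : Pot u t x = negLapInv (u t) x := by
  simp [Pot, hu]

theorem convolution_integrable {u : Fld} (hu : Test u) (t : ℝ) (x : Plane) :
    Integrable fun y : Plane => Real.log ‖y‖ * u t (x - y) := by
  have := (hu.hasCompactSupport t).convolutionExists_right (ContinuousLinearMap.mul ℝ ℝ)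
    locallyIntegrable_log_norm (u.continuous t) x
  exact this

theorem Pot_add {u v : Fld} (hu : Test u) (hv : Test v) : Pot (u + v) = Pot u + Pot v := by
  ext t x
  rw [add_ap, Pot_ap hu, Pot_ap hv, Pot_ap (hu.add hv)]
  simp only [negLapInv, ← mul_add]
  rw [← integral_add (convolution_integrable hu t x) (convolution_integrable hv t x)]
  congr 2
  ext y
  rw [add_ap, mul_add]

theorem Pot_smul {u : Fld} (c : ℝ) (hu : Test u) : Pot (c • u) = c • Pot u := by
  ext t x
  rw [smul_ap, Pot_ap hu, Pot_ap (hu.smul c)]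
  simp only [negLapInv, smul_ap, mul_left_comm _ c]
  rw [integral_const_mul]; ring

theorem Pot_neg {u : Fld} (hu : Test u) : Pot (-u) = -Pot u := by
  have := Pot_smul (-1) hu; simpa using this

theorem Pot_sub {u v : Fld} (hu : Test u) (hv : Test v) : Pot (u - v) = Pot u - Pot v := by
  rw [sub_eq_add_neg, Pot_add hu hv.neg, Pot_neg hv, sub_eq_add_neg]

/-- Differentiating a convolution with a parameter, in a coordinate direction of space-time. -/
theorem hasFDerivAt_conv_apply {f : Plane → ℝ} (hf : LocallyIntegrable f) {u : Fld} (hu : Test u)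
    (a : Fin 3) (t : ℝ) (x : Plane) :
    ∃ L : ℝ × Plane →L[ℝ] ℝ, HasFDerivAt (fun q : ℝ × Plane =>
      MeasureTheory.convolution f (u q.1) (ContinuousLinearMap.mul ℝ ℝ) volume q.2) L (t, x) ∧
      L (dir a) = MeasureTheory.convolution f (D a u t) (ContinuousLinearMap.mul ℝ ℝ) volume x := by
  obtain ⟨k, hk, hku⟩ := hu.exists_compact
  have h := hasFDerivAt_convolution_right_with_param (μ := (volume : Measure Plane))
    (ContinuousLinearMap.mul ℝ ℝ) (g := u.val) (s := univ) isOpen_univ hk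
    (fun p x _ hx => hku p x hx) hf
    ((u.smooth.of_le (by simp)).contDiffOn) (t, x) (mem_univ _)
  refine ⟨_, h, ?_⟩
  have hc : HasCompactSupport fun y : Plane => fderiv ℝ (fun p : ℝ × Plane => u p.1 p.2) (t, y) := by
    refine HasCompactSupport.intro hk fun y hy => ?_
    refine (hasFDerivAt_zero_of_eventually_const 0 ?_).fderiv
    have M2 : kᶜ ∈ 𝓝 y := hk.isClosed.isOpen_compl.mem_nhds hy
    rw [nhds_prod_eq]
    filter_upwards [prod_mem_prod univ_mem M2]
    rintro ⟨p, z⟩ ⟨-, hz⟩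
    exact hku p z hz
  have hcont : Continuous fun y : Plane => fderiv ℝ (fun p : ℝ × Plane => u p.1 p.2) (t, y) :=
    (u.smooth.continuous_fderiv (by simp)).comp (Continuous.prodMk_right t)
  have hi := hc.convolutionExists_right ((ContinuousLinearMap.mul ℝ ℝ).precompR (ℝ × Plane))
    hf hcont x
  simp only [MeasureTheory.convolution]
  have hi' : Integrable (fun s => (((ContinuousLinearMap.mul ℝ ℝ).precompR (ℝ × Plane)) (f s))
    ((fun y : Plane => fderiv ℝ (fun p : ℝ × Plane => u p.1 p.2) (t, y)) (x - s))) := hi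
  refine (ContinuousLinearMap.integral_apply hi' (dir a)).trans ?_
  congr 1
  ext y
  rw [D_ap]
  simp

theorem Pot_D {u : Fld} (hu : Test u) (a : Fin 3) : Pot (D a u) = D a (Pot u) := by
  ext t x
  rw [Pot_ap (hu.D a), D_ap]
  obtain ⟨L, hL, hLa⟩ := hasFDerivAt_conv_apply locallyIntegrable_log_norm hu a t x
  have h1 : (fun p : ℝ × Plane => Pot u p.1 p.2) = fun q => -(2 * Real.pi)⁻¹ *
      MeasureTheory.convolution (fun y : Plane => Real.log ‖y‖) (u q.1)
        (ContinuousLinearMap.mul ℝ ℝ) volume q.2 := by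
    funext q
    rw [Pot_ap hu, negLapInv_eq_convolution]
  rw [h1, (hL.const_mul _).fderiv, negLapInv_eq_convolution]
  simp [hLa]

/-- Differentiation under the spatial integral. -/
theorem hasDerivAt_I {u : Fld} (hu : Test u) (t : ℝ) :
    HasDerivAt (fun s => I s u) (I t (D 0 u)) t := by
  obtain ⟨L, hL, hLa⟩ := hasFDerivAt_conv_apply (f := fun _ => (1 : ℝ))
    (locallyIntegrable_const 1) hu 0 t 0
  have h1 : HasDerivAt (fun s : ℝ => (s, (0 : Plane))) (dir 0) t :=
    (hasDerivAt_id t).prodMk (hasDerivAt_const t 0)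
  have h2 := hL.comp_hasDerivAt t h1
  rw [hLa] at h2
  have key : ∀ (v : Fld) (s : ℝ), MeasureTheory.convolution (fun _ : Plane => (1 : ℝ)) (v s)
      (ContinuousLinearMap.mul ℝ ℝ) volume 0 = I s v := by
    intro v s
    simp only [MeasureTheory.convolution, I, zero_sub, ContinuousLinearMap.mul_apply', one_mul]
    exact integral_neg_eq_self (v s) volume
  rw [key] at h2
  refine h2.congr_of_eventuallyEq (Eventually.of_forall fun s => ?_)
  exact (key u s).symm

/-! ### Inverses, square roots and logarithms of positive functions -/

/-- The reciprocal of a positive smooth function. -/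
def Fld.inv (u : Fld) (h : ∀ t x, 0 < u t x) : Fld :=
  Fld.mk (fun t x => (u t x)⁻¹) (ContDiff.inv u.smooth fun p => (h p.1 p.2).ne')

/-- The square root of a positive smooth function. -/
def Fld.sqrt (u : Fld) (h : ∀ t x, 0 < u t x) : Fld :=
  Fld.mk (fun t x => √(u t x)) (ContDiff.sqrt u.smooth fun p => (h p.1 p.2).ne')

/-- The logarithm of a positive smooth function. -/
def Fld.log (u : Fld) (h : ∀ t x, 0 < u t x) : Fld :=
  Fld.mk (fun t x => Real.log (u t x)) (ContDiff.log u.smooth fun p => (h p.1 p.2).ne')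

@[simp] theorem inv_ap (u : Fld) (h : ∀ t x, 0 < u t x) (t : ℝ) (x : Plane) :
    u.inv h t x = (u t x)⁻¹ := rfl
@[simp] theorem sqrt_ap (u : Fld) (h : ∀ t x, 0 < u t x) (t : ℝ) (x : Plane) :
    u.sqrt h t x = √(u t x) := rfl
@[simp] theorem log_ap (u : Fld) (h : ∀ t x, 0 < u t x) (t : ℝ) (x : Plane) :
    u.log h t x = Real.log (u t x) := rfl

theorem mul_inv_self (u : Fld) (h : ∀ t x, 0 < u t x) : u * u.inv h = 1 := by
  ext t x
  simp [(h t x).ne']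

theorem sqrt_mul_self (u : Fld) (h : ∀ t x, 0 < u t x) : u.sqrt h * u.sqrt h = u := by
  ext t x
  simp [Real.mul_self_sqrt (h t x).le]

theorem D_inv (a : Fin 3) (u : Fld) (h : ∀ t x, 0 < u t x) :
    D a (u.inv h) = -(u.inv h ^ 2 * D a u) := by
  have h1 := mul_inv_self u h
  have h2 : D a (u * u.inv h) = 0 := by rw [h1]; simp
  rw [D_mul] at h2
  linear_combination u.inv h * h2 - D a (u.inv h) * h1

theorem D_sqrt (a : Fin 3) (u : Fld) (h : ∀ t x, 0 < u t x) :
    2 * (u.sqrt h * D a (u.sqrt h)) = D a u := by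
  have h1 : D a (u.sqrt h * u.sqrt h) = D a u := by rw [sqrt_mul_self]
  rw [D_mul] at h1
  linear_combination h1

theorem D_log (a : Fin 3) (u : Fld) (h : ∀ t x, 0 < u t x) :
    D a (u.log h) = u.inv h * D a u := by
  ext t x
  rw [D_ap, mul_ap, D_ap]
  have h1 := ((u.diffAt (t, x)).hasFDerivAt.log (h t x).ne').fderiv
  have h2 : (fun p : ℝ × Plane => u.log h p.1 p.2) = fun p => Real.log (u p.1 p.2) := rfl
  rw [h2, h1]; simp

theorem D_one_Rsq : D 1 Rsq = 2 * X 0 := by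
  simp [Rsq, D_mul, _root_.pow_two]; ring
theorem D_two_Rsq : D 2 Rsq = 2 * X 1 := by
  simp [Rsq, D_mul, _root_.pow_two]; ring
theorem D_zero_Rsq : D 0 Rsq = 0 := by
  simp [Rsq, D_mul, _root_.pow_two]
/-- `r² + ε`. -/
def Rreg (ε : ℝ) : Fld := Rsq + algebraMap ℝ Fld ε

@[simp] theorem Rreg_ap (ε t : ℝ) (x : Plane) : Rreg ε t x = ‖x‖ ^ 2 + ε := by simp [Rreg]
theorem Rreg_pos {ε : ℝ} (hε : 0 < ε) (t : ℝ) (x : Plane) : 0 < Rreg ε t x := by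
  rw [Rreg_ap]; positivity
theorem D_one_Rreg (ε : ℝ) : D 1 (Rreg ε) = 2 * X 0 := by
  simp [Rreg, D_one_Rsq]
theorem D_two_Rreg (ε : ℝ) : D 2 (Rreg ε) = 2 * X 1 := by
  simp [Rreg, D_two_Rsq]

/-! ### The logarithm is a fundamental solution of the Laplacian -/

theorem Lap_log_Rreg {ε : ℝ} (hε : 0 < ε) :
    Lap ((Rreg ε).log (Rreg_pos hε)) =
      algebraMap ℝ Fld (4 * ε) * (Rreg ε).inv (Rreg_pos hε) ^ 2 := by
  have h1 := mul_inv_self (Rreg ε) (Rreg_pos hε)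
  have h2 : Rreg ε = X 0 ^ 2 + X 1 ^ 2 + algebraMap ℝ Fld ε := rfl
  simp only [Lap_def, D_log, D_inv, D_mul, D_one_Rreg, D_two_Rreg, D_ofNat, D_one_X_zero,
    D_two_X_one]
  have h3 : algebraMap ℝ Fld (4 * ε) = 4 * algebraMap ℝ Fld ε := by
    rw [map_mul]; rfl
  rw [h3]
  generalize (Rreg ε).inv (Rreg_pos hε) = r at *
  rw [h2] at h1
  linear_combination (-4 * r) * h1

theorem I_mul_Lap_comm {u v : Fld} (hu : Test u) (t : ℝ) : I t (v * Lap u) = I t (u * Lap v) := by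
  have h1 : I t (D 1 (v * D 1 u - u * D 1 v) + D 2 (v * D 2 u - u * D 2 v)) = 0 := by
    have ha : Test (v * D 1 u - u * D 1 v) :=
      ((hu.D 1).mul_left v).sub (by rw [mul_comm]; exact hu.mul_left _)
    have hb : Test (v * D 2 u - u * D 2 v) :=
      ((hu.D 2).mul_left v).sub (by rw [mul_comm]; exact hu.mul_left _)
    exact I_div_eq_zero (ha.itg t) ((ha.D 1).itg t) (hb.itg t) ((hb.D 2).itg t)
  have h2 : D 1 (v * D 1 u - u * D 1 v) + D 2 (v * D 2 u - u * D 2 v)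
      = v * Lap u - u * Lap v := by
    simp only [Lap_def, map_sub, D_mul]; ring
  rw [h2, I_sub ((hu.Lap.mul_left v).itg t)
    ((by rw [mul_comm]; exact hu.mul_left _ : Test (u * Lap v)).itg t)] at h1
  linarith

theorem integral_kernel :
    ∫ x : Plane, 2 / (1 + ‖x‖ ^ 2) ^ 2 = 2 * Real.pi := by
  rw [integral_fun_norm_addHaar volume (f := fun r : ℝ => 2 / (1 + r ^ 2) ^ 2)]
  have hd : Module.finrank ℝ Plane = 2 := by simp
  have hv : (volume : Measure Plane).real (Metric.ball 0 1) = Real.pi := by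
    rw [Measure.real, EuclideanSpace.volume_ball_fin_two]
    simp [Real.pi_pos.le]
  rw [hd, hv]
  have h1 : ∫ y in Ioi (0 : ℝ), y ^ (2 - 1) • (2 / (1 + y ^ 2) ^ 2) = 0 - (-1) := by
    have hder : ∀ y ∈ Ici (0 : ℝ), HasDerivAt (fun y : ℝ => -(1 + y ^ 2)⁻¹)
        (y ^ (2 - 1) • (2 / (1 + y ^ 2) ^ 2)) y := by
      intro y _
      have h : HasDerivAt (fun y : ℝ => 1 + y ^ 2) (2 * y) y := by
        simpa using (hasDerivAt_pow 2 y).const_add 1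
      have hne : (1 + y ^ 2) ≠ 0 := by positivity
      refine (h.inv hne).neg.congr_deriv ?_
      simp [div_eq_mul_inv]; ring
    have := integral_Ioi_of_hasDerivAt_of_nonneg' (l := 0) hder
      (fun y (hy : 0 < y) => by positivity) ?_
    · rw [this]; norm_num
    · have h2 : Tendsto (fun y : ℝ => 1 + y ^ 2) atTop atTop :=
        tendsto_atTop_add_const_left _ _ (tendsto_pow_atTop (by norm_num))
      simpa using (tendsto_inv_atTop_zero.comp h2).neg
  rw [h1]; simp; 

theorem integrable_kernel : Integrable fun x : Plane => 2 / (1 + ‖x‖ ^ 2) ^ 2 := by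
  by_contra h
  have := integral_undef h
  rw [integral_kernel] at this
  have := Real.pi_pos
  linarith

theorem integrable_log_mul {u : Fld} (hu : Test u) (t : ℝ) :
    Integrable fun y : Plane => Real.log ‖y‖ * u t y := by
  have := locallyIntegrable_log_norm.integrable_smul_right_of_hasCompactSupport
    (u.continuous t) (hu.hasCompactSupport t)
  simpa [mul_comm] using this

theorem integral_log_mul_Lap {u : Fld} (hu : Test u) (t : ℝ) :
    ∫ y : Plane, Real.log ‖y‖ * Lap u t y = 2 * Real.pi * u t 0 := by
  -- the regularised logarithm `½ log (|y|² + δ²)` and the limit `δ → 0`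
  have key : ∀ δ : ℝ, 0 < δ → ∫ y : Plane, (1 / 2 * Real.log (‖y‖ ^ 2 + δ ^ 2)) * Lap u t y
      = ∫ z : Plane, 2 / (1 + ‖z‖ ^ 2) ^ 2 * u t (δ • z) := by
    intro δ hδ
    have hδ2 : 0 < δ ^ 2 := by positivity
    have h1 := I_mul_Lap_comm (v := (Rreg (δ ^ 2)).log (Rreg_pos hδ2)) hu t
    rw [Lap_log_Rreg hδ2] at h1
    have h2 : ∫ y : Plane, (1 / 2 * Real.log (‖y‖ ^ 2 + δ ^ 2)) * Lap u t y
        = 1 / 2 * I t ((Rreg (δ ^ 2)).log (Rreg_pos hδ2) * Lap u) := by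
      rw [I, ← integral_const_mul]
      congr 1; ext y; simp; ring
    have h3 := Measure.integral_comp_smul (volume : Measure Plane)
      (fun y => 1 / 2 * (u t y * (4 * δ ^ 2 * ((‖y‖ ^ 2 + δ ^ 2)⁻¹) ^ 2))) δ
    rw [h2, h1]
    have h4 : 1 / 2 * I t (u * (algebraMap ℝ Fld (4 * δ ^ 2) * (Rreg (δ ^ 2)).inv (Rreg_pos hδ2) ^ 2))
        = ∫ y : Plane, 1 / 2 * (u t y * (4 * δ ^ 2 * ((‖y‖ ^ 2 + δ ^ 2)⁻¹) ^ 2)) := by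
      rw [I, ← integral_const_mul]
      congr 1; ext y; simp
    have hd : Module.finrank ℝ Plane = 2 := by simp
    rw [h4]
    rw [hd, abs_of_pos (by positivity), smul_eq_mul] at h3
    have h5 : ∫ y : Plane, 1 / 2 * (u t y * (4 * δ ^ 2 * ((‖y‖ ^ 2 + δ ^ 2)⁻¹) ^ 2)) =
        δ ^ 2 * ∫ (x : Plane), 1 / 2 * (u t (δ • x) * (4 * δ ^ 2 * (‖δ • x‖ ^ 2 + δ ^ 2)⁻¹ ^ 2)) := by
      rw [h3, mul_inv_cancel_left₀ hδ2.ne']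
    rw [h5, ← integral_const_mul]
    congr 1; ext z
    rw [norm_smul, Real.norm_eq_abs, mul_pow, sq_abs]
    have : δ ^ 2 * ‖z‖ ^ 2 + δ ^ 2 = δ ^ 2 * (1 + ‖z‖ ^ 2) := by ring
    rw [this]
    field_simp
    ring
  have lim1 : Tendsto (fun δ : ℝ => ∫ y : Plane, (1 / 2 * Real.log (‖y‖ ^ 2 + δ ^ 2)) * Lap u t y)
      (𝓝[>] 0) (𝓝 (∫ y : Plane, Real.log ‖y‖ * Lap u t y)) := by
    have hb : Integrable fun y : Plane => |Real.log ‖y‖ * Lap u t y| +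
        |1 / 2 * Real.log (‖y‖ ^ 2 + 1) * Lap u t y| := by
      refine (integrable_log_mul hu.Lap t).abs.add ?_
      have := (hu.Lap.mul_left ((Rreg 1).log (Rreg_pos one_pos))).itg t
      have := (this.const_mul (1 / 2)).abs
      refine this.congr (ae_of_all _ fun y => ?_)
      simp [mul_assoc]
    refine tendsto_integral_filter_of_dominated_convergence _ ?_ ?_ hb ?_
    · filter_upwards [self_mem_nhdsWithin] with δ (hδ : 0 < δ)
      have hδ2 : 0 < δ ^ 2 := by positivity
      refine Continuous.aestronglyMeasurable ?_
      have := ((((Rreg (δ ^ 2)).log (Rreg_pos hδ2)).continuous t).const_smul (1 / 2 : ℝ)).mul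
        ((Lap u).continuous t)
      refine this.congr fun y => ?_
      simp
    · have : Ioo (0 : ℝ) 1 ∈ 𝓝[>] (0 : ℝ) := Ioo_mem_nhdsGT one_pos
      filter_upwards [this] with δ hδ
      have h0 : ∀ᵐ y : Plane, y ≠ 0 := by
        simp [ae_iff, measure_singleton]
      filter_upwards [h0] with y hy
      have hy' : 0 < ‖y‖ := norm_pos_iff.2 hy
      have hδ0 : 0 < δ := hδ.1
      rw [Real.norm_eq_abs, abs_mul, abs_mul (Real.log _), abs_mul (1 / 2 * _), ← add_mul]
      gcongr
      have ha : Real.log ‖y‖ ≤ 1 / 2 * Real.log (‖y‖ ^ 2 + δ ^ 2) := by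
        have : Real.log (‖y‖ ^ 2) ≤ Real.log (‖y‖ ^ 2 + δ ^ 2) := by
          gcongr; linarith [sq_nonneg δ]
        rw [Real.log_pow] at this; push_cast at this; linarith
      have hb : 1 / 2 * Real.log (‖y‖ ^ 2 + δ ^ 2) ≤ 1 / 2 * Real.log (‖y‖ ^ 2 + 1) := by
        gcongr; nlinarith [hδ.2]
      rw [abs_le]
      constructor
      · linarith [neg_abs_le (Real.log ‖y‖), abs_nonneg (1 / 2 * Real.log (‖y‖ ^ 2 + 1))]
      · linarith [abs_nonneg (Real.log ‖y‖), le_abs_self (1 / 2 * Real.log (‖y‖ ^ 2 + 1))]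
    · have h0 : ∀ᵐ y : Plane, y ≠ 0 := by simp [ae_iff, measure_singleton]
      filter_upwards [h0] with y hy
      have hy' : 0 < ‖y‖ := norm_pos_iff.2 hy
      refine Tendsto.mul_const _ ?_
      have h1 : Tendsto (fun δ : ℝ => ‖y‖ ^ 2 + δ ^ 2) (𝓝[>] 0) (𝓝 (‖y‖ ^ 2)) := by
        have : Tendsto (fun δ : ℝ => ‖y‖ ^ 2 + δ ^ 2) (𝓝 0) (𝓝 (‖y‖ ^ 2 + 0 ^ 2)) :=
          (by fun_prop : Continuous fun δ : ℝ => ‖y‖ ^ 2 + δ ^ 2).tendsto 0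
        simpa using this.mono_left nhdsWithin_le_nhds
      have h2 := (h1.log (by positivity)).const_mul (1 / 2)
      rw [Real.log_pow] at h2
      convert h2 using 2
      push_cast; ring
  have lim2 : Tendsto (fun δ : ℝ => ∫ z : Plane, 2 / (1 + ‖z‖ ^ 2) ^ 2 * u t (δ • z))
      (𝓝[>] 0) (𝓝 (∫ z : Plane, 2 / (1 + ‖z‖ ^ 2) ^ 2 * u t 0)) := by
    obtain ⟨M, hM⟩ := (hu.hasCompactSupport t).exists_bound_of_continuous (u.continuous t)
    refine tendsto_integral_filter_of_dominated_convergence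
      (fun z => 2 / (1 + ‖z‖ ^ 2) ^ 2 * M) ?_ ?_ (integrable_kernel.mul_const M) ?_
    · refine Eventually.of_forall fun δ => Continuous.aestronglyMeasurable ?_
      refine Continuous.mul ?_ ((u.continuous t).comp (continuous_const_smul δ))
      exact Continuous.div (by fun_prop) (by fun_prop) fun z => by positivity
    · refine Eventually.of_forall fun δ => ae_of_all _ fun z => ?_
      rw [norm_mul, Real.norm_of_nonneg (by positivity)]
      gcongr
      exact hM _
    · refine ae_of_all _ fun z => Tendsto.const_mul _ ?_
      have : Tendsto (fun δ : ℝ => u t (δ • z)) (𝓝 0) (𝓝 (u t ((0 : ℝ) • z))) :=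
        ((u.continuous t).comp (continuous_id.smul continuous_const)).tendsto 0
      rw [zero_smul] at this
      exact this.mono_left nhdsWithin_le_nhds
  rw [integral_mul_const, integral_kernel] at lim2
  refine tendsto_nhds_unique lim1 (lim2.congr' ?_)
  filter_upwards [self_mem_nhdsWithin] with δ hδ
  exact (key δ hδ).symm

/-- The reflected translate `(t, y) ↦ u (t, x - y)`. -/
def reflect (x : Plane) (u : Fld) : Fld :=
  Fld.mk (fun t y => u t (x - y))
    (u.smooth.comp (contDiff_fst.prodMk (contDiff_const.sub contDiff_snd)))

@[simp] theorem reflect_ap (x : Plane) (u : Fld) (t : ℝ) (y : Plane) :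
    reflect x u t y = u t (x - y) := rfl

theorem D_reflect (x : Plane) (u : Fld) (i : Fin 2) :
    D i.succ (reflect x u) = -reflect x (D i.succ u) := by
  ext t y
  rw [neg_ap, reflect_ap, D_succ_ap, D_succ_ap]
  have h : HasFDerivAt (fun y : Plane => x - y) (-ContinuousLinearMap.id ℝ Plane) y :=
    (hasFDerivAt_id y).const_sub x
  have h2 := (((u.contDiff t).differentiable (by simp)) (x - y)).hasFDerivAt.comp y h
  have h3 : (reflect x u).val t = u.val t ∘ fun y => x - y := rfl
  rw [h3, h2.fderiv]
  simp

theorem Lap_reflect (x : Plane) (u : Fld) : Lap (reflect x u) = reflect x (Lap u) := by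
  have h1 : ∀ v, D 1 (reflect x v) = -reflect x (D 1 v) := fun v => D_reflect x v 0
  have h2 : ∀ v, D 2 (reflect x v) = -reflect x (D 2 v) := fun v => D_reflect x v 1
  rw [Lap_def, h1, h2, map_neg, map_neg, h1, h2]
  ext t y; simp [Lap_def]

theorem Test.reflect {u : Fld} (hu : Test u) (x : Plane) : Test (reflect x u) := by
  obtain ⟨R, hR⟩ := test_iff.1 hu
  refine test_iff.2 ⟨max R (‖x‖ + R), fun t y hy => hR t (x - y) ?_⟩
  rw [Prod.norm_def] at hy ⊢
  rcases lt_max_iff.1 hy with h | h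
  · exact lt_max_iff.2 (Or.inl ((le_max_left _ _).trans_lt h))
  · refine lt_max_iff.2 (Or.inr ?_)
    have h1 := (le_max_right _ _).trans_lt h
    have h2 := norm_sub_norm_le y x
    rw [norm_sub_rev] at h2
    simp only at *
    linarith

/-- The potential of `u` solves `-Δ φ = u`. -/
theorem Lap_Pot {u : Fld} (hu : Test u) : Lap (Pot u) = -u := by
  have h1 : Lap (Pot u) = Pot (Lap u) := by
    rw [Lap_def, Lap_def, ← Pot_D hu, ← Pot_D (hu.D 1), ← Pot_D hu, ← Pot_D (hu.D 2),
      Pot_add ((hu.D 1).D 1) ((hu.D 2).D 2)]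
  rw [h1]
  ext t x
  rw [Pot_ap hu.Lap, negLapInv, neg_ap]
  have h2 := integral_log_mul_Lap (hu.reflect x) t
  rw [Lap_reflect] at h2
  simp only [reflect_ap, sub_zero] at h2
  rw [h2]
  field_simp

/-! ### Decay of potentials -/

/-- The plane as complex numbers. -/
def toC (x : Plane) : ℂ := ⟨x 0, x 1⟩

theorem toC_sub (x y : Plane) : toC (x - y) = toC x - toC y := by
  apply Complex.ext <;> simp [toC]

theorem norm_toC (x : Plane) : ‖toC x‖ = ‖x‖ := by
  have h : ‖toC x‖ ^ 2 = ‖x‖ ^ 2 := by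
    rw [norm_sq_eq, ← Complex.normSq_eq_norm_sq, Complex.normSq_apply]; simp [toC]; ring
  exact (pow_left_inj₀ (norm_nonneg _) (norm_nonneg _) two_ne_zero).1 h

/-- The real-linear functionals `Re` and `-Im`, which turn `1 / z` into the components of
`x / |x|²`. -/
def reIm (i : Fin 2) (z : ℂ) : ℝ := if i = 0 then z.re else -z.im

theorem reIm_sub (i : Fin 2) (z w : ℂ) : reIm i (z - w) = reIm i z - reIm i w := by
  fin_cases i <;> simp [reIm]; ring
theorem reIm_add (i : Fin 2) (z w : ℂ) : reIm i (z + w) = reIm i z + reIm i w := by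
  fin_cases i <;> simp [reIm]; ring
theorem reIm_mul_ofReal (i : Fin 2) (a : ℝ) (z : ℂ) : reIm i (a * z) = a * reIm i z := by
  fin_cases i <;> simp [reIm]
theorem abs_reIm_le (i : Fin 2) (z : ℂ) : |reIm i z| ≤ ‖z‖ := by
  fin_cases i
  · simpa [reIm] using Complex.abs_re_le_norm z
  · simpa [reIm] using Complex.abs_im_le_norm z

theorem coord_div_norm_sq (i : Fin 2) (x : Plane) : x i / ‖x‖ ^ 2 = reIm i (toC x)⁻¹ := by
  have h : Complex.normSq (toC x) = ‖x‖ ^ 2 := by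
    rw [Complex.normSq_eq_norm_sq, norm_toC]
  fin_cases i
  · simp only [reIm, Complex.inv_re, h]; simp [toC]
  · simp only [reIm, Complex.inv_im, h]; simp [toC, neg_div]

theorem hasFDerivAt_log_norm_sub {x y : Plane} (h : x ≠ y) :
    ∃ L : Plane →L[ℝ] ℝ, HasFDerivAt (fun y : Plane => Real.log ‖x - y‖) L y ∧
      ∀ i, L (EuclideanSpace.single i 1) = -((x - y) i / ‖x - y‖ ^ 2) := by
  have hne : ‖x - y‖ ^ 2 ≠ 0 := by
    have := norm_pos_iff.2 (sub_ne_zero.2 h); positivity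
  have h1 : HasFDerivAt (fun y : Plane => x - y) (-ContinuousLinearMap.id ℝ Plane) y :=
    (hasFDerivAt_id y).const_sub x
  have h2 := ((hasStrictFDerivAt_norm_sq (x - y)).hasFDerivAt.comp y h1).log hne
  have h3 := h2.const_mul (1 / 2)
  refine ⟨_, h3.congr_of_eventuallyEq (Eventually.of_forall fun z => ?_), fun i => ?_⟩
  · simp only [Function.comp]
    rw [Real.log_pow]; push_cast; ring
  · simp [EuclideanSpace.inner_single_right]
    field_simp

/-- Away from the support of `u`, the gradient of the potential of `u` is given by the kernel
`-x / (2π |x|²)`. -/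
theorem D_Pot_far {u : Fld} (hu : Test u) {t R : ℝ} (hR : ∀ x : Plane, R < ‖x‖ → u t x = 0)
    (i : Fin 2) {x : Plane} (hx : R < ‖x‖) :
    D i.succ (Pot u) t x = -(2 * Real.pi)⁻¹ * ∫ y : Plane, (x - y) i / ‖x - y‖ ^ 2 * u t y := by
  rw [← Pot_D hu, Pot_ap (hu.D _), negLapInv]
  congr 1
  have h1 := integral_sub_left_eq_self (fun y : Plane => Real.log ‖x - y‖ * D i.succ u t y) volume x
  simp only [sub_sub_cancel] at h1
  rw [h1]
  set H : Plane → ℝ := fun y => Real.log ‖x - y‖ * u t y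
  have hopen : IsOpen {z : Plane | R < ‖z‖} := isOpen_lt continuous_const continuous_norm
  have hnear : ∀ z : Plane, R < ‖z‖ → u t =ᶠ[𝓝 z] fun _ => 0 := fun z hz => by
    filter_upwards [hopen.mem_nhds hz] with w hw using hR w hw
  have hH : ContDiff ℝ 1 H := by
    rw [contDiff_iff_contDiffAt]
    intro y
    by_cases hy : y = x
    · subst hy
      have : H =ᶠ[𝓝 y] fun _ => 0 := (hnear y hx).mono fun w hw => by simp [H, hw]
      exact contDiffAt_const.congr_of_eventuallyEq this
    · have hne : x - y ≠ 0 := sub_ne_zero.2 (Ne.symm hy)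
      have hn : ContDiffAt ℝ 1 (fun y : Plane => ‖x - y‖) y :=
        (contDiffAt_norm ℝ hne).comp y (contDiffAt_const.sub contDiffAt_id)
      exact (hn.log (norm_ne_zero_iff.2 hne)).mul ((u.contDiff t).of_le (by simp)).contDiffAt
  have hHc : HasCompactSupport H := (hu.hasCompactSupport t).mul_left
  have hder : ∀ y, fderiv ℝ H y (EuclideanSpace.single i 1) =
      Real.log ‖x - y‖ * D i.succ u t y - (x - y) i / ‖x - y‖ ^ 2 * u t y := by
    intro y
    by_cases hy : y = x
    · subst hy
      have h2 : H =ᶠ[𝓝 y] fun _ => 0 := (hnear y hx).mono fun w hw => by simp [H, hw]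
      rw [h2.fderiv_eq]
      simp
    · obtain ⟨L, hL, hLi⟩ := hasFDerivAt_log_norm_sub (Ne.symm hy)
      have hu' := (((u.contDiff t).differentiable (by simp)) y).hasFDerivAt
      have h3 := (hL.mul hu').fderiv
      have h4 : H = fun y => Real.log ‖x - y‖ * u t y := rfl
      rw [h4]
      erw [h3]
      simp only [add_apply, smul_apply, smul_eq_mul, hLi,
        D_succ_ap]
      ring
  have hci : Continuous fun y => fderiv ℝ H y (EuclideanSpace.single i 1) :=
    (hH.continuous_fderiv (by simp)).clm_apply continuous_const
  have hIi : Integrable fun y => fderiv ℝ H y (EuclideanSpace.single i 1) :=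
    hci.integrable_of_hasCompactSupport (hHc.fderiv_apply (𝕜 := ℝ) _)
  have hz := integral_fderiv_eq_zero (v := EuclideanSpace.single i 1)
    (hH.differentiable (by simp)) (hH.continuous.integrable_of_hasCompactSupport hHc) hIi
  have hlog : Integrable fun y => Real.log ‖x - y‖ * D i.succ u t y := by
    have := (convolution_integrable (hu.D i.succ) t x).comp_sub_left x
    simpa using this
  have hK : Integrable fun y => (x - y) i / ‖x - y‖ ^ 2 * u t y := by
    refine (hlog.sub hIi).congr (ae_of_all _ fun y => ?_)
    simp only [Pi.sub_apply, hder]; ring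
  simp only [hder] at hz
  rw [integral_sub hlog hK] at hz
  linarith

/-- If the kernel, minus a function annihilating `u`, is small on the support of `u`, then so is
the gradient of the potential. -/
theorem abs_D_Pot_le {u : Fld} (hu : Test u) {t R : ℝ} (hR : ∀ x : Plane, R < ‖x‖ → u t x = 0)
    (i : Fin 2) {x : Plane} (hx : R < ‖x‖) {G : Plane → ℝ}
    (hGi : Integrable fun y => G y * u t y) (hG : ∫ y, G y * u t y = 0) {B : ℝ}
    (hB : ∀ y : Plane, ‖y‖ ≤ R → |(x - y) i / ‖x - y‖ ^ 2 - G y| ≤ B) :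
    |D i.succ (Pot u) t x| ≤ B * ∫ y, |u t y| := by
  rw [D_Pot_far hu hR i hx, abs_mul]
  have hle : ∀ y, ‖((x - y) i / ‖x - y‖ ^ 2 - G y) * u t y‖ ≤ B * |u t y| := by
    intro y
    rw [norm_mul, Real.norm_eq_abs, Real.norm_eq_abs]
    rcases le_or_gt ‖y‖ R with h | h
    · gcongr; exact hB y h
    · simp [hR y h]
  have hI : Integrable fun y => |u t y| := (hu.itg t).abs
  have h1 : |∫ y, (x - y) i / ‖x - y‖ ^ 2 * u t y| ≤ B * ∫ y, |u t y| := by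
    by_cases hint : Integrable fun y => (x - y) i / ‖x - y‖ ^ 2 * u t y
    · have : ∫ y, (x - y) i / ‖x - y‖ ^ 2 * u t y =
          ∫ y, ((x - y) i / ‖x - y‖ ^ 2 - G y) * u t y := by
        simp only [sub_mul]
        rw [integral_sub hint hGi, hG, sub_zero]
      rw [this, ← integral_const_mul]
      exact norm_integral_le_of_norm_le (hI.const_mul B) (ae_of_all _ hle)
    · rw [integral_undef hint, abs_zero, ← integral_const_mul]
      exact integral_nonneg fun y => (norm_nonneg _).trans (hle y)
  have hpi : |-(2 * Real.pi)⁻¹| ≤ 1 := by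
    rw [abs_neg, abs_of_pos (by have := Real.pi_pos; positivity)]
    refine inv_le_one_of_one_le₀ ?_
    nlinarith [Real.pi_gt_three]
  calc _ ≤ 1 * |∫ y, (x - y) i / ‖x - y‖ ^ 2 * u t y| := by gcongr
    _ ≤ _ := by rw [one_mul]; exact h1

theorem dec_of_far {t C R : ℝ} {u : Fld} {k : ℕ}
    (h : ∀ x : Plane, R < ‖x‖ → |u t x| ≤ C * (‖x‖ ^ k)⁻¹) : Dec t k u := by
  set R' := max R 1
  obtain ⟨M, hM⟩ := (isCompact_closedBall (0 : Plane) R').exists_bound_of_continuousOn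
    (u.continuous t).continuousOn
  have hM0 : 0 ≤ M := (norm_nonneg _).trans (hM 0 (by simp [R']))
  refine ⟨M * (1 + R') ^ k + |C| * 2 ^ k, fun x => ?_⟩
  have h1 := one_add_norm_pos x
  rw [zpow_neg, zpow_natCast]
  rcases le_or_gt ‖x‖ R' with hx | hx
  · have h2 := hM x (by simpa using hx)
    rw [Real.norm_eq_abs] at h2
    calc |u t x| ≤ M := h2
      _ = M * (1 + ‖x‖) ^ k * ((1 + ‖x‖) ^ k)⁻¹ := by field_simp
      _ ≤ M * (1 + R') ^ k * ((1 + ‖x‖) ^ k)⁻¹ := by gcongr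
      _ ≤ _ := by
        gcongr
        linarith [show 0 ≤ |C| * 2 ^ k by positivity]
  · have hx1 : 1 < ‖x‖ := (le_max_right _ _).trans_lt hx
    have h2 := h x ((le_max_left _ _).trans_lt hx)
    have h3 : (‖x‖ ^ k)⁻¹ ≤ 2 ^ k * ((1 + ‖x‖) ^ k)⁻¹ := by
      rw [← div_eq_mul_inv, le_div_iff₀ (by positivity), inv_mul_eq_div,
        div_le_iff₀ (by positivity), ← mul_pow]
      gcongr; linarith
    have hR0 : 0 ≤ R' := le_trans zero_le_one (le_max_right _ _)
    calc |u t x| ≤ C * (‖x‖ ^ k)⁻¹ := h2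
      _ ≤ |C| * (‖x‖ ^ k)⁻¹ := by gcongr; exact le_abs_self C
      _ ≤ |C| * (2 ^ k * ((1 + ‖x‖) ^ k)⁻¹) := by gcongr
      _ = |C| * 2 ^ k * ((1 + ‖x‖) ^ k)⁻¹ := by ring
      _ ≤ _ := by
        gcongr
        linarith [show 0 ≤ M * (1 + R') ^ k by positivity]

theorem norm_sub_ge_half {x y : Plane} {R : ℝ} (hx : 2 * R < ‖x‖) (hy : ‖y‖ ≤ R) :
    ‖x‖ / 2 ≤ ‖x - y‖ := by
  have := norm_sub_norm_le x y
  linarith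

theorem dec_one_D_Pot {u : Fld} (hu : Test u) (t : ℝ) (i : Fin 2) :
    Dec t 1 (D i.succ (Pot u)) := by
  obtain ⟨R, hR0, hR⟩ := hu.exists_radius t
  refine dec_of_far (R := 2 * R) (k := 1) (C := 2 * ∫ y, |u t y|) fun x hx => ?_
  have hx0 : 0 < ‖x‖ := by linarith
  have := abs_D_Pot_le hu hR i (x := x) (by linarith) (G := fun _ => 0) (by simp) (by simp)
    (B := 2 * ‖x‖⁻¹) fun y hy => by
      have h1 := norm_sub_ge_half hx hy
      rw [sub_zero, coord_div_norm_sq]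
      refine (abs_reIm_le _ _).trans ?_
      rw [norm_inv, norm_toC]
      calc ‖x - y‖⁻¹ ≤ (‖x‖ / 2)⁻¹ := by gcongr
        _ = _ := by field_simp
  refine this.trans (le_of_eq ?_)
  rw [pow_one]; ring

theorem dec_two_D_Pot {u : Fld} (hu : Test u) {t : ℝ} (h0 : I t u = 0) (i : Fin 2) :
    Dec t 2 (D i.succ (Pot u)) := by
  obtain ⟨R, hR0, hR⟩ := hu.exists_radius t
  refine dec_of_far (R := 2 * R) (k := 2) (C := 2 * R * ∫ y, |u t y|) fun x hx => ?_
  have hx0 : 0 < ‖x‖ := by linarith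
  have := abs_D_Pot_le hu hR i (x := x) (by linarith) (G := fun _ => reIm i (toC x)⁻¹)
    ((hu.itg t).const_mul _) (by rw [integral_const_mul, show ∫ y, u t y = 0 from h0, mul_zero])
    (B := 2 * R * (‖x‖ ^ 2)⁻¹) fun y hy => by
      have h1 := norm_sub_ge_half hx hy
      have hxy : 0 < ‖x - y‖ := by linarith
      rw [coord_div_norm_sq, ← reIm_sub]
      refine (abs_reIm_le _ _).trans ?_
      have hz : toC x ≠ 0 := by rw [← norm_ne_zero_iff, norm_toC]; exact hx0.ne'
      have hz' : toC (x - y) ≠ 0 := by rw [← norm_ne_zero_iff, norm_toC]; exact hxy.ne'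
      have h2 : (toC (x - y))⁻¹ - (toC x)⁻¹ = toC y * ((toC (x - y))⁻¹ * (toC x)⁻¹) := by
        field_simp; rw [toC_sub]; ring
      rw [h2, norm_mul, norm_mul, norm_inv, norm_inv, norm_toC, norm_toC, norm_toC]
      calc ‖y‖ * (‖x - y‖⁻¹ * ‖x‖⁻¹) ≤ R * ((‖x‖ / 2)⁻¹ * ‖x‖⁻¹) := by gcongr
        _ = _ := by field_simp
  refine this.trans (le_of_eq ?_)
  ring

theorem dec_three_D_Pot {u : Fld} (hu : Test u) {t : ℝ} (h0 : I t u = 0)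
    (h1 : ∀ j, I t (X j * u) = 0) (i : Fin 2) : Dec t 3 (D i.succ (Pot u)) := by
  obtain ⟨R, hR0, hR⟩ := hu.exists_radius t
  refine dec_of_far (R := 2 * R) (k := 3) (C := 2 * R ^ 2 * ∫ y, |u t y|) fun x hx => ?_
  have hx0 : 0 < ‖x‖ := by linarith
  have hG : ∀ y : Plane, reIm i ((toC x)⁻¹ + toC y * ((toC x)⁻¹) ^ 2) * u t y =
      reIm i (toC x)⁻¹ * u t y + (reIm i (((toC x)⁻¹) ^ 2) * (X 0 * u) t y +
        reIm i (Complex.I * ((toC x)⁻¹) ^ 2) * (X 1 * u) t y) := by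
    intro y
    have : toC y * ((toC x)⁻¹) ^ 2 = (y 0 : ℝ) * ((toC x)⁻¹) ^ 2 +
        (y 1 : ℝ) * (Complex.I * ((toC x)⁻¹) ^ 2) := by
      have : toC y = (y 0 : ℝ) + (y 1 : ℝ) * Complex.I := by
        apply Complex.ext <;> simp [toC]
      rw [this]; ring
    rw [this, reIm_add, reIm_add, reIm_mul_ofReal, reIm_mul_ofReal]
    simp; ring
  have hX : ∀ j, Integrable ((X j * u).val t) := fun j => (hu.mul_left (X j)).itg t
  have := abs_D_Pot_le hu hR i (x := x) (by linarith)
    (G := fun y => reIm i ((toC x)⁻¹ + toC y * ((toC x)⁻¹) ^ 2))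
    (by simp only [hG]
        exact ((hu.itg t).const_mul _).add (((hX 0).const_mul _).add ((hX 1).const_mul _)))
    (by simp only [hG]
        refine (integral_add ((hu.itg t).const_mul _)
          (((hX 0).const_mul _).add ((hX 1).const_mul _))).trans ?_
        rw [integral_const_mul, show ∫ y, u t y = 0 from h0]
        refine (congrArg (_ + ·) (integral_add ((hX 0).const_mul _) ((hX 1).const_mul _))).trans ?_
        rw [integral_const_mul, integral_const_mul,
          show ∫ y, (X 0 * u) t y = 0 from h1 0, show ∫ y, (X 1 * u) t y = 0 from h1 1]
        simp)
    (B := 2 * R ^ 2 * (‖x‖ ^ 3)⁻¹) fun y hy => by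
      have h1 := norm_sub_ge_half hx hy
      have hxy : 0 < ‖x - y‖ := by linarith
      rw [coord_div_norm_sq, ← reIm_sub]
      refine (abs_reIm_le _ _).trans ?_
      have hz : toC x ≠ 0 := by rw [← norm_ne_zero_iff, norm_toC]; exact hx0.ne'
      have hz' : toC (x - y) ≠ 0 := by rw [← norm_ne_zero_iff, norm_toC]; exact hxy.ne'
      have h2 : (toC (x - y))⁻¹ - ((toC x)⁻¹ + toC y * ((toC x)⁻¹) ^ 2) =
          toC y * toC y * ((toC (x - y))⁻¹ * ((toC x)⁻¹) ^ 2) := by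
        field_simp; rw [toC_sub]; ring
      rw [h2, norm_mul, norm_mul, norm_mul, norm_pow, norm_inv, norm_inv, norm_toC, norm_toC,
        norm_toC]
      calc ‖y‖ * ‖y‖ * (‖x - y‖⁻¹ * ‖x‖⁻¹ ^ 2) ≤ R * R * ((‖x‖ / 2)⁻¹ * ‖x‖⁻¹ ^ 2) := by gcongr
        _ = _ := by field_simp
  refine this.trans (le_of_eq ?_)
  ring

theorem Test.I_D_eq_zero {u : Fld} (hu : Test u) (t : ℝ) (i : Fin 2) : I t (ElasticWave.D i.succ u) = 0 :=
  ElasticWave.I_D_eq_zero i (hu.itg t) ((hu.D _).itg t)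

/-- Divergences of compactly supported vector fields: the class of functions whose potentials
decay like `1 / r`. -/
def IsDiv (u : Fld) : Prop := ∃ a b, Test a ∧ Test b ∧ u = D 1 a + D 2 b

theorem IsDiv.test {u : Fld} (h : IsDiv u) : Test u := by
  obtain ⟨a, b, ha, hb, rfl⟩ := h
  exact (ha.D 1).add (hb.D 2)

theorem IsDiv.add {u v : Fld} (hu : IsDiv u) (hv : IsDiv v) : IsDiv (u + v) := by
  obtain ⟨a, b, ha, hb, rfl⟩ := hu
  obtain ⟨a', b', ha', hb', rfl⟩ := hv
  exact ⟨a + a', b + b', ha.add ha', hb.add hb', by simp only [map_add]; ring⟩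

theorem IsDiv.smul {u : Fld} (c : ℝ) (hu : IsDiv u) : IsDiv (c • u) := by
  obtain ⟨a, b, ha, hb, rfl⟩ := hu
  exact ⟨c • a, c • b, ha.smul c, hb.smul c, by simp⟩

theorem IsDiv.D {u : Fld} (hu : IsDiv u) (c : Fin 3) : IsDiv (D c u) := by
  obtain ⟨a, b, ha, hb, rfl⟩ := hu
  exact ⟨ElasticWave.D c a, ElasticWave.D c b, ha.D c, hb.D c, by
    rw [map_add, D_comm c 1, D_comm c 2]⟩

theorem IsDiv.S {u : Fld} (hu : IsDiv u) : IsDiv (S u) := by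
  obtain ⟨a, b, ha, hb, rfl⟩ := hu
  exact ⟨ElasticWave.S a - a, ElasticWave.S b - b, ha.S.sub ha, hb.S.sub hb, by
    simp only [map_add, map_sub, D_S]; ring⟩

theorem IsDiv.Om {u : Fld} (hu : IsDiv u) : IsDiv (Om u) := by
  obtain ⟨a, b, ha, hb, rfl⟩ := hu
  refine ⟨ElasticWave.Om a - b, ElasticWave.Om b + a, ha.Om.sub hb, hb.Om.add ha, ?_⟩
  simp only [map_add, map_sub, D_one_Om, D_two_Om]; ring

theorem isDiv_Rd {u : Fld} (hu : IsDiv u) : IsDiv (Rd u) := by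
  obtain ⟨a, b, ha, hb, rfl⟩ := hu
  have hR : ∀ {v}, Test v → Test (Rd v) := fun {v} hv =>
    ((hv.D 1).mul_left (X 0)).add ((hv.D 2).mul_left (X 1))
  refine ⟨Rd a - a, Rd b - b, (hR ha).sub ha, (hR hb).sub hb, ?_⟩
  simp only [Rd_def, map_add, map_sub, D_mul, D_one_X_zero, D_one_X_one, D_two_X_zero,
    D_two_X_one, D_comm_21]; ring

theorem IsDiv.I_eq_zero {u : Fld} (hu : IsDiv u) (t : ℝ) : I t u = 0 := by
  obtain ⟨a, b, ha, hb, rfl⟩ := hu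
  exact I_div_eq_zero (ha.itg t) ((ha.D 1).itg t) (hb.itg t) ((hb.D 2).itg t)

theorem dec_Pot {u : Fld} (hu : IsDiv u) (t : ℝ) : Dec t 1 (Pot u) := by
  obtain ⟨a, b, ha, hb, rfl⟩ := hu
  rw [Pot_add (ha.D 1) (hb.D 2), Pot_D ha, Pot_D hb]
  exact (dec_one_D_Pot ha t 0).add (dec_one_D_Pot hb t 1)

theorem dec_D_Pot {u : Fld} (hu : IsDiv u) (t : ℝ) (i : Fin 2) : Dec t 2 (D i.succ (Pot u)) :=
  dec_two_D_Pot hu.test (hu.I_eq_zero t) i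

theorem dec_D_D_Pot {u : Fld} (hu : IsDiv u) (t : ℝ) (i j : Fin 2) :
    Dec t 3 (D i.succ (D j.succ (Pot u))) := by
  rw [← Pot_D hu.test]
  refine dec_three_D_Pot (hu.test.D _) ((hu.D _).I_eq_zero t) (fun k => ?_) i
  have h1 : X k * D j.succ u = D j.succ (X k * u) - (if j = k then 1 else 0) * u := by
    rw [D_mul, D_succ_X]; ring
  rw [h1, I_sub (((hu.test.mul_left _).D _).itg t) ((hu.test.mul_left _).itg t),
    (hu.test.mul_left _).I_D_eq_zero]
  split_ifs
  · rw [one_mul, hu.I_eq_zero, sub_zero]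
  · simp [I]

/-- A harmonic function decaying like a potential is constant in space. -/
theorem grad_eq_zero_of_harmonic {H : Fld} {t : ℝ} (h1 : Dec t 1 H)
    (h2 : ∀ i : Fin 2, Dec t 2 (D i.succ H)) (h3 : ∀ i : Fin 2, Dec t 2 (D i.succ (D i.succ H)))
    (hL : ∀ x, Lap H t x = 0) (i : Fin 2) (x : Plane) : D i.succ H t x = 0 := by
  have ha : Dec t 2 (D 1 H) := h2 0
  have hb : Dec t 2 (D 2 H) := h2 1
  have haa : Dec t 2 (D 1 (D 1 H)) := h3 0
  have hbb : Dec t 2 (D 2 (D 2 H)) := h3 1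
  have hda : Itg t (D 1 (H * D 1 H)) := by
    rw [D_mul]
    exact ((h1.mul' haa (m := 3) (by norm_num)).add (ha.mul' ha (by norm_num))).itg le_rfl
  have hdb : Itg t (D 2 (H * D 2 H)) := by
    rw [D_mul]
    exact ((h1.mul' hbb (m := 3) (by norm_num)).add (hb.mul' hb (by norm_num))).itg le_rfl
  have h0 := I_div_eq_zero ((h1.mul ha).itg (by norm_num)) hda ((h1.mul hb).itg (by norm_num)) hdb
  have hq : I t (D 1 H ^ 2 + D 2 H ^ 2) = 0 := by
    rw [← h0]
    refine integral_congr_ae (ae_of_all _ fun x => ?_)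
    have := hL x
    simp only [Lap_def, add_ap] at this
    simp only [add_ap, D_mul, mul_ap, pow_ap]
    linear_combination (-H t x) * this
  have hcont : Continuous ((D 1 H ^ 2 + D 2 H ^ 2).val t) := Fld.continuous _ t
  have hint : Itg t (D 1 H ^ 2 + D 2 H ^ 2) :=
    ((ha.pow_two (m := 3) (by norm_num)).add (hb.pow_two (by norm_num))).itg le_rfl
  have hz' := (integral_eq_zero_iff_of_nonneg (fun x => by
    simp only [add_ap, pow_ap, Pi.zero_apply]; positivity) hint).1 hq
  have hz := (hcont.ae_eq_iff_eq volume continuous_const).1 hz'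
  have hx : (D 1 H ^ 2 + D 2 H ^ 2) t x = 0 := congrFun hz x
  simp only [add_ap, pow_ap, Pi.zero_apply] at hx
  have h1 : D 1 H t x = 0 := by nlinarith [sq_nonneg (D 1 H t x), sq_nonneg (D 2 H t x)]
  have h2 : D 2 H t x = 0 := by nlinarith [sq_nonneg (D 1 H t x), sq_nonneg (D 2 H t x)]
  fin_cases i
  · exact h1
  · exact h2

theorem dec_D_Pot' {u : Fld} (hu : IsDiv u) (t : ℝ) {a : Fin 3} (ha : a ≠ 0) :
    Dec t 2 (D a (Pot u)) := by
  obtain ⟨i, rfl⟩ := Fin.exists_succ_eq.2 ha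
  exact dec_D_Pot hu t i

theorem dec_D_D_Pot' {u : Fld} (hu : IsDiv u) (t : ℝ) {a b : Fin 3} (ha : a ≠ 0) (hb : b ≠ 0) :
    Dec t 3 (D a (D b (Pot u))) := by
  obtain ⟨i, rfl⟩ := Fin.exists_succ_eq.2 ha
  obtain ⟨j, rfl⟩ := Fin.exists_succ_eq.2 hb
  exact dec_D_D_Pot hu t i j

theorem dec_D_D_D_Pot {u : Fld} (hu : IsDiv u) (t : ℝ) {a b : Fin 3} (c : Fin 3) (ha : a ≠ 0)
    (hb : b ≠ 0) : Dec t 3 (D a (D b (D c (Pot u)))) := by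
  rw [← Pot_D hu.test]
  exact dec_D_D_Pot' (hu.D c) t ha hb

/-- A harmonic function decaying like a potential vanishes. -/
theorem eq_zero_of_harmonic {H : Fld} {t : ℝ} (h1 : Dec t 1 H)
    (h2 : ∀ a : Fin 3, a ≠ 0 → Dec t 2 (D a H)) (h3 : ∀ a : Fin 3, a ≠ 0 → Dec t 2 (D a (D a H)))
    (hL : ∀ x, Lap H t x = 0) (x : Plane) : H t x = 0 := by
  have hg := grad_eq_zero_of_harmonic h1 (fun i => h2 _ (Fin.succ_ne_zero i))
    (fun i => h3 _ (Fin.succ_ne_zero i)) hL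
  have hd : ∀ y, fderiv ℝ (H t) y = 0 := by
    intro y
    ext v
    have hv : v = v 0 • EuclideanSpace.single (0 : Fin 2) (1 : ℝ) +
        v 1 • EuclideanSpace.single (1 : Fin 2) (1 : ℝ) := by
      ext j; fin_cases j <;> simp
    rw [hv, map_add, map_smul, map_smul]
    have e0 := hg 0 y
    have e1 := hg 1 y
    rw [D_succ_ap] at e0 e1
    rw [e0, e1]; simp
  have hconst := is_const_of_fderiv_eq_zero ((H.contDiff t).differentiable (by simp)) hd
  obtain ⟨C, hC⟩ := h1
  have hlim : Tendsto (fun n : ℕ => C * (1 + (n : ℝ)) ^ (-1 : ℤ)) atTop (𝓝 (C * 0)) := by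
    refine Tendsto.const_mul C ?_
    simp only [zpow_neg, zpow_one]
    exact tendsto_inv_atTop_zero.comp (tendsto_atTop_add_const_left _ _ tendsto_natCast_atTop_atTop)
  have hle : ∀ n : ℕ, |H t x| ≤ C * (1 + (n : ℝ)) ^ (-1 : ℤ) := by
    intro n
    have h := hC (EuclideanSpace.single 0 (n : ℝ))
    rw [hconst _ x] at h
    simpa using h
  have := ge_of_tendsto' hlim hle
  rw [mul_zero] at this
  exact abs_eq_zero.1 (le_antisymm this (abs_nonneg _))

/-! ### The potential commutes with the vector fields -/

theorem Rd_D (a : Fin 3) (u : Fld) (ha : a ≠ 0) : D a (Rd u) = Rd (D a u) + D a u := by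
  fin_cases a
  · exact absurd rfl ha
  · simp [Rd_def, D_mul, D_comm_21]; ring
  · simp [Rd_def, D_mul, D_comm_21]; ring

theorem Pot_Rd {f : Fld} (hf : IsDiv f) : Pot (Rd f) = Rd (Pot f) - 2 * Pot f := by
  ext t x
  have hp := isDiv_Rd hf
  have key := eq_zero_of_harmonic (H := Rd (Pot f) - 2 * Pot f - Pot (Rd f)) (t := t) ?_ ?_ ?_ ?_ x
  · simp only [sub_ap] at key ⊢; linarith
  · refine Dec.sub (Dec.sub ?_ ?_) (dec_Pot hp t)
    · exact ((dec_D_Pot' hf t (by decide)).X_mul 0 (by norm_num)).add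
        ((dec_D_Pot' hf t (by decide)).X_mul 1 (by norm_num))
    · exact (dec_ofNat t 2).mul' (dec_Pot hf t) (by norm_num)
  · intro a ha
    rw [map_sub, map_sub, Rd_D _ _ ha, Rd_def, D_mul, D_ofNat]
    refine Dec.sub (Dec.sub (Dec.add (Dec.add ?_ ?_) ?_) ?_) (dec_D_Pot' hp t ha)
    · exact (dec_D_D_Pot' hf t (by decide) ha).X_mul 0 (by norm_num)
    · exact (dec_D_D_Pot' hf t (by decide) ha).X_mul 1 (by norm_num)
    · exact dec_D_Pot' hf t ha
    · rw [mul_zero, add_zero]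
      exact (dec_ofNat t 2).mul' (dec_D_Pot' hf t ha) (by norm_num)
  · intro a ha
    rw [map_sub, map_sub, map_sub, map_sub, Rd_D _ _ ha, D_mul, D_ofNat, mul_zero, add_zero,
      D_mul, D_ofNat, mul_zero, add_zero, map_add, Rd_D _ _ ha, Rd_def]
    refine Dec.sub (Dec.sub (Dec.add (Dec.add (Dec.add ?_ ?_) ?_) ?_) ?_)
      ((dec_D_D_Pot' hp t ha ha).mono (by norm_num))
    · exact (dec_D_D_D_Pot hf t a (by decide) ha).X_mul 0 (by norm_num)
    · exact (dec_D_D_D_Pot hf t a (by decide) ha).X_mul 1 (by norm_num)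
    · exact (dec_D_D_Pot' hf t ha ha).mono (by norm_num)
    · exact (dec_D_D_Pot' hf t ha ha).mono (by norm_num)
    · exact (dec_ofNat t 2).mul' (dec_D_D_Pot' hf t ha ha) (by norm_num)
  · intro y
    have : Lap (Rd (Pot f) - 2 * Pot f - Pot (Rd f)) = 0 := by
      have h2 : Lap (2 * Pot f) = 2 * Lap (Pot f) := by simp [Lap_def, D_mul]; ring
      rw [map_sub, map_sub, Lap_Rd, h2, Lap_Pot hf.test, Lap_Pot hp.test, map_neg]; ring
    rw [this]; rfl

theorem Om_D (a : Fin 3) (u : Fld) : ∃ b c : ℝ, D a (Om u) = Om (D a u) + b • D 1 u + c • D 2 u := by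
  fin_cases a
  · exact ⟨0, 0, by simpa using D_zero_Om u⟩
  · exact ⟨0, -1, by simpa [sub_eq_add_neg] using D_one_Om u⟩
  · exact ⟨1, 0, by simpa using D_two_Om u⟩

theorem Pot_Om {f : Fld} (hf : IsDiv f) : Pot (Om f) = Om (Pot f) := by
  ext t x
  have hp := hf.Om
  have key := eq_zero_of_harmonic (H := Om (Pot f) - Pot (Om f)) (t := t) ?_ ?_ ?_ ?_ x
  · simp only [sub_ap] at key ⊢; linarith
  · refine Dec.sub ?_ (dec_Pot hp t)
    exact ((dec_D_Pot' hf t (by decide)).X_mul 1 (by norm_num)).sub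
        ((dec_D_Pot' hf t (by decide)).X_mul 0 (by norm_num))
  · intro a ha
    obtain ⟨b, c, hbc⟩ := Om_D a (Pot f)
    rw [map_sub, hbc, Om_def]
    refine Dec.sub (Dec.add (Dec.add (Dec.sub ?_ ?_) ?_) ?_) (dec_D_Pot' hp t ha)
    · exact (dec_D_D_Pot' hf t (by decide) ha).X_mul 1 (by norm_num)
    · exact (dec_D_D_Pot' hf t (by decide) ha).X_mul 0 (by norm_num)
    · exact (dec_D_Pot' hf t (by decide)).smul b
    · exact (dec_D_Pot' hf t (by decide)).smul c
  · intro a ha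
    obtain ⟨b, c, hbc⟩ := Om_D a (Pot f)
    obtain ⟨b', c', hbc'⟩ := Om_D a (D a (Pot f))
    rw [map_sub, map_sub, hbc, map_add, map_add, hbc', Om_def, Derivation.map_smul,
      Derivation.map_smul]
    refine Dec.sub (Dec.add (Dec.add (Dec.add (Dec.add (Dec.sub ?_ ?_) ?_) ?_) ?_) ?_)
      ((dec_D_D_Pot' hp t ha ha).mono (by norm_num))
    · exact (dec_D_D_D_Pot hf t a (by decide) ha).X_mul 1 (by norm_num)
    · exact (dec_D_D_D_Pot hf t a (by decide) ha).X_mul 0 (by norm_num)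
    · exact ((dec_D_D_Pot' hf t (by decide) ha).mono (by norm_num)).smul b'
    · exact ((dec_D_D_Pot' hf t (by decide) ha).mono (by norm_num)).smul c'
    · exact ((dec_D_D_Pot' hf t ha (by decide)).mono (by norm_num)).smul b
    · exact ((dec_D_D_Pot' hf t ha (by decide)).mono (by norm_num)).smul c
  · intro y
    have : Lap (Om (Pot f) - Pot (Om f)) = 0 := by
      rw [map_sub, Lap_Om, Lap_Pot hf.test, Lap_Pot hp.test, map_neg]; ring
    rw [this]; rfl

theorem Pot_Tm_mul {f : Fld} (hf : Test f) : Pot (Tm * f) = Tm * Pot f := by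
  ext t x
  rw [mul_ap, Pot_ap hf, Pot_ap (hf.mul_left _)]
  simp only [negLapInv, mul_ap, Tm_ap, mul_left_comm _ t]
  rw [integral_const_mul]; ring

theorem Pot_S {f : Fld} (hf : IsDiv f) : Pot (S f) = S (Pot f) - 2 * Pot f := by
  have h1 : S f = Tm * D 0 f + Rd f := rfl
  have h2 : S (Pot f) = Tm * D 0 (Pot f) + Rd (Pot f) := rfl
  rw [h1, Pot_add ((hf.test.D 0).mul_left _) (isDiv_Rd hf).test, Pot_Tm_mul (hf.test.D 0),
    Pot_D hf.test, Pot_Rd hf, h2]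
  ring

/-! ### Vector fields with smooth components -/

/-- The vector field with components `a`, `b`. -/
def vec (a b : Fld) : VField := fun t x => !₂[a t x, b t x]

theorem contDiff_vec (a b : Fld) : ContDiff ℝ ∞ fun p : ℝ × Plane => vec a b p.1 p.2 := by
  rw [contDiff_euclidean]
  intro i
  fin_cases i
  · exact a.smooth
  · exact b.smooth

theorem vec_congr {a b a' b' : Fld} (ha : a = a') (hb : b = b') : vec a b = vec a' b' := by
  rw [ha, hb]

theorem d_vec (k : Fin 3) (a b : Fld) : d k (vec a b) = vec (D k a) (D k b) := by
  funext t x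
  ext j
  rw [d_eq_fderiv (contDiff_vec a b)]
  have h := (((contDiff_vec a b).differentiable (by simp)) (t, x)).hasFDerivAt
  have h2 := ((EuclideanSpace.proj j : Plane →L[ℝ] ℝ).hasFDerivAt.comp (t, x) h).fderiv
  have h3 := congrArg (fun L => L (dir k)) h2
  refine Eq.trans h3.symm ?_
  fin_cases j
  · exact (D_ap k a t x).symm
  · exact (D_ap k b t x).symm

theorem dt_vec (a b : Fld) : dt (vec a b) = vec (D 0 a) (D 0 b) := d_vec 0 a b
theorem dx_zero_vec (a b : Fld) : dx 0 (vec a b) = vec (D 1 a) (D 1 b) := d_vec 1 a b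
theorem dx_one_vec (a b : Fld) : dx 1 (vec a b) = vec (D 2 a) (D 2 b) := d_vec 2 a b

theorem grad_val (q : Fld) : grad q = vec (D 1 q) (D 2 q) := rfl
theorem gradPerp_val (q : Fld) : gradPerp q = vec (D 2 q) (-D 1 q) := rfl
theorem div_vec (a b : Fld) : div (vec a b) = (D 1 a + D 2 b).val := by
  funext t x
  simp only [div, dx_zero_vec, dx_one_vec]
  simp [vec]
theorem curl_vec (a b : Fld) : curl (vec a b) = (D 2 a - D 1 b).val := by
  funext t x
  simp only [curl, dx_zero_vec, dx_one_vec]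
  simp [vec]
theorem neg_vec (a b : Fld) (t : ℝ) (x : Plane) : -vec a b t x = vec (-a) (-b) t x := by
  ext j; fin_cases j <;> simp [vec]

theorem rdr_vec (a b : Fld) : rdr (vec a b) = vec (Rd a) (Rd b) := by
  funext t x
  simp only [rdr, Fin.sum_univ_two, dx_zero_vec, dx_one_vec]
  ext j; fin_cases j <;> simp [vec, Rd_def]

theorem scalMod_vec (a b : Fld) : scalMod (vec a b) = vec (S a - a) (S b - b) := by
  funext t x
  simp only [scalMod, scal, rdr_vec, dt_vec]
  ext j; fin_cases j <;> simp [vec, Rd_def, S_def]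

theorem rotMod_vec (a b : Fld) : rotMod (vec a b) = vec (Om a - b) (Om b + a) := by
  funext t x
  simp only [rotMod, rot, dx_zero_vec, dx_one_vec]
  ext j; fin_cases j <;> simp [vec, Om_def]; ring

theorem exists_vec {U : VField} (hU : ContDiff ℝ ∞ fun p : ℝ × Plane => U p.1 p.2)
    (hc : HasCompactSupport fun p : ℝ × Plane => U p.1 p.2) :
    ∃ a b, Test a ∧ Test b ∧ U = vec a b := by
  have h := contDiff_euclidean.1 hU
  refine ⟨Fld.mk (fun t x => U t x 0) (h 0), Fld.mk (fun t x => U t x 1) (h 1), ?_, ?_, ?_⟩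
  · exact hc.comp_left (g := fun v : Plane => v 0) rfl
  · exact hc.comp_left (g := fun v : Plane => v 1) rfl
  · funext t x
    ext j; fin_cases j <;> simp [vec]

/-! ### The iterated vector fields -/

/-- `Z^α = ∂_t^{α_0} ∂_1^{α_1} ∂_2^{α_2} S^{α_3} Ω^{α_4}` on scalar functions. -/
def Z (α : Fin 5 → ℕ) (u : Fld) : Fld :=
  (D 0)^[α 0] ((D 1)^[α 1] ((D 2)^[α 2] (S^[α 3] (Om^[α 4] u))))

theorem iterate_rel {A B : Type} {R : A → B → Prop} {F : A → A} {G : B → B}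
    (h : ∀ a b, R a b → R (F a) (G b)) (n : ℕ) {a : A} {b : B} (hab : R a b) :
    R (F^[n] a) (G^[n] b) := by
  induction n with
  | zero => exact hab
  | succ n ih => rw [Function.iterate_succ_apply', Function.iterate_succ_apply']; exact h _ _ ih

/-- If a relation between vector fields and scalar functions is preserved by the five basic vector
fields, it is preserved by `Γ^α` and `Z^α`. -/
theorem Gam_rel {R : VField → Fld → Prop} (h0 : ∀ V f, R V f → R (dt V) (D 0 f))
    (h1 : ∀ V f, R V f → R (dx 0 V) (D 1 f)) (h2 : ∀ V f, R V f → R (dx 1 V) (D 2 f))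
    (h3 : ∀ V f, R V f → R (scalMod V) (S f)) (h4 : ∀ V f, R V f → R (rotMod V) (Om f))
    (α : Fin 5 → ℕ) {V : VField} {f : Fld} (h : R V f) : R (Gam α V) (Z α f) :=
  iterate_rel h0 _ (iterate_rel h1 _ (iterate_rel h2 _ (iterate_rel h3 _ (iterate_rel h4 _ h))))

theorem Z_ind {P : Fld → Prop} (h0 : ∀ a f, P f → P (D a f)) (h3 : ∀ f, P f → P (S f))
    (h4 : ∀ f, P f → P (Om f)) (α : Fin 5 → ℕ) {f : Fld} (h : P f) : P (Z α f) :=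
  Gam_rel (R := fun _ g => P g) (fun _ => h0 0) (fun _ => h0 1) (fun _ => h0 2) (fun _ => h3)
    (fun _ => h4) α (V := fun _ _ => 0) h

theorem Z_isDiv (α : Fin 5 → ℕ) {f : Fld} (h : IsDiv f) : IsDiv (Z α f) :=
  Z_ind (fun a _ hf => hf.D a) (fun _ hf => hf.S) (fun _ hf => hf.Om) α h

/-- `∇ · Γ^α U = Z^α ∇ · U` and `∇^⊥ · Γ^α U = Z^α ∇^⊥ · U`. -/
theorem Gam_vec (α : Fin 5 → ℕ) {a b : Fld} (ha : Test a) (hb : Test b) :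
    ∃ a' b', Test a' ∧ Test b' ∧ Gam α (vec a b) = vec a' b' ∧
      D 1 a' + D 2 b' = Z α (D 1 a + D 2 b) ∧ D 2 a' - D 1 b' = Z α (D 2 a - D 1 b) := by
  have hdiv : ∀ c : Bool, ∀ {V f}, (∃ a b, Test a ∧ Test b ∧ V = vec a b ∧
      (if c then D 1 a + D 2 b else D 2 a - D 1 b) = f) →
      ∃ a b, Test a ∧ Test b ∧ Gam α V = vec a b ∧
      (if c then D 1 a + D 2 b else D 2 a - D 1 b) = Z α f := by
    intro c V f h
    refine Gam_rel (R := fun V f => ∃ a b, Test a ∧ Test b ∧ V = vec a b ∧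
      (if c then D 1 a + D 2 b else D 2 a - D 1 b) = f) ?_ ?_ ?_ ?_ ?_ α h
    · rintro _ _ ⟨a, b, ha, hb, rfl, rfl⟩
      refine ⟨_, _, ha.D 0, hb.D 0, dt_vec a b, ?_⟩
      split_ifs <;> simp only [map_add, map_sub, D_comm 0]
    · rintro _ _ ⟨a, b, ha, hb, rfl, rfl⟩
      refine ⟨_, _, ha.D 1, hb.D 1, dx_zero_vec a b, ?_⟩
      split_ifs <;> simp only [map_add, map_sub, D_comm_21]
    · rintro _ _ ⟨a, b, ha, hb, rfl, rfl⟩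
      refine ⟨_, _, ha.D 2, hb.D 2, dx_one_vec a b, ?_⟩
      split_ifs <;> simp only [map_add, map_sub, D_comm_21]
    · rintro _ _ ⟨a, b, ha, hb, rfl, rfl⟩
      refine ⟨_, _, ha.S.sub ha, hb.S.sub hb, scalMod_vec a b, ?_⟩
      split_ifs <;> simp only [map_add, map_sub, D_S] <;> ring
    · rintro _ _ ⟨a, b, ha, hb, rfl, rfl⟩
      refine ⟨_, _, ha.Om.sub hb, hb.Om.add ha, rotMod_vec a b, ?_⟩
      split_ifs <;> simp only [map_add, map_sub, D_one_Om, D_two_Om] <;> ring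
  obtain ⟨a1, b1, ha1, hb1, h1, h1'⟩ := hdiv true ⟨a, b, ha, hb, rfl, rfl⟩
  obtain ⟨a2, b2, ha2, hb2, h2, h2'⟩ := hdiv false ⟨a, b, ha, hb, rfl, rfl⟩
  have hvv : vec a1 b1 = vec a2 b2 := h1 ▸ h2
  have e1 : a1 = a2 := by
    ext t x
    simpa [vec] using congrArg (fun v : Plane => v 0) (congrFun (congrFun hvv t) x)
  have e2 : b1 = b2 := by
    ext t x
    simpa [vec] using congrArg (fun v : Plane => v 1) (congrFun (congrFun hvv t) x)
  subst e1 e2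
  exact ⟨a1, b1, ha1, hb1, h1, by simpa using h1', by simpa using h2'⟩

/-- The curl-free field `-∇ (-Δ)⁻¹ f`. -/
def cfOf (f : Fld) : VField := vec (-D 1 (Pot f)) (-D 2 (Pot f))
/-- The divergence-free field `-∇^⊥ (-Δ)⁻¹ f`. -/
def dfOf (f : Fld) : VField := vec (-D 2 (Pot f)) (D 1 (Pot f))

theorem cf_vec {a b : Fld} (h : Test (D 1 a + D 2 b)) : cf (vec a b) = cfOf (D 1 a + D 2 b) := by
  funext t x
  have : (fun s => negLapInv (div (vec a b) s)) = (Pot (D 1 a + D 2 b)).val := by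
    funext s y
    rw [Pot_ap h, div_vec]
  rw [cf, this, grad_val, neg_vec, cfOf]

theorem df_vec {a b : Fld} (h : Test (D 2 a - D 1 b)) : df (vec a b) = dfOf (D 2 a - D 1 b) := by
  funext t x
  have : (fun s => negLapInv (curl (vec a b) s)) = (Pot (D 2 a - D 1 b)).val := by
    funext s y
    rw [Pot_ap h, curl_vec]
  rw [df, this, gradPerp_val, neg_vec, dfOf, neg_neg]

theorem Gam_cfOf (α : Fin 5 → ℕ) {f : Fld} (hf : IsDiv f) : Gam α (cfOf f) = cfOf (Z α f) := by
  refine (Gam_rel (R := fun V f => IsDiv f ∧ V = cfOf f) ?_ ?_ ?_ ?_ ?_ α ⟨hf, rfl⟩).2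
  · rintro _ f ⟨h, rfl⟩
    refine ⟨h.D 0, (dt_vec _ _).trans (vec_congr ?_ ?_)⟩ <;>
      simp only [Pot_D h.test, map_neg, D_comm 0]
  · rintro _ f ⟨h, rfl⟩
    refine ⟨h.D 1, (dx_zero_vec _ _).trans (vec_congr ?_ ?_)⟩ <;>
      simp only [Pot_D h.test, map_neg, D_comm_21]
  · rintro _ f ⟨h, rfl⟩
    refine ⟨h.D 2, (dx_one_vec _ _).trans (vec_congr ?_ ?_)⟩ <;>
      simp only [Pot_D h.test, map_neg, D_comm_21]
  · rintro _ f ⟨h, rfl⟩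
    refine ⟨h.S, (scalMod_vec _ _).trans (vec_congr ?_ ?_)⟩ <;>
      simp only [Pot_S h, map_neg, map_sub, D_S, D_mul, D_ofNat] <;> ring
  · rintro _ f ⟨h, rfl⟩
    refine ⟨h.Om, (rotMod_vec _ _).trans (vec_congr ?_ ?_)⟩ <;>
      simp only [Pot_Om h, map_neg, D_one_Om, D_two_Om] <;> ring

theorem Gam_dfOf (α : Fin 5 → ℕ) {f : Fld} (hf : IsDiv f) : Gam α (dfOf f) = dfOf (Z α f) := by
  refine (Gam_rel (R := fun V f => IsDiv f ∧ V = dfOf f) ?_ ?_ ?_ ?_ ?_ α ⟨hf, rfl⟩).2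
  · rintro _ f ⟨h, rfl⟩
    refine ⟨h.D 0, (dt_vec _ _).trans (vec_congr ?_ ?_)⟩ <;>
      simp only [Pot_D h.test, map_neg, D_comm 0]
  · rintro _ f ⟨h, rfl⟩
    refine ⟨h.D 1, (dx_zero_vec _ _).trans (vec_congr ?_ ?_)⟩ <;>
      simp only [Pot_D h.test, map_neg, D_comm_21]
  · rintro _ f ⟨h, rfl⟩
    refine ⟨h.D 2, (dx_one_vec _ _).trans (vec_congr ?_ ?_)⟩ <;>
      simp only [Pot_D h.test, map_neg, D_comm_21]
  · rintro _ f ⟨h, rfl⟩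
    refine ⟨h.S, (scalMod_vec _ _).trans (vec_congr ?_ ?_)⟩ <;>
      simp only [Pot_S h, map_neg, map_sub, D_S, D_mul, D_ofNat] <;> ring
  · rintro _ f ⟨h, rfl⟩
    refine ⟨h.Om, (rotMod_vec _ _).trans (vec_congr ?_ ?_)⟩ <;>
      simp only [Pot_Om h, map_neg, D_one_Om, D_two_Om] <;> ring

/-! ### Integration in Cartesian and polar coordinates -/

theorem lintegral_plane (g : Plane → ENNReal) :
    ∫⁻ x, g x = ∫⁻ p : ℝ × ℝ, g !₂[p.1, p.2] := by
  have e := ((PiLp.volume_preserving_ofLp (Fin 2)).symm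
    (MeasurableEquiv.toLp 2 (Fin 2 → ℝ)).symm).comp
      ((volume_preserving_finTwoArrow ℝ).symm MeasurableEquiv.finTwoArrow)
  rw [← e.lintegral_comp_emb (MeasurableEquiv.measurableEmbedding
    ((MeasurableEquiv.finTwoArrow.symm).trans (MeasurableEquiv.toLp 2 (Fin 2 → ℝ))))]
  refine lintegral_congr fun p => congrArg g ?_
  ext i; fin_cases i <;> rfl

/-- The point of the plane with polar coordinates `(ρ, θ)`. -/
def polarPt (ρ θ : ℝ) : Plane := !₂[ρ * Real.cos θ, ρ * Real.sin θ]

@[simp] theorem polarPt_zero (ρ θ : ℝ) : polarPt ρ θ 0 = ρ * Real.cos θ := rfl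
@[simp] theorem polarPt_one (ρ θ : ℝ) : polarPt ρ θ 1 = ρ * Real.sin θ := rfl

theorem norm_polarPt_sq (ρ θ : ℝ) : ‖polarPt ρ θ‖ ^ 2 = ρ ^ 2 := by
  rw [norm_sq_eq, polarPt_zero, polarPt_one]
  linear_combination ρ ^ 2 * Real.sin_sq_add_cos_sq θ

theorem norm_polarPt {ρ : ℝ} (hρ : 0 ≤ ρ) (θ : ℝ) : ‖polarPt ρ θ‖ = ρ := by
  have := norm_polarPt_sq ρ θ
  rwa [sq_eq_sq₀ (norm_nonneg _) hρ] at this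

theorem exists_polarPt (x : Plane) :
    ∃ θ ∈ Icc (-Real.pi) Real.pi, x = polarPt ‖x‖ θ := by
  refine ⟨Complex.arg (toC x), ⟨(Complex.neg_pi_lt_arg _).le, Complex.arg_le_pi _⟩, ?_⟩
  have h1 := Complex.norm_mul_cos_arg (toC x)
  have h2 := Complex.norm_mul_sin_arg (toC x)
  rw [norm_toC] at h1 h2
  ext i; fin_cases i
  · exact h1.symm
  · exact h2.symm

theorem contDiff_polarPt : ContDiff ℝ ∞ fun p : ℝ × ℝ => polarPt p.1 p.2 := by
  rw [contDiff_euclidean]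
  intro i; fin_cases i
  · exact contDiff_fst.mul (Real.contDiff_cos.comp contDiff_snd)
  · exact contDiff_fst.mul (Real.contDiff_sin.comp contDiff_snd)

theorem lintegral_polar (g : Plane → ENNReal) (hg : Measurable g) :
    ∫⁻ x, g x = ∫⁻ ρ in Ioi (0:ℝ), ∫⁻ θ in Ioo (-Real.pi) Real.pi,
      ENNReal.ofReal ρ * g (polarPt ρ θ) := by
  rw [lintegral_plane, ← lintegral_comp_polarCoord_symm]
  show ∫⁻ p in Ioi (0:ℝ) ×ˢ Ioo (-Real.pi) Real.pi, _ = _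
  rw [Measure.volume_eq_prod, ← Measure.prod_restrict, lintegral_prod]
  · rfl
  · refine Measurable.aemeasurable ?_
    exact (ENNReal.measurable_ofReal.comp measurable_fst).mul
      (hg.comp contDiff_polarPt.continuous.measurable)

theorem lintegral_polar' (g : Plane → ENNReal) (hg : Measurable g) :
    ∫⁻ x, g x = ∫⁻ θ in Ioo (-Real.pi) Real.pi, ∫⁻ ρ in Ioi (0:ℝ),
      ENNReal.ofReal ρ * g (polarPt ρ θ) := by
  rw [lintegral_polar g hg, lintegral_lintegral_swap]
  refine Measurable.aemeasurable ?_
  exact (ENNReal.measurable_ofReal.comp measurable_fst).mul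
      (hg.comp contDiff_polarPt.continuous.measurable)

theorem hasFDerivAt_fld (F : Fld) (t : ℝ) (x : Plane) :
    ∃ L : Plane →L[ℝ] ℝ, HasFDerivAt (F t) L x ∧ ∀ v, L v = v 0 * D 1 F t x + v 1 * D 2 F t x := by
  refine ⟨fderiv ℝ (F t) x, (((F.contDiff t).differentiable (by simp)) x).hasFDerivAt, fun v => ?_⟩
  have hv : v = v 0 • EuclideanSpace.single 0 (1:ℝ) + v 1 • EuclideanSpace.single 1 (1:ℝ) := by
    ext i; fin_cases i <;> simp
  conv_lhs => rw [hv]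
  rw [map_add, map_smul, map_smul]
  rfl

theorem hasDerivAt_fld (F : Fld) (t : ℝ) {γ : ℝ → Plane} {γ0 γ1 s : ℝ}
    (h0 : HasDerivAt (fun s => γ s 0) γ0 s) (h1 : HasDerivAt (fun s => γ s 1) γ1 s) :
    HasDerivAt (fun s => F t (γ s)) (γ0 * D 1 F t (γ s) + γ1 * D 2 F t (γ s)) s := by
  obtain ⟨L, hL, hv⟩ := hasFDerivAt_fld F t (γ s)
  have h : HasDerivAt γ !₂[γ0, γ1] s := by
    have := (h0.smul_const (EuclideanSpace.single 0 (1:ℝ) : Plane)).add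
      (h1.smul_const (EuclideanSpace.single 1 (1:ℝ) : Plane))
    refine (this.congr_deriv ?_).congr_of_eventuallyEq (Eventually.of_forall fun r => ?_) <;>
    · ext i; fin_cases i <;> simp
  have := hL.comp_hasDerivAt s h
  rw [hv] at this
  exact this

theorem hasDerivAt_angle (F : Fld) (t ρ θ : ℝ) :
    HasDerivAt (fun s => F t (polarPt ρ s)) (-(Om F t (polarPt ρ θ))) θ := by
  have := hasDerivAt_fld F t (γ := polarPt ρ) (s := θ)
    ((Real.hasDerivAt_cos θ).const_mul ρ) ((Real.hasDerivAt_sin θ).const_mul ρ)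
  refine this.congr_deriv ?_
  simp [Om_def]; ring

theorem hasDerivAt_radius (F : Fld) (t ρ θ : ℝ) :
    HasDerivAt (fun s => F t (polarPt s θ))
      (Real.cos θ * D 1 F t (polarPt ρ θ) + Real.sin θ * D 2 F t (polarPt ρ θ)) ρ := by
  have := hasDerivAt_fld F t (γ := fun s => polarPt s θ) (s := ρ)
    ((hasDerivAt_id ρ).mul_const (Real.cos θ)) ((hasDerivAt_id ρ).mul_const (Real.sin θ))
  refine this.congr_deriv ?_
  simp

/-! ### Sobolev inequalities in `L¹` -/

theorem ofReal_abs_le_Iic {f : ℝ → ℝ} (hf : ContDiff ℝ 1 f) (h : HasCompactSupport f) (a : ℝ) :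
    ENNReal.ofReal |f a| ≤ ∫⁻ s, ENNReal.ofReal |deriv f s| := by
  rw [← h.integral_Iic_deriv_eq hf a]
  refine (ENNReal.ofReal_le_ofReal (abs_integral_le_integral_abs)).trans ?_
  have hi : Integrable (deriv f) :=
    (hf.continuous_deriv le_rfl).integrable_of_hasCompactSupport h.deriv
  rw [ofReal_integral_eq_lintegral_ofReal hi.abs.integrableOn
    (Eventually.of_forall fun x => abs_nonneg _)]
  exact setLIntegral_le_lintegral _ _

theorem ofReal_abs_le_Ioi {f : ℝ → ℝ} (hf : ContDiff ℝ 1 f) (h : HasCompactSupport f) (a : ℝ) :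
    ENNReal.ofReal |f a| ≤ ∫⁻ s in Ioi a, ENNReal.ofReal |deriv f s| := by
  rw [← abs_neg, ← h.integral_Ioi_deriv_eq hf a]
  refine (ENNReal.ofReal_le_ofReal (abs_integral_le_integral_abs)).trans ?_
  have hi : Integrable (deriv f) :=
    (hf.continuous_deriv le_rfl).integrable_of_hasCompactSupport h.deriv
  rw [ofReal_integral_eq_lintegral_ofReal hi.abs.integrableOn
    (Eventually.of_forall fun x => abs_nonneg _)]

theorem Test.hasCompactSupport_comp {F : Fld} (hF : Test F) (t : ℝ) {γ : ℝ → Plane}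
    (hn : ∀ s, |s| ≤ ‖γ s‖) : HasCompactSupport fun s => F t (γ s) := by
  obtain ⟨R, hR⟩ := hF.exists_radius t
  refine HasCompactSupport.intro (isCompact_Icc (a := -(max R 0)) (b := max R 0)) fun s hs => ?_
  have : max R 0 < |s| := by
    by_contra h
    exact hs (abs_le.1 (not_lt.1 h))
  grind

theorem abs_le_integral_D_D {F : Fld} (hF : Test F) (t : ℝ) (x : Plane) :
    |F t x| ≤ ∫ y : Plane, |D 1 (D 2 F) t y| := by
  have key : ENNReal.ofReal |F t x| ≤ ∫⁻ y : Plane, ENNReal.ofReal |D 1 (D 2 F) t y| := by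
    have hm : Measurable fun p : ℝ × ℝ => ENNReal.ofReal |D 1 (D 2 F) t !₂[p.1, p.2]| := by
      refine ENNReal.measurable_ofReal.comp (Continuous.measurable ?_)
      exact ((D 1 (D 2 F)).continuous t |>.comp (by fun_prop)).abs
    rw [lintegral_plane, Measure.volume_eq_prod, lintegral_prod_symm' _ hm]
    have hc : ∀ G : Fld, ∀ b : ℝ, ContDiff ℝ 1 fun s : ℝ => G t !₂[s, b] := fun G b =>
      ((G.contDiff t).of_le (by simp)).comp (by
        rw [contDiff_euclidean]; intro i; fin_cases i
        · exact contDiff_id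
        · exact contDiff_const)
    have hc' : ∀ G : Fld, ∀ b : ℝ, ContDiff ℝ 1 fun s : ℝ => G t !₂[b, s] := fun G b =>
      ((G.contDiff t).of_le (by simp)).comp (by
        rw [contDiff_euclidean]; intro i; fin_cases i
        · exact contDiff_const
        · exact contDiff_id)
    have h2 := ofReal_abs_le_Iic (hc' F (x 0)) (hF.hasCompactSupport_comp t
      fun s => by simpa using abs_coord_le !₂[x 0, s] 1) (x 1)
    have hx : !₂[x 0, x 1] = x := by ext i; fin_cases i <;> rfl
    rw [hx] at h2
    refine h2.trans (lintegral_mono fun s => ?_)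
    have e : deriv (fun s : ℝ => F t !₂[x 0, s]) s = D 2 F t !₂[x 0, s] := by
      have := hasDerivAt_fld F t (γ := fun s => !₂[x 0, s]) (s := s)
        (hasDerivAt_const s (x 0)) (hasDerivAt_id s)
      simpa using this.deriv
    rw [e]
    have h1 := ofReal_abs_le_Iic (hc (D 2 F) s) ((hF.D 2).hasCompactSupport_comp t
      fun r => by simpa using abs_coord_le !₂[r, s] 0) (x 0)
    refine h1.trans (lintegral_mono fun r => ?_)
    have e : deriv (fun r : ℝ => D 2 F t !₂[r, s]) r = D 1 (D 2 F) t !₂[r, s] := by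
      have := hasDerivAt_fld (D 2 F) t (γ := fun r => !₂[r, s]) (s := r)
        (hasDerivAt_id r) (hasDerivAt_const r s)
      simpa using this.deriv
    rw [e]
  have hi : Integrable fun y => |D 1 (D 2 F) t y| := (((hF.D 2).D 1).itg t).abs
  rw [← ofReal_integral_eq_lintegral_ofReal hi (Eventually.of_forall fun x => abs_nonneg _)] at key
  exact (ENNReal.ofReal_le_ofReal_iff (integral_nonneg fun _ => abs_nonneg _)).1 key

/-- The mean of `|F|` over a circle, times its radius, is at most the `L¹` norm of the gradient. -/
theorem lintegral_circle_le {F : Fld} (hF : Test F) (t : ℝ) {ρ : ℝ} (hρ : 0 < ρ) :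
    ∫⁻ θ in Ioo (-Real.pi) Real.pi, ENNReal.ofReal (ρ * |F t (polarPt ρ θ)|) ≤
      ENNReal.ofReal (∫ y : Plane, (|D 1 F t y| + |D 2 F t y|)) := by
  have hi : Integrable fun y => |D 1 F t y| + |D 2 F t y| :=
    (((hF.D 1).itg t).abs).add ((hF.D 2).itg t).abs
  rw [ofReal_integral_eq_lintegral_ofReal hi (Eventually.of_forall fun x => by positivity),
    lintegral_polar']
  · refine lintegral_mono fun θ => ?_
    have hd : ContDiff ℝ 1 fun s => F t (polarPt s θ) :=
      (((F.contDiff t).of_le (by simp)).comp (contDiff_polarPt.of_le (by simp))).comp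
        (contDiff_id.prodMk contDiff_const)
    have h := ofReal_abs_le_Ioi hd (hF.hasCompactSupport_comp t
        (γ := fun s => polarPt s θ) fun s => by
          rw [← sq_le_sq₀ (abs_nonneg _) (norm_nonneg _), norm_polarPt_sq, sq_abs]) ρ
    rw [ENNReal.ofReal_mul hρ.le]
    refine (mul_le_mul_right h _).trans ?_
    rw [← lintegral_const_mul']
    · refine le_trans ?_ (lintegral_mono_set (Ioi_subset_Ioi hρ.le))
      refine setLIntegral_mono' measurableSet_Ioi fun s hs => ?_
      refine mul_le_mul' (ENNReal.ofReal_le_ofReal (le_of_lt hs)) (ENNReal.ofReal_le_ofReal ?_)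
      rw [(hasDerivAt_radius F t s θ).deriv]
      refine (abs_add_le _ _).trans (add_le_add ?_ ?_) <;> rw [abs_mul]
      · exact mul_le_of_le_one_left (abs_nonneg _) (Real.abs_cos_le_one _)
      · exact mul_le_of_le_one_left (abs_nonneg _) (Real.abs_sin_le_one _)
    · exact ENNReal.ofReal_ne_top
  · refine ENNReal.measurable_ofReal.comp (Continuous.measurable ?_)
    exact ((D 1 F).continuous t).abs.add ((D 2 F).continuous t).abs

theorem abs_le_circle {g g' : ℝ → ℝ} (hg : ∀ θ, HasDerivAt g (g' θ) θ) (hc : Continuous g')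
    {θ : ℝ} (hθ : θ ∈ Icc (-Real.pi) Real.pi) :
    |g θ| ≤ (∫ s in (-Real.pi)..Real.pi, |g s|) + ∫ s in (-Real.pi)..Real.pi, |g' s| := by
  have hgc : Continuous g := continuous_iff_continuousAt.2 fun s => (hg s).continuousAt
  have hpi := Real.pi_pos
  set J := ∫ s in (-Real.pi)..Real.pi, |g' s|
  set K := ∫ s in (-Real.pi)..Real.pi, |g s|
  have hJ : ∀ s ∈ Icc (-Real.pi) Real.pi, |g θ| - J ≤ |g s| := fun s hs => by
    have h1 : ∫ r in s..θ, g' r = g θ - g s :=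
      intervalIntegral.integral_eq_sub_of_hasDerivAt (fun r _ => hg r) (hc.intervalIntegrable _ _)
    have h2 : |∫ r in s..θ, g' r| ≤ J := by
      have hJ0 : 0 ≤ J := intervalIntegral.integral_nonneg (by linarith) fun _ _ => abs_nonneg _
      rw [← abs_of_nonneg hJ0]
      refine (intervalIntegral.norm_integral_le_abs_integral_norm (f := g')).trans ?_
      refine intervalIntegral.abs_integral_mono_interval ?_
        (Eventually.of_forall fun _ => abs_nonneg _) (hc.abs.intervalIntegrable _ _)
      rw [uIoc_of_le (by linarith : -Real.pi ≤ Real.pi)]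
      exact Ioc_subset_Ioc (le_min hs.1 hθ.1) (max_le hs.2 hθ.2)
    have h3 := abs_sub_abs_le_abs_sub (g θ) (g s)
    rw [h1] at h2
    linarith
  have h4 : ∫ s in (-Real.pi)..Real.pi, (|g θ| - J) ≤ K :=
    intervalIntegral.integral_mono_on (by linarith) (by simp) (hgc.abs.intervalIntegrable _ _) hJ
  rw [intervalIntegral.integral_const, smul_eq_mul] at h4
  have hK : 0 ≤ K := intervalIntegral.integral_nonneg (by linarith) fun _ _ => abs_nonneg _
  by_contra hcon
  push Not at hcon
  have : (1:ℝ) * (|g θ| - J) ≤ (Real.pi - -Real.pi) * (|g θ| - J) :=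
    mul_le_mul_of_nonneg_right (by linarith [Real.pi_gt_three]) (by linarith)
  linarith

/-- The radial Sobolev inequality. -/
theorem norm_mul_abs_le {F : Fld} (hF : Test F) (t : ℝ) (x : Plane) :
    ‖x‖ * |F t x| ≤ (∫ y : Plane, (|D 1 F t y| + |D 2 F t y|))
      + ∫ y : Plane, (|D 1 (Om F) t y| + |D 2 (Om F) t y|) := by
  rcases (norm_nonneg x).eq_or_lt with h0 | h0
  · rw [← h0, zero_mul]; positivity
  obtain ⟨θ, hθ, hx⟩ := exists_polarPt x
  set ρ := ‖x‖
  have hpc : Continuous fun s => polarPt ρ s :=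
    contDiff_polarPt.continuous.comp (by fun_prop : Continuous fun s : ℝ => (ρ, s))
  have hint : ∀ G : Fld, Test G → ρ * ∫ s in (-Real.pi)..Real.pi, |G t (polarPt ρ s)| ≤
      ∫ y : Plane, (|D 1 G t y| + |D 2 G t y|) := fun G hG => by
    have h := lintegral_circle_le hG t h0
    have hcont : Continuous fun s => ρ * |G t (polarPt ρ s)| :=
      continuous_const.mul ((G.continuous t).comp hpc).abs
    rw [← ofReal_integral_eq_lintegral_ofReal
      ((hcont.integrableOn_Icc (a := -Real.pi) (b := Real.pi)).mono_set Ioo_subset_Icc_self)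
      (Eventually.of_forall fun x => by positivity), ENNReal.ofReal_le_ofReal_iff (by positivity),
      ← integral_Ioc_eq_integral_Ioo,
      ← intervalIntegral.integral_of_le (by linarith [Real.pi_pos]),
      intervalIntegral.integral_const_mul] at h
    exact h
  have h := abs_le_circle (hasDerivAt_angle F t ρ) (((Om F).continuous t).comp hpc).neg hθ
  simp only [abs_neg] at h
  rw [hx]
  have := mul_le_mul_of_nonneg_left h h0.le
  rw [mul_add] at this
  linarith [hint F hF, hint _ hF.Om]

/-! ### Wirtinger's inequality on circles -/

/-- Wirtinger's inequality for a derivative `g'` of a `2π`-periodic function. -/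
theorem wirtinger {g g' g'' : ℝ → ℝ} (hg : ∀ θ, HasDerivAt g (g' θ) θ)
    (hg' : ∀ θ, HasDerivAt g' (g'' θ) θ) (hc : Continuous g'')
    (h0 : g (-Real.pi) = g Real.pi) (h1 : g' (-Real.pi) = g' Real.pi) :
    ∫ s in (-Real.pi)..Real.pi, g' s ^ 2 ≤ ∫ s in (-Real.pi)..Real.pi, g'' s ^ 2 := by
  have hpi := Real.pi_pos
  have hab : -Real.pi < Real.pi := by linarith
  have hgc : Continuous g' := continuous_iff_continuousAt.2 fun s => (hg' s).continuousAt
  have hL : ∀ f : ℝ → ℝ, Continuous f →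
      MemLp (fun s => (f s : ℂ)) 2 (volume.restrict (Ioc (-Real.pi) Real.pi)) := fun f hf => by
    refine (memLp_two_iff_integrable_sq_norm
      (Complex.continuous_ofReal.comp hf).aestronglyMeasurable).2 ?_
    have : Continuous fun s => ‖(f s : ℂ)‖ ^ 2 := by fun_prop
    exact (this.integrableOn_Icc (a := -Real.pi) (b := Real.pi)).mono_set Ioc_subset_Icc_self
  have s1 := hasSum_sq_fourierCoeffOn hab (hL g' hgc)
  have s2 := hasSum_sq_fourierCoeffOn hab (hL g'' hc)
  have hle := hasSum_le (fun n => ?_) s1 s2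
  · simp only [Complex.norm_real, Real.norm_eq_abs, sq_abs, smul_eq_mul] at hle
    exact (mul_le_mul_iff_of_pos_left (inv_pos.2 (by linarith))).1 hle
  · by_cases hn : n = 0
    · have : fourierCoeffOn hab (fun s => (g' s : ℂ)) n = 0 := by
        rw [fourierCoeffOn_eq_integral, hn]
        simp only [neg_zero, fourier_zero, one_smul]
        rw [intervalIntegral.integral_ofReal, intervalIntegral.integral_eq_sub_of_hasDerivAt
          (fun r _ => hg r) (hgc.intervalIntegrable _ _), h0]
        simp
      rw [this]; simp
    · rw [fourierCoeffOn_of_hasDerivAt hab hn (fun x _ => (hg' x).ofReal_comp)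
        ((Complex.continuous_ofReal.comp hc).intervalIntegrable _ _), h1, sub_self, mul_zero,
        zero_sub, norm_mul, norm_neg, norm_mul]
      have e1 : ‖((Real.pi:ℂ) - ((-Real.pi : ℝ) : ℂ))‖ = 2 * Real.pi := by
        rw [← Complex.ofReal_sub, Complex.norm_real, Real.norm_eq_abs, abs_of_pos (by linarith)]
        ring
      have e2 : ‖1 / (-2 * (Real.pi : ℂ) * Complex.I * n)‖ = 1 / (2 * Real.pi * |(n:ℝ)|) := by
        simp [abs_of_pos hpi]; 
      rw [e1, e2]
      have hn1 : (1:ℝ) ≤ |(n:ℝ)| := by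
        rw [← Int.cast_abs]; exact_mod_cast Int.one_le_abs hn
      have e3 : 1 / (2 * Real.pi * |(n:ℝ)|) * (2 * Real.pi * ‖fourierCoeffOn hab (fun s => (g'' s : ℂ)) n‖)
          = ‖fourierCoeffOn hab (fun s => (g'' s : ℂ)) n‖ / |(n:ℝ)| := by
        field_simp
      rw [e3]
      exact pow_le_pow_left₀ (by positivity) (div_le_self (norm_nonneg _) hn1) 2

/-- Wirtinger's inequality on circles, integrated against a radial weight. -/
theorem I_Om_sq_le {t : ℝ} {φ W : Fld} {w : ℝ → ℝ} (hw : ∀ x, W t x = w ‖x‖) (hw0 : ∀ x, 0 ≤ w x)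
    (h1 : Itg t (W * Om φ ^ 2)) (h2 : Itg t (W * Om (Om φ) ^ 2)) :
    I t (W * Om φ ^ 2) ≤ I t (W * Om (Om φ) ^ 2) := by
  have n1 : ∀ G : Fld, ∀ x, 0 ≤ (W * G ^ 2 : Fld) t x := fun G x => by
    simp only [mul_ap, pow_ap, hw]; exact mul_nonneg (hw0 _) (sq_nonneg _)
  have hm : ∀ G : Fld, Measurable fun x => ENNReal.ofReal (G t x) := fun G =>
    ENNReal.measurable_ofReal.comp (G.continuous t).measurable
  unfold I
  rw [← ENNReal.ofReal_le_ofReal_iff (integral_nonneg (n1 _)),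
    ofReal_integral_eq_lintegral_ofReal h1 (Eventually.of_forall (n1 _)),
    ofReal_integral_eq_lintegral_ofReal h2 (Eventually.of_forall (n1 _)),
    lintegral_polar _ (hm _), lintegral_polar _ (hm _)]
  refine setLIntegral_mono' measurableSet_Ioi fun ρ hρ => ?_
  have hpc : Continuous fun s => polarPt ρ s :=
    contDiff_polarPt.continuous.comp (by fun_prop : Continuous fun s : ℝ => (ρ, s))
  have e : ∀ G : Fld, ∫⁻ θ in Ioo (-Real.pi) Real.pi,
      ENNReal.ofReal ρ * ENNReal.ofReal ((W * G ^ 2 : Fld) t (polarPt ρ θ)) =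
      ENNReal.ofReal (ρ * w ρ * ∫ θ in (-Real.pi)..Real.pi, G t (polarPt ρ θ) ^ 2) := fun G => by
    rw [← intervalIntegral.integral_const_mul,
      intervalIntegral.integral_of_le (by linarith [Real.pi_pos]), integral_Ioc_eq_integral_Ioo,
      ofReal_integral_eq_lintegral_ofReal]
    · refine lintegral_congr fun θ => ?_
      rw [← ENNReal.ofReal_mul (le_of_lt hρ), mul_ap, pow_ap, hw, norm_polarPt (le_of_lt hρ),
        mul_assoc]
    · have hcont : Continuous fun s => ρ * w ρ * G t (polarPt ρ s) ^ 2 :=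
        continuous_const.mul (((G.continuous t).comp hpc).pow 2)
      exact (hcont.integrableOn_Icc (a := -Real.pi) (b := Real.pi)).mono_set Ioo_subset_Icc_self
    · exact Eventually.of_forall fun x =>
        mul_nonneg (mul_nonneg (le_of_lt hρ) (hw0 _)) (sq_nonneg _)
  rw [e, e]
  refine ENNReal.ofReal_le_ofReal (mul_le_mul_of_nonneg_left ?_ (mul_nonneg (le_of_lt hρ) (hw0 _)))
  have hp : ∀ G : Fld, G t (polarPt ρ (-Real.pi)) = G t (polarPt ρ Real.pi) := fun G => by
    simp [polarPt]
  have := wirtinger (g := fun s => -φ t (polarPt ρ s)) (g' := fun s => Om φ t (polarPt ρ s))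
    (g'' := fun s => -Om (Om φ) t (polarPt ρ s))
    (fun θ => ((hasDerivAt_angle φ t ρ θ).neg).congr_deriv (neg_neg _))
    (fun θ => by simpa using hasDerivAt_angle (Om φ) t ρ θ)
    (((Om (Om φ)).continuous t).comp hpc).neg (by simp [hp]) (hp _)
  simpa using this

/-! ### Decay of a field together with its gradient -/

/-- `u` decays like `|x|^{-k}` and its spatial gradient like `|x|^{-k-1}`, at time `t`. -/
def SymDec (t : ℝ) (k : ℤ) (u : Fld) : Prop := Dec t k u ∧ ∀ i : Fin 2, Dec t (k + 1) (D i.succ u)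

theorem SymDec.add {t : ℝ} {k : ℤ} {u v : Fld} (hu : SymDec t k u) (hv : SymDec t k v) :
    SymDec t k (u + v) :=
  ⟨hu.1.add hv.1, fun i => by rw [map_add]; exact (hu.2 i).add (hv.2 i)⟩

theorem SymDec.sub {t : ℝ} {k : ℤ} {u v : Fld} (hu : SymDec t k u) (hv : SymDec t k v) :
    SymDec t k (u - v) :=
  ⟨hu.1.sub hv.1, fun i => by rw [map_sub]; exact (hu.2 i).sub (hv.2 i)⟩

theorem SymDec.mul {t : ℝ} {k l m : ℤ} {u v : Fld} (hu : SymDec t k u) (hv : SymDec t l v)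
    (h : k + l = m) : SymDec t m (u * v) :=
  ⟨hu.1.mul' hv.1 h.ge, fun i => by
    rw [D_mul]
    exact (hu.1.mul' (hv.2 i) (by omega)).add (hv.1.mul' (hu.2 i) (by omega))⟩

theorem SymDec.smul {t : ℝ} {k : ℤ} {u : Fld} (c : ℝ) (hu : SymDec t k u) : SymDec t k (c • u) :=
  ⟨hu.1.smul c, fun i => by rw [Derivation.map_smul]; exact (hu.2 i).smul c⟩

theorem symDec_X (t : ℝ) (i : Fin 2) : SymDec t (-1) (X i) :=
  ⟨dec_X t i, fun j => by
    rw [D_succ_X]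
    split_ifs
    · exact dec_one t
    · exact dec_of_bounded (C := 0) fun x => by simp⟩

theorem SymDec.X_mul {t : ℝ} {k m : ℤ} {u : Fld} (hu : SymDec t k u) (i : Fin 2) (h : m + 1 = k) :
    SymDec t m (X i * u) := (symDec_X t i).mul hu (by omega)

theorem SymDec.I_div {t : ℝ} {u v : Fld} (hu : SymDec t 3 u) (hv : SymDec t 3 v) :
    I t (D 1 u + D 2 v) = 0 :=
  I_div_eq_zero (hu.1.itg le_rfl) ((hu.2 0).itg (by norm_num)) (hv.1.itg le_rfl)
    ((hv.2 1).itg (by norm_num))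

theorem symDec_Pot {f : Fld} (hf : IsDiv f) (t : ℝ) : SymDec t 1 (Pot f) :=
  ⟨dec_Pot hf t, fun i => dec_D_Pot hf t i⟩

theorem symDec_D_Pot {f : Fld} (hf : IsDiv f) (t : ℝ) {a : Fin 3} (ha : a ≠ 0) :
    SymDec t 2 (D a (Pot f)) :=
  ⟨dec_D_Pot' hf t ha, fun i => dec_D_D_Pot' hf t (Fin.succ_ne_zero i) ha⟩

theorem symDec_Rd_Pot {f : Fld} (hf : IsDiv f) (t : ℝ) : SymDec t 1 (Rd (Pot f)) :=
  ((symDec_D_Pot hf t (by decide)).X_mul 0 (by norm_num)).add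
    ((symDec_D_Pot hf t (by decide)).X_mul 1 (by norm_num))

theorem Test.sq {u : Fld} (hu : Test u) : Test (u ^ 2) := by
  rw [_root_.pow_two]; exact hu.mul_left u

/-! ### Energy identities for the Newtonian potential -/

/-- `∇u · ∇v`. -/
def dot (u v : Fld) : Fld := D 1 u * D 1 v + D 2 u * D 2 v

theorem Dec.dot {t : ℝ} {u v : Fld} (hu : SymDec t 1 u) (hv : SymDec t 1 v) :
    Dec t 4 (dot u v) :=
  ((hu.2 0).mul' (hv.2 0) (by norm_num)).add ((hu.2 1).mul' (hv.2 1) (by norm_num))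

theorem dot_self_nonneg (u : Fld) (t : ℝ) (x : Plane) : 0 ≤ dot u u t x := by
  simp only [ElasticWave.dot, add_ap, mul_ap]
  exact add_nonneg (mul_self_nonneg _) (mul_self_nonneg _)

theorem Dec.dot_itg {t : ℝ} {u v : Fld} (hu : SymDec t 1 u) (hv : SymDec t 1 v) :
    Itg t (ElasticWave.dot u v) := (Dec.dot hu hv).itg (by norm_num)

/-- The sum of the squares of the second spatial derivatives. -/
def hess (u : Fld) : Fld := D 1 (D 1 u) ^ 2 + 2 * D 1 (D 2 u) ^ 2 + D 2 (D 2 u) ^ 2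

theorem Dec.hess_itg {f : Fld} (hf : IsDiv f) (t : ℝ) : Itg t (hess (Pot f)) := by
  have h : ∀ a b : Fin 3, a ≠ 0 → b ≠ 0 → Dec t 3 (D a (D b (Pot f)) ^ 2) := fun a b ha hb =>
    (dec_D_D_Pot' hf t ha hb).pow_two (by norm_num)
  exact (((h 1 1 (by decide) (by decide)).add ((dec_ofNat t 2).mul' (h 1 2 (by decide) (by decide))
    (by norm_num))).add (h 2 2 (by decide) (by decide))).itg le_rfl

theorem SymDec.mono {t : ℝ} {k l : ℤ} {u : Fld} (h : SymDec t k u) (hl : l ≤ k) : SymDec t l u :=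
  ⟨h.1.mono hl, fun i => (h.2 i).mono (by omega)⟩

theorem SymDec.neg {t : ℝ} {k : ℤ} {u : Fld} (hu : SymDec t k u) : SymDec t k (-u) :=
  ⟨hu.1.neg, fun i => by rw [map_neg]; exact (hu.2 i).neg⟩

theorem symDec_D_D_Pot {f : Fld} (hf : IsDiv f) (t : ℝ) {a b : Fin 3} (ha : a ≠ 0) (hb : b ≠ 0) :
    SymDec t 2 (D a (D b (Pot f))) :=
  ⟨(dec_D_D_Pot' hf t ha hb).mono (by norm_num), fun i => by
    have h := dec_D_D_D_Pot hf t a (Fin.succ_ne_zero i) hb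
    rwa [D_comm b a] at h⟩

/-- Integration by parts: fields that differ by a decaying divergence have the same integral. -/
theorem I_eq_of_div {t : ℝ} {A B u v : Fld} (hA : Itg t A) (hu : SymDec t 3 u) (hv : SymDec t 3 v)
    (h : A = B + (D 1 u + D 2 v)) : I t A = I t B ∧ Itg t B := by
  have hi : Itg t (D 1 u + D 2 v) := ((hu.2 0).itg (by norm_num)).add ((hv.2 1).itg (by norm_num))
  have hB : B = A - (D 1 u + D 2 v) := by rw [h, add_sub_cancel_right]
  rw [hB]
  exact ⟨by rw [I_sub hA hi, hu.I_div hv, sub_zero], hA.sub hi⟩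

theorem I_hess_Pot {f : Fld} (hf : IsDiv f) (t : ℝ) : I t (hess (Pot f)) = I t (f ^ 2) := by
  have s1 := symDec_D_Pot hf t (a := 2) (by decide)
  have s2 := symDec_D_D_Pot hf t (a := 1) (b := 2) (by decide) (by decide)
  have s3 := symDec_D_D_Pot hf t (a := 1) (b := 1) (by decide) (by decide)
  have hL : f ^ 2 = Lap (Pot f) ^ 2 := by rw [Lap_Pot hf.test, neg_sq]
  rw [hL]
  refine (I_eq_of_div (Dec.hess_itg hf t) (((s1.add s1).mul s2 rfl).mono (by norm_num))
    (((s1.add s1).mul s3 rfl).neg.mono (by norm_num)) ?_).1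
  simp only [hess, Lap_def, D_mul, map_neg, map_add, D_comm_21]
  ring

/-- `x Δφ = ∇(r∂_rφ) - ∇^⊥(Ωφ)`, an orthogonal decomposition. -/
theorem I_dot_Rd_add_dot_Om {f : Fld} (hf : IsDiv f) (t : ℝ) :
    I t (dot (Rd (Pot f)) (Rd (Pot f))) + I t (dot (Om (Pot f)) (Om (Pot f))) =
      I t (Rsq * f ^ 2) := by
  have hr := symDec_Rd_Pot hf t
  have ho : SymDec t 1 (Om (Pot f)) := by rw [← Pot_Om hf]; exact symDec_Pot hf.Om t
  have ho' : ∀ a : Fin 3, a ≠ 0 → SymDec t 2 (D a (Om (Pot f))) := fun a ha => by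
    rw [← Pot_Om hf]; exact symDec_D_Pot hf.Om t ha
  rw [← I_add (Dec.dot_itg hr hr) (Dec.dot_itg ho ho)]
  have hL : f ^ 2 = Lap (Pot f) ^ 2 := by rw [Lap_Pot hf.test, neg_sq]
  rw [hL]
  refine (I_eq_of_div ((Dec.dot_itg hr hr).add (Dec.dot_itg ho ho))
    ((hr.add hr).mul (ho' 2 (by decide)) rfl)
    ((hr.add hr).mul (ho' 1 (by decide)) rfl).neg ?_).1
  have e : dot (Rd (Pot f)) (Rd (Pot f)) + dot (Om (Pot f)) (Om (Pot f)) =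
      (D 1 (Rd (Pot f)) - D 2 (Om (Pot f))) ^ 2 + (D 2 (Rd (Pot f)) + D 1 (Om (Pot f))) ^ 2
      + 2 * (D 1 (Rd (Pot f)) * D 2 (Om (Pot f)) - D 2 (Rd (Pot f)) * D 1 (Om (Pot f))) := by
    rw [dot, dot]; ring
  have e1 : D 1 (Rd (Pot f)) - D 2 (Om (Pot f)) = X 0 * Lap (Pot f) := by
    simp [Rd_def, Om_def, Lap_def, D_mul, D_comm_21]; ring
  have e2 : D 2 (Rd (Pot f)) + D 1 (Om (Pot f)) = X 1 * Lap (Pot f) := by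
    simp [Rd_def, Om_def, Lap_def, D_mul, D_comm_21]; ring
  rw [e, e1, e2]
  simp only [D_mul, map_neg, map_add, D_comm_21, Rsq]
  ring

theorem I_dot_Rd {f : Fld} (hf : IsDiv f) (t : ℝ) : I t (dot (Rd (Pot f)) (Pot f)) = 0 := by
  have hr := symDec_Rd_Pot hf t
  have hp := symDec_Pot hf t
  have h1 := symDec_D_Pot hf t (a := 1) (by decide)
  have h2 := symDec_D_Pot hf t (a := 2) (by decide)
  have hq := (((h1.mul h1 rfl).add (h2.mul h2 rfl)).smul (1/2))
  have e := (I_eq_of_div (Dec.dot_itg hr hp) (hq.X_mul 0 (by norm_num)) (hq.X_mul 1 (by norm_num))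
    (B := 0) ?_).1
  · rw [e]; simp [I]
  · have h2 : (algebraMap ℝ Fld (1/2)) * 2 = 1 := by
      rw [show (2 : Fld) = algebraMap ℝ Fld 2 from (map_ofNat _ 2).symm, ← map_mul]; norm_num
    simp only [dot, Algebra.smul_def, Rd_def, D_mul, map_add, D_comm_21, D_algebraMap, D_one_X_zero,
      D_one_X_one, D_two_X_zero, D_two_X_one]
    linear_combination (-(D 1 (Pot f)) * X 0 * D 1 (D 1 (Pot f)) - D 2 (Pot f) * X 0 * D 1 (D 2 (Pot f))
      - D 1 (Pot f) * X 1 * D 1 (D 2 (Pot f)) - D 2 (Pot f) * X 1 * D 2 (D 2 (Pot f))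
      - D 1 (Pot f) ^ 2 - D 2 (Pot f) ^ 2) * h2

/-! ### A Hardy inequality -/

theorem dec_inv_Rreg {ε : ℝ} (hε : 0 < ε) (t : ℝ) : Dec t 2 ((Rreg ε).inv (Rreg_pos hε)) := by
  refine ⟨2 + 2 / ε, fun x => ?_⟩
  have hp := Rreg_pos hε t x
  rw [inv_ap, abs_of_pos (inv_pos.2 hp), zpow_neg, ← div_eq_mul_inv, le_div_iff₀ (by positivity),
    inv_mul_le_iff₀ hp, Rreg_ap]
  have : (2:ℝ) / ε * ε = 2 := div_mul_cancel₀ _ hε.ne'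
  have h2 : (1 + ‖x‖) ^ (2:ℤ) = (1 + ‖x‖) ^ 2 := by norm_cast
  rw [h2]
  nlinarith [sq_nonneg (1 - ‖x‖), mul_nonneg (div_nonneg zero_le_two hε.le) (sq_nonneg ‖x‖)]

theorem symDec_inv_Rreg {ε : ℝ} (hε : 0 < ε) (t : ℝ) :
    SymDec t 2 ((Rreg ε).inv (Rreg_pos hε)) := by
  have h := dec_inv_Rreg hε t
  refine ⟨h, fun i => ?_⟩
  rw [D_inv]
  have hX : D i.succ (Rreg ε) = 2 * X i := by
    fin_cases i
    · exact D_one_Rreg ε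
    · exact D_two_Rreg ε
  rw [hX]
  exact (((h.pow_two (m := 4) (by norm_num)).mul' ((dec_ofNat t 2).mul' (dec_X t i)
    (m := -1) (by norm_num)) (by norm_num))).neg

theorem itg_log_mul {ε t : ℝ} (hε : 0 < ε) {u : Fld} (hu : Dec t 3 u) :
    Itg t ((Rreg ε).log (Rreg_pos hε) * u) := by
  obtain ⟨C, hC⟩ := hu
  have hi := integrable_one_add_norm (E := Plane) (μ := volume) (r := 5/2) (by simp; norm_num)
  refine (hi.const_mul ((4 + |Real.log ε| + |Real.log (1 + ε)|) * C)).mono'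
    ((Fld.continuous _ t).aestronglyMeasurable) (ae_of_all _ fun x => ?_)
  have hx := one_add_norm_pos x
  have h1 : (1:ℝ) ≤ (1 + ‖x‖) ^ (1/2 : ℝ) :=
    Real.one_le_rpow (by linarith [norm_nonneg x]) (by norm_num)
  have hlog : |Real.log (Rreg ε t x)| ≤
      (4 + |Real.log ε| + |Real.log (1 + ε)|) * (1 + ‖x‖) ^ (1/2 : ℝ) := by
    have hp := Rreg_pos hε t x
    have a1 : Real.log ε ≤ Real.log (Rreg ε t x) :=
      Real.log_le_log hε (by rw [Rreg_ap]; nlinarith [sq_nonneg ‖x‖])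
    have a2 : Real.log (Rreg ε t x) ≤ 4 * (1 + ‖x‖) ^ (1/2 : ℝ) + Real.log (1 + ε) := by
      have b1 : Rreg ε t x ≤ (1 + ‖x‖) ^ 2 * (1 + ε) := by
        rw [Rreg_ap]; nlinarith [norm_nonneg x, mul_nonneg hε.le (norm_nonneg x),
          mul_nonneg hε.le (sq_nonneg ‖x‖)]
      have b2 := Real.log_le_log hp b1
      rw [Real.log_mul (by positivity) (by positivity), Real.log_pow] at b2
      have b3 := Real.log_le_rpow_div hx.le (by norm_num : (0:ℝ) < 1/2)
      push_cast at b2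
      linarith
    have a3 := neg_abs_le (Real.log ε)
    have a4 := le_abs_self (Real.log (1 + ε))
    have a5 := mul_le_mul_of_nonneg_left h1 (abs_nonneg (Real.log ε))
    have a6 := mul_le_mul_of_nonneg_left h1 (abs_nonneg (Real.log (1 + ε)))
    have a7 := abs_nonneg (Real.log ε)
    have a8 := abs_nonneg (Real.log (1 + ε))
    rw [abs_le]
    constructor <;> nlinarith
  have hCx := hC x
  rw [Real.norm_eq_abs, mul_ap, abs_mul, log_ap]
  refine (mul_le_mul hlog hCx (abs_nonneg _) (by positivity)).trans (le_of_eq ?_)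
  have : (1 + ‖x‖) ^ (-3 : ℤ) * (1 + ‖x‖) ^ (1/2 : ℝ) = (1 + ‖x‖) ^ (-(5/2) : ℝ) := by
    rw [← Real.rpow_intCast, ← Real.rpow_add hx]; norm_num
  rw [← this]; ring

/-- The weight inequality behind the radial part of `hardy`. -/
theorem mul_log_sq_le {y : ℝ} (h0 : 0 < y) (h1 : y ≤ 1) : y * Real.log y ^ 2 ≤ 1 - y := by
  have hs : 0 < √y := Real.sqrt_pos.2 h0
  have hs2 : √y * √y = y := Real.mul_self_sqrt h0.le
  have hs1 : √y ≤ 1 := by nlinarith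
  -- `s ≤ sinh s` at `s = -(log y) / 2`
  have h2 : -Real.log y ≤ 1 / √y - √y := by
    have := (Real.self_le_sinh_iff (x := -Real.log y / 2)).2
      (by have := Real.log_nonpos h0.le h1; linarith)
    rw [Real.sinh_eq] at this
    have e1 : Real.exp (-Real.log y / 2) = 1 / √y := by
      rw [Real.sqrt_eq_rpow, Real.rpow_def_of_pos h0, one_div, ← Real.exp_neg]; ring_nf
    have e2 : Real.exp (-(-Real.log y / 2)) = √y := by
      rw [Real.sqrt_eq_rpow, Real.rpow_def_of_pos h0]; ring_nf
    rw [e1, e2] at this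
    linarith
  have h3 := Real.log_nonpos h0.le h1
  have h4 : Real.log y ^ 2 ≤ (1 / √y - √y) ^ 2 := by
    rw [← neg_sq]; exact pow_le_pow_left₀ (by linarith) h2 2
  have h5 : y * (1 / √y - √y) ^ 2 = (1 - y) ^ 2 := by
    have : y = √y * √y := hs2.symm
    field_simp
    rw [sq √y, hs2]
  nlinarith

theorem dot_Om_ap_le (u : Fld) (t : ℝ) (x : Plane) : Om u t x ^ 2 ≤ ‖x‖ ^ 2 * dot u u t x := by
  rw [norm_sq_eq]
  simp only [Om_def, dot, sub_ap, mul_ap, add_ap, X_ap]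
  nlinarith [sq_nonneg (x 0 * D 1 u t x + x 1 * D 2 u t x)]

/-- The multiplier identity behind the Hardy inequality, in integrated form: half of the radial part
is absorbed. -/
theorem I_radial_le {f : Fld} (hf : IsDiv f) {t R : ℝ} (hR : ∀ x : Plane, R < ‖x‖ → f t x = 0)
    (hR0 : 0 < R) {ε : ℝ} (hε : 0 < ε) :
    I t ((Rreg ε).inv (Rreg_pos hε) * Rd (Pot f) ^ 2) ≤
      2 * I t ((Rreg ε).inv (Rreg_pos hε) * Om (Pot f) ^ 2)
        + I t ((algebraMap ℝ Fld (R ^ 2) - Rsq) * f ^ 2) := by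
  set w := (Rreg ε).inv (Rreg_pos hε) with hw
  set φ := Pot f with hφ
  set c := Real.log (R ^ 2 + ε)
  have s1 := symDec_D_Pot hf t (a := 1) (by decide)
  have s2 := symDec_D_Pot hf t (a := 2) (by decide)
  have sr := symDec_Rd_Pot hf t
  have so : SymDec t 1 (Om φ) := by rw [hφ, ← Pot_Om hf]; exact symDec_Pot hf.Om t
  rw [← hφ] at s1 s2 sr
  have sw := symDec_inv_Rreg hε t
  rw [← hw] at sw
  -- twice the logarithmic multiplier
  set h : Fld := algebraMap ℝ Fld c - (Rreg ε).log (Rreg_pos hε) with hh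
  have ih : ∀ u : Fld, Dec t 3 u → Itg t (h * u) := fun u hu => by
    have e : h * u = c • u - (Rreg ε).log (Rreg_pos hε) * u := by
      rw [hh, sub_mul, Algebra.smul_def]
    rw [e]
    exact ((hu.itg le_rfl).smul c).sub (itg_log_mul hε hu)
  have h1 : D 1 h = -(2 * (w * X 0)) := by
    rw [hh, map_sub, D_algebraMap, D_log, D_one_Rreg]; ring
  have h2 : D 2 h = -(2 * (w * X 1)) := by
    rw [hh, map_sub, D_algebraMap, D_log, D_two_Rreg]; ring
  have hq := (s1.mul s1 rfl).add (s2.mul s2 rfl)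
  have su := ((s1.add s1).mul sr (m := 3) rfl).sub (hq.X_mul 0 (by norm_num))
  have sv := ((s2.add s2).mul sr (m := 3) rfl).sub (hq.X_mul 1 (by norm_num))
  have hwX : ∀ i : Fin 2, ∀ u, Dec t 3 u → Dec t 3 (u * -(2 * (w * X i))) := fun i u hu =>
    hu.mul' (((dec_ofNat t 2).mul' (sw.1.mul' (dec_X t i) (m := 1) (by norm_num))
      (m := 0) (by norm_num)).neg) (by norm_num)
  have key := I_div_eq_zero (t := t) (ih _ su.1) (by
      rw [D_mul, h1]
      exact (ih _ ((su.2 0).mono (by norm_num))).add ((hwX 0 _ su.1).itg le_rfl)) (ih _ sv.1) (by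
      rw [D_mul, h2]
      exact (ih _ ((sv.2 1).mono (by norm_num))).add ((hwX 1 _ sv.1).itg le_rfl))
  have iR : Itg t (w * Rd φ ^ 2) := (sw.1.mul' (sr.1.pow_two (m := 2) (by norm_num))
    (m := 3) (by norm_num)).itg le_rfl
  have iO : Itg t (w * Om φ ^ 2) := (sw.1.mul' (so.1.pow_two (m := 2) (by norm_num))
    (m := 3) (by norm_num)).itg le_rfl
  have tF : Test (h * f * Rd φ) := by
    rw [mul_right_comm]; exact hf.test.mul_left _
  have hL : Lap φ = -f := Lap_Pot hf.test
  rw [show D 1 (h * ((D 1 φ + D 1 φ) * Rd φ - X 0 * (D 1 φ * D 1 φ + D 2 φ * D 2 φ)))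
      + D 2 (h * ((D 2 φ + D 2 φ) * Rd φ - X 1 * (D 1 φ * D 1 φ + D 2 φ * D 2 φ)))
      = (2 : ℝ) • (w * Om φ ^ 2 - w * Rd φ ^ 2 - h * f * Rd φ) by
    have : f = -Lap φ := by rw [hL, neg_neg]
    rw [this, D_mul, D_mul, h1, h2]
    simp only [Rd_def, Om_def, Lap_def, D_mul, map_sub, map_add, D_comm_21, two_smul, D_one_X_zero,
      D_one_X_one, D_two_X_zero, D_two_X_one]
    ring, I_smul, I_sub (iO.sub iR) (tF.itg t), I_sub iO iR] at key
  have tG : Test ((algebraMap ℝ Fld (R ^ 2) - Rsq) * f ^ 2) := hf.test.sq.mul_left _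
  have hb : -I t (h * f * Rd φ) ≤ 1 / 2 * I t (w * Rd φ ^ 2)
      + 1 / 2 * I t ((algebraMap ℝ Fld (R ^ 2) - Rsq) * f ^ 2) := by
    rw [← I_neg, ← I_smul, ← I_smul, ← I_add (iR.smul _) ((tG.itg t).smul _)]
    refine I_mono (tF.itg t).neg ((iR.smul _).add ((tG.itg t).smul _)) fun x => ?_
    have hρ := Rreg_pos hε t x
    simp only [neg_ap, mul_ap, add_ap, smul_ap, pow_ap, sub_ap, Rsq_ap, algebraMap_ap, hh, hw,
      inv_ap, log_ap]
    by_cases hx : R < ‖x‖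
    · rw [hR x hx]
      have : 0 ≤ (Rreg ε t x)⁻¹ * Rd φ t x ^ 2 := by positivity
      nlinarith
    · push Not at hx
      have hxx : ‖x‖ ^ 2 ≤ R ^ 2 := pow_le_pow_left₀ (norm_nonneg x) hx 2
      rw [Rreg_ap] at hρ ⊢
      have hP : 0 < R ^ 2 + ε := by positivity
      have hy := mul_log_sq_le (div_pos hρ hP) ((div_le_one hP).2 (by linarith))
      rw [Real.log_div hρ.ne' hP.ne'] at hy
      have hy2 : (‖x‖ ^ 2 + ε) * (c - Real.log (‖x‖ ^ 2 + ε)) ^ 2 ≤ R ^ 2 - ‖x‖ ^ 2 := by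
        have e1 : (‖x‖ ^ 2 + ε) / (R ^ 2 + ε) * (R ^ 2 + ε) = ‖x‖ ^ 2 + ε :=
          div_mul_cancel₀ _ hP.ne'
        have := mul_le_mul_of_nonneg_right hy hP.le
        have e2 : (Real.log (‖x‖ ^ 2 + ε) - Real.log (R ^ 2 + ε)) ^ 2 =
          (c - Real.log (‖x‖ ^ 2 + ε)) ^ 2 := by ring
        rw [e2] at this
        nlinarith
      set L := c - Real.log (‖x‖ ^ 2 + ε)
      set ρ := ‖x‖ ^ 2 + ε
      have e3 : ρ⁻¹ * ρ = 1 := inv_mul_cancel₀ hρ.ne'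
      have e4 : 0 ≤ ρ⁻¹ * (Rd φ t x + ρ * L * f t x) ^ 2 := by positivity
      have e5 : ρ⁻¹ * (Rd φ t x + ρ * L * f t x) ^ 2 = ρ⁻¹ * Rd φ t x ^ 2
          + 2 * (L * f t x * Rd φ t x) + (ρ * L ^ 2) * f t x ^ 2 := by
        linear_combination (2 * L * f t x * Rd φ t x + ρ * L ^ 2 * f t x ^ 2) * e3
      have := mul_le_mul_of_nonneg_right hy2 (sq_nonneg (f t x))
      linarith
  linarith

theorem tendsto_eps_I {u : Fld} {t : ℝ} (hu : Itg t u) (hu0 : ∀ x, 0 ≤ u t x) :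
    Tendsto (fun n : ℕ => ∫ x, (1 / ((n : ℝ) + 1)) / (‖x‖ ^ 2 + 1 / ((n : ℝ) + 1)) * u t x)
      atTop (𝓝 0) := by
  have h0 : (0 : ℝ) = ∫ _x : Plane, (0:ℝ) := by simp
  rw [h0]
  have hpos : ∀ n : ℕ, (0:ℝ) < 1 / ((n:ℝ) + 1) := fun n => by positivity
  refine tendsto_integral_of_dominated_convergence (u t) (fun n => ?_) hu (fun n => ?_) ?_
  · refine (Continuous.mul ?_ (u.continuous t)).aestronglyMeasurable
    refine continuous_const.div (by fun_prop) fun x => ?_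
    have := hpos n; positivity
  · refine ae_of_all _ fun x => ?_
    have := hpos n
    rw [Real.norm_eq_abs, abs_of_nonneg (mul_nonneg (by positivity) (hu0 x))]
    refine mul_le_of_le_one_left (hu0 x) ((div_le_one (by positivity)).2 ?_)
    nlinarith [sq_nonneg ‖x‖]
  · have : ∀ᵐ x : Plane, x ≠ 0 := by
      rw [ae_iff]; simp
    filter_upwards [this] with x hx
    have hx' : 0 < ‖x‖ ^ 2 := by positivity
    have h1 := tendsto_one_div_add_atTop_nhds_zero_nat (𝕜 := ℝ)
    have h2 := (h1.div (tendsto_const_nhds.add h1 : Tendsto (fun n : ℕ => ‖x‖ ^ 2 + 1 / ((n : ℝ) + 1))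
      atTop (𝓝 (‖x‖ ^ 2 + 0))) (by positivity)).mul_const (u t x)
    simpa using h2

/-- A Hardy inequality for `∇φ`, `φ = Pot f`, which involves no weight at infinity. Split `∇φ` into its
radial and angular parts: the radial part is governed by the source `f` in the disc `|x| ≤ R`, and
the angular part by `∇Ωφ`, since `Ωφ` has mean zero on circles. The origin is cut out by
`|x|² / (|x|² + ε)` with `ε → 0`. -/
theorem hardy {f : Fld} (hf : IsDiv f) {t R : ℝ} (hR : ∀ x : Plane, R < ‖x‖ → f t x = 0)
    (hR0 : 0 < R) :
    I t (dot (Pot f) (Pot f)) ≤ 3 * I t (dot (Om (Pot f)) (Om (Pot f)))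
      + I t ((algebraMap ℝ Fld (R ^ 2) - Rsq) * f ^ 2) := by
  set φ := Pot f with hφ
  have sp := symDec_Pot hf t
  have sr := symDec_Rd_Pot hf t
  have so : SymDec t 1 (Om φ) := by rw [hφ, ← Pot_Om hf]; exact symDec_Pot hf.Om t
  have soo : SymDec t 1 (Om (Om φ)) := by
    rw [hφ, ← Pot_Om hf, ← Pot_Om hf.Om]; exact symDec_Pot hf.Om.Om t
  rw [← hφ] at sp sr
  have hlim := tendsto_eps_I (Dec.dot_itg sp sp) (fun x => by
    simp only [dot, add_ap, mul_ap]; nlinarith [sq_nonneg (D 1 φ t x), sq_nonneg (D 2 φ t x)])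
  refine le_of_tendsto' (f := fun n : ℕ => I t (dot φ φ) - ∫ x, (1 / ((n : ℝ) + 1)) /
    (‖x‖ ^ 2 + 1 / ((n : ℝ) + 1)) * dot φ φ t x) (by simpa using (hlim.const_sub (I t (dot φ φ))))
    fun n => ?_
  have hε : (0:ℝ) < 1 / ((n:ℝ) + 1) := by positivity
  set ε := 1 / ((n:ℝ) + 1)
  set w := (Rreg ε).inv (Rreg_pos hε) with hw
  have sw := symDec_inv_Rreg hε t
  rw [← hw] at sw
  have iw : ∀ u, SymDec t 1 u → Itg t (w * u ^ 2) := fun u hu =>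
    (sw.1.mul' (hu.1.pow_two (m := 2) (by norm_num)) (m := 3) (by norm_num)).itg le_rfl
  have ie : Itg t (ε • (w * dot φ φ)) :=
    ((sw.1.mul' (Dec.dot sp sp) (m := 3) (by norm_num)).itg le_rfl).smul ε
  have e1 : (∫ x, ε / (‖x‖ ^ 2 + ε) * dot φ φ t x) = I t (ε • (w * dot φ φ)) := by
    refine integral_congr_ae (ae_of_all _ fun x => ?_)
    simp only [smul_ap, mul_ap, hw, inv_ap, Rreg_ap]; ring
  have e2 : dot φ φ = (w * Rd φ ^ 2 + w * Om φ ^ 2) + ε • (w * dot φ φ) := by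
    have h1 := mul_inv_self (Rreg ε) (Rreg_pos hε)
    rw [← hw, Rreg, Rsq] at h1
    simp only [dot, Rd_def, Om_def, Algebra.smul_def]
    linear_combination (-(D 1 φ * D 1 φ + D 2 φ * D 2 φ)) * h1
  have e3 : I t (dot φ φ) = I t (w * Rd φ ^ 2) + I t (w * Om φ ^ 2) + I t (ε • (w * dot φ φ)) := by
    conv_lhs => rw [e2]
    rw [I_add ((iw _ sr).add (iw _ so)) ie, I_add (iw _ sr) (iw _ so)]
  have e4 := I_radial_le hf hR hR0 hε
  have e5 : I t (w * Om φ ^ 2) ≤ I t (w * Om (Om φ) ^ 2) :=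
    I_Om_sq_le (w := fun r => (r ^ 2 + ε)⁻¹) (fun x => by rw [hw, inv_ap, Rreg_ap])
      (fun r => by positivity) (iw _ so) (iw _ soo)
  have e6 : I t (w * Om (Om φ) ^ 2) ≤ I t (dot (Om φ) (Om φ)) := by
    refine I_mono (iw _ soo) (Dec.dot_itg so so) fun x => ?_
    have h1 := dot_Om_ap_le (Om φ) t x
    have h2 : 0 ≤ dot (Om φ) (Om φ) t x := by
      simp only [dot, add_ap, mul_ap]
      nlinarith [sq_nonneg (D 1 (Om φ) t x), sq_nonneg (D 2 (Om φ) t x)]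
    have hp := Rreg_pos hε t x
    rw [mul_ap, pow_ap, hw, inv_ap, inv_mul_le_iff₀ hp]
    refine h1.trans (mul_le_mul_of_nonneg_right ?_ h2)
    rw [Rreg_ap]; linarith
  rw [← hw] at e4
  show I t (dot φ φ) - (∫ x, ε / (‖x‖ ^ 2 + ε) * dot φ φ t x) ≤ _
  rw [e1]
  linarith

/-! ### Coercivity of the Morawetz energy -/

theorem norm_vec_sq (a b : Fld) (t : ℝ) (x : Plane) :
    ‖vec a b t x‖ ^ 2 = a t x ^ 2 + b t x ^ 2 := norm_sq_eq _

theorem inner_vec (a b a' b' : Fld) (t : ℝ) (x : Plane) :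
    inner ℝ (vec a b t x) (vec a' b' t x) = a t x * a' t x + b t x * b' t x := by
  simp [vec, PiLp.inner_apply, mul_comm]

/-- The density of the Morawetz energy of the field `(a, b)`, where `τ = t + 1/c + 1`. -/
def morDensity (c τ : ℝ) (a b : Fld) : Fld :=
  τ • (D 0 a ^ 2 + D 0 b ^ 2) + (c ^ 2 * τ) • (D 1 a ^ 2 + D 1 b ^ 2 + (D 2 a ^ 2 + D 2 b ^ 2))
    + (2:ℝ) • (Rd a * D 0 a + Rd b * D 0 b) + (a * D 0 a + b * D 0 b)

theorem morawetz_vec (c t : ℝ) (a b : Fld) :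
    morawetz c (vec a b) t = 1 / 2 * I t (morDensity c (t + 1 / c + 1) a b) := by
  unfold morawetz I
  congr 1
  refine integral_congr_ae (ae_of_all _ fun x => ?_)
  simp only [dt_vec, dx_zero_vec, dx_one_vec, rdr_vec, Fin.sum_univ_two, norm_vec_sq, inner_vec,
    morDensity, add_ap, smul_ap, mul_ap, pow_ap]

theorem morawetz_dfOf_eq (c t : ℝ) (f : Fld) : morawetz c (dfOf f) t = morawetz c (cfOf f) t := by
  rw [dfOf, cfOf, morawetz_vec, morawetz_vec]
  congr 2
  simp only [morDensity, map_neg, Algebra.smul_def]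
  ring

theorem half_smul_two : (algebraMap ℝ Fld (1 / 2)) * 2 = 1 := by
  rw [show (2 : Fld) = algebraMap ℝ Fld 2 from (map_ofNat _ 2).symm, ← map_mul]; norm_num

/-- Coercivity of the Morawetz energy of the gradient of a potential. With `φ = Pot f` and
`q = r∂ᵣφ - φ / 2`, the mixed terms of the density add up to `2 ∇q · ∇∂ₜφ`. After Cauchy-Schwarz,
integration by parts and `hardy` bound `‖∇q‖²` by `(c t + 1)² ‖f‖²` minus a multiple of
`∫ ((c t + 1)² - r²) f²`. -/
theorem morawetz_lower {f : Fld} (hf : IsDiv f) {c t : ℝ} (hc : 0 < c) (ht : 0 ≤ t)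
    (hR : ∀ x : Plane, c * t + 1 < ‖x‖ → f t x = 0) :
    1 / 2 * I t (dot (Pot (D 0 f)) (Pot (D 0 f))) + c ^ 2 / 2 * I t (f ^ 2)
      + 3 * c / (8 * (c * t + 1)) * I t ((algebraMap ℝ Fld ((c * t + 1) ^ 2) - Rsq) * f ^ 2)
      ≤ morawetz c (cfOf f) t := by
  set R := c * t + 1 with hRdef
  have hR0 : 0 < R := by positivity
  rw [cfOf, morawetz_vec]
  set φ := Pot f with hφ
  set τ := t + 1 / c + 1 with hτ
  have hτR : τ = R / c + 1 := by rw [hτ, hRdef]; field_simp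
  have hW : Pot (D 0 f) = D 0 φ := Pot_D hf.test 0
  have sp := symDec_Pot hf t
  have sr := symDec_Rd_Pot hf t
  have so : SymDec t 1 (Om φ) := by rw [hφ, ← Pot_Om hf]; exact symDec_Pot hf.Om t
  have sW : SymDec t 1 (D 0 φ) := by rw [← hW]; exact symDec_Pot (hf.D 0) t
  rw [← hφ] at sp sr
  rw [hW]
  set q := Rd φ - (1/2 : ℝ) • φ with hq
  have sq : SymDec t 1 q := sr.sub (sp.smul _)
  have e1 : morDensity c τ (-D 1 φ) (-D 2 φ) = τ • dot (D 0 φ) (D 0 φ) + (c ^ 2 * τ) • hess φ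
      + (2 : ℝ) • dot q (D 0 φ) := by
    have h2 := half_smul_two
    have h3 : (2 : Fld) = algebraMap ℝ Fld 2 := (map_ofNat _ 2).symm
    simp only [morDensity, dot, hess, hq, Algebra.smul_def, map_sub, map_neg, D_mul, D_algebraMap,
      Rd_def, D_comm_10, D_comm_20, D_comm_21, map_add, D_one_X_zero,
      D_one_X_one, D_two_X_zero, D_two_X_one, ← h3]
    linear_combination (D 1 φ * D 0 (D 1 φ) + D 2 φ * D 0 (D 2 φ)) * h2
  have e2 : dot q q = dot (Rd φ) (Rd φ) - dot (Rd φ) φ + (1/4 : ℝ) • dot φ φ := by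
    have h2 := half_smul_two
    have h4 : algebraMap ℝ Fld (1/4) = algebraMap ℝ Fld (1/2) * algebraMap ℝ Fld (1/2) := by
      rw [← map_mul]; norm_num
    simp only [dot, hq, Algebra.smul_def, map_sub, D_mul, D_algebraMap, h4]
    linear_combination (-(D 1 (Rd φ) * D 1 φ + D 2 (Rd φ) * D 2 φ)) * h2
  have i2 : I t (dot q q) = I t (dot (Rd φ) (Rd φ)) - I t (dot (Rd φ) φ)
      + 1/4 * I t (dot φ φ) := by
    rw [e2, I_add ((Dec.dot_itg sr sr).sub (Dec.dot_itg sr sp)) ((Dec.dot_itg sp sp).smul _),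
      I_sub (Dec.dot_itg sr sr) (Dec.dot_itg sr sp), I_smul]
  have i1 : I t (morDensity c τ (-D 1 φ) (-D 2 φ)) = τ * I t (dot (D 0 φ) (D 0 φ))
      + c ^ 2 * τ * I t (f ^ 2) + 2 * I t (dot q (D 0 φ)) := by
    rw [e1, I_add (((Dec.dot_itg sW sW).smul _).add ((Dec.hess_itg hf t).smul _))
      ((Dec.dot_itg sq sW).smul _), I_add ((Dec.dot_itg sW sW).smul _)
      ((Dec.hess_itg hf t).smul _), I_smul, I_smul, I_smul, hφ, I_hess_Pot hf]
  have i3 := I_dot_Rd hf t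
  have i4 := I_dot_Rd_add_dot_Om hf t
  have i5 := hardy hf hR hR0
  rw [← hφ] at i3 i4 i5
  have tF := hf.test.sq
  have i6 : I t ((algebraMap ℝ Fld (R ^ 2) - Rsq) * f ^ 2) = R ^ 2 * I t (f ^ 2)
      - I t (Rsq * f ^ 2) := by
    rw [sub_mul, ← Algebra.smul_def, I_sub ((tF.itg t).smul _) ((tF.mul_left _).itg t), I_smul]
  -- Cauchy-Schwarz for the cross term
  have i7 : -(c / R * I t (dot q q) + R / c * I t (dot (D 0 φ) (D 0 φ))) ≤
      2 * I t (dot q (D 0 φ)) := by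
    rw [← I_smul, ← I_smul, ← I_smul, ← I_add ((Dec.dot_itg sq sq).smul _)
      ((Dec.dot_itg sW sW).smul _), ← I_neg]
    refine I_mono (((Dec.dot_itg sq sq).smul _).add ((Dec.dot_itg sW sW).smul _)).neg
      ((Dec.dot_itg sq sW).smul _) fun x => ?_
    simp only [neg_ap, add_ap, smul_ap, dot, mul_ap]
    have h1 : ∀ a b : ℝ, 0 ≤ c / R * (a * a) + R / c * (b * b) + 2 * (a * b) := fun a b => by
      have : c / R * (a * a) + R / c * (b * b) + 2 * (a * b) = c / R * (a + R / c * b) ^ 2 := by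
        field_simp; ring
      rw [this]; positivity
    linarith [h1 (D 1 q t x) (D 1 (D 0 φ) t x), h1 (D 2 q t x) (D 2 (D 0 φ) t x)]
  set H := I t ((algebraMap ℝ Fld (R ^ 2) - Rsq) * f ^ 2)
  have i8 : I t (dot q q) ≤ R ^ 2 * I t (f ^ 2) - 3 / 4 * H := by
    linarith [I_nonneg (dot_self_nonneg (Om φ) t)]
  have i9 := mul_le_mul_of_nonneg_left i8 (div_nonneg hc.le hR0.le)
  have e5 : c / R * (R ^ 2 * I t (f ^ 2) - 3 / 4 * H) =
      c * R * I t (f ^ 2) - 2 * (3 * c / (8 * R) * H) := by field_simp; ring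
  rw [e5] at i9
  have e6 : c ^ 2 * τ = c * R + c ^ 2 := by rw [hτR]; field_simp
  rw [i1, e6, hτR]
  linarith

/-! ### Klainerman-Sideris estimates: pointwise part -/

theorem sq_Tm_mul_sub (q : Fld) : Tm ^ 2 * D 0 (D 0 q) - Rsq * Lap q =
    Tm * D 0 (S q) - Tm * D 0 q - Rd (S q) - Om (Om q) := by
  simp [S_def, Rd_def, Om_def, Lap_def, Rsq, D_mul, D_comm_10, D_comm_20, D_comm_21]; ring

theorem Tm_mul_D_one (q : Fld) :
    Tm * D 0 (D 1 q) = D 1 (S q) - D 2 (Om q) - X 0 * Lap q := by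
  simp [S_def, Rd_def, Om_def, Lap_def, D_mul, D_comm_10, D_comm_20, D_comm_21]; ring

theorem Tm_mul_D_two (q : Fld) :
    Tm * D 0 (D 2 q) = D 2 (S q) + D 1 (Om q) - X 1 * Lap q := by
  simp [S_def, Rd_def, Om_def, Lap_def, D_mul, D_comm_10, D_comm_20, D_comm_21]; ring

theorem Rsq_mul_D_one (q : Fld) : Rsq * D 0 (D 1 q) =
    X 0 * (D 0 (S q) - D 0 q - Tm * D 0 (D 0 q)) + X 1 * D 0 (Om q) := by
  simp [S_def, Rd_def, Om_def, Rsq, D_mul, D_comm_10, D_comm_20, D_comm_21]; ring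

theorem Rsq_mul_D_two (q : Fld) : Rsq * D 0 (D 2 q) =
    X 1 * (D 0 (S q) - D 0 q - Tm * D 0 (D 0 q)) - X 0 * D 0 (Om q) := by
  simp [S_def, Rd_def, Om_def, Rsq, D_mul, D_comm_10, D_comm_20, D_comm_21]; ring

theorem ks_lap_bound {c t r G b L A : ℝ} (hc : 0 < c) (ht : 0 ≤ t) (hr : 0 ≤ r) (hG : 0 ≤ G)
    (hb : 0 ≤ b) (h : |(c ^ 2 * t ^ 2 - r ^ 2) * L| ≤ A) (hA : A ≤ 4 * (t + r) * G + t ^ 2 * b) :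
    |c * t - r| * |L| ≤ 4 * (1 + 1 / c) * (G + t * b) := by
  have hK : 0 ≤ 4 * (1 + 1 / c) * (G + t * b) := by positivity
  rcases (add_nonneg (mul_nonneg hc.le ht) hr).eq_or_lt with h0 | h0
  · have h1 : r = 0 := by nlinarith [mul_nonneg hc.le ht]
    have h2 : c * t = 0 := by linarith
    rw [h1, h2]; simpa using hK
  · refine le_of_mul_le_mul_left ?_ h0
    have e : (c * t + r) * (|c * t - r| * |L|) = |(c ^ 2 * t ^ 2 - r ^ 2) * L| := by
      rw [show (c ^ 2 * t ^ 2 - r ^ 2) * L = (c * t + r) * ((c * t - r) * L) by ring, abs_mul,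
        abs_mul, abs_of_pos h0]
    have h1 : t + r ≤ (c * t + r) * (1 + 1 / c) := by
      have : (c * t + r) * (1 + 1 / c) = c * t + r + t + r / c := by field_simp; ring
      rw [this]
      have := div_nonneg hr hc.le
      nlinarith [mul_nonneg hc.le ht]
    have h2 : A ≤ 4 * (t + r) * (G + t * b) := by
      nlinarith [mul_nonneg (mul_nonneg hr ht) hb, mul_nonneg (mul_nonneg ht ht) hb]
    rw [e]
    have h3 : 0 ≤ G + t * b := by positivity
    nlinarith [mul_le_mul_of_nonneg_right h1 h3]

theorem ks_mixed_bound {c t r G b L m p M : ℝ} (ht : 0 ≤ t) (hr : 0 ≤ r) (hG : 0 ≤ G)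
    (hb : 0 ≤ b) (hc : 0 < c) (hM : 0 ≤ M) (hL : |c * t - r| * |L| ≤ M * (G + t * b))
    (h1 : t * |m| ≤ 2 * G + r * |L|) (h2 : r ^ 2 * |m| ≤ r * (3 * G + t * p))
    (hp : p ≤ c ^ 2 * |L| + b) :
    |c * t - r| * |m| ≤ (M * (1 + c ^ 2) + 3 * (c + 1)) * (G + t * b) := by
  set d := |c * t - r| with hd
  set H := G + t * b with hH
  have hH0 : 0 ≤ H := by positivity
  have hd0 : 0 ≤ d := abs_nonneg _
  have hG' : G ≤ H := by nlinarith [mul_nonneg ht hb]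
  have hdle : d ≤ c * t + r := by
    rw [hd, abs_le]; constructor <;> nlinarith [mul_nonneg hc.le ht]
  have hm := abs_nonneg m
  have key : 0 ≤ (M * (1 + c ^ 2) + 3 * (c + 1)) * H := by positivity
  rcases le_or_gt r t with hrt | hrt
  · rcases ht.eq_or_lt with h0 | h0
    · have : d = 0 := by
        have : r = 0 := by linarith
        rw [hd, ← h0, this]; simp
      rw [this, zero_mul]; exact key
    · refine le_of_mul_le_mul_left ?_ h0
      have a1 := mul_le_mul_of_nonneg_left h1 hd0
      have a2 := mul_le_mul_of_nonneg_left hL hr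
      have a3 : r * (M * H) ≤ t * (M * H) := mul_le_mul_of_nonneg_right hrt (by positivity)
      have a4 : d * G ≤ ((c + 1) * t) * H := mul_le_mul (by nlinarith) hG' hG (by positivity)
      have a5 : 0 ≤ t * (M * c ^ 2 * H) := by positivity
      have a6 : 0 ≤ t * ((c + 1) * H) := by positivity
      nlinarith
  · have hr0 : 0 < r := lt_of_le_of_lt ht hrt
    refine le_of_mul_le_mul_left ?_ hr0
    have h2' : r * |m| ≤ 3 * G + t * p := by
      refine le_of_mul_le_mul_left ?_ hr0
      nlinarith
    have a1 := mul_le_mul_of_nonneg_left h2' hd0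
    have a2 := mul_le_mul_of_nonneg_left hp (mul_nonneg hd0 ht)
    have a3 := mul_le_mul_of_nonneg_left hL (mul_nonneg ht (sq_nonneg c))
    have a4 : t * c ^ 2 * (M * H) ≤ r * c ^ 2 * (M * H) := by
      have : 0 ≤ c ^ 2 * (M * H) := by positivity
      nlinarith
    have a5 : d * (3 * G + t * b) ≤ ((c + 1) * r) * (3 * H) := by
      refine mul_le_mul (by nlinarith) (by nlinarith [mul_nonneg ht hb]) (by positivity)
        (by positivity)
    have a6 : 0 ≤ r * (M * H) := by positivity
    nlinarith

/-- The sum of the squares of all first derivatives. -/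
def allSq (q : Fld) : Fld := D 0 q ^ 2 + D 1 q ^ 2 + D 2 q ^ 2

theorem sq_le_allSq (q : Fld) (a : Fin 3) (t : ℝ) (x : Plane) :
    D a q t x ^ 2 ≤ allSq q t x := by
  simp only [allSq, add_ap, pow_ap]
  fin_cases a
  · exact le_add_of_le_of_nonneg (le_add_of_nonneg_right (sq_nonneg _)) (sq_nonneg _)
  · exact le_add_of_le_of_nonneg (le_add_of_nonneg_left (sq_nonneg _)) (sq_nonneg _)
  · exact le_add_of_nonneg_left (add_nonneg (sq_nonneg _) (sq_nonneg _))

theorem allSq_nonneg (q : Fld) (t : ℝ) (x : Plane) : 0 ≤ allSq q t x :=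
  (sq_nonneg _).trans (sq_le_allSq q 0 t x)

theorem ks_mixed_of_identities {c t r G b L m p M s xi xj e1 e2 e3 e4 e5 : ℝ} (ht : 0 ≤ t)
    (hr : 0 ≤ r) (hG : 0 ≤ G) (hb : 0 ≤ b) (hc : 0 < c) (hM : 0 ≤ M)
    (hL : |c * t - r| * |L| ≤ M * (G + t * b)) (hp : |p| ≤ c ^ 2 * |L| + b) (hs : |s| = 1)
    (hxi : |xi| ≤ r) (hxj : |xj| ≤ r) (h1 : |e1| ≤ G) (h2 : |e2| ≤ G) (h3 : |e3| ≤ G)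
    (h4 : |e4| ≤ G) (h5 : |e5| ≤ G) (i1 : t * m = e1 - s * e2 - xi * L)
    (i2 : r ^ 2 * m = xi * (e3 - e4 - t * p) + s * (xj * e5)) :
    |c * t - r| * |m| ≤ (M * (1 + c ^ 2) + 3 * (c + 1)) * (G + t * b) := by
  refine ks_mixed_bound ht hr hG hb hc hM hL ?_ ?_ hp
  · have a1 : |xi * L| ≤ r * |L| := by
      rw [abs_mul]; exact mul_le_mul_of_nonneg_right hxi (abs_nonneg _)
    have a2 := abs_sub (e1 - s * e2) (xi * L)
    have a3 := abs_sub e1 (s * e2)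
    rw [abs_mul, hs, one_mul] at a3
    rw [← i1, abs_mul, abs_of_nonneg ht] at a2
    linarith
  · have a1 := abs_add_le (xi * (e3 - e4 - t * p)) (s * (xj * e5))
    rw [← i2, abs_mul, abs_of_nonneg (sq_nonneg r), abs_mul s, hs, one_mul, abs_mul xi] at a1
    have a2 : |xj * e5| ≤ r * G := by
      rw [abs_mul]; exact mul_le_mul hxj h5 (abs_nonneg _) hr
    have a3 := abs_sub (e3 - e4) (t * p)
    have a4 := abs_sub e3 e4
    rw [abs_mul, abs_of_nonneg ht] at a3
    have a5 : |xi| * |e3 - e4 - t * p| ≤ r * (2 * G + t * |p|) :=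
      mul_le_mul hxi (by linarith) (abs_nonneg _) hr
    linarith

theorem sum_sq_le_of_bounds {d y1 y2 y3 M N H R : ℝ} (h1 : |d| * |y1| ≤ M * H)
    (h2 : |d| * |y2| ≤ N * H) (h3 : |d| * |y3| ≤ N * H) (hR : H ^ 2 ≤ 2 * R) :
    d ^ 2 * (y1 ^ 2 + y2 ^ 2 + y3 ^ 2) ≤ 2 * (M ^ 2 + 2 * N ^ 2) * R := by
  have sqle : ∀ {y K : ℝ}, |d| * |y| ≤ K * H → d ^ 2 * y ^ 2 ≤ K ^ 2 * H ^ 2 := fun {y K} h => by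
    have := pow_le_pow_left₀ (by positivity) h 2
    rwa [mul_pow, mul_pow, sq_abs, sq_abs] at this
  have f1 := sqle h1
  have f2 := sqle h2
  have f3 := sqle h3
  have f5 := mul_le_mul_of_nonneg_left hR (by positivity : 0 ≤ M ^ 2 + 2 * N ^ 2)
  linarith

theorem Box_ap (c : ℝ) (q : Fld) (t : ℝ) (x : Plane) :
    Box c q t x = D 0 (D 0 q) t x - c ^ 2 * Lap q t x := by
  rw [Box_def, sub_ap, smul_ap]

theorem ks_lap_pointwise {c : ℝ} (hc : 0 < c) (q : Fld) (t : ℝ) (x : Plane) (ht : 0 ≤ t) {G : ℝ}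
    (hG0 : 0 ≤ G) (g0 : |D 0 q t x| ≤ G) (g1 : ∀ a, |D a (S q) t x| ≤ G)
    (g2 : ∀ a, |D a (Om q) t x| ≤ G) :
    |c * t - ‖x‖| * |Lap q t x| ≤ 4 * (1 + 1 / c) * (G + t * |Box c q t x|) := by
  refine ks_lap_bound hc ht (norm_nonneg x) hG0 (abs_nonneg _) (le_refl _) ?_
  have e := congrArg (fun u : Fld => u t x) (sq_Tm_mul_sub q)
  simp only [sub_ap, mul_ap, pow_ap, Tm_ap, Rsq_ap, Rd_def, Om_def (Om q), add_ap, X_ap] at e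
  have mulle : ∀ i (s : ℝ), |s| ≤ G → |x i * s| ≤ ‖x‖ * G := fun i s hs => by
    rw [abs_mul]; exact mul_le_mul (abs_coord_le x i) hs (abs_nonneg _) (norm_nonneg x)
  have y1 : |t * D 0 (S q) t x| ≤ t * G := by
    rw [abs_mul, abs_of_nonneg ht]; exact mul_le_mul_of_nonneg_left (g1 0) ht
  have y2 : |t * D 0 q t x| ≤ t * G := by
    rw [abs_mul, abs_of_nonneg ht]; exact mul_le_mul_of_nonneg_left g0 ht
  have y3 := mulle 0 _ (g1 1)
  have y4 := mulle 1 _ (g1 2)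
  have y5 := mulle 1 _ (g2 1)
  have y6 := mulle 0 _ (g2 2)
  have y8 := neg_abs_le (Box c q t x)
  have y9 := le_abs_self (Box c q t x)
  have y10 := mul_nonneg ht hG0
  have y11 := mul_le_mul_of_nonneg_left y8 (sq_nonneg t)
  have y12 := mul_le_mul_of_nonneg_left y9 (sq_nonneg t)
  have eB := Box_ap c q t x
  rw [abs_le] at y1 y2 y3 y4 y5 y6 ⊢
  generalize Box c q t x = B at *
  constructor <;> nlinarith

/-- The pointwise estimate of Klainerman and Sideris: up to `Box c q`, the weight `c t - r` in front of
second derivatives is traded for the fields `S` and `Ω`. -/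
theorem ks_pointwise {c : ℝ} (hc : 0 < c) : ∃ K > 0, ∀ (q : Fld) (t : ℝ) (x : Plane), 0 ≤ t →
    (c * t - ‖x‖) ^ 2 * (Lap q t x ^ 2 + D 0 (D 1 q) t x ^ 2 + D 0 (D 2 q) t x ^ 2) ≤
      K * (allSq q t x + allSq (S q) t x + allSq (Om q) t x + t ^ 2 * Box c q t x ^ 2) := by
  set M := 4 * (1 + 1 / c) with hM
  have hM0 : 0 < M := by positivity
  refine ⟨2 * (M ^ 2 + 2 * (M * (1 + c ^ 2) + 3 * (c + 1)) ^ 2), by positivity,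
    fun q t x ht => ?_⟩
  have hr : 0 ≤ ‖x‖ := norm_nonneg x
  have n0 := allSq_nonneg q t x
  have n1 := allSq_nonneg (S q) t x
  have n2 := allSq_nonneg (Om q) t x
  obtain ⟨Q, hQ⟩ : ∃ Q, Q = allSq q t x + allSq (S q) t x + allSq (Om q) t x := ⟨_, rfl⟩
  rw [← hQ]
  have hQ0 : 0 ≤ Q := by rw [hQ]; positivity
  have hG0 : 0 ≤ √Q := Real.sqrt_nonneg _
  have g0 : |D 0 q t x| ≤ √Q :=
    Real.abs_le_sqrt ((sq_le_allSq q 0 t x).trans (by linarith))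
  have g1 : ∀ a, |D a (S q) t x| ≤ √Q := fun a =>
    Real.abs_le_sqrt ((sq_le_allSq (S q) a t x).trans (by linarith))
  have g2 : ∀ a, |D a (Om q) t x| ≤ √Q := fun a =>
    Real.abs_le_sqrt ((sq_le_allSq (Om q) a t x).trans (by linarith))
  have hb0 : 0 ≤ |Box c q t x| := abs_nonneg _
  have hL := ks_lap_pointwise hc q t x ht hG0 g0 g1 g2
  rw [← hM] at hL
  have hp : |D 0 (D 0 q) t x| ≤ c ^ 2 * |Lap q t x| + |Box c q t x| := by
    have : D 0 (D 0 q) t x = c ^ 2 * Lap q t x + Box c q t x := by rw [Box_ap]; ring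
    rw [this]
    refine (abs_add_le _ _).trans (le_of_eq ?_)
    rw [abs_mul, abs_of_nonneg (sq_nonneg c)]
  have a1 := congrArg (fun u : Fld => u t x) (Tm_mul_D_one q)
  have a2 := congrArg (fun u : Fld => u t x) (Rsq_mul_D_one q)
  have b1 := congrArg (fun u : Fld => u t x) (Tm_mul_D_two q)
  have b2 := congrArg (fun u : Fld => u t x) (Rsq_mul_D_two q)
  simp only [sub_ap, mul_ap, add_ap, X_ap, Tm_ap, Rsq_ap] at a1 a2 b1 b2
  have hm1 := ks_mixed_of_identities (s := 1) (m := D 0 (D 1 q) t x) ht hr hG0 hb0 hc hM0.le hL hp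
    (by simp) (abs_coord_le x 0) (abs_coord_le x 1) (g1 1) (g2 2) (g1 0) g0 (g2 0)
    (by rw [a1]; ring) (by rw [a2]; ring)
  have hm2 := ks_mixed_of_identities (s := -1) (m := D 0 (D 2 q) t x) ht hr hG0 hb0 hc hM0.le hL hp
    (by simp) (abs_coord_le x 1) (abs_coord_le x 0) (g1 2) (g2 1) (g1 0) g0 (g2 0)
    (by rw [b1]; ring) (by rw [b2]; ring)
  refine sum_sq_le_of_bounds hL hm1 hm2 ?_
  have hGG : √Q ^ 2 = Q := Real.sq_sqrt hQ0
  have hbb : |Box c q t x| ^ 2 = Box c q t x ^ 2 := sq_abs _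
  rw [← hbb]
  nlinarith [sq_nonneg (√Q - t * |Box c q t x|)]

/-! ### Klainerman-Sideris estimates: integrated form -/

/-- `c t - ⟨x⟩`, a smooth substitute for `c t - |x|`. -/
def coneFld (c : ℝ) : Fld := algebraMap ℝ Fld c * Tm - (Rreg 1).sqrt (Rreg_pos one_pos)

/-- The smooth weight `1 + (c t - ⟨x⟩)²`, comparable to `⟨c t - |x|⟩²`. -/
def wt (c : ℝ) : Fld := 1 + coneFld c ^ 2

theorem coneFld_ap (c t : ℝ) (x : Plane) : coneFld c t x = c * t - √(‖x‖ ^ 2 + 1) := by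
  simp [coneFld, sqrt_ap, Rreg_ap]

theorem wt_ap (c t : ℝ) (x : Plane) : wt c t x = 1 + (c * t - √(‖x‖ ^ 2 + 1)) ^ 2 := by
  simp [wt, coneFld_ap]

theorem norm_le_sqrt (x : Plane) : ‖x‖ ≤ √(‖x‖ ^ 2 + 1) :=
  Real.le_sqrt_of_sq_le (by linarith)

theorem sqrt_le_norm_add_one (x : Plane) : √(‖x‖ ^ 2 + 1) ≤ ‖x‖ + 1 :=
  Real.sqrt_le_iff.2 ⟨by positivity, by nlinarith [norm_nonneg x]⟩

theorem one_le_wt (c t : ℝ) (x : Plane) : 1 ≤ wt c t x := by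
  rw [wt_ap]; nlinarith [sq_nonneg (c * t - √(‖x‖ ^ 2 + 1))]

theorem wt_le (c t : ℝ) (x : Plane) : wt c t x ≤ 3 + 2 * (c * t - ‖x‖) ^ 2 := by
  rw [wt_ap]
  have h1 := norm_le_sqrt x
  have h2 := sqrt_le_norm_add_one x
  set s := √(‖x‖ ^ 2 + 1)
  nlinarith [sq_nonneg (c * t - ‖x‖ + (s - ‖x‖))]

theorem le_wt (c t : ℝ) (x : Plane) : 1 + (c * t - ‖x‖) ^ 2 ≤ 3 * wt c t x := by
  rw [wt_ap]
  have h1 := norm_le_sqrt x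
  have h2 := sqrt_le_norm_add_one x
  set s := √(‖x‖ ^ 2 + 1)
  nlinarith [sq_nonneg (c * t - s - (s - ‖x‖))]

theorem abs_D_coneFld_le (c t : ℝ) (x : Plane) (i : Fin 2) : |D i.succ (coneFld c) t x| ≤ 1 := by
  have h1 := congrArg (fun u : Fld => u t x) (D_sqrt i.succ (Rreg 1) (Rreg_pos one_pos))
  have hX : D i.succ (Rreg 1) = 2 * X i := by
    fin_cases i
    · exact D_one_Rreg 1
    · exact D_two_Rreg 1
  rw [hX] at h1
  simp only [mul_ap, ofNat_ap, X_ap, sqrt_ap, Rreg_ap] at h1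
  have h2 : D i.succ (coneFld c) t x = -D i.succ ((Rreg 1).sqrt (Rreg_pos one_pos)) t x := by
    simp only [coneFld, map_sub, D_mul, D_algebraMap, D_succ_Tm, mul_zero, add_zero, sub_ap,
      zero_ap]; ring
  rw [h2, abs_neg]
  set y := D i.succ ((Rreg 1).sqrt (Rreg_pos one_pos)) t x
  have h3 : √(‖x‖ ^ 2 + 1) * y = x i := by linarith
  have h4 := (abs_coord_le x i).trans (norm_le_sqrt x)
  have h5 : 0 < √(‖x‖ ^ 2 + 1) := Real.sqrt_pos.2 (by positivity)
  rw [← h3, abs_mul, abs_of_pos h5] at h4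
  exact (mul_le_iff_le_one_right h5).1 h4

theorem D_wt (c : ℝ) (a : Fin 3) : D a (wt c) = 2 * (coneFld c * D a (coneFld c)) := by
  rw [wt, map_add, Derivation.map_one_eq_zero, zero_add, pow_two, D_mul]; ring

theorem D_wt_sq_le (c t : ℝ) (x : Plane) (i : Fin 2) : D i.succ (wt c) t x ^ 2 ≤ 4 * wt c t x := by
  rw [D_wt]
  have h := abs_D_coneFld_le c t x i
  simp only [wt, mul_ap, ofNat_ap, add_ap, one_ap, pow_ap]
  have h2 : D i.succ (coneFld c) t x ^ 2 ≤ 1 := by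
    rw [← sq_abs]; exact pow_le_one₀ (abs_nonneg _) h
  have := mul_le_mul_of_nonneg_left h2 (sq_nonneg (coneFld c t x))
  nlinarith

theorem dec_coneFld (c t : ℝ) : Dec t (-1) (coneFld c) := by
  refine ⟨|c * t| + 1, fun x => ?_⟩
  rw [coneFld_ap, neg_neg, zpow_one]
  have h1 := norm_le_sqrt x
  have h2 := sqrt_le_norm_add_one x
  refine (abs_sub _ _).trans ?_
  rw [abs_of_nonneg (Real.sqrt_nonneg _)]
  nlinarith [abs_nonneg (c * t), norm_nonneg x, mul_nonneg (abs_nonneg (c * t)) (norm_nonneg x)]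

theorem dec_wt (c t : ℝ) : Dec t (-2) (wt c) :=
  ((dec_one t).mono (by norm_num)).add ((dec_coneFld c t).pow_two (by norm_num))

theorem dec_D_wt (c t : ℝ) (i : Fin 2) : Dec t (-2) (D i.succ (wt c)) := by
  rw [D_wt]
  exact (dec_ofNat t 2).mul' ((dec_coneFld c t).mul' (dec_of_bounded (abs_D_coneFld_le c t · i))
    (m := -1) (by norm_num)) (by norm_num)

/-- A weighted version of `‖∇²q‖ = ‖Δq‖`; the error is of lower order because the derivatives of the
weight are bounded by its square root. -/
theorem I_wt_hess_le {g : Fld} (hg : IsDiv g) {j : Fin 3} (hj : j ≠ 0) (c t : ℝ) :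
    I t (wt c * hess (D j (Pot g))) ≤ 2 * I t (wt c * Lap (D j (Pot g)) ^ 2)
      + 32 * I t (D 2 (D j (Pot g)) ^ 2) := by
  set q := D j (Pot g) with hq
  have q' : q = Pot (D j g) := by rw [hq, Pot_D hg.test]
  have d1 : ∀ a : Fin 3, a ≠ 0 → Dec t 3 (D a q) := fun a ha => dec_D_D_Pot' hg t ha hj
  have d2 : ∀ a b : Fin 3, a ≠ 0 → b ≠ 0 → Dec t 3 (D a (D b q)) := fun a b ha hb => by
    rw [q']; exact dec_D_D_Pot' (hg.D j) t ha hb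
  have d3 : ∀ c a b : Fin 3, a ≠ 0 → b ≠ 0 → Dec t 3 (D a (D b (D c q))) := fun c a b ha hb => by
    rw [q']; exact dec_D_D_D_Pot (hg.D j) t c ha hb
  have n1 : (1 : Fin 3) ≠ 0 := by decide
  have n2 : (2 : Fin 3) ≠ 0 := by decide
  have dw : ∀ u, Dec t 6 u → Itg t (wt c * u) := fun u hu =>
    ((dec_wt c t).mul' hu (m := 3) (by norm_num)).itg le_rfl
  have dw' : ∀ (i : Fin 2) u, Dec t 6 u → Itg t (u * D i.succ (wt c)) := fun i u hu =>
    (hu.mul' (dec_D_wt c t i) (m := 3) (by norm_num)).itg le_rfl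
  have u0 : Dec t 6 (D 2 q * D 1 (D 2 q)) := (d1 2 n2).mul' (d2 1 2 n1 n2) (by norm_num)
  have v0 : Dec t 6 (D 2 q * D 1 (D 1 q)) := (d1 2 n2).mul' (d2 1 1 n1 n1) (by norm_num)
  have key : I t (D 1 (wt c * (D 2 q * D 1 (D 2 q))) + D 2 (-(wt c * (D 2 q * D 1 (D 1 q))))) = 0 := by
    refine I_div_eq_zero (dw _ u0) ?_ (dw _ v0).neg ?_
    · rw [D_mul]
      refine (dw _ ?_).add (dw' 0 _ u0)
      rw [D_mul]
      exact ((d1 2 n2).mul' (d3 2 1 1 n1 n1) (by norm_num)).add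
        ((d2 1 2 n1 n2).mul' (d2 1 2 n1 n2) (by norm_num))
    · rw [map_neg, D_mul]
      refine ((dw _ ?_).add (dw' 1 _ v0)).neg
      rw [D_mul]
      exact ((d1 2 n2).mul' (d3 1 2 1 n2 n1) (by norm_num)).add
        ((d2 1 1 n1 n1).mul' (d2 2 2 n2 n2) (by norm_num))
  have iH : Itg t (wt c * hess q) := by
    refine dw _ ((Dec.add (Dec.add ?_ ?_) ?_))
    · exact (d2 1 1 n1 n1).pow_two (by norm_num)
    · exact (dec_ofNat t 2).mul' ((d2 1 2 n1 n2).pow_two (m := 6) (by norm_num)) (by norm_num)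
    · exact (d2 2 2 n2 n2).pow_two (by norm_num)
  have iL : Itg t (wt c * Lap q ^ 2) :=
    dw _ (((d2 1 1 n1 n1).add (d2 2 2 n2 n2)).pow_two (by norm_num))
  have iq : Itg t (D 2 q ^ 2) := ((d1 2 n2).pow_two (m := 3) (by norm_num)).itg le_rfl
  set E := (2:ℝ) • (D 2 q * D 1 (D 1 q) * D 2 (wt c) - D 2 q * D 1 (D 2 q) * D 1 (wt c)) with hE
  have iE : Itg t E := ((dw' 1 _ v0).sub (dw' 0 _ u0)).smul _
  have e : wt c * hess q = wt c * Lap q ^ 2 + (2:ℝ) • (D 1 (wt c * (D 2 q * D 1 (D 2 q)))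
      + D 2 (-(wt c * (D 2 q * D 1 (D 1 q))))) + E := by
    simp only [hE, hess, Lap_def, D_mul, map_neg, D_comm_21, two_smul]
    ring
  have iD : Itg t (D 1 (wt c * (D 2 q * D 1 (D 2 q))) + D 2 (-(wt c * (D 2 q * D 1 (D 1 q))))) := by
    have h2 : D 1 (wt c * (D 2 q * D 1 (D 2 q))) + D 2 (-(wt c * (D 2 q * D 1 (D 1 q))))
        = (1/2 : ℝ) • (wt c * hess q - wt c * Lap q ^ 2 - E) := by
      rw [e, add_sub_right_comm, add_sub_cancel_left, add_sub_cancel_right, smul_smul]; norm_num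
    rw [h2]
    exact ((iH.sub iL).sub iE).smul _
  have e2 : I t (wt c * hess q) = I t (wt c * Lap q ^ 2) + I t E := by
    conv_lhs => rw [e]
    rw [I_add (iL.add (iD.smul _)) iE, I_add iL (iD.smul _), I_smul, key]; ring
  have e3 : I t E ≤ 1/2 * I t (wt c * hess q) + 16 * I t (D 2 q ^ 2) := by
    rw [← I_smul, ← I_smul, ← I_add (iH.smul _) (iq.smul _)]
    refine I_mono iE ((iH.smul _).add (iq.smul _)) fun x => ?_
    simp only [hE, hess, add_ap, smul_ap, mul_ap, sub_ap, pow_ap, ofNat_ap]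
    have w1 : D 1 (wt c) t x ^ 2 ≤ 4 * wt c t x := D_wt_sq_le c t x 0
    have w2 : D 2 (wt c) t x ^ 2 ≤ 4 * wt c t x := D_wt_sq_le c t x 1
    have w0 := one_le_wt c t x
    generalize wt c t x = w at *
    generalize D 1 (wt c) t x = w1' at *
    generalize D 2 (wt c) t x = w2' at *
    generalize D 2 q t x = b
    generalize D 1 (D 1 q) t x = q11
    generalize D 1 (D 2 q) t x = q12
    generalize D 2 (D 2 q) t x = q22
    have y : ∀ s p : ℝ, s ^ 2 ≤ 4 * w → 2 * (b * p * s) ≤ 1/2 * (w * p ^ 2) + 8 * b ^ 2 :=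
      fun s p hs => by
        have h1 := mul_le_mul_of_nonneg_right hs (sq_nonneg p)
        nlinarith [sq_nonneg (s * p - 8 * b)]
    have y1 := y w2' q11 w2
    have y2 := y (-w1') q12 (by rwa [neg_sq])
    have y3 : 0 ≤ w * q22 ^ 2 := by positivity
    have y4 : 0 ≤ w * q12 ^ 2 := by positivity
    nlinarith
  linarith

/-- The energy density of `∇φ`, where `φ` is the Newtonian potential of `f`. -/
def enF (f : Fld) : Fld := allSq (D 1 (Pot f)) + allSq (D 2 (Pot f))

/-- The energy of `∇φ`, where `φ` is the Newtonian potential of `f`. -/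
def En (t : ℝ) (f : Fld) : ℝ := I t (enF f)

/-- The sum of `(∂∂_i∂_jφ)²` over all `∂`, `i`, `j`, where `φ` is the Newtonian potential of `f`. -/
def thirdSq (f : Fld) : Fld :=
  allSq (D 1 (D 1 (Pot f))) + allSq (D 2 (D 1 (Pot f)))
    + (allSq (D 1 (D 2 (Pot f))) + allSq (D 2 (D 2 (Pot f))))

/-- The weighted norm `∑ ‖⟨ct - r⟩ ∂∇∇φ‖²`, where `φ` is the Newtonian potential of `f`. -/
def XX (c t : ℝ) (f : Fld) : ℝ := I t (wt c * thirdSq f)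

theorem enF_nonneg (f : Fld) (t : ℝ) (x : Plane) : 0 ≤ enF f t x :=
  add_nonneg (allSq_nonneg _ t x) (allSq_nonneg _ t x)

theorem thirdSq_nonneg (f : Fld) (t : ℝ) (x : Plane) : 0 ≤ thirdSq f t x :=
  add_nonneg (add_nonneg (allSq_nonneg _ t x) (allSq_nonneg _ t x))
    (add_nonneg (allSq_nonneg _ t x) (allSq_nonneg _ t x))

theorem En_nonneg (f : Fld) (t : ℝ) : 0 ≤ En t f := I_nonneg (enF_nonneg f t)

theorem XX_nonneg (c : ℝ) (f : Fld) (t : ℝ) : 0 ≤ XX c t f := I_nonneg fun x => by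
  rw [mul_ap]
  exact mul_nonneg (zero_le_one.trans (one_le_wt c t x)) (thirdSq_nonneg f t x)

theorem dec_first {f : Fld} (hf : IsDiv f) (t : ℝ) (a : Fin 3) {j : Fin 3} (hj : j ≠ 0) :
    Dec t 2 (D a (D j (Pot f))) := by
  rw [D_comm a j, ← Pot_D hf.test]; exact dec_D_Pot' (hf.D a) t hj

theorem dec_second {f : Fld} (hf : IsDiv f) (t : ℝ) (a : Fin 3) {i j : Fin 3} (hi : i ≠ 0)
    (hj : j ≠ 0) : Dec t 3 (D a (D i (D j (Pot f)))) := by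
  rw [D_comm a i, D_comm a j, ← Pot_D hf.test]; exact dec_D_D_Pot' (hf.D a) t hi hj

theorem dec_allSq {t : ℝ} {k m : ℤ} {u : Fld} (h : ∀ a, Dec t k (D a u)) (hm : m ≤ 2 * k) :
    Dec t m (allSq u) :=
  (((h 0).pow_two hm).add ((h 1).pow_two hm)).add ((h 2).pow_two hm)

theorem dec_enF {f : Fld} (hf : IsDiv f) (t : ℝ) : Dec t 4 (enF f) :=
  (dec_allSq (fun a => dec_first hf t a (by decide)) (by norm_num)).add
    (dec_allSq (fun a => dec_first hf t a (by decide)) (by norm_num))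

theorem itg_enF {f : Fld} (hf : IsDiv f) (t : ℝ) : Itg t (enF f) :=
  (dec_enF hf t).itg (by norm_num)

theorem dec_thirdSq {f : Fld} (hf : IsDiv f) (t : ℝ) : Dec t 6 (thirdSq f) :=
  ((dec_allSq (fun a => dec_second hf t a (by decide) (by decide)) (by norm_num)).add
    (dec_allSq (fun a => dec_second hf t a (by decide) (by decide)) (by norm_num))).add
  ((dec_allSq (fun a => dec_second hf t a (by decide) (by decide)) (by norm_num)).add
    (dec_allSq (fun a => dec_second hf t a (by decide) (by decide)) (by norm_num)))

theorem itg_wt_mul {c t : ℝ} {u : Fld} (h : Dec t 6 u) : Itg t (wt c * u) :=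
  ((dec_wt c t).mul' h (m := 3) (by norm_num)).itg le_rfl

theorem itg_wt_thirdSq {f : Fld} (hf : IsDiv f) (c t : ℝ) : Itg t (wt c * thirdSq f) :=
  itg_wt_mul (dec_thirdSq hf t)

theorem IsDiv.neg {u : Fld} (hu : IsDiv u) : IsDiv (-u) := by
  have := hu.smul (-1); rwa [neg_one_smul] at this

theorem IsDiv.Lap {u : Fld} (hu : IsDiv u) : IsDiv (Lap u) := ((hu.D 1).D 1).add ((hu.D 2).D 2)

theorem IsDiv.Box {u : Fld} (hu : IsDiv u) (c : ℝ) : IsDiv (Box c u) := by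
  rw [Box_def, sub_eq_add_neg]
  exact ((hu.D 0).D 0).add (hu.Lap.smul _).neg

theorem Pot_Lap {f : Fld} (hf : Test f) : Pot (Lap f) = Lap (Pot f) := by
  rw [Lap_def, Lap_def, Pot_add ((hf.D 1).D 1) ((hf.D 2).D 2), Pot_D (hf.D 1), Pot_D hf,
    Pot_D (hf.D 2), Pot_D hf]

theorem Pot_Box {f : Fld} (hf : Test f) (c : ℝ) : Pot (Box c f) = Box c (Pot f) := by
  rw [Box_def, Box_def, Pot_sub ((hf.D 0).D 0) (hf.Lap.smul _), Pot_smul _ hf.Lap, Pot_Lap hf,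
    Pot_D (hf.D 0), Pot_D hf]

theorem itg_dot_Box {f : Fld} (hf : IsDiv f) (c t : ℝ) :
    Itg t (dot (Box c (Pot f)) (Box c (Pot f))) := by
  rw [← Pot_Box hf.test]
  exact Dec.dot_itg (symDec_Pot (hf.Box c) t) (symDec_Pot (hf.Box c) t)

theorem allSq_add_le (u v : Fld) (t : ℝ) (x : Plane) :
    allSq (u + v) t x ≤ 2 * allSq u t x + 2 * allSq v t x := by
  simp only [allSq, map_add, add_ap, pow_ap]
  linarith [add_sq_le (a := D 0 u t x) (b := D 0 v t x), add_sq_le (a := D 1 u t x) (b := D 1 v t x),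
    add_sq_le (a := D 2 u t x) (b := D 2 v t x)]

theorem allSq_neg (u : Fld) : allSq (-u) = allSq u := by
  simp only [allSq, map_neg, neg_sq]

theorem S_D_Pot {f : Fld} (hf : IsDiv f) (j : Fin 3) :
    S (D j (Pot f)) = D j (Pot (S f)) + D j (Pot f) := by
  rw [Pot_S hf, map_sub, D_S, D_mul, D_ofNat]; ring

theorem Om_D_one_Pot {f : Fld} (hf : IsDiv f) :
    Om (D 1 (Pot f)) = D 1 (Pot (Om f)) + D 2 (Pot f) := by
  rw [Pot_Om hf, D_one_Om]; ring

theorem Om_D_two_Pot {f : Fld} (hf : IsDiv f) :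
    Om (D 2 (Pot f)) = D 2 (Pot (Om f)) + -D 1 (Pot f) := by
  rw [Pot_Om hf, D_two_Om]; ring

/-- The Klainerman-Sideris estimate for the gradient of the Newtonian potential of `f`. -/
theorem klainerman_sideris {c : ℝ} (hc : 0 < c) : ∃ K > 0, ∀ (f : Fld) (t : ℝ), IsDiv f → 0 ≤ t →
    XX c t f ≤ K * (En t f + En t (S f) + En t (Om f) + ∑ a, En t (D a f)
      + t ^ 2 * I t (dot (Box c (Pot f)) (Box c (Pot f)))) := by
  obtain ⟨K, hK, hks⟩ := ks_pointwise hc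
  refine ⟨64 + 18 + 20 * K, by positivity, fun f t hf ht => ?_⟩
  set φ := Pot f with hφ
  set F := Box c φ with hF
  set P : Fld := Lap (D 1 φ) ^ 2 + D 0 (D 1 (D 1 φ)) ^ 2 + D 0 (D 2 (D 1 φ)) ^ 2
    + (Lap (D 2 φ) ^ 2 + D 0 (D 1 (D 2 φ)) ^ 2 + D 0 (D 2 (D 2 φ)) ^ 2) with hP
  have n1 : (1 : Fin 3) ≠ 0 := by decide
  have n2 : (2 : Fin 3) ≠ 0 := by decide
  have dL : ∀ j : Fin 3, j ≠ 0 → Dec t 3 (Lap (D j φ)) := fun j hj =>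
    (dec_second hf t 1 n1 hj).add (dec_second hf t 2 n2 hj)
  have dP : Dec t 6 P := by
    refine Dec.add (Dec.add (Dec.add ?_ ?_) ?_) (Dec.add (Dec.add ?_ ?_) ?_)
    · exact (dL 1 n1).pow_two (by norm_num)
    · exact (dec_second hf t 0 n1 n1).pow_two (by norm_num)
    · exact (dec_second hf t 0 n2 n1).pow_two (by norm_num)
    · exact (dL 2 n2).pow_two (by norm_num)
    · exact (dec_second hf t 0 n1 n2).pow_two (by norm_num)
    · exact (dec_second hf t 0 n2 n2).pow_two (by norm_num)
  have d2 : ∀ a j : Fin 3, j ≠ 0 → Itg t (D a (D j φ) ^ 2) := fun a j hj =>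
    ((dec_first hf t a hj).pow_two (m := 3) (by norm_num)).itg le_rfl
  have dh : ∀ j : Fin 3, j ≠ 0 → Dec t 6 (hess (D j φ)) := fun j hj =>
    (((dec_second hf t 1 n1 hj).pow_two (by norm_num)).add ((dec_ofNat t 2).mul'
      ((dec_second hf t 1 n2 hj).pow_two (m := 6) (by norm_num)) (by norm_num))).add
      ((dec_second hf t 2 n2 hj).pow_two (by norm_num))
  -- the spatial second derivatives are controlled by the Laplacian
  have e1 : wt c * thirdSq f = wt c * hess (D 1 φ) + wt c * hess (D 2 φ)
      + (wt c * P - wt c * Lap (D 1 φ) ^ 2 - wt c * Lap (D 2 φ) ^ 2) := by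
    simp only [thirdSq, allSq, hess, hP, ← hφ, D_comm_21]; ring
  have iL : ∀ j : Fin 3, j ≠ 0 → Itg t (wt c * Lap (D j φ) ^ 2) := fun j hj =>
    itg_wt_mul ((dL j hj).pow_two (by norm_num))
  have iH : ∀ j : Fin 3, j ≠ 0 → Itg t (wt c * hess (D j φ)) := fun j hj => itg_wt_mul (dh j hj)
  have iP : Itg t (wt c * P) := itg_wt_mul dP
  have h1 : XX c t f ≤ 2 * I t (wt c * P) + 32 * En t f := by
    rw [XX, e1, I_add ((iH 1 n1).add (iH 2 n2)) ((iP.sub (iL 1 n1)).sub (iL 2 n2)),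
      I_add (iH 1 n1) (iH 2 n2), I_sub (iP.sub (iL 1 n1)) (iL 2 n2), I_sub iP (iL 1 n1)]
    have a1 := I_wt_hess_le hf n1 c t
    have a2 := I_wt_hess_le hf n2 c t
    rw [← hφ] at a1 a2
    have a3 : I t (wt c * Lap (D 1 φ) ^ 2) + I t (wt c * Lap (D 2 φ) ^ 2) ≤ I t (wt c * P) := by
      rw [← I_add (iL 1 n1) (iL 2 n2)]
      refine I_mono ((iL 1 n1).add (iL 2 n2)) iP fun x => ?_
      rw [← mul_add, mul_ap, mul_ap]
      refine mul_le_mul_of_nonneg_left ?_ (zero_le_one.trans (one_le_wt c t x))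
      simp only [hP, add_ap, pow_ap]
      nlinarith [sq_nonneg (D 0 (D 1 (D 1 φ)) t x), sq_nonneg (D 0 (D 2 (D 1 φ)) t x),
        sq_nonneg (D 0 (D 1 (D 2 φ)) t x), sq_nonneg (D 0 (D 2 (D 2 φ)) t x)]
    have a4 : I t (D 2 (D 1 φ) ^ 2) + I t (D 2 (D 2 φ) ^ 2) ≤ En t f := by
      rw [← I_add (d2 2 1 n1) (d2 2 2 n2)]
      refine I_mono ((d2 2 1 n1).add (d2 2 2 n2)) (itg_enF hf t) fun x => ?_
      exact add_le_add (sq_le_allSq (D 1 φ) 2 t x) (sq_le_allSq (D 2 φ) 2 t x)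
    linarith
  -- the pointwise estimate
  have iF : Itg t (dot F F) := itg_dot_Box hf c t
  have h2 : I t (wt c * P) ≤ I t ((9:ℝ) • (enF (D 1 f) + enF (D 2 f)) + (2 * K) • ((5:ℝ) • enF f
      + (2:ℝ) • (enF (S f) + enF (Om f)) + t ^ 2 • dot F F)) := by
    refine I_mono iP (((((itg_enF (hf.D 1) t).add (itg_enF (hf.D 2) t)).smul _).add
      (((((itg_enF hf t).smul _).add (((itg_enF hf.S t).add (itg_enF hf.Om t)).smul _)).add
        (iF.smul _)).smul _))) fun x => ?_
    have k1 := hks (D 1 φ) t x ht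
    have k2 := hks (D 2 φ) t x ht
    have s1 := allSq_add_le (D 1 (Pot (S f))) (D 1 φ) t x
    have s2 := allSq_add_le (D 2 (Pot (S f))) (D 2 φ) t x
    have o1 := allSq_add_le (D 1 (Pot (Om f))) (D 2 φ) t x
    have o2 := allSq_add_le (D 2 (Pot (Om f))) (-D 1 φ) t x
    rw [← S_D_Pot hf] at s1 s2
    rw [← Om_D_one_Pot hf] at o1
    rw [← Om_D_two_Pot hf, allSq_neg] at o2
    rw [Box_D] at k1 k2
    have w := wt_le c t x
    have hb : ∀ i j : Fin 3, i ≠ 0 → ∀ b : Fin 3, D b (D i (D j φ)) t x ^ 2 ≤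
        allSq (D j (Pot (D i f))) t x := fun i j _ b => by
      rw [Pot_D hf.test, D_comm i j]; exact sq_le_allSq _ _ _ _
    have p1 : ∀ j : Fin 3, j ≠ 0 → Lap (D j φ) t x ^ 2 + D 0 (D 1 (D j φ)) t x ^ 2
        + D 0 (D 2 (D j φ)) t x ^ 2 ≤ 3 * allSq (D j (Pot (D 1 f))) t x
          + 3 * allSq (D j (Pot (D 2 f))) t x := fun j _ => by
      have q1 := hb 1 j n1 1
      have q2 := hb 2 j n2 2
      have q3 := hb 1 j n1 0
      have q4 := hb 2 j n2 0
      have q5 := add_sq_le (a := D 1 (D 1 (D j φ)) t x) (b := D 2 (D 2 (D j φ)) t x)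
      rw [Lap_def, add_ap]
      linarith
    have p11 := p1 1 n1
    have p12 := p1 2 n2
    simp only [mul_ap, add_ap, smul_ap, enF, hP, pow_ap, dot] at *
    set P1 := Lap (D 1 φ) t x ^ 2 + D 0 (D 1 (D 1 φ)) t x ^ 2 + D 0 (D 2 (D 1 φ)) t x ^ 2
    set P2 := Lap (D 2 φ) t x ^ 2 + D 0 (D 1 (D 2 φ)) t x ^ 2 + D 0 (D 2 (D 2 φ)) t x ^ 2
    have hPP : 0 ≤ P1 + P2 := by positivity
    have w2 := mul_le_mul_of_nonneg_right w hPP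
    have k3 := mul_le_mul_of_nonneg_left (add_le_add (add_le_add s1 s2) (add_le_add o1 o2)) hK.le
    linarith
  have h3 : I t ((9:ℝ) • (enF (D 1 f) + enF (D 2 f)) + (2 * K) • ((5:ℝ) • enF f
      + (2:ℝ) • (enF (S f) + enF (Om f)) + t ^ 2 • dot F F)) =
      9 * (En t (D 1 f) + En t (D 2 f)) + (2 * K) * (5 * En t f
      + 2 * (En t (S f) + En t (Om f)) + t ^ 2 * I t (dot F F)) := by
    rw [I_add (((itg_enF (hf.D 1) t).add (itg_enF (hf.D 2) t)).smul _)
      (((((itg_enF hf t).smul _).add (((itg_enF hf.S t).add (itg_enF hf.Om t)).smul _)).add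
        (iF.smul _)).smul _), I_smul, I_smul, I_add (itg_enF (hf.D 1) t) (itg_enF (hf.D 2) t),
      I_add (((itg_enF hf t).smul _).add (((itg_enF hf.S t).add (itg_enF hf.Om t)).smul _))
        (iF.smul _), I_add ((itg_enF hf t).smul _) (((itg_enF hf.S t).add (itg_enF hf.Om t)).smul _),
      I_smul, I_smul, I_smul, I_add (itg_enF hf.S t) (itg_enF hf.Om t)]
    rfl
  rw [h3] at h2
  have m0 := En_nonneg f t
  have m1 := En_nonneg (S f) t
  have m2 := En_nonneg (Om f) t
  have m3 := En_nonneg (D 0 f) t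
  have m4 := En_nonneg (D 1 f) t
  have m5 := En_nonneg (D 2 f) t
  have m6 : 0 ≤ t ^ 2 * I t (dot F F) := mul_nonneg (sq_nonneg t) (I_nonneg (dot_self_nonneg F t))
  rw [Fin.sum_univ_three]
  have k0 := mul_nonneg hK.le m0
  have k1 := mul_nonneg hK.le m1
  have k2 := mul_nonneg hK.le m2
  have k3 := mul_nonneg hK.le m3
  have k4 := mul_nonneg hK.le m4
  have k5 := mul_nonneg hK.le m5
  have k6 := mul_nonneg hK.le m6
  linarith

/-! ### Commutators of the vector fields -/

/-- The order `|β|` of a multi-index. -/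
def ord (β : Fin 5 → ℕ) : ℕ := ∑ j, β j

theorem mem_multiIndices {N : ℕ} {β : Fin 5 → ℕ} : β ∈ multiIndices N ↔ ord β ≤ N := by
  simp only [multiIndices, Finset.mem_filter, Fintype.mem_piFinset, Finset.mem_range, ord]
  refine ⟨fun h => h.2, fun h => ⟨fun j => ?_, h⟩⟩
  have := Finset.single_le_sum (f := β) (fun i _ => Nat.zero_le _) (Finset.mem_univ j)
  omega

theorem ord_eq (β : Fin 5 → ℕ) : ord β = β 0 + β 1 + β 2 + β 3 + β 4 := by
  rw [ord, Fin.sum_univ_five]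

theorem S_D_iterate (a : Fin 3) (n : ℕ) (u : Fld) :
    S ((D a)^[n] u) = (D a)^[n] (S u) - (n : ℝ) • (D a)^[n] u := by
  induction n with
  | zero => simp
  | succ n ih =>
    have h : ∀ v, S (D a v) = D a (S v) - D a v := fun v => by rw [D_S]; ring
    rw [Function.iterate_succ_apply', Function.iterate_succ_apply', h, ih, map_sub,
      Derivation.map_smul]
    push_cast
    rw [add_smul, one_smul]; ring

theorem D_iterate_sub (a : Fin 3) (n : ℕ) (u v : Fld) :
    (D a)^[n] (u - v) = (D a)^[n] u - (D a)^[n] v := by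
  induction n generalizing u v with
  | zero => rfl
  | succ n ih => rw [Function.iterate_succ_apply, map_sub, ih]; rfl

theorem D_iterate_add (a : Fin 3) (n : ℕ) (u v : Fld) :
    (D a)^[n] (u + v) = (D a)^[n] u + (D a)^[n] v := by
  induction n generalizing u v with
  | zero => rfl
  | succ n ih => rw [Function.iterate_succ_apply, map_add, ih]; rfl

theorem D_iterate_smul (a : Fin 3) (n : ℕ) (c : ℝ) (u : Fld) :
    (D a)^[n] (c • u) = c • (D a)^[n] u := by
  induction n generalizing u with
  | zero => rfl
  | succ n ih => rw [Function.iterate_succ_apply, Derivation.map_smul, ih]; rfl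

theorem D_iterate_comm (a b : Fin 3) (n : ℕ) (u : Fld) : D b ((D a)^[n] u) = (D a)^[n] (D b u) := by
  induction n generalizing u with
  | zero => rfl
  | succ n ih => rw [Function.iterate_succ_apply, ih, D_comm b a]; rfl

theorem Om_D_one_iterate (n : ℕ) (u : Fld) :
    Om ((D 1)^[n] u) = (D 1)^[n] (Om u) + (n : ℝ) • (D 1)^[n - 1] (D 2 u) := by
  induction n with
  | zero => simp
  | succ n ih =>
    have h : ∀ v, Om (D 1 v) = D 1 (Om v) + D 2 v := fun v => by rw [D_one_Om]; ring
    rw [Function.iterate_succ_apply', Function.iterate_succ_apply', h, ih, map_add,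
      Derivation.map_smul, D_iterate_comm 1 2]
    rcases n with _ | n
    · simp
    · have e : ∀ v, D 1 ((D 1)^[n] v) = (D 1)^[n + 1] v := fun v =>
        (Function.iterate_succ_apply' (D 1) n v).symm
      simp only [Nat.add_sub_cancel, e]
      push_cast
      simp only [add_smul, one_smul, Nat.succ_eq_add_one]; ring

theorem Om_D_two_iterate (n : ℕ) (u : Fld) :
    Om ((D 2)^[n] u) = (D 2)^[n] (Om u) - (n : ℝ) • (D 2)^[n - 1] (D 1 u) := by
  induction n with
  | zero => simp
  | succ n ih =>
    have h : ∀ v, Om (D 2 v) = D 2 (Om v) - D 1 v := fun v => by rw [D_two_Om]; ring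
    rw [Function.iterate_succ_apply', Function.iterate_succ_apply', h, ih, map_sub,
      Derivation.map_smul, D_iterate_comm 2 1]
    rcases n with _ | n
    · simp
    · have e : ∀ v, D 2 ((D 2)^[n] v) = (D 2)^[n + 1] v := fun v =>
        (Function.iterate_succ_apply' (D 2) n v).symm
      simp only [Nat.add_sub_cancel, e]
      push_cast
      simp only [add_smul, one_smul, Nat.succ_eq_add_one]; ring

theorem Om_D_zero_iterate (n : ℕ) (u : Fld) : Om ((D 0)^[n] u) = (D 0)^[n] (Om u) := by
  induction n generalizing u with
  | zero => rfl
  | succ n ih => rw [Function.iterate_succ_apply, ih, ← D_zero_Om]; rfl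

theorem Om_S_iterate (n : ℕ) (u : Fld) : Om (S^[n] u) = S^[n] (Om u) := by
  induction n generalizing u with
  | zero => rfl
  | succ n ih => rw [Function.iterate_succ_apply, ih, ← S_Om]; rfl

theorem Z_def (β : Fin 5 → ℕ) (u : Fld) :
    Z β u = (D 0)^[β 0] ((D 1)^[β 1] ((D 2)^[β 2] (S^[β 3] (Om^[β 4] u)))) := rfl

theorem D_Z (a : Fin 3) (β : Fin 5 → ℕ) :
    ∃ β', ord β' = ord β + 1 ∧ ∀ u, D a (Z β u) = Z β' u := by
  fin_cases a
  · refine ⟨![β 0 + 1, β 1, β 2, β 3, β 4], ?_, fun u => ?_⟩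
    · simp [ord_eq]; ring
    · rw [Z_def, Z_def]
      exact (Function.iterate_succ_apply' (D 0) _ _).symm
  · refine ⟨![β 0, β 1 + 1, β 2, β 3, β 4], ?_, fun u => ?_⟩
    · simp [ord_eq]; ring
    · rw [Z_def, Z_def]
      simp only [Fin.mk_one, Fin.isValue]
      rw [D_iterate_comm]
      exact congrArg _ (Function.iterate_succ_apply' (D 1) _ _).symm
  · refine ⟨![β 0, β 1, β 2 + 1, β 3, β 4], ?_, fun u => ?_⟩
    · simp [ord_eq]; ring
    · rw [Z_def, Z_def]
      simp only [Fin.reduceFinMk, Fin.isValue]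
      rw [D_iterate_comm, D_iterate_comm]
      exact congrArg _ (congrArg _ (Function.iterate_succ_apply' (D 2) _ _).symm)

theorem S_Z (β : Fin 5 → ℕ) :
    ∃ β' : Fin 5 → ℕ, ∃ c : ℝ, ord β' = ord β + 1 ∧ ∀ u, S (Z β u) = Z β' u + c • Z β u := by
  refine ⟨![β 0, β 1, β 2, β 3 + 1, β 4], -((β 0 : ℝ) + β 1 + β 2), ?_, fun u => ?_⟩
  · simp [ord_eq]; ring
  · rw [Z_def, S_D_iterate, S_D_iterate, S_D_iterate, D_iterate_sub, D_iterate_sub, D_iterate_sub,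
      D_iterate_smul, D_iterate_smul, D_iterate_smul, ← Function.iterate_succ_apply' S, Z_def]
    simp only [Matrix.cons_val, add_smul, neg_smul]
    ring

theorem Om_Z (β : Fin 5 → ℕ) :
    ∃ β₁ β₂ β₃ : Fin 5 → ℕ, ∃ b c : ℝ, ord β₁ ≤ ord β + 1 ∧ ord β₂ ≤ ord β + 1 ∧
      ord β₃ ≤ ord β + 1 ∧ ∀ u, Om (Z β u) = Z β₁ u + b • Z β₂ u + c • Z β₃ u := by
  refine ⟨![β 0, β 1, β 2, β 3, β 4 + 1], ![β 0, β 1 - 1, β 2 + 1, β 3, β 4],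
    ![β 0, β 1 + 1, β 2 - 1, β 3, β 4], β 1, -(β 2 : ℝ), ?_, ?_, ?_, fun u => ?_⟩
  · simp [ord_eq]; omega
  · simp [ord_eq]; omega
  · simp [ord_eq]; omega
  · rw [Z_def, Om_D_zero_iterate, Om_D_one_iterate, Om_D_two_iterate, Om_S_iterate,
      ← Function.iterate_succ_apply' Om, D_iterate_add, D_iterate_smul, D_iterate_sub, D_iterate_sub,
      D_iterate_smul, D_iterate_smul, ← Function.iterate_succ_apply' (D 2)]
    simp only [Z_def, Matrix.cons_val, neg_smul, Nat.succ_eq_add_one, D_iterate_comm,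
      Function.iterate_succ_apply]
    ring

/-- The vector fields `∂_t, ∂_1, ∂_2, S, Ω`. -/
inductive IsField : Derivation ℝ Fld Fld → Prop
  | D (a : Fin 3) : IsField (D a)
  | S : IsField S
  | Om : IsField Om

/-- The operators that are linear combinations of `Z^β` with `|β| ≤ k`. -/
def ZSpan (k : ℕ) : Submodule ℝ (Fld → Fld) :=
  Submodule.span ℝ {A | ∃ β, ord β ≤ k ∧ A = Z β}

theorem Z_mem {k : ℕ} {β : Fin 5 → ℕ} (h : ord β ≤ k) : Z β ∈ ZSpan k :=
  Submodule.subset_span ⟨β, h, rfl⟩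

theorem field_Z_mem {e : Derivation ℝ Fld Fld} (he : IsField e) (β : Fin 5 → ℕ) :
    (fun u => e (Z β u)) ∈ ZSpan (ord β + 1) := by
  cases he with
  | D a =>
    obtain ⟨β', h1, h2⟩ := D_Z a β
    rw [funext h2]
    exact Z_mem h1.le
  | S =>
    obtain ⟨β', c, h1, h2⟩ := S_Z β
    rw [funext h2]
    exact Submodule.add_mem _ (Z_mem h1.le) (Submodule.smul_mem _ c (Z_mem (by omega)))
  | Om =>
    obtain ⟨β₁, β₂, β₃, b, c, h1, h2, h3, h4⟩ := Om_Z β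
    rw [funext h4]
    exact Submodule.add_mem _ (Submodule.add_mem _ (Z_mem h1) (Submodule.smul_mem _ b (Z_mem h2)))
      (Submodule.smul_mem _ c (Z_mem h3))

/-- The bilinear operators that are combinations of `Z^β f Z^γ g` with `|β| + |γ| ≤ k`. -/
def ZZSpan (k : ℕ) : Submodule ℝ (Fld → Fld → Fld) :=
  Submodule.span ℝ {B | ∃ β γ, ord β + ord γ ≤ k ∧ B = fun f g => Z β f * Z γ g}

theorem ZZ_mem_right {k l m : ℕ} {β : Fin 5 → ℕ} (h : ord β ≤ k) {A : Fld → Fld} (hA : A ∈ ZSpan l)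
    (hm : k + l ≤ m) : (fun f g => Z β f * A g) ∈ ZZSpan m := by
  induction hA using Submodule.span_induction with
  | mem A hA =>
    obtain ⟨γ, h2, rfl⟩ := hA
    exact Submodule.subset_span ⟨β, γ, by omega, rfl⟩
  | zero =>
    convert Submodule.zero_mem (ZZSpan m) using 1
    funext f g
    exact mul_zero _
  | add A B _ _ h1 h2 =>
    convert Submodule.add_mem _ h1 h2 using 1
    funext f g
    exact mul_add _ _ _
  | smul c A _ h1 =>
    convert Submodule.smul_mem _ c h1 using 1
    funext f g
    exact mul_smul_comm c (Z β f) (A g)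

theorem ZZ_mem_left {k l m : ℕ} {β : Fin 5 → ℕ} (h : ord β ≤ k) {A : Fld → Fld} (hA : A ∈ ZSpan l)
    (hm : k + l ≤ m) : (fun f g => A f * Z β g) ∈ ZZSpan m := by
  induction hA using Submodule.span_induction with
  | mem A hA =>
    obtain ⟨γ, h2, rfl⟩ := hA
    exact Submodule.subset_span ⟨γ, β, by omega, rfl⟩
  | zero =>
    convert Submodule.zero_mem (ZZSpan m) using 1
    funext f g
    exact zero_mul _
  | add A B _ _ h1 h2 =>
    convert Submodule.add_mem _ h1 h2 using 1
    funext f g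
    exact add_mul _ _ _
  | smul c A _ h1 =>
    convert Submodule.smul_mem _ c h1 using 1
    funext f g
    exact smul_mul_assoc c (A f) (Z β g)

theorem field_ZZ_mem {e : Derivation ℝ Fld Fld} (he : IsField e) {k : ℕ} {B : Fld → Fld → Fld}
    (hB : B ∈ ZZSpan k) : (fun f g => e (B f g)) ∈ ZZSpan (k + 1) := by
  induction hB using Submodule.span_induction with
  | mem B hB =>
    obtain ⟨β, γ, h, rfl⟩ := hB
    have h1 := ZZ_mem_right (m := k + 1) (le_refl (ord β)) (field_Z_mem he γ) (by omega)
    have h2 := ZZ_mem_left (m := k + 1) (le_refl (ord γ)) (field_Z_mem he β) (by omega)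
    convert Submodule.add_mem _ h1 h2 using 1
    funext f g
    rw [Derivation.leibniz, smul_eq_mul, smul_eq_mul, mul_comm (Z γ g)]
    rfl
  | zero =>
    convert Submodule.zero_mem (ZZSpan (k + 1)) using 1
    funext f g
    exact map_zero e
  | add A B _ _ h1 h2 =>
    convert Submodule.add_mem _ h1 h2 using 1
    funext f g
    exact map_add e _ _
  | smul c A _ h1 =>
    convert Submodule.smul_mem _ c h1 using 1
    funext f g
    exact Derivation.map_smul e _ _

theorem iterate_ZZ_mem {e : Derivation ℝ Fld Fld} (he : IsField e) (n : ℕ) {k : ℕ}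
    {B : Fld → Fld → Fld} (hB : B ∈ ZZSpan k) : (fun f g => e^[n] (B f g)) ∈ ZZSpan (k + n) := by
  induction n with
  | zero => exact hB
  | succ n ih =>
    have := field_ZZ_mem he ih
    simp only [← Function.iterate_succ_apply' e] at this
    exact this

/-- Leibniz's rule. -/
theorem Z_mul_mem (α : Fin 5 → ℕ) : (fun f g => Z α (f * g)) ∈ ZZSpan (ord α) := by
  have h0 : (fun f g : Fld => f * g) ∈ ZZSpan 0 :=
    Submodule.subset_span ⟨0, 0, by simp [ord_eq], rfl⟩
  have h := iterate_ZZ_mem (IsField.D 0) (α 0) (iterate_ZZ_mem (IsField.D 1) (α 1)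
    (iterate_ZZ_mem (IsField.D 2) (α 2) (iterate_ZZ_mem IsField.S (α 3)
      (iterate_ZZ_mem IsField.Om (α 4) h0))))
  rw [show 0 + α 4 + α 3 + α 2 + α 1 + α 0 = ord α by rw [ord_eq]; ring] at h
  exact h

theorem ZSpan_mono {k l : ℕ} (h : k ≤ l) : ZSpan k ≤ ZSpan l :=
  Submodule.span_mono fun _ ⟨β, h1, h2⟩ => ⟨β, h1.trans h, h2⟩

theorem field_ZSpan_mem {e : Derivation ℝ Fld Fld} (he : IsField e) {k : ℕ} {A : Fld → Fld}
    (hA : A ∈ ZSpan k) : (fun f => e (A f)) ∈ ZSpan (k + 1) := by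
  induction hA using Submodule.span_induction with
  | mem B hB =>
    obtain ⟨β, h, rfl⟩ := hB
    exact ZSpan_mono (by omega) (field_Z_mem he β)
  | zero =>
    convert Submodule.zero_mem (ZSpan (k + 1)) using 1
    funext f
    exact map_zero e
  | add A B _ _ h1 h2 =>
    convert Submodule.add_mem _ h1 h2 using 1
    funext f
    exact map_add e _ _
  | smul c A _ h1 =>
    convert Submodule.smul_mem _ c h1 using 1
    funext f
    exact Derivation.map_smul e _ _

/-! ### Pointwise product estimates -/

/-- `∑_{|β| ≤ k} |Z^β f|²` at a point. -/
def nn (k : ℕ) (f : Fld) (t : ℝ) (x : Plane) : ℝ := ∑ β ∈ multiIndices k, Z β f t x ^ 2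

/-- `∑_{|β| ≤ k} |∇Z^β f|²` at a point. -/
def dd (k : ℕ) (f : Fld) (t : ℝ) (x : Plane) : ℝ :=
  ∑ β ∈ multiIndices k, (D 1 (Z β f) t x ^ 2 + D 2 (Z β f) t x ^ 2)

theorem nn_nonneg (k : ℕ) (f : Fld) (t : ℝ) (x : Plane) : 0 ≤ nn k f t x :=
  Finset.sum_nonneg fun _ _ => sq_nonneg _

theorem dd_nonneg (k : ℕ) (f : Fld) (t : ℝ) (x : Plane) : 0 ≤ dd k f t x :=
  Finset.sum_nonneg fun _ _ => by positivity

theorem multiIndices_mono {k l : ℕ} (h : k ≤ l) : multiIndices k ⊆ multiIndices l := fun _ hβ =>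
  mem_multiIndices.2 ((mem_multiIndices.1 hβ).trans h)

theorem nn_mono {k l : ℕ} (h : k ≤ l) (f : Fld) (t : ℝ) (x : Plane) : nn k f t x ≤ nn l f t x :=
  Finset.sum_le_sum_of_subset_of_nonneg (multiIndices_mono h) fun _ _ _ => sq_nonneg _

theorem sq_le_nn {k : ℕ} {β : Fin 5 → ℕ} (h : ord β ≤ k) (f : Fld) (t : ℝ) (x : Plane) :
    Z β f t x ^ 2 ≤ nn k f t x :=
  Finset.single_le_sum (f := fun β => Z β f t x ^ 2) (fun _ _ => sq_nonneg _)
    (mem_multiIndices.2 h)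

theorem sq_le_dd {k : ℕ} {β : Fin 5 → ℕ} (h : ord β ≤ k) (f : Fld) (t : ℝ) (x : Plane) :
    D 1 (Z β f) t x ^ 2 + D 2 (Z β f) t x ^ 2 ≤ dd k f t x :=
  Finset.single_le_sum (f := fun β => D 1 (Z β f) t x ^ 2 + D 2 (Z β f) t x ^ 2)
    (fun _ _ => by positivity) (mem_multiIndices.2 h)

theorem exists_bound_sum {ι : Type} (s : Finset ι) {P : Type} (F : ι → P → ℝ) (G : P → ℝ)
    (h : ∀ i ∈ s, ∃ C : ℝ, 0 ≤ C ∧ ∀ p, F i p ≤ C * G p) :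
    ∃ C : ℝ, 0 ≤ C ∧ ∀ p, ∑ i ∈ s, F i p ≤ C * G p := by
  induction s using Finset.cons_induction with
  | empty => exact ⟨0, le_rfl, fun p => by simp⟩
  | cons a s ha ih =>
    obtain ⟨C, hC0, hC⟩ := ih fun i hi => h i (Finset.mem_cons_of_mem hi)
    obtain ⟨C', hC0', hC'⟩ := h a (Finset.mem_cons_self _ _)
    refine ⟨C' + C, add_nonneg hC0' hC0, fun p => ?_⟩
    rw [Finset.sum_cons, add_mul]
    exact add_le_add (hC' p) (hC p)

/-- A property of squares that passes to linear combinations. -/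
theorem span_bound {V P : Type} [AddCommGroup V] [Module ℝ V] {s : Set V} {ev : P → V →ₗ[ℝ] ℝ}
    {G : P → ℝ} (h : ∀ B ∈ s, ∃ C : ℝ, 0 ≤ C ∧ ∀ p, ev p B ^ 2 ≤ C * G p)
    {B : V} (hB : B ∈ Submodule.span ℝ s) : ∃ C : ℝ, 0 ≤ C ∧ ∀ p, ev p B ^ 2 ≤ C * G p := by
  induction hB using Submodule.span_induction with
  | mem B hB => exact h B hB
  | zero => exact ⟨0, le_rfl, fun p => by simp⟩
  | add A B _ _ h1 h2 =>
    obtain ⟨C, hC0, hC⟩ := h1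
    obtain ⟨C', hC0', hC'⟩ := h2
    refine ⟨2 * C + 2 * C', by positivity, fun p => ?_⟩
    rw [map_add]
    have := add_sq_le (a := ev p A) (b := ev p B)
    linarith [hC p, hC' p]
  | smul c A _ h1 =>
    obtain ⟨C, hC0, hC⟩ := h1
    refine ⟨c ^ 2 * C, by positivity, fun p => ?_⟩
    rw [map_smul, smul_eq_mul, mul_pow, mul_assoc]
    exact mul_le_mul_of_nonneg_left (hC p) (sq_nonneg c)

/-- Evaluation of a bilinear operator at two fields and a point, after a linear operator. -/
def evZZ (A : Fld →ₗ[ℝ] Fld) (p : Fld × Fld × ℝ × Plane) : (Fld → Fld → Fld) →ₗ[ℝ] ℝ where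
  toFun B := A (B p.1 p.2.1) p.2.2.1 p.2.2.2
  map_add' B C := by
    show A (B _ _ + C _ _) _ _ = _
    rw [map_add, add_ap]
  map_smul' c B := by
    show A (c • B _ _) _ _ = _
    rw [map_smul, smul_ap]; rfl

theorem ZZ_bound {k : ℕ} {B : Fld → Fld → Fld} (hB : B ∈ ZZSpan k) (A : Fld →ₗ[ℝ] Fld)
    {G : Fld → Fld → ℝ → Plane → ℝ}
    (h : ∀ β γ, ord β + ord γ ≤ k → ∀ f g t x, A (Z β f * Z γ g) t x ^ 2 ≤ 4 * G f g t x) :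
    ∃ C : ℝ, 0 ≤ C ∧ ∀ f g t x, A (B f g) t x ^ 2 ≤ C * G f g t x := by
  obtain ⟨C, hC0, hC⟩ := span_bound (ev := evZZ A) (G := fun p => G p.1 p.2.1 p.2.2.1 p.2.2.2)
    (fun B hB => by
      obtain ⟨β, γ, hk, rfl⟩ := hB
      exact ⟨4, by norm_num, fun p => h β γ hk _ _ _ _⟩) hB
  exact ⟨C, hC0, fun f g t x => hC (f, g, t, x)⟩

theorem sum_bound {N : ℕ} (A : Fld →ₗ[ℝ] Fld)
    {G : Fld → Fld → ℝ → Plane → ℝ}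
    (h : ∀ β γ, ord β + ord γ ≤ N → ∀ f g t x, A (Z β f * Z γ g) t x ^ 2 ≤ 4 * G f g t x) :
    ∃ C : ℝ, 0 ≤ C ∧ ∀ f g t x, ∑ α ∈ multiIndices N, A (Z α (f * g)) t x ^ 2 ≤ C * G f g t x := by
  obtain ⟨C, hC0, hC⟩ := exists_bound_sum (P := Fld × Fld × ℝ × Plane) (multiIndices N)
    (fun α p => A (Z α (p.1 * p.2.1)) p.2.2.1 p.2.2.2 ^ 2) (fun p => G p.1 p.2.1 p.2.2.1 p.2.2.2)
    (fun α hα => by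
      obtain ⟨C, h0, h1⟩ := ZZ_bound (Z_mul_mem α) A
        (fun β γ hk => h β γ (hk.trans (mem_multiIndices.1 hα)))
      exact ⟨C, h0, fun p => h1 _ _ _ _⟩)
  exact ⟨C, hC0, fun f g t x => hC (f, g, t, x)⟩

theorem nn_mul_low (L : ℕ) : ∃ C : ℝ, 0 ≤ C ∧ ∀ f g t x,
    nn L (f * g) t x ≤ C * (nn L f t x * nn L g t x) := by
  refine sum_bound LinearMap.id (G := fun f g t x => nn L f t x * nn L g t x) fun β γ h f g t x => ?_
  rw [LinearMap.id_apply, mul_ap, mul_pow]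
  have := mul_le_mul (sq_le_nn (k := L) (by omega : ord β ≤ L) f t x)
    (sq_le_nn (by omega : ord γ ≤ L) g t x) (sq_nonneg _) (nn_nonneg _ _ _ _)
  have h0 := mul_nonneg (nn_nonneg L f t x) (nn_nonneg L g t x)
  linarith

/-- Since `n ≤ 2 * L + 1`, one of the two factors always carries at most `L` fields. -/
theorem nn_mul_high {n L : ℕ} (hL : n ≤ 2 * L + 1) : ∃ C : ℝ, 0 ≤ C ∧ ∀ f g t x,
    nn n (f * g) t x ≤ C * (nn n f t x * nn L g t x + nn L f t x * nn n g t x) := by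
  refine sum_bound LinearMap.id
    (G := fun f g t x => nn n f t x * nn L g t x + nn L f t x * nn n g t x) fun β γ h f g t x => ?_
  rw [LinearMap.id_apply, mul_ap, mul_pow]
  have h0 := mul_nonneg (nn_nonneg n f t x) (nn_nonneg L g t x)
  have h1 := mul_nonneg (nn_nonneg L f t x) (nn_nonneg n g t x)
  rcases le_or_gt (ord γ) L with hγ | hγ
  · have := mul_le_mul (sq_le_nn (k := n) (by omega : ord β ≤ n) f t x)
      (sq_le_nn hγ g t x) (sq_nonneg _) (nn_nonneg _ _ _ _)
    linarith
  · have := mul_le_mul (sq_le_nn (k := L) (by omega : ord β ≤ L) f t x)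
      (sq_le_nn (k := n) (by omega : ord γ ≤ n) g t x) (sq_nonneg _) (nn_nonneg _ _ _ _)
    linarith

theorem D_mul_sq_le {a b : ℕ} {β γ : Fin 5 → ℕ} (hβ : ord β ≤ a) (hγ : ord γ ≤ b) (i : Fin 3)
    (hi : i = 1 ∨ i = 2) (f g : Fld) (t : ℝ) (x : Plane) :
    D i (Z β f * Z γ g) t x ^ 2 ≤
      2 * (dd a f t x * nn b g t x) + 2 * (nn a f t x * dd b g t x) := by
  have hd : ∀ {k : ℕ} {β : Fin 5 → ℕ}, ord β ≤ k → ∀ f, D i (Z β f) t x ^ 2 ≤ dd k f t x :=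
    fun {k β} h f => by
      have := sq_le_dd h f t x
      rcases hi with rfl | rfl <;> nlinarith [sq_nonneg (D 1 (Z β f) t x), sq_nonneg (D 2 (Z β f) t x)]
  rw [D_mul, add_ap, mul_ap, mul_ap]
  have h1 := mul_le_mul (hd hβ f) (sq_le_nn hγ g t x) (sq_nonneg _) (dd_nonneg _ _ _ _)
  have h2 := mul_le_mul (sq_le_nn hβ f t x) (hd hγ g) (sq_nonneg _) (nn_nonneg _ _ _ _)
  rw [← mul_pow] at h1 h2
  have := add_sq_le (a := Z β f t x * D i (Z γ g) t x) (b := Z γ g t x * D i (Z β f) t x)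
  rw [mul_comm (Z γ g t x)] at this ⊢
  linarith

theorem dd_mul_of {N : ℕ} {G : Fld → Fld → ℝ → Plane → ℝ}
    (h : ∀ i : Fin 3, i = 1 ∨ i = 2 → ∀ β γ, ord β + ord γ ≤ N → ∀ f g t x,
      D i (Z β f * Z γ g) t x ^ 2 ≤ 4 * G f g t x) :
    ∃ C : ℝ, 0 ≤ C ∧ ∀ f g t x, dd N (f * g) t x ≤ C * G f g t x := by
  obtain ⟨C₁, p1, h1⟩ := sum_bound (N := N) (D 1 : Fld →ₗ[ℝ] Fld) (h 1 (Or.inl rfl))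
  obtain ⟨C₂, p2, h2⟩ := sum_bound (N := N) (D 2 : Fld →ₗ[ℝ] Fld) (h 2 (Or.inr rfl))
  refine ⟨C₁ + C₂, add_nonneg p1 p2, fun f g t x => ?_⟩
  rw [dd, Finset.sum_add_distrib, add_mul]
  exact add_le_add (h1 f g t x) (h2 f g t x)

theorem dd_mul_low (L : ℕ) : ∃ C : ℝ, 0 ≤ C ∧ ∀ f g t x,
    dd L (f * g) t x ≤ C * (dd L f t x * nn L g t x + nn L f t x * dd L g t x) := by
  refine dd_mul_of (G := fun f g t x => dd L f t x * nn L g t x + nn L f t x * dd L g t x) fun i hi β γ h f g t x => ?_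
  have := D_mul_sq_le (by omega : ord β ≤ L) (by omega : ord γ ≤ L) i hi f g t x
  have h0 := mul_nonneg (dd_nonneg L f t x) (nn_nonneg L g t x)
  have h1 := mul_nonneg (nn_nonneg L f t x) (dd_nonneg L g t x)
  linarith

/-- The version of `nn_mul_high` for `dd`: one of the two factors always carries at most `L` fields. -/
theorem dd_mul_high {n L : ℕ} (hL : n ≤ 2 * L + 1) : ∃ C : ℝ, 0 ≤ C ∧ ∀ f g t x,
    dd n (f * g) t x ≤ C * (dd n f t x * nn L g t x + nn n f t x * dd L g t x
      + (dd L f t x * nn n g t x + nn L f t x * dd n g t x)) := by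
  refine dd_mul_of (G := fun f g t x => dd n f t x * nn L g t x + nn n f t x * dd L g t x
      + (dd L f t x * nn n g t x + nn L f t x * dd n g t x)) fun i hi β γ h f g t x => ?_
  have h0 := mul_nonneg (dd_nonneg n f t x) (nn_nonneg L g t x)
  have h1 := mul_nonneg (nn_nonneg n f t x) (dd_nonneg L g t x)
  have h2 := mul_nonneg (dd_nonneg L f t x) (nn_nonneg n g t x)
  have h3 := mul_nonneg (nn_nonneg L f t x) (dd_nonneg n g t x)
  rcases le_or_gt (ord γ) L with hγ | hγ
  · have := D_mul_sq_le (by omega : ord β ≤ n) hγ i hi f g t x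
    linarith
  · have := D_mul_sq_le (by omega : ord β ≤ L) (by omega : ord γ ≤ n) i hi f g t x
    linarith

/-! ### Fields that vanish on a part of the slab -/

/-- `u` vanishes at the points of `O` with time in `[0, T]`. -/
def Van (T : ℝ) (O : Set (ℝ × Plane)) (u : Fld) : Prop :=
  ∀ t ∈ Icc 0 T, ∀ x, (t, x) ∈ O → u t x = 0

theorem Van.add {T : ℝ} {O : Set (ℝ × Plane)} {u v : Fld} (hu : Van T O u) (hv : Van T O v) :
    Van T O (u + v) := fun t ht x hx => by rw [add_ap, hu t ht x hx, hv t ht x hx, add_zero]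

theorem Van.sub {T : ℝ} {O : Set (ℝ × Plane)} {u v : Fld} (hu : Van T O u) (hv : Van T O v) :
    Van T O (u - v) := fun t ht x hx => by rw [sub_ap, hu t ht x hx, hv t ht x hx, sub_zero]

theorem Van.mul_left {T : ℝ} {O : Set (ℝ × Plane)} {v : Fld} (u : Fld) (hv : Van T O v) :
    Van T O (u * v) := fun t ht x hx => by rw [mul_ap, hv t ht x hx, mul_zero]

theorem Van.mono {T : ℝ} {O O' : Set (ℝ × Plane)} {v : Fld} (hv : Van T O v) (h : O' ⊆ O) :
    Van T O' v := fun t ht x hx => hv t ht x (h hx)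

theorem D_eq_zero_of_eventually {u : Fld} {t : ℝ} {x : Plane} (h : ∀ᶠ y in 𝓝 x, u t y = 0)
    (i : Fin 2) : D i.succ u t x = 0 := by
  have h1 : u t =ᶠ[𝓝 x] fun _ => 0 := h
  show fderiv ℝ (u t) x _ = 0
  rw [h1.fderiv_eq]; simp

theorem Van.D {T : ℝ} (hT : 0 < T) {O : Set (ℝ × Plane)} (hO : IsOpen O) {u : Fld}
    (hu : Van T O u) (a : Fin 3) : Van T O (D a u) := by
  intro t ht x hx
  have hn := hO.mem_nhds hx
  refine Fin.cases ?_ (fun i => ?_) a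
  · have h1 : ∀ᶠ s in 𝓝 t, (s, x) ∈ O :=
      (Continuous.prodMk_left x).continuousAt.preimage_mem_nhds hn
    have h2 : (fun s => u s x) =ᶠ[𝓝[Icc 0 T] t] fun _ => 0 := by
      filter_upwards [nhdsWithin_le_nhds h1, self_mem_nhdsWithin] with s hs hs'
      exact hu s hs' x hs
    have hd : DifferentiableAt ℝ (fun s => u s x) t :=
      ((u.smooth.comp (contDiff_prodMk_left x)).differentiable (by simp)) t
    rw [D_zero_ap, ← hd.derivWithin (uniqueDiffOn_Icc hT t ht), h2.derivWithin_eq (hu t ht x hx)]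
    simp
  · refine D_eq_zero_of_eventually ?_ i
    have h1 : ∀ᶠ y in 𝓝 x, (t, y) ∈ O :=
      (Continuous.prodMk_right t).continuousAt.preimage_mem_nhds hn
    filter_upwards [h1] with y hy
    exact hu t ht y hy

theorem Van.S {T : ℝ} (hT : 0 < T) {O : Set (ℝ × Plane)} (hO : IsOpen O) {u : Fld}
    (hu : Van T O u) : Van T O (S u) :=
  ((hu.D hT hO 0).mul_left Tm).add
    (((hu.D hT hO 1).mul_left (X 0)).add ((hu.D hT hO 2).mul_left (X 1)))

theorem Van.Om {T : ℝ} (hT : 0 < T) {O : Set (ℝ × Plane)} (hO : IsOpen O) {u : Fld}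
    (hu : Van T O u) : Van T O (Om u) :=
  ((hu.D hT hO 1).mul_left (X 1)).sub ((hu.D hT hO 2).mul_left (X 0))

theorem Van.Z {T : ℝ} (hT : 0 < T) {O : Set (ℝ × Plane)} (hO : IsOpen O) {u : Fld}
    (hu : Van T O u) (α : Fin 5 → ℕ) : Van T O (Z α u) :=
  Z_ind (P := Van T O) (fun a _ h => h.D hT hO a) (fun _ h => h.S hT hO) (fun _ h => h.Om hT hO) α hu

theorem Van.Lap {T : ℝ} (hT : 0 < T) {O : Set (ℝ × Plane)} (hO : IsOpen O) {u : Fld}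
    (hu : Van T O u) : Van T O (Lap u) :=
  ((hu.D hT hO 1).D hT hO 1).add ((hu.D hT hO 2).D hT hO 2)

theorem Z_rel {R : Fld → Fld → Prop} (h0 : ∀ a f g, R f g → R (D a f) (D a g))
    (h3 : ∀ f g, R f g → R (S f) (S g)) (h4 : ∀ f g, R f g → R (Om f) (Om g))
    (α : Fin 5 → ℕ) {f g : Fld} (h : R f g) : R (Z α f) (Z α g) :=
  iterate_rel (h0 0) _ (iterate_rel (h0 1) _ (iterate_rel (h0 2) _ (iterate_rel h3 _
    (iterate_rel h4 _ h))))

/-- The equation `□f = Δn` is inherited by `Z^α f` and `Z^α n`. -/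
theorem van_Box_sub_Lap {T c : ℝ} (hT : 0 < T) {f n : Fld} (h : Van T univ (Box c f - Lap n))
    (α : Fin 5 → ℕ) : Van T univ (Box c (Z α f) - Lap (Z α n)) := by
  refine Z_rel (R := fun f n => Van T univ (Box c f - Lap n)) (fun a f n h => ?_) (fun f n h => ?_)
    (fun f n h => ?_) α h
  · rw [Box_D, Lap_D, ← map_sub]
    exact h.D hT isOpen_univ a
  · have e : Box c (S f) - Lap (S n) = S (Box c f - Lap n) + 2 * (Box c f - Lap n) := by
      rw [Box_S, Lap_S, map_sub]; ring
    rw [e]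
    exact (h.S hT isOpen_univ).add (h.mul_left 2)
  · rw [Box_Om, Lap_Om, ← map_sub]
    exact h.Om hT isOpen_univ

theorem dot_congr {u v : Fld} {t : ℝ} (h : ∀ x, u t x = v t x) (x : Plane) :
    dot u u t x = dot v v t x := by
  have e : u t = v t := funext h
  have h1 : ∀ i : Fin 2, D i.succ u t x = D i.succ v t x := fun i => by
    rw [D_succ_ap, D_succ_ap, e]
  have h2 : D 1 u t x = D 1 v t x := h1 0
  have h3 : D 2 u t x = D 2 v t x := h1 1
  simp only [dot, add_ap, mul_ap, h2, h3]

/-- The source of the wave equation for the potential: `□(-Δ)⁻¹f = -n` when `□f = Δn`. -/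
theorem I_dot_Box_Pot {T c t : ℝ} {f n : Fld} (hf : IsDiv f) (hn : Test n)
    (h : Van T univ (Box c f - Lap n)) (ht : t ∈ Icc 0 T) :
    I t (dot (Box c (Pot f)) (Box c (Pot f))) = I t (dot n n) := by
  refine integral_congr_ae (ae_of_all _ fun x => ?_)
  have e : dot n n t x = dot (-n) (-n) t x := by simp only [dot, map_neg]; congr 1; ring
  show dot _ _ t x = dot n n t x
  rw [e]
  refine dot_congr (fun y => ?_) x
  have h1 : (Box c f) t = (Lap n) t := by
    funext z
    have := h t ht z (mem_univ _)
    rw [sub_ap] at this; linarith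
  rw [← Pot_Box hf.test, Pot_ap (hf.Box c).test, h1, ← Pot_ap hn.Lap, Pot_Lap hn, Lap_Pot hn]

/-! ### Finite speed of propagation -/

/-- The region `|x| > c t + 1`. -/
def outer (c : ℝ) : Set (ℝ × Plane) := {p | c * p.1 + 1 < ‖p.2‖}

theorem isOpen_outer (c : ℝ) : IsOpen (outer c) :=
  isOpen_lt (by fun_prop) (by fun_prop)

theorem contDiff_smoothTransition : ContDiff ℝ ∞ Real.smoothTransition :=
  Real.smoothTransition.contDiff

/-- Composition of a field with a smooth function. -/
def compFld (χ : ℝ → ℝ) (hχ : ContDiff ℝ ∞ χ) (u : Fld) : Fld :=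
  Fld.mk (fun t x => χ (u t x)) (hχ.comp u.smooth)

theorem D_compFld (χ : ℝ → ℝ) (hχ : ContDiff ℝ ∞ χ) (u : Fld) (a : Fin 3) (t : ℝ) (x : Plane) :
    D a (compFld χ hχ u) t x = deriv χ (u t x) * D a u t x := by
  have h1 : DifferentiableAt ℝ χ (u t x) := (hχ.differentiable (by simp)) _
  rw [D_ap, D_ap]
  have h2 := (h1.hasDerivAt.comp_hasFDerivAt (t, x) (u.diffAt (t, x)).hasFDerivAt).fderiv
  show fderiv ℝ (χ ∘ fun p : ℝ × Plane => u p.1 p.2) (t, x) (dir a) = _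
  rw [h2]; rfl

/-- `√(ε + |x|²) - √(ε + 1) - c t`. -/
def phase (c ε : ℝ) (hε : 0 < ε) : Fld :=
  (Rreg ε).sqrt (Rreg_pos hε) - algebraMap ℝ Fld √(1 + ε) - algebraMap ℝ Fld c * Tm

theorem phase_ap {c ε : ℝ} (hε : 0 < ε) (t : ℝ) (x : Plane) :
    phase c ε hε t x = √(‖x‖ ^ 2 + ε) - √(1 + ε) - c * t := by
  simp [phase, sqrt_ap, Rreg_ap]

theorem mem_outer_of_phase_pos {c ε : ℝ} (hc : 0 < c) (hε : 0 < ε) {t : ℝ} (ht : 0 ≤ t) {x : Plane}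
    (h : 0 < phase c ε hε t x) : (t, x) ∈ outer c := by
  rw [phase_ap] at h
  show c * t + 1 < ‖x‖
  have h1 : 1 ≤ √(1 + ε) := Real.one_le_sqrt.2 (by linarith)
  have h2 : √(1 + ε) ^ 2 = 1 + ε := Real.sq_sqrt (by linarith)
  have h3 : √(‖x‖ ^ 2 + ε) ^ 2 = ‖x‖ ^ 2 + ε := Real.sq_sqrt (by positivity)
  have hct := mul_nonneg hc.le ht
  have h4 : (√(1 + ε) + c * t) ^ 2 < √(‖x‖ ^ 2 + ε) ^ 2 :=
    pow_lt_pow_left₀ (by linarith) (by linarith) two_ne_zero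
  refine lt_of_pow_lt_pow_left₀ 2 (norm_nonneg x) ?_
  nlinarith

theorem D_phase_sq_le {c ε : ℝ} (hε : 0 < ε) (t : ℝ) (x : Plane) :
    D 1 (phase c ε hε) t x ^ 2 + D 2 (phase c ε hε) t x ^ 2 ≤ 1 := by
  have h1 := congrArg (fun u : Fld => u t x) (D_sqrt 1 (Rreg ε) (Rreg_pos hε))
  have h2 := congrArg (fun u : Fld => u t x) (D_sqrt 2 (Rreg ε) (Rreg_pos hε))
  have e : ∀ i : Fin 2, D i.succ (phase c ε hε) = D i.succ ((Rreg ε).sqrt (Rreg_pos hε)) :=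
    fun i => by
      simp only [phase, map_sub, D_mul, D_algebraMap, D_succ_Tm, mul_zero, add_zero, sub_zero]
  have e1 : D 1 (phase c ε hε) = D 1 ((Rreg ε).sqrt (Rreg_pos hε)) := e 0
  have e2 : D 2 (phase c ε hε) = D 2 ((Rreg ε).sqrt (Rreg_pos hε)) := e 1
  rw [e1, e2]
  rw [D_one_Rreg] at h1
  rw [D_two_Rreg] at h2
  simp only [mul_ap, ofNat_ap, X_ap, sqrt_ap, Rreg_ap] at h1 h2
  set y1 := D 1 ((Rreg ε).sqrt (Rreg_pos hε)) t x
  set y2 := D 2 ((Rreg ε).sqrt (Rreg_pos hε)) t x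
  have hp : 0 < ‖x‖ ^ 2 + ε := by positivity
  have h3 : √(‖x‖ ^ 2 + ε) ^ 2 = ‖x‖ ^ 2 + ε := Real.sq_sqrt hp.le
  set s := √(‖x‖ ^ 2 + ε)
  have h4 : (‖x‖ ^ 2 + ε) * (y1 ^ 2 + y2 ^ 2) = ‖x‖ ^ 2 := by
    rw [norm_sq_eq, ← norm_sq_eq, ← h3, norm_sq_eq]
    have a1 : s * y1 = x 0 := by linarith
    have a2 : s * y2 = x 1 := by linarith
    rw [← a1, ← a2]; ring
  by_contra hcon
  push Not at hcon
  nlinarith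

theorem D_zero_phase {c ε : ℝ} (hε : 0 < ε) (t : ℝ) (x : Plane) :
    D 0 (phase c ε hε) t x = -c := by
  have h1 := congrArg (fun u : Fld => u t x) (D_sqrt 0 (Rreg ε) (Rreg_pos hε))
  have h2 : D 0 (Rreg ε) = 0 := by rw [Rreg, map_add, D_zero_Rsq, D_algebraMap, add_zero]
  rw [h2] at h1
  simp only [mul_ap, ofNat_ap, sqrt_ap, Rreg_ap, zero_ap] at h1
  have hp : 0 < √(‖x‖ ^ 2 + ε) := Real.sqrt_pos.2 (by positivity)
  have h3 : D 0 ((Rreg ε).sqrt (Rreg_pos hε)) t x = 0 := by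
    rcases mul_eq_zero.1 h1 with h | h
    · norm_num at h
    · exact (mul_eq_zero.1 h).resolve_left hp.ne'
  simp only [phase, map_sub, D_mul, D_algebraMap, mul_zero, add_zero, sub_ap, sub_zero, mul_ap, h3]
  simp

theorem energy_cross_le {c k wt w1 w2 p1 p2 : ℝ} (hc : 0 < c) (hk : 0 ≤ k)
    (hp : p1 ^ 2 + p2 ^ 2 ≤ 1) :
    k * (-c) * (wt ^ 2 + c ^ 2 * (w1 ^ 2 + w2 ^ 2)) / 2
      - c ^ 2 * (k * p1 * w1 + k * p2 * w2) * wt ≤ 0 := by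
  have h1 : (p1 * w1 + p2 * w2) ^ 2 ≤ w1 ^ 2 + w2 ^ 2 := by
    nlinarith [sq_nonneg (p1 * w2 - p2 * w1), mul_nonneg (sub_nonneg.2 hp)
      (add_nonneg (sq_nonneg w1) (sq_nonneg w2))]
  have h2 : 0 ≤ (wt + c * (p1 * w1 + p2 * w2)) ^ 2 := sq_nonneg _
  have h3 : 0 ≤ wt ^ 2 + c ^ 2 * (w1 ^ 2 + w2 ^ 2) + 2 * c * (p1 * w1 + p2 * w2) * wt := by
    nlinarith [mul_le_mul_of_nonneg_left h1 (sq_nonneg c)]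
  nlinarith [mul_nonneg (mul_nonneg hk hc.le) h3]

/-- The energy density of `u`, integrated against a nondecreasing smooth cutoff of `phase`, vanishes
initially and does not increase, because `phase` has spatial gradient at most `1` and time
derivative `-c`. -/
theorem finite_speed {u : Fld} (hu : Test u) {c T : ℝ} (hc : 0 < c)
    (hbox : Van T (outer c) (Box c u)) (h0 : ∀ x : Plane, 1 < ‖x‖ → u 0 x = 0)
    (h1 : ∀ x : Plane, 1 < ‖x‖ → D 0 u 0 x = 0) : Van T (outer c) u := by
  intro t ht x hx
  obtain ⟨ε, hε, hpos⟩ : ∃ ε, ∃ hε : 0 < ε, 0 < phase c ε hε t x := by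
    have hx' : c * t + 1 < ‖x‖ := hx
    refine ⟨‖x‖ - (c * t + 1), by linarith, ?_⟩
    rw [phase_ap]
    have hε : 0 < ‖x‖ - (c * t + 1) := by linarith
    set ε := ‖x‖ - (c * t + 1) with hεd
    have a1 : ‖x‖ ≤ √(‖x‖ ^ 2 + ε) := Real.le_sqrt_of_sq_le (by linarith)
    have a2 : √(1 + ε) < 1 + ε := by
      rw [Real.sqrt_lt' (by linarith)]; nlinarith
    linarith
  set ψ := phase c ε hε with hψ
  set η := compFld _ contDiff_smoothTransition ψ with hη
  have hη0 : ∀ s y, 0 ≤ η s y := fun s y => Real.smoothTransition.nonneg _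
  have hηψ : ∀ s y, η s y ≠ 0 → 0 < ψ s y := fun s y h => by
    by_contra hcon
    exact h (Real.smoothTransition.zero_of_nonpos (not_lt.1 hcon))
  set E : Fld := D 0 u ^ 2 + c ^ 2 • (D 1 u ^ 2 + D 2 u ^ 2) with hE
  have tE : Test E := (hu.D 0).sq.add ((((hu.D 1).sq).add ((hu.D 2).sq)).smul _)
  have hE0 : ∀ s y, 0 ≤ E s y := fun s y => by
    simp only [hE, add_ap, pow_ap, smul_ap]; positivity
  -- the weighted energy is nonincreasing
  have hder : ∀ s ∈ Icc 0 T, I s (D 0 (η * E)) ≤ 0 := fun s hs => by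
    have tF : ∀ i : Fin 2, Test (η * D 0 u * D i.succ u) := fun i => (hu.D _).mul_left _
    have key := I_div_eq_zero ((tF 0).itg s) (((tF 0).D 1).itg s) ((tF 1).itg s)
      (((tF 1).D 2).itg s)
    have td : Test (D 1 (η * D 0 u * D 1 u) + D 2 (η * D 0 u * D 2 u)) :=
      ((tF 0).D 1).add ((tF 1).D 2)
    have h2 : I s (D 0 (η * E)) = I s (D 0 (η * E) - (2 * c ^ 2) • (D 1 (η * D 0 u * D 1 u)
        + D 2 (η * D 0 u * D 2 u))) := by
      rw [I_sub (((tE.mul_left η).D 0).itg s) ((td.itg s).smul _), I_smul]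
      have : I s (D 1 (η * D 0 u * D 1 u) + D 2 (η * D 0 u * D 2 u)) = 0 := key
      rw [this]; ring
    rw [h2]
    refine integral_nonpos fun y => ?_
    have e : D 0 (η * E) - (2 * c ^ 2) • (D 1 (η * D 0 u * D 1 u) + D 2 (η * D 0 u * D 2 u))
        = D 0 η * E - (2 * c ^ 2) • ((D 1 η * D 1 u + D 2 η * D 2 u) * D 0 u)
          + 2 * (η * D 0 u * Box c u) := by
      simp only [hE, Box_def, Lap_def, D_mul, pow_two, map_add, Algebra.smul_def, D_algebraMap,
        D_comm_10, D_comm_20, map_mul, map_ofNat]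
      ring
    rw [e]
    simp only [add_ap, sub_ap, mul_ap, smul_ap, ofNat_ap, Pi.zero_apply]
    have z : η s y * D 0 u s y * Box c u s y = 0 := by
      by_cases h : η s y = 0
      · rw [h]; ring
      · rw [hbox s hs y (mem_outer_of_phase_pos hc hε hs.1 (hηψ s y h))]; ring
    rw [z, hη, D_compFld, D_compFld, D_compFld, hψ, D_zero_phase]
    have hk : 0 ≤ deriv Real.smoothTransition (phase c ε hε s y) :=
      Real.smoothTransition.monotone.deriv_nonneg
    have := energy_cross_le (wt := D 0 u s y) (w1 := D 1 u s y) (w2 := D 2 u s y) hc hk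
      (D_phase_sq_le (c := c) hε s y)
    simp only [hE, add_ap, pow_ap, smul_ap]
    linarith
  have hanti : AntitoneOn (fun s => I s (η * E)) (Icc 0 T) := by
    have hd := fun s => hasDerivAt_I (tE.mul_left η) s
    refine antitoneOn_of_deriv_nonpos (convex_Icc 0 T)
      (fun s _ => (hd s).continuousAt.continuousWithinAt)
      (fun s _ => (hd s).differentiableAt.differentiableWithinAt) fun s hs => ?_
    rw [(hd s).deriv]
    exact hder s (interior_subset hs)
  have hu0 : ∀ y : Plane, 1 < ‖y‖ → ∀ i : Fin 2, D i.succ u 0 y = 0 := fun y hy i => by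
    refine D_eq_zero_of_eventually ?_ i
    filter_upwards [(isOpen_lt continuous_const continuous_norm).mem_nhds hy] with z hz
    exact h0 z hz
  have hE00 : I 0 (η * E) = 0 := by
    have : ∀ y, (η * E) 0 y = 0 := fun y => by
      rw [mul_ap]
      by_cases h : η 0 y = 0
      · rw [h, zero_mul]
      · have hy : 1 < ‖y‖ := by
          have : c * 0 + 1 < ‖y‖ := mem_outer_of_phase_pos hc hε le_rfl (hηψ 0 y h)
          linarith
        have b1 : D 1 u 0 y = 0 := hu0 y hy 0
        have b2 : D 2 u 0 y = 0 := hu0 y hy 1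
        simp [hE, h1 y hy, b1, b2]
    simp [I, this]
  have hzero : ∀ s ∈ Icc 0 T, ∀ y, (η * E) s y = 0 := fun s hs y => by
    have hn : ∀ y, 0 ≤ (η * E) s y := fun y => mul_nonneg (hη0 s y) (hE0 s y)
    have hI : I s (η * E) = 0 := le_antisymm
      (hE00 ▸ hanti (left_mem_Icc.2 (hs.1.trans hs.2)) hs hs.1) (I_nonneg hn)
    have h2 := (integral_eq_zero_iff_of_nonneg hn ((tE.mul_left η).itg s)).1 hI
    exact congrFun (Continuous.ae_eq_iff_eq volume ((η * E).continuous s) continuous_const |>.1 h2) y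
  -- `u` is constant in time along the vertical segment below `(t, x)`
  have hseg : ∀ s ∈ Icc 0 t, D 0 u s x = 0 := fun s hs => by
    have hs' : s ∈ Icc 0 T := ⟨hs.1, hs.2.trans ht.2⟩
    have hp : 0 < ψ s x := by
      rw [hψ, phase_ap] at hpos ⊢
      have := mul_le_mul_of_nonneg_left hs.2 hc.le
      linarith
    have hηp : 0 < η s x := Real.smoothTransition.pos_of_pos hp
    have h2 := hzero s hs' x
    rw [mul_ap] at h2
    have h3 := (mul_eq_zero.1 h2).resolve_left hηp.ne'
    simp only [hE, add_ap, pow_ap, smul_ap] at h3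
    have h4 : 0 ≤ c ^ 2 * (D 1 u s x ^ 2 + D 2 u s x ^ 2) := by positivity
    have h5 : D 0 u s x ^ 2 = 0 := le_antisymm (by linarith) (sq_nonneg _)
    exact pow_eq_zero_iff two_ne_zero |>.1 h5
  have hdiff : Differentiable ℝ fun s => u s x :=
    (u.smooth.comp (contDiff_prodMk_left x)).differentiable (by simp)
  have hconst := constant_of_derivWithin_zero (f := fun s => u s x) (a := 0) (b := t)
    hdiff.differentiableOn (fun s hs => by
      rcases (hs.1.trans hs.2.le).eq_or_lt with h | h
      · exact absurd h (by have := hs.1; have := hs.2; intro h; linarith)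
      · rw [(hdiff s).derivWithin (uniqueDiffOn_Icc h s (Ico_subset_Icc_self hs))]
        exact hseg s (Ico_subset_Icc_self hs)) t (right_mem_Icc.2 ht.1)
  have hx1 : 1 < ‖x‖ := by
    have hx' : c * t + 1 < ‖x‖ := hx
    have := mul_nonneg hc.le ht.1
    linarith
  rw [show u t x = u 0 x from hconst, h0 x hx1]

/-! ### The equations for the divergence and the curl -/

theorem lap_vec (a b : Fld) : lap (vec a b) = vec (Lap a) (Lap b) := by
  funext t x
  rw [lap, Fin.sum_univ_two, dx_zero_vec, dx_one_vec, dx_zero_vec, dx_one_vec]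
  ext i; fin_cases i <;> rfl

/-- The factor `G` in the factorization `n = (∇^⊥ · U) G` of the nonlinearity. -/
def nonlinFactor (g : Fin 3 → ℝ) (h : Fin 4 → ℝ) (v w : Fld) : Fld :=
  g 1 • v + h 1 • (v * v) + (h 2 • (v * w) + h 3 • (w * w))

theorem nonlin_vec {g : Fin 3 → ℝ} {h : Fin 4 → ℝ} (hg0 : g 0 = 0) (hg2 : g 2 = 0) (hh0 : h 0 = 0)
    (a b : Fld) : nonlin g h (vec a b) =
      ((D 2 a - D 1 b) * nonlinFactor g h (D 1 a + D 2 b) (D 2 a - D 1 b)).val := by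
  funext t x
  simp only [nonlin, div_vec, curl_vec, hg0, hg2, hh0, nonlinFactor, mul_ap, add_ap, smul_ap]
  ring

/-- What the argument uses of a solution: its divergence `v` and its curl `w`. -/
structure Reduced (c₁ c₂ : ℝ) (g : Fin 3 → ℝ) (h : Fin 4 → ℝ) (T : ℝ) (a b v w : Fld) : Prop where
  testa : Test a
  testb : Test b
  v_eq : D 1 a + D 2 b = v
  w_eq : D 2 a - D 1 b = w
  eqv : Van T univ (Box c₁ v - Lap (w * nonlinFactor g h v w))
  eqw : Van T univ (Box c₂ w - Lap 0)
  suppv : Van T (outer c₁) v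
  suppw : Van T (outer c₂) w

theorem IsSolution.reduced {c₁ c₂ T : ℝ} {g : Fin 3 → ℝ} {h : Fin 4 → ℝ} {U : VField}
    (hU : IsSolution c₁ c₂ g h T U) (hc₂ : 0 < c₂) (hc : c₂ < c₁) (hT : 0 < T) (hg0 : g 0 = 0)
    (hg2 : g 2 = 0) (hh0 : h 0 = 0) : ∃ a b v w, U = vec a b ∧ Reduced c₁ c₂ g h T a b v w := by
  obtain ⟨a, b, ha, hb, rfl⟩ : ∃ a b, Test a ∧ Test b ∧ U = vec a b := by
    obtain ⟨a, b, h⟩ := exists_vec hU.smooth hU.compact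
    grind
  obtain ⟨v, hv⟩ : ∃ v, v = D 1 a + D 2 b := ⟨_, rfl⟩
  obtain ⟨w, hw⟩ : ∃ w, w = D 2 a - D 1 b := ⟨_, rfl⟩
  set N := w * nonlinFactor g h v w with hN
  have hnl : nonlin g h (vec a b) = N.val := by rw [nonlin_vec hg0 hg2 hh0, ← hv, ← hw]
  have heq := hU.eqn
  have hdiv : div (vec a b) = v.val := by rw [div_vec, hv]
  have ea : Van T univ (D 0 (D 0 a) - c₂ ^ 2 • Lap a - (c₁ ^ 2 - c₂ ^ 2) • D 1 v - D 1 N) :=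
    fun t ht x _ => by
      have := congrArg (fun p : Plane => p 0) (heq t ht x)
      rw [dt_vec, dt_vec, lap_vec, hdiv, hnl, grad_val, grad_val] at this
      simp only [vec, PiLp.sub_apply, PiLp.smul_apply, smul_eq_mul] at this
      simp only [sub_ap, smul_ap]
      simp at this
      linarith
  have eb : Van T univ (D 0 (D 0 b) - c₂ ^ 2 • Lap b - (c₁ ^ 2 - c₂ ^ 2) • D 2 v - D 2 N) :=
    fun t ht x _ => by
      have := congrArg (fun p : Plane => p 1) (heq t ht x)
      rw [dt_vec, dt_vec, lap_vec, hdiv, hnl, grad_val, grad_val] at this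
      simp only [vec, PiLp.sub_apply, PiLp.smul_apply, smul_eq_mul] at this
      simp only [sub_ap, smul_ap]
      simp at this
      linarith
  have eqv : Van T univ (Box c₁ v - Lap N) := by
    have := (ea.D hT isOpen_univ 1).add (eb.D hT isOpen_univ 2)
    convert this using 1
    rw [hv]
    simp only [Box_def, Lap_def, map_sub, map_add, Derivation.map_smul, D_comm_10, D_comm_20,
      D_comm_21]
    simp only [Algebra.smul_def, map_sub]
    ring
  have eqw : Van T univ (Box c₂ w - Lap 0) := by
    have := (ea.D hT isOpen_univ 2).sub (eb.D hT isOpen_univ 1)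
    convert this using 1
    rw [hw, map_zero]
    simp only [Box_def, Lap_def, map_sub, map_add, Derivation.map_smul, D_comm_10, D_comm_20,
      D_comm_21]
    simp only [Algebra.smul_def, map_sub]
    ring
  have out : ∀ x : Plane, 1 < ‖x‖ → x ∉ Metric.ball (0 : Plane) 1 := fun x hx h => by
    rw [mem_ball_zero_iff] at h; linarith
  have i0 : ∀ x : Plane, 1 < ‖x‖ → a 0 x = 0 ∧ b 0 x = 0 := fun x hx => by
    have h1 : vec a b 0 x = 0 := image_eq_zero_of_notMem_tsupport
      fun h => out x hx (hU.data_zero h)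
    exact ⟨congrArg (fun p : Plane => p 0) h1, congrArg (fun p : Plane => p 1) h1⟩
  have i1 : ∀ x : Plane, 1 < ‖x‖ → D 0 a 0 x = 0 ∧ D 0 b 0 x = 0 := fun x hx => by
    have h1 : dt (vec a b) 0 x = 0 := image_eq_zero_of_notMem_tsupport
      fun h => out x hx (hU.data_one h)
    rw [dt_vec] at h1
    exact ⟨congrArg (fun p : Plane => p 0) h1, congrArg (fun p : Plane => p 1) h1⟩
  have hD : ∀ u : Fld, (∀ x : Plane, 1 < ‖x‖ → u 0 x = 0) → ∀ (i : Fin 2) (x : Plane), 1 < ‖x‖ →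
      D i.succ u 0 x = 0 := fun u hu i x hx => by
    refine D_eq_zero_of_eventually ?_ i
    filter_upwards [(isOpen_lt continuous_const continuous_norm).mem_nhds hx] with z hz
    exact hu z hz
  have suppw : Van T (outer c₂) w := by
    refine finite_speed (by rw [hw]; exact (ha.D 2).sub (hb.D 1)) hc₂ ?_ (fun x hx => ?_)
      fun x hx => ?_
    · rw [map_zero, sub_zero] at eqw
      exact eqw.mono (subset_univ _)
    · have a1 : D 2 a 0 x = 0 := hD a (fun x hx => (i0 x hx).1) 1 x hx
      have a2 : D 1 b 0 x = 0 := hD b (fun x hx => (i0 x hx).2) 0 x hx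
      rw [hw, sub_ap, a1, a2, sub_zero]
    · have a1 : D 2 (D 0 a) 0 x = 0 := hD _ (fun x hx => (i1 x hx).1) 1 x hx
      have a2 : D 1 (D 0 b) 0 x = 0 := hD _ (fun x hx => (i1 x hx).2) 0 x hx
      rw [hw, map_sub, ← D_comm_20, ← D_comm_10, sub_ap, a1, a2, sub_zero]
  have suppv : Van T (outer c₁) v := by
    refine finite_speed (by rw [hv]; exact (ha.D 1).add (hb.D 2)) (hc₂.trans hc) ?_ (fun x hx => ?_)
      fun x hx => ?_
    · have h1 : Van T (outer c₁) N := by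
        intro t ht x hx
        have : (t, x) ∈ outer c₂ := by
          have hx' : c₁ * t + 1 < ‖x‖ := hx
          have := mul_le_mul_of_nonneg_right hc.le ht.1
          exact show c₂ * t + 1 < ‖x‖ by linarith
        rw [hN, mul_ap, suppw t ht x this, zero_mul]
      have h2 := (eqv.mono (subset_univ _)).add (h1.Lap hT (isOpen_outer c₁))
      rwa [sub_add_cancel] at h2
    · have a1 : D 1 a 0 x = 0 := hD a (fun x hx => (i0 x hx).1) 0 x hx
      have a2 : D 2 b 0 x = 0 := hD b (fun x hx => (i0 x hx).2) 1 x hx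
      rw [hv, add_ap, a1, a2, add_zero]
    · have a1 : D 1 (D 0 a) 0 x = 0 := hD _ (fun x hx => (i1 x hx).1) 0 x hx
      have a2 : D 2 (D 0 b) 0 x = 0 := hD _ (fun x hx => (i1 x hx).2) 1 x hx
      rw [hv, map_add, ← D_comm_20, ← D_comm_10, add_ap, a1, a2, add_zero]
  exact ⟨a, b, v, w, rfl, ha, hb, hv.symm, hw.symm, eqv, eqw, suppv, suppw⟩

/-! ### Comparison of the energies -/

theorem Test.symDec {u : Fld} (hu : Test u) (t : ℝ) (k : ℤ) : SymDec t k u :=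
  ⟨hu.dec t k, fun _ => (hu.D _).dec t _⟩

/-- The Helmholtz projections are bounded on `L²`. -/
theorem I_dot_Pot_div_le {p q : Fld} (hp : Test p) (hq : Test q) (t : ℝ) :
    I t (dot (Pot (D 1 p + D 2 q)) (Pot (D 1 p + D 2 q))) ≤ I t (p ^ 2 + q ^ 2) := by
  have hf : IsDiv (D 1 p + D 2 q) := ⟨p, q, hp, hq, rfl⟩
  have hL : Lap (Pot (D 1 p + D 2 q)) = -(D 1 p + D 2 q) := Lap_Pot hf.test
  have s0 := symDec_Pot hf t
  have s1 := symDec_D_Pot hf t (a := 1) (by decide)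
  have s2 := symDec_D_Pot hf t (a := 2) (by decide)
  set ψ := Pot (D 1 p + D 2 q)
  have t1 : Test (ψ * p) := hp.mul_left _
  have t2 : Test (ψ * q) := hq.mul_left _
  obtain ⟨e, iB⟩ := I_eq_of_div (B := -(D 1 ψ * p + D 2 ψ * q)) (Dec.dot_itg s0 s0)
    ((s0.mul s1 rfl).add (t1.symDec t 3)) ((s0.mul s2 rfl).add (t2.symDec t 3)) (by
      simp only [map_add, D_mul, dot]
      rw [Lap_def] at hL
      linear_combination (-ψ) * hL)
  have iT : Itg t (p ^ 2 + q ^ 2) := (hp.sq.add hq.sq).itg t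
  have h : I t (-(D 1 ψ * p + D 2 ψ * q)) ≤ 1/2 * I t (dot ψ ψ) + 1/2 * I t (p ^ 2 + q ^ 2) := by
    rw [← I_smul, ← I_smul, ← I_add ((Dec.dot_itg s0 s0).smul _) (iT.smul _)]
    refine I_mono iB (((Dec.dot_itg s0 s0).smul _).add (iT.smul _)) fun x => ?_
    simp only [dot, add_ap, smul_ap, neg_ap, mul_ap, pow_ap]
    nlinarith [sq_nonneg (D 1 ψ t x + p t x), sq_nonneg (D 2 ψ t x + q t x)]
  linarith

/-- The energy of the potential field of `f`, in terms of `f`: the integral of the squared Hessian of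
`Pot f` is that of `f ^ 2`. -/
theorem En_eq {f : Fld} (hf : IsDiv f) (t : ℝ) :
    En t f = I t (dot (Pot (D 0 f)) (Pot (D 0 f))) + I t (f ^ 2) := by
  have s := symDec_Pot (hf.D 0) t
  rw [← I_hess_Pot hf, ← I_add (Dec.dot_itg s s) (Dec.hess_itg hf t), En]
  congr 1
  simp only [enF, allSq, dot, hess, Pot_D hf.test, D_comm_10, D_comm_20, D_comm_21]
  ring

/-- The density of the energy of the field `(a, b)`. -/
def energyDensity (c₁ c₂ : ℝ) (a b : Fld) : Fld :=
  D 0 a ^ 2 + D 0 b ^ 2 + (c₂ ^ 2) • (D 1 a ^ 2 + D 1 b ^ 2 + (D 2 a ^ 2 + D 2 b ^ 2))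
    + (c₁ ^ 2 - c₂ ^ 2) • (D 1 a + D 2 b) ^ 2

theorem En_le_energyDensity {c₁ c₂ : ℝ} (hc₂ : 0 < c₂) (hc : c₂ < c₁) {a b f p q : Fld}
    (ha : Test a) (hb : Test b) (hp : Test p) (hq : Test q) (hf : f = D 1 p + D 2 q)
    (hpq : ∀ i : Fin 3, ∀ t x, D i p t x ^ 2 + D i q t x ^ 2 = D i a t x ^ 2 + D i b t x ^ 2)
    (t : ℝ) : En t f ≤ (1 + 2 / c₂ ^ 2) * I t (energyDensity c₁ c₂ a b) := by
  have hfd : IsDiv f := ⟨p, q, hp, hq, hf⟩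
  have h0 : D 0 f = D 1 (D 0 p) + D 2 (D 0 q) := by rw [hf, map_add, D_comm_10, D_comm_20]
  have h1 := I_dot_Pot_div_le (hp.D 0) (hq.D 0) t
  rw [← h0] at h1
  have hi : Itg t (D 0 p ^ 2 + D 0 q ^ 2) := ((hp.D 0).sq.add (hq.D 0).sq).itg t
  have hfi : Itg t (f ^ 2) := hfd.test.sq.itg t
  have hE : Itg t (energyDensity c₁ c₂ a b) :=
    ((((ha.D 0).sq.add (hb.D 0).sq).add (((((ha.D 1).sq).add (hb.D 1).sq).add
      (((ha.D 2).sq).add (hb.D 2).sq)).smul _)).add ((((ha.D 1).add (hb.D 2)).sq).smul _)).itg t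
  rw [En_eq hfd]
  have h2 : I t (D 0 p ^ 2 + D 0 q ^ 2) + I t (f ^ 2) ≤
      (1 + 2 / c₂ ^ 2) * I t (energyDensity c₁ c₂ a b) := by
    rw [← I_add hi hfi, ← I_smul]
    refine I_mono (hi.add hfi) (hE.smul _) fun x => ?_
    have e0 := hpq 0 t x
    have e1 := hpq 1 t x
    have e2 := hpq 2 t x
    have hff : f t x ^ 2 ≤ 2 * (D 1 a t x ^ 2 + D 1 b t x ^ 2 + (D 2 a t x ^ 2 + D 2 b t x ^ 2)) := by
      rw [hf, add_ap]
      have := add_sq_le (a := D 1 p t x) (b := D 2 q t x)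
      nlinarith [sq_nonneg (D 1 q t x), sq_nonneg (D 2 p t x)]
    simp only [add_ap, smul_ap, pow_ap, energyDensity]
    rw [e0]
    set A := D 0 a t x ^ 2 + D 0 b t x ^ 2
    set G := D 1 a t x ^ 2 + D 1 b t x ^ 2 + (D 2 a t x ^ 2 + D 2 b t x ^ 2)
    set d := (D 1 a t x + D 2 b t x) ^ 2
    have hA : 0 ≤ A := by positivity
    have hG : 0 ≤ G := by positivity
    have hd : 0 ≤ (c₁ ^ 2 - c₂ ^ 2) * d := mul_nonneg (by nlinarith) (sq_nonneg _)
    have e : (1 + 2 / c₂ ^ 2) * (A + c₂ ^ 2 * G + (c₁ ^ 2 - c₂ ^ 2) * d) =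
        A + 2 * G + (c₂ ^ 2 * G + (c₁ ^ 2 - c₂ ^ 2) * d + 2 / c₂ ^ 2 * (A + (c₁ ^ 2 - c₂ ^ 2) * d)) := by
      field_simp; ring
    rw [e]
    have : 0 ≤ c₂ ^ 2 * G + (c₁ ^ 2 - c₂ ^ 2) * d + 2 / c₂ ^ 2 * (A + (c₁ ^ 2 - c₂ ^ 2) * d) := by
      positivity
    linarith
  linarith

/-- `∑_{|β| ≤ k} En(Z^β f)`. -/
def EN (k : ℕ) (t : ℝ) (f : Fld) : ℝ := ∑ β ∈ multiIndices k, En t (Z β f)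

/-- `∑_{|β| ≤ k} XX(Z^β f)`. -/
def XN (c : ℝ) (k : ℕ) (t : ℝ) (f : Fld) : ℝ := ∑ β ∈ multiIndices k, XX c t (Z β f)

theorem EN_nonneg (k : ℕ) (t : ℝ) (f : Fld) : 0 ≤ EN k t f := Finset.sum_nonneg fun _ _ => En_nonneg _ _

theorem XN_nonneg (c : ℝ) (k : ℕ) (t : ℝ) (f : Fld) : 0 ≤ XN c k t f :=
  Finset.sum_nonneg fun _ _ => XX_nonneg _ _ _

theorem EN_mono {k l : ℕ} (h : k ≤ l) (t : ℝ) (f : Fld) : EN k t f ≤ EN l t f :=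
  Finset.sum_le_sum_of_subset_of_nonneg (multiIndices_mono h) fun _ _ _ => En_nonneg _ _

theorem XN_mono {k l : ℕ} (h : k ≤ l) (c t : ℝ) (f : Fld) : XN c k t f ≤ XN c l t f :=
  Finset.sum_le_sum_of_subset_of_nonneg (multiIndices_mono h) fun _ _ _ => XX_nonneg _ _ _

theorem EN_add_EN_le_energy {c₁ c₂ : ℝ} (hc₂ : 0 < c₂) (hc : c₂ < c₁) {a b : Fld}
    (ha : Test a) (hb : Test b) (κ : ℕ) (t : ℝ) :
    EN (κ - 1) t (D 1 a + D 2 b) + EN (κ - 1) t (D 2 a - D 1 b) ≤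
      4 * (1 + 2 / c₂ ^ 2) * energy c₁ c₂ κ (vec a b) t := by
  rw [EN, EN, ← Finset.sum_add_distrib, energy]
  have e : 4 * (1 + 2 / c₂ ^ 2) * (1 / 2 * ∑ α ∈ multiIndices (κ - 1), ∫ x : Plane,
      (‖dt (Gam α (vec a b)) t x‖ ^ 2 + c₂ ^ 2 * ∑ i, ‖dx i (Gam α (vec a b)) t x‖ ^ 2
      + (c₁ ^ 2 - c₂ ^ 2) * (div (Gam α (vec a b)) t x) ^ 2)) =
      ∑ α ∈ multiIndices (κ - 1), 2 * (1 + 2 / c₂ ^ 2) * ∫ x : Plane,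
      (‖dt (Gam α (vec a b)) t x‖ ^ 2 + c₂ ^ 2 * ∑ i, ‖dx i (Gam α (vec a b)) t x‖ ^ 2
      + (c₁ ^ 2 - c₂ ^ 2) * (div (Gam α (vec a b)) t x) ^ 2) := by
    rw [← Finset.mul_sum]; ring
  rw [e]
  refine Finset.sum_le_sum fun α _ => ?_
  obtain ⟨a', b', ha', hb', e1, e2, e3⟩ := Gam_vec α ha hb
  rw [e1, ← e2, ← e3]
  have e4 : (∫ x : Plane, (‖dt (vec a' b') t x‖ ^ 2 + c₂ ^ 2 * ∑ i, ‖dx i (vec a' b') t x‖ ^ 2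
      + (c₁ ^ 2 - c₂ ^ 2) * (div (vec a' b') t x) ^ 2)) = I t (energyDensity c₁ c₂ a' b') := by
    refine integral_congr_ae (ae_of_all _ fun x => ?_)
    simp only [dt_vec, dx_zero_vec, dx_one_vec, div_vec, Fin.sum_univ_two, norm_vec_sq,
      energyDensity, add_ap, smul_ap, pow_ap]
  rw [e4]
  have h1 := En_le_energyDensity (f := D 1 a' + D 2 b') hc₂ hc ha' hb' ha' hb' rfl
    (fun i t x => rfl) t
  have h2 := En_le_energyDensity (f := D 2 a' - D 1 b') hc₂ hc ha' hb' hb'.neg ha'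
    (by rw [map_neg]; ring) (fun i t x => by rw [map_neg, neg_ap]; ring) t
  linarith

theorem EN_le_energyDf {c₂ : ℝ} (hc₂ : 0 < c₂) {w : Fld} (hw : IsDiv w) (κ : ℕ) (t : ℝ) :
    EN (κ - 1) t w ≤ 2 * (1 + 1 / c₂ ^ 2) * energyDf c₂ κ (dfOf w) t := by
  rw [EN, energyDf, ← mul_assoc, Finset.mul_sum]
  refine Finset.sum_le_sum fun α _ => ?_
  have hf := Z_isDiv α hw
  rw [Gam_dfOf α hw]
  set f := Z α w
  have s := symDec_Pot (hf.D 0) t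
  have hfi : Itg t (f ^ 2) := hf.test.sq.itg t
  have e4 : (∫ x : Plane, (‖dt (dfOf f) t x‖ ^ 2 + c₂ ^ 2 * (curl (dfOf f) t x) ^ 2)) =
      I t (dot (Pot (D 0 f)) (Pot (D 0 f))) + c₂ ^ 2 * I t (f ^ 2) := by
    rw [← I_smul, ← I_add (Dec.dot_itg s s) (hfi.smul _)]
    refine integral_congr_ae (ae_of_all _ fun x => ?_)
    have hL : -D 2 (D 2 (Pot f)) - D 1 (D 1 (Pot f)) = f := by
      have := Lap_Pot hf.test
      rw [Lap_def] at this
      linear_combination -this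
    simp only [dfOf, dt_vec, curl_vec, norm_vec_sq, map_neg]
    simp only [hL, add_ap, smul_ap, pow_ap, dot, mul_ap,
      Pot_D hf.test, map_neg, neg_ap, D_comm_10, D_comm_20]
    ring
  rw [e4, En_eq hf]
  have n1 := I_nonneg (dot_self_nonneg (Pot (D 0 f)) t)
  have n2 : 0 ≤ I t (f ^ 2) := I_nonneg fun x => by rw [pow_ap]; positivity
  have e : 2 * (1 + 1 / c₂ ^ 2) * (1 / 2) * (I t (dot (Pot (D 0 f)) (Pot (D 0 f))) + c₂ ^ 2 * I t (f ^ 2))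
      = I t (dot (Pot (D 0 f)) (Pot (D 0 f))) + I t (f ^ 2) + (1 / c₂ ^ 2 *
        I t (dot (Pot (D 0 f)) (Pot (D 0 f))) + c₂ ^ 2 * I t (f ^ 2)) := by
    field_simp; ring
  rw [e]
  have : 0 ≤ 1 / c₂ ^ 2 * I t (dot (Pot (D 0 f)) (Pot (D 0 f))) + c₂ ^ 2 * I t (f ^ 2) := by positivity
  linarith

/-! ### Comparison of the weighted norms -/

/-- The square of a single term of `chiPart`. -/
def YY (c t : ℝ) (f : Fld) : ℝ := ∫ x : Plane, bracket (c * t - ‖x‖) ^ 2 * thirdSq f t x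

theorem bracket_sq (s : ℝ) : bracket s ^ 2 = 1 + s ^ 2 := Real.sq_sqrt (by positivity)

theorem YY_nonneg (c t : ℝ) (f : Fld) : 0 ≤ YY c t f :=
  integral_nonneg fun x => mul_nonneg (sq_nonneg _) (thirdSq_nonneg f t x)

theorem YY_integrable {f : Fld} (hf : IsDiv f) (c t : ℝ) :
    Integrable fun x : Plane => bracket (c * t - ‖x‖) ^ 2 * thirdSq f t x := by
  refine ((itg_wt_thirdSq hf c t).const_mul 3).mono' ?_ (ae_of_all _ fun x => ?_)
  · refine (Continuous.mul ?_ ((thirdSq f).continuous t)).aestronglyMeasurable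
    simp only [bracket_sq]
    fun_prop
  · rw [Real.norm_eq_abs, abs_of_nonneg (mul_nonneg (sq_nonneg _) (thirdSq_nonneg f t x)),
      bracket_sq, mul_ap, ← mul_assoc]
    exact mul_le_mul_of_nonneg_right (le_wt c t x) (thirdSq_nonneg f t x)

theorem YY_le {f : Fld} (hf : IsDiv f) (c t : ℝ) : YY c t f ≤ 3 * XX c t f := by
  rw [YY, XX, I, ← integral_const_mul]
  refine integral_mono (YY_integrable hf c t) ((itg_wt_thirdSq hf c t).const_mul 3) fun x => ?_
  simp only [bracket_sq, mul_ap]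
  rw [← mul_assoc]
  exact mul_le_mul_of_nonneg_right (le_wt c t x) (thirdSq_nonneg f t x)

theorem XX_le {f : Fld} (hf : IsDiv f) (c t : ℝ) : XX c t f ≤ 3 * YY c t f := by
  rw [YY, XX, I, ← integral_const_mul]
  refine integral_mono (itg_wt_thirdSq hf c t) ((YY_integrable hf c t).const_mul 3) fun x => ?_
  simp only [bracket_sq, mul_ap]
  rw [← mul_assoc]
  refine mul_le_mul_of_nonneg_right ?_ (thirdSq_nonneg f t x)
  nlinarith [wt_le c t x, sq_nonneg (c * t - ‖x‖)]

theorem sum_d_dx_cfOf (f : Fld) (t : ℝ) (x : Plane) :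
    ∑ a, ∑ i, ‖d a (dx i (cfOf f)) t x‖ ^ 2 = thirdSq f t x := by
  simp only [Fin.sum_univ_three, Fin.sum_univ_two, cfOf, dx_zero_vec, dx_one_vec, d_vec,
    norm_vec_sq, thirdSq, allSq, add_ap, pow_ap, map_neg, neg_ap, neg_sq]
  ring

theorem sum_d_dx_dfOf (f : Fld) (t : ℝ) (x : Plane) :
    ∑ a, ∑ i, ‖d a (dx i (dfOf f)) t x‖ ^ 2 = thirdSq f t x := by
  simp only [Fin.sum_univ_three, Fin.sum_univ_two, dfOf, dx_zero_vec, dx_one_vec, d_vec,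
    norm_vec_sq, thirdSq, allSq, add_ap, pow_ap, map_neg, neg_ap, neg_sq]
  ring

theorem chiPart_cfOf {v : Fld} (hv : IsDiv v) (c : ℝ) (κ : ℕ) (t : ℝ) :
    chiPart c κ (cfOf v) t = ∑ α ∈ multiIndices (κ - 2), √(YY c t (Z α v)) := by
  refine Finset.sum_congr rfl fun α _ => ?_
  simp only [Gam_cfOf α hv, sum_d_dx_cfOf, YY]

theorem chiPart_dfOf {v : Fld} (hv : IsDiv v) (c : ℝ) (κ : ℕ) (t : ℝ) :
    chiPart c κ (dfOf v) t = ∑ α ∈ multiIndices (κ - 2), √(YY c t (Z α v)) := by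
  refine Finset.sum_congr rfl fun α _ => ?_
  simp only [Gam_dfOf α hv, sum_d_dx_dfOf, YY]

theorem sum_sqrt_sq_le {ι : Type} (s : Finset ι) (y : ι → ℝ) (hy : ∀ i, 0 ≤ y i) :
    (∑ i ∈ s, √(y i)) ^ 2 ≤ s.card * ∑ i ∈ s, y i := by
  have := sq_sum_le_card_mul_sum_sq (s := s) (f := fun i => √(y i))
  simpa only [Real.sq_sqrt (hy _)] using this

theorem sum_le_sum_sqrt_sq {ι : Type} (s : Finset ι) (y : ι → ℝ) (hy : ∀ i, 0 ≤ y i) :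
    ∑ i ∈ s, y i ≤ (∑ i ∈ s, √(y i)) ^ 2 := by
  have := Finset.sum_sq_le_sq_sum_of_nonneg (s := s) (f := fun i => √(y i))
    (fun i _ => Real.sqrt_nonneg _)
  simpa only [Real.sq_sqrt (hy _)] using this

theorem XN_le_sq {v : Fld} (hv : IsDiv v) (c : ℝ) (k : ℕ) (t : ℝ) :
    XN c k t v ≤ 3 * (∑ α ∈ multiIndices k, √(YY c t (Z α v))) ^ 2 := by
  refine le_trans ?_ (mul_le_mul_of_nonneg_left
    (sum_le_sum_sqrt_sq (multiIndices k) (fun α => YY c t (Z α v)) fun α => YY_nonneg _ _ _)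
    (by norm_num))
  rw [XN, Finset.mul_sum]
  exact Finset.sum_le_sum fun α _ => XX_le (Z_isDiv α hv) c t

theorem sq_le_XN {v : Fld} (hv : IsDiv v) (c : ℝ) (k : ℕ) (t : ℝ) :
    (∑ α ∈ multiIndices k, √(YY c t (Z α v))) ^ 2 ≤ 3 * (multiIndices k).card * XN c k t v := by
  refine (sum_sqrt_sq_le (multiIndices k) (fun α => YY c t (Z α v)) fun α => YY_nonneg _ _ _).trans ?_
  rw [mul_comm (3:ℝ), mul_assoc]
  refine mul_le_mul_of_nonneg_left ?_ (Nat.cast_nonneg _)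
  rw [XN, Finset.mul_sum]
  exact Finset.sum_le_sum fun α _ => YY_le (Z_isDiv α hv) c t

/-! ### Lower bounds for the Morawetz energies -/

/-- The lower bound for the density of the Morawetz energy at time `t`. -/
def MD (c t : ℝ) (f : Fld) : Fld := (c ^ 2 / 2) • f ^ 2
  + (3 * c / (8 * (c * t + 1))) • ((algebraMap ℝ Fld ((c * t + 1) ^ 2) - Rsq) * f ^ 2)

theorem MD_ap (c t : ℝ) (f : Fld) (x : Plane) : MD c t f t x = (c ^ 2 / 2
    + 3 * c / (8 * (c * t + 1)) * ((c * t + 1) ^ 2 - ‖x‖ ^ 2)) * f t x ^ 2 := by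
  simp only [MD, add_ap, smul_ap, mul_ap, sub_ap, pow_ap, algebraMap_ap, Rsq_ap]; ring

theorem itg_MD {f : Fld} (hf : Test f) (c t : ℝ) : Itg t (MD c t f) :=
  (((hf.sq).smul _).add ((hf.sq.mul_left _).smul _)).itg t

theorem I_MD_le_morawetz {c t T : ℝ} (hc : 0 < c) {f : Fld} (hf : IsDiv f) (h : Van T (outer c) f)
    (ht : t ∈ Icc 0 T) : I t (MD c t f) ≤ morawetz c (cfOf f) t := by
  have h1 := morawetz_lower hf hc ht.1 fun x hx => h t ht x hx
  rw [MD, I_add ((hf.test.sq.itg t).smul _) (((hf.test.sq.mul_left _).itg t).smul _), I_smul, I_smul]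
  have n1 := I_nonneg (dot_self_nonneg (Pot (D 0 f)) t)
  linarith

theorem weight_ge {c t r : ℝ} (hc : 0 < c) (ht : 0 ≤ t) (hr : 0 ≤ r) (h : r ≤ c * t + 1) :
    3 * c / 8 * (c * t + 1 - r) ≤ 3 * c / (8 * (c * t + 1)) * ((c * t + 1) ^ 2 - r ^ 2) := by
  have hR : 0 < c * t + 1 := by positivity
  have e : 3 * c / (8 * (c * t + 1)) * ((c * t + 1) ^ 2 - r ^ 2) =
      3 * c / 8 * (c * t + 1 - r) + 3 * c / 8 * (c * t + 1 - r) * (r / (c * t + 1)) := by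
    field_simp; ring
  rw [e]
  have h1 : 0 ≤ c * t + 1 - r := by linarith
  have : 0 ≤ 3 * c / 8 * (c * t + 1 - r) * (r / (c * t + 1)) := by positivity
  linarith

theorem MD_nonneg {c t T : ℝ} (hc : 0 < c) {f : Fld} (h : Van T (outer c) f)
    (ht : t ∈ Icc 0 T) (x : Plane) : 0 ≤ MD c t f t x := by
  rw [MD_ap]
  by_cases hx : c * t + 1 < ‖x‖
  · rw [h t ht x hx]; simp
  · have := weight_ge hc ht.1 (norm_nonneg x) (not_lt.1 hx)
    refine mul_nonneg (add_nonneg (by positivity) (le_trans ?_ this)) (sq_nonneg _)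
    exact mul_nonneg (by positivity) (by linarith)

theorem morawetz_nonneg {c t T : ℝ} (hc : 0 < c) {f : Fld} (hf : IsDiv f) (h : Van T (outer c) f)
    (ht : t ∈ Icc 0 T) : 0 ≤ morawetz c (cfOf f) t :=
  (I_nonneg (MD_nonneg hc h ht)).trans (I_MD_le_morawetz hc hf h ht)

/-- Inside the slower cone the fast Morawetz energy controls `f²` with the weight `1 + t`. -/
theorem fast_le_MD {c₁ c₂ : ℝ} (hc₂ : 0 < c₂) (hc : c₂ < c₁) : ∃ C > 0, ∀ (t : ℝ) (f : Fld)
    (x : Plane), 0 ≤ t → ‖x‖ ≤ c₂ * t + 1 → (1 + t) * f t x ^ 2 ≤ C * MD c₁ t f t x := by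
  have hc₁ := hc₂.trans hc
  have h0 : 0 < c₁ - c₂ := by linarith
  refine ⟨2 / c₁ ^ 2 + 8 / (3 * c₁ * (c₁ - c₂)), by positivity, fun t f x ht hx => ?_⟩
  rw [MD_ap, ← mul_assoc]
  refine mul_le_mul_of_nonneg_right ?_ (sq_nonneg _)
  have hx' : ‖x‖ ≤ c₁ * t + 1 := hx.trans (by nlinarith)
  have h1 := weight_ge hc₁ ht (norm_nonneg x) hx'
  have h2 : 3 * c₁ / 8 * ((c₁ - c₂) * t) ≤ 3 * c₁ / 8 * (c₁ * t + 1 - ‖x‖) :=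
    mul_le_mul_of_nonneg_left (by linarith) (by positivity)
  have h3 : c₁ ^ 2 / 2 + 3 * c₁ / 8 * ((c₁ - c₂) * t) ≤ c₁ ^ 2 / 2
    + 3 * c₁ / (8 * (c₁ * t + 1)) * ((c₁ * t + 1) ^ 2 - ‖x‖ ^ 2) := by linarith
  refine le_trans ?_ (mul_le_mul_of_nonneg_left h3 (by positivity))
  have e : (2 / c₁ ^ 2 + 8 / (3 * c₁ * (c₁ - c₂))) * (c₁ ^ 2 / 2 + 3 * c₁ / 8 * ((c₁ - c₂) * t)) =
      1 + t + (2 / c₁ ^ 2 * (3 * c₁ / 8 * ((c₁ - c₂) * t))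
        + 8 / (3 * c₁ * (c₁ - c₂)) * (c₁ ^ 2 / 2)) := by
    field_simp; ring
  rw [e]
  have : 0 ≤ 2 / c₁ ^ 2 * (3 * c₁ / 8 * ((c₁ - c₂) * t))
        + 8 / (3 * c₁ * (c₁ - c₂)) * (c₁ ^ 2 / 2) := by positivity
  linarith

/-- Inside its cone, the Morawetz energy controls `f²` with the weight `(1 + t) / (1 + r)`. -/
theorem slow_le_MD {c : ℝ} (hc : 0 < c) : ∃ C > 0, ∀ (t : ℝ) (f : Fld)
    (x : Plane), 0 ≤ t → ‖x‖ ≤ c * t + 1 →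
      (1 + t) * f t x ^ 2 ≤ C * ((1 + ‖x‖) * MD c t f t x) := by
  refine ⟨(1 + 1 / c) * (2 / c ^ 2 + 8 / (3 * c)), by positivity, fun t f x ht hx => ?_⟩
  rw [MD_ap, ← mul_assoc, ← mul_assoc]
  refine mul_le_mul_of_nonneg_right ?_ (sq_nonneg _)
  have h1 := weight_ge hc ht (norm_nonneg x) hx
  set r := ‖x‖
  have hr : 0 ≤ r := norm_nonneg x
  set W := c ^ 2 / 2 + 3 * c / (8 * (c * t + 1)) * ((c * t + 1) ^ 2 - r ^ 2)
  have h2 : 1 + (c * t + 1 - r) ≤ (2 / c ^ 2 + 8 / (3 * c)) * W := by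
    have h3 : c ^ 2 / 2 + 3 * c / 8 * (c * t + 1 - r) ≤ W := by
      exact add_le_add le_rfl h1
    refine le_trans ?_ (mul_le_mul_of_nonneg_left h3 (by positivity))
    have h0 : 0 ≤ c * t + 1 - r := by linarith
    have e : (2 / c ^ 2 + 8 / (3 * c)) * (c ^ 2 / 2 + 3 * c / 8 * (c * t + 1 - r)) =
      1 + (c * t + 1 - r) + (2 / c ^ 2 * (3 * c / 8 * (c * t + 1 - r)) + 8 / (3 * c) * (c ^ 2 / 2)) := by
      field_simp; ring
    rw [e]
    have : 0 ≤ 2 / c ^ 2 * (3 * c / 8 * (c * t + 1 - r)) + 8 / (3 * c) * (c ^ 2 / 2) := by positivity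
    linarith
  have h4 : 1 + t ≤ (1 + 1 / c) * ((1 + r) * (1 + (c * t + 1 - r))) := by
    have h5 : 1 + c * t ≤ (1 + r) * (1 + (c * t + 1 - r)) := by nlinarith
    have h6 : 1 + t ≤ (1 + 1 / c) * (1 + c * t) := by
      have : (1 + 1 / c) * (1 + c * t) = 1 + t + (c * t + 1 / c) := by field_simp; ring
      rw [this]
      have : 0 ≤ c * t + 1 / c := by positivity
      linarith
    exact h6.trans (mul_le_mul_of_nonneg_left h5 (by positivity))
  have h7 := mul_le_mul_of_nonneg_left h2 (by positivity : 0 ≤ (1 + 1 / c) * (1 + r))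
  calc 1 + t ≤ _ := h4
    _ = (1 + 1 / c) * (1 + r) * (1 + (c * t + 1 - r)) := by ring
    _ ≤ _ := h7
    _ = _ := by ring

/-- `∑_{|β| ≤ k} MD(Z^β f)`. -/
def MN (c t : ℝ) (k : ℕ) (f : Fld) : Fld := ∑ β ∈ multiIndices k, MD c t (Z β f)

/-- `∑_{|β| ≤ k} ∑_∂ MD(∂Z^β f)`, together with the terms of `MN`. -/
def MDN (c t : ℝ) (k : ℕ) (f : Fld) : Fld :=
  ∑ β ∈ multiIndices k, (MD c t (Z β f) + (MD c t (D 1 (Z β f)) + MD c t (D 2 (Z β f))))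

theorem I_sum {ι : Type} (s : Finset ι) {t : ℝ} {u : ι → Fld} (h : ∀ i ∈ s, Itg t (u i)) :
    I t (∑ i ∈ s, u i) = ∑ i ∈ s, I t (u i) ∧ Itg t (∑ i ∈ s, u i) := by
  induction s using Finset.cons_induction with
  | empty => exact ⟨by simp [I], by rw [Finset.sum_empty]; exact integrable_zero Plane ℝ volume⟩
  | cons a s ha ih =>
    have h1 := ih fun i hi => h i (Finset.mem_cons_of_mem hi)
    have h2 := h a (Finset.mem_cons_self _ _)
    rw [Finset.sum_cons, Finset.sum_cons]
    exact ⟨by rw [I_add h2 h1.2, h1.1], h2.add h1.2⟩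

theorem I_MN_le {c t T : ℝ} (hc : 0 < c) {f : Fld} (hf : IsDiv f) (hT : 0 < T)
    (h : Van T (outer c) f) (ht : t ∈ Icc 0 T) (κ : ℕ) :
    I t (MN c t (κ - 1) f) ≤ morawetzCf c κ (cfOf f) t := by
  rw [MN, (I_sum _ fun β _ => itg_MD (Z_isDiv β hf).test c t).1, morawetzCf]
  refine Finset.sum_le_sum fun α _ => ?_
  rw [Gam_cfOf α hf]
  exact I_MD_le_morawetz hc (Z_isDiv α hf) (h.Z hT (isOpen_outer c) α) ht

theorem d_dfOf {f : Fld} (hf : IsDiv f) (a : Fin 3) : d a (dfOf f) = dfOf (D a f) := by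
  rw [dfOf, dfOf, d_vec]
  refine vec_congr ?_ ?_
  · rw [map_neg, Pot_D hf.test, D_comm]
  · rw [Pot_D hf.test, D_comm]

theorem I_MDN_le {c t T : ℝ} (hc : 0 < c) {f : Fld} (hf : IsDiv f) (hT : 0 < T)
    (h : Van T (outer c) f) (ht : t ∈ Icc 0 T) (κ : ℕ) :
    I t (MDN c t (κ - 2) f) ≤ morawetzDf c κ (dfOf f) t := by
  have iM : ∀ β, Itg t (MD c t (Z β f)) := fun β => itg_MD (Z_isDiv β hf).test c t
  have iD : ∀ a β, Itg t (MD c t (D a (Z β f))) := fun a β => itg_MD ((Z_isDiv β hf).D a).test c t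
  rw [MDN, (I_sum _ fun β _ => (iM β).add ((iD 1 β).add (iD 2 β))).1, morawetzDf]
  refine Finset.sum_le_sum fun α _ => ?_
  have hα := Z_isDiv α hf
  have vα := h.Z hT (isOpen_outer c) α
  have vD := fun a => vα.D hT (isOpen_outer c) a
  rw [Gam_dfOf α hf, I_add (iM α) ((iD 1 α).add (iD 2 α)), I_add (iD 1 α) (iD 2 α)]
  simp only [d_dfOf hα, morawetz_dfOf_eq]
  rw [Fin.sum_univ_three]
  have h0 := I_MD_le_morawetz hc hα vα ht
  have h1 := I_MD_le_morawetz hc (hα.D 1) (vD 1) ht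
  have h2 := I_MD_le_morawetz hc (hα.D 2) (vD 2) ht
  have h3 := morawetz_nonneg hc (hα.D 0) (vD 0) ht
  linarith

/-! ### Commuting the vector fields through the energies -/

/-- A nonnegative quadratic functional of `A f`, where `A` is a combination of the `Z^β` with
`|β| ≤ k`, is bounded by the sum of its values at the `Z^β f`. -/
theorem ZSpan_quad {P : Type} {Q : P → Fld → ℝ} (h0 : ∀ p u, 0 ≤ Q p u)
    (hadd : ∀ p u v, IsDiv u → IsDiv v → Q p (u + v) ≤ 2 * Q p u + 2 * Q p v)
    (hs : ∀ p c u, IsDiv u → Q p (c • u) ≤ c ^ 2 * Q p u) {k : ℕ} {A : Fld → Fld}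
    (hA : A ∈ ZSpan k) : ∃ C : ℝ, 0 ≤ C ∧ ∀ p f, IsDiv f → IsDiv (A f) ∧
      Q p (A f) ≤ C * ∑ β ∈ multiIndices k, Q p (Z β f) := by
  have hz : ∀ p f, IsDiv f → IsDiv (0 : Fld) ∧ Q p 0 ≤ 0 := fun p f hf => by
    have h1 := hf.smul 0
    have h2 := hs p 0 f hf
    rw [zero_smul] at h1 h2
    exact ⟨h1, h2.trans (by simp)⟩
  induction hA using Submodule.span_induction with
  | mem A hA =>
    obtain ⟨β, h, rfl⟩ := hA
    refine ⟨1, zero_le_one, fun p f hf => ⟨Z_isDiv β hf, ?_⟩⟩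
    rw [one_mul]
    exact Finset.single_le_sum (f := fun β => Q p (Z β f)) (fun _ _ => h0 _ _)
      (mem_multiIndices.2 h)
  | zero => exact ⟨0, le_rfl, fun p f hf => ⟨(hz p f hf).1, by simpa using (hz p f hf).2⟩⟩
  | add A B _ _ h1 h2 =>
    obtain ⟨C, hC0, hC⟩ := h1
    obtain ⟨C', hC0', hC'⟩ := h2
    refine ⟨2 * C + 2 * C', by positivity, fun p f hf => ?_⟩
    obtain ⟨a1, a2⟩ := hC p f hf
    obtain ⟨b1, b2⟩ := hC' p f hf
    exact ⟨a1.add b1, (hadd p _ _ a1 b1).trans (by linarith)⟩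
  | smul c A _ h1 =>
    obtain ⟨C, hC0, hC⟩ := h1
    refine ⟨c ^ 2 * C, by positivity, fun p f hf => ?_⟩
    obtain ⟨a1, a2⟩ := hC p f hf
    refine ⟨a1.smul c, (hs p c _ a1).trans ?_⟩
    rw [mul_assoc]
    exact mul_le_mul_of_nonneg_left a2 (sq_nonneg c)

theorem allSq_smul (c : ℝ) (u : Fld) : allSq (c • u) = c ^ 2 • allSq u := by
  simp only [allSq, Derivation.map_smul, smul_pow, smul_add]

theorem enF_add_le {u v : Fld} (hu : Test u) (hv : Test v) (t : ℝ) (x : Plane) :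
    enF (u + v) t x ≤ 2 * enF u t x + 2 * enF v t x := by
  have h1 := allSq_add_le (D 1 (Pot u)) (D 1 (Pot v)) t x
  have h2 := allSq_add_le (D 2 (Pot u)) (D 2 (Pot v)) t x
  simp only [enF, Pot_add hu hv, map_add, add_ap]
  linarith

theorem thirdSq_add_le {u v : Fld} (hu : Test u) (hv : Test v) (t : ℝ) (x : Plane) :
    thirdSq (u + v) t x ≤ 2 * thirdSq u t x + 2 * thirdSq v t x := by
  have h := fun i j => allSq_add_le (D i (D j (Pot u))) (D i (D j (Pot v))) t x
  simp only [thirdSq, Pot_add hu hv, map_add, add_ap]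
  linarith [h 1 1, h 1 2, h 2 1, h 2 2]

theorem enF_smul (c : ℝ) {u : Fld} (hu : Test u) : enF (c • u) = c ^ 2 • enF u := by
  simp only [enF, Pot_smul c hu, Derivation.map_smul, allSq_smul, smul_add]

theorem thirdSq_smul (c : ℝ) {u : Fld} (hu : Test u) : thirdSq (c • u) = c ^ 2 • thirdSq u := by
  simp only [thirdSq, Pot_smul c hu, Derivation.map_smul, allSq_smul, smul_add]

theorem En_add_le {u v : Fld} (hu : IsDiv u) (hv : IsDiv v) (t : ℝ) :
    En t (u + v) ≤ 2 * En t u + 2 * En t v := by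
  simp only [En]
  rw [← I_smul, ← I_smul, ← I_add ((itg_enF hu t).smul 2) ((itg_enF hv t).smul 2)]
  refine I_mono (itg_enF (hu.add hv) t) (((itg_enF hu t).smul 2).add ((itg_enF hv t).smul 2))
    fun x => ?_
  simpa only [add_ap, smul_ap] using enF_add_le hu.test hv.test t x

theorem XX_add_le (c : ℝ) {u v : Fld} (hu : IsDiv u) (hv : IsDiv v) (t : ℝ) :
    XX c t (u + v) ≤ 2 * XX c t u + 2 * XX c t v := by
  have iu := itg_wt_thirdSq hu c t
  have iv := itg_wt_thirdSq hv c t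
  simp only [XX]
  rw [← I_smul, ← I_smul, ← I_add (iu.smul 2) (iv.smul 2)]
  refine I_mono (itg_wt_thirdSq (hu.add hv) c t) ((iu.smul 2).add (iv.smul 2)) fun x => ?_
  simp only [add_ap, smul_ap, mul_ap]
  have h1 := thirdSq_add_le hu.test hv.test t x
  have h2 := mul_le_mul_of_nonneg_left h1 (zero_le_one.trans (one_le_wt c t x))
  linarith

theorem En_span {k : ℕ} {A : Fld → Fld} (hA : A ∈ ZSpan k) : ∃ C : ℝ, 0 ≤ C ∧ ∀ t f, IsDiv f →
    En t (A f) ≤ C * EN k t f := by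
  obtain ⟨C, h0, h⟩ := ZSpan_quad (Q := fun t u => En t u) (fun t u => En_nonneg u t)
    (fun t u v hu hv => En_add_le hu hv t)
    (fun t c u hu => by simp only [En, enF_smul c hu.test, I_smul]; exact le_rfl) hA
  exact ⟨C, h0, fun t f hf => (h t f hf).2⟩

theorem XX_span (c : ℝ) {k : ℕ} {A : Fld → Fld} (hA : A ∈ ZSpan k) : ∃ C : ℝ, 0 ≤ C ∧
    ∀ t f, IsDiv f → XX c t (A f) ≤ C * XN c k t f := by
  obtain ⟨C, h0, h⟩ := ZSpan_quad (Q := fun t u => XX c t u) (fun t u => XX_nonneg c u t)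
    (fun t u v hu hv => XX_add_le c hu hv t)
    (fun t b u hu => by
      simp only [XX, thirdSq_smul b hu.test, mul_smul_comm, I_smul]; exact le_rfl) hA
  exact ⟨C, h0, fun t f hf => (h t f hf).2⟩

/-- The Klainerman-Sideris estimate, summed over the vector fields. -/
theorem XN_le {c : ℝ} (hc : 0 < c) (k : ℕ) : ∃ C : ℝ, 0 ≤ C ∧ ∀ t f, IsDiv f → 0 ≤ t →
    XN c k t f ≤ C * (EN (k + 1) t f + t ^ 2 * ∑ β ∈ multiIndices k,
      I t (dot (Box c (Pot (Z β f))) (Box c (Pot (Z β f))))) := by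
  obtain ⟨K, hK, hks⟩ := klainerman_sideris hc
  have key : ∀ β ∈ multiIndices k, ∃ C : ℝ, 0 ≤ C ∧ ∀ p : {p : ℝ × Fld // IsDiv p.2},
      (En p.1.1 (Z β p.1.2) + En p.1.1 (S (Z β p.1.2)) + En p.1.1 (Om (Z β p.1.2))
        + ∑ a, En p.1.1 (D a (Z β p.1.2))) ≤ C * EN (k + 1) p.1.1 p.1.2 := fun β hβ => by
    have hb : ord β + 1 ≤ k + 1 := by have := mem_multiIndices.1 hβ; omega
    obtain ⟨C0, p0, h0⟩ := En_span (Z_mem (k := k + 1) (β := β) (by omega))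
    obtain ⟨C1, p1, h1⟩ := En_span (ZSpan_mono hb (field_Z_mem .S β))
    obtain ⟨C2, p2, h2⟩ := En_span (ZSpan_mono hb (field_Z_mem .Om β))
    obtain ⟨C3, p3, h3⟩ := En_span (ZSpan_mono hb (field_Z_mem (.D 0) β))
    obtain ⟨C4, p4, h4⟩ := En_span (ZSpan_mono hb (field_Z_mem (.D 1) β))
    obtain ⟨C5, p5, h5⟩ := En_span (ZSpan_mono hb (field_Z_mem (.D 2) β))
    refine ⟨C0 + C1 + C2 + C3 + C4 + C5, by positivity, fun ⟨(t, f), hf⟩ => ?_⟩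
    rw [Fin.sum_univ_three]
    linarith [h0 t f hf, h1 t f hf, h2 t f hf, h3 t f hf, h4 t f hf, h5 t f hf]
  obtain ⟨C, hC0, hC⟩ := exists_bound_sum _ _ _ key
  refine ⟨K * (C + 1), by positivity, fun t f hf ht => ?_⟩
  have h1 : XN c k t f ≤ ∑ β ∈ multiIndices k, K * ((En t (Z β f) + En t (S (Z β f))
      + En t (Om (Z β f)) + ∑ a, En t (D a (Z β f)))
      + t ^ 2 * I t (dot (Box c (Pot (Z β f))) (Box c (Pot (Z β f))))) :=
    Finset.sum_le_sum fun β _ => hks (Z β f) t (Z_isDiv β hf) ht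
  rw [← Finset.mul_sum, Finset.sum_add_distrib, ← Finset.mul_sum] at h1
  refine h1.trans ?_
  rw [mul_assoc]
  refine mul_le_mul_of_nonneg_left ?_ hK.le
  have h2 := hC ⟨(t, f), hf⟩
  have h3 : 0 ≤ t ^ 2 * ∑ β ∈ multiIndices k,
      I t (dot (Box c (Pot (Z β f))) (Box c (Pot (Z β f)))) :=
    mul_nonneg (sq_nonneg t) (Finset.sum_nonneg fun β _ => I_nonneg (dot_self_nonneg _ t))
  have h4 := EN_nonneg (k + 1) t f
  have h5 := mul_nonneg hC0 h3
  dsimp only at h2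
  linarith

/-! ### Weighted Sobolev inequalities -/

theorem wt_pos (c t : ℝ) (x : Plane) : 0 < wt c t x := one_pos.trans_le (one_le_wt c t x)

/-- The square root of the weight `1 + (c t - ⟨x⟩)²`. -/
def sqrtWt (c : ℝ) : Fld := (wt c).sqrt (wt_pos c)

theorem one_le_sqrtWt (c t : ℝ) (x : Plane) : 1 ≤ sqrtWt c t x := Real.one_le_sqrt.2 (one_le_wt c t x)

theorem sqrtWt_sq (c t : ℝ) (x : Plane) : sqrtWt c t x ^ 2 = wt c t x := Real.sq_sqrt (wt_pos c t x).le

theorem abs_coneFld_le (c t : ℝ) (x : Plane) : |coneFld c t x| ≤ sqrtWt c t x := by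
  refine Real.le_sqrt_of_sq_le ?_
  rw [sq_abs]
  simp only [wt, add_ap, one_ap, pow_ap]
  linarith

theorem abs_D_D_coneFld_le (c t : ℝ) (x : Plane) : |D 1 (D 2 (coneFld c)) t x| ≤ 1 := by
  set s := (Rreg 1).sqrt (Rreg_pos one_pos) with hs
  have e : ∀ i : Fin 2, D i.succ (coneFld c) = -D i.succ s := fun i => by
    simp only [coneFld, map_sub, D_mul, D_algebraMap, D_succ_Tm, mul_zero, add_zero, zero_sub, hs]
  have e1 : D 1 (coneFld c) = -D 1 s := e 0
  have e2 : D 2 (coneFld c) = -D 2 s := e 1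
  have h2 := D_sqrt 2 (Rreg 1) (Rreg_pos one_pos)
  rw [D_two_Rreg, ← hs] at h2
  have h3 := congrArg (D 1) h2
  simp only [D_mul, D_ofNat, D_one_X_one, mul_zero, add_zero] at h3
  have h4 := congrArg (fun u : Fld => u t x) h3
  simp only [mul_ap, add_ap, ofNat_ap, zero_ap] at h4
  have b1 := abs_D_coneFld_le c t x 0
  have b2 := abs_D_coneFld_le c t x 1
  rw [e, neg_ap, abs_neg] at b1 b2
  have hs1 : 1 ≤ s t x := by
    rw [hs, sqrt_ap, Rreg_ap]; exact Real.one_le_sqrt.2 (by nlinarith [sq_nonneg ‖x‖])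
  rw [e2, map_neg, neg_ap, abs_neg]
  have h5 : s t x * D 1 (D 2 s) t x = -(D 1 s t x * D 2 s t x) := by
    linarith
  have h6 : s t x * |D 1 (D 2 s) t x| ≤ 1 := by
    have := congrArg abs h5
    rw [abs_mul, abs_neg, abs_mul, abs_of_pos (by linarith : 0 < s t x)] at this
    rw [this]
    exact mul_le_one₀ b1 (abs_nonneg _) b2
  nlinarith [abs_nonneg (D 1 (D 2 s) t x)]

theorem sqrtWt_mul_D (c : ℝ) (a : Fin 3) : sqrtWt c * D a (sqrtWt c) = coneFld c * D a (coneFld c) := by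
  have h := D_sqrt a (wt c) (wt_pos c)
  rw [D_wt] at h
  ext t x
  have := congrArg (fun u : Fld => u t x) h
  simp only [mul_ap, ofNat_ap] at this ⊢
  exact mul_left_cancel₀ two_ne_zero this

theorem abs_D_sqrtWt_le (c t : ℝ) (x : Plane) (i : Fin 2) : |D i.succ (sqrtWt c) t x| ≤ 1 := by
  have h := congrArg (fun u : Fld => |u t x|) (sqrtWt_mul_D c i.succ)
  have hp := zero_lt_one.trans_le (one_le_sqrtWt c t x)
  simp only [mul_ap, abs_mul] at h
  rw [abs_of_pos hp] at h
  refine le_of_mul_le_mul_left ?_ hp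
  rw [h]
  exact mul_le_mul (abs_coneFld_le c t x) (abs_D_coneFld_le c t x i) (abs_nonneg _) hp.le

theorem abs_D_D_sqrtWt_le (c t : ℝ) (x : Plane) : |D 1 (D 2 (sqrtWt c)) t x| ≤ 3 := by
  have h := congrArg (fun u : Fld => u t x) (congrArg (D 1) (sqrtWt_mul_D c 2))
  simp only [D_mul, mul_ap, add_ap] at h
  have hp := one_le_sqrtWt c t x
  have a1 : |D 1 (sqrtWt c) t x| ≤ 1 := abs_D_sqrtWt_le c t x 0
  have a2 : |D 2 (sqrtWt c) t x| ≤ 1 := abs_D_sqrtWt_le c t x 1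
  have a3 : |D 1 (coneFld c) t x| ≤ 1 := abs_D_coneFld_le c t x 0
  have a4 : |D 2 (coneFld c) t x| ≤ 1 := abs_D_coneFld_le c t x 1
  have b1 : |D 2 (sqrtWt c) t x * D 1 (sqrtWt c) t x| ≤ 1 := by
    rw [abs_mul]; exact mul_le_one₀ a2 (abs_nonneg _) a1
  have b2 : |D 2 (coneFld c) t x * D 1 (coneFld c) t x| ≤ 1 := by
    rw [abs_mul]; exact mul_le_one₀ a4 (abs_nonneg _) a3
  have b3 : |coneFld c t x * D 1 (D 2 (coneFld c)) t x| ≤ sqrtWt c t x := by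
    rw [abs_mul, ← mul_one (sqrtWt c t x)]
    exact mul_le_mul (abs_coneFld_le c t x) (abs_D_D_coneFld_le c t x) (abs_nonneg _) (by linarith)
  have h1 : sqrtWt c t x * |D 1 (D 2 (sqrtWt c)) t x| ≤ sqrtWt c t x * 3 := by
    rw [← abs_of_pos (by linarith : 0 < sqrtWt c t x), ← abs_mul,
      abs_of_pos (by linarith : 0 < sqrtWt c t x), abs_le]
    rw [abs_le] at b1 b2 b3
    constructor <;> linarith
  exact le_of_mul_le_mul_left h1 (by linarith)

/-- The weight is radial. -/
theorem Om_sqrtWt (c : ℝ) : Om (sqrtWt c) = 0 := by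
  have e1 : Om ((Rreg 1).sqrt (Rreg_pos one_pos)) = 0 := by
    ext t x
    have h1 := congrArg (fun u : Fld => u t x) (D_sqrt 1 (Rreg 1) (Rreg_pos one_pos))
    have h2 := congrArg (fun u : Fld => u t x) (D_sqrt 2 (Rreg 1) (Rreg_pos one_pos))
    rw [D_one_Rreg] at h1
    rw [D_two_Rreg] at h2
    simp only [mul_ap, ofNat_ap, X_ap, sqrt_ap, Rreg_ap, Om_def, sub_ap, zero_ap] at *
    have hp : 0 < √(‖x‖ ^ 2 + 1) := Real.sqrt_pos.2 (by positivity)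
    refine (mul_eq_zero.1 (?_ : √(‖x‖ ^ 2 + 1) * _ = 0)).resolve_left hp.ne'
    linear_combination x 1 / 2 * h1 - x 0 / 2 * h2
  have e2 : Om (coneFld c) = 0 := by
    rw [coneFld, map_sub, e1, Om_def]
    simp [D_mul]
  have e3 : sqrtWt c * Om (sqrtWt c) = 0 := by
    have h1 := sqrtWt_mul_D c 1
    have h2 := sqrtWt_mul_D c 2
    rw [Om_def] at e2 ⊢
    linear_combination X 1 * h1 - X 0 * h2 + coneFld c * e2
  ext t x
  have := congrArg (fun u : Fld => u t x) e3
  exact (mul_eq_zero.1 this).resolve_left (zero_lt_one.trans_le (one_le_sqrtWt c t x)).ne'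

theorem sq_le_enF {f : Fld} (hf : Test f) (t : ℝ) (x : Plane) : f t x ^ 2 ≤ 2 * enF f t x := by
  have h := congrArg (fun u : Fld => u t x) (Lap_Pot hf)
  simp only [Lap_def, add_ap, neg_ap] at h
  have h1 := sq_le_allSq (D 1 (Pot f)) 1 t x
  have h2 := sq_le_allSq (D 2 (Pot f)) 2 t x
  have h3 : f t x = -(D 1 (D 1 (Pot f)) t x + D 2 (D 2 (Pot f)) t x) := by linarith
  rw [h3, neg_sq, enF, add_ap]
  linarith [add_sq_le (a := D 1 (D 1 (Pot f)) t x) (b := D 2 (D 2 (Pot f)) t x)]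

theorem D_sq_le_thirdSq {f : Fld} (hf : Test f) (a : Fin 3) (t : ℝ) (x : Plane) :
    D a f t x ^ 2 ≤ 2 * thirdSq f t x := by
  have h := congrArg (fun u : Fld => u t x) (congrArg (D a) (Lap_Pot hf))
  simp only [Lap_def, map_add, map_neg, add_ap, neg_ap] at h
  have h1 := sq_le_allSq (D 1 (D 1 (Pot f))) a t x
  have h2 := sq_le_allSq (D 2 (D 2 (Pot f))) a t x
  have h3 : D a f t x = -(D a (D 1 (D 1 (Pot f))) t x + D a (D 2 (D 2 (Pot f))) t x) := by linarith
  rw [h3, neg_sq, thirdSq, add_ap, add_ap, add_ap]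
  linarith [add_sq_le (a := D a (D 1 (D 1 (Pot f))) t x) (b := D a (D 2 (D 2 (Pot f))) t x),
    allSq_nonneg (D 2 (D 1 (Pot f))) t x, allSq_nonneg (D 1 (D 2 (Pot f))) t x]

theorem integral_abs_le {t : ℝ} {u v : Fld} (hu : Itg t u) (hv : Itg t v)
    (h : ∀ x, |u t x| ≤ v t x) : ∫ x : Plane, |u t x| ≤ I t v := integral_mono hu.abs hv h

theorem I_sq_le {f : Fld} (hf : IsDiv f) (t : ℝ) : I t (f ^ 2) ≤ 2 * En t f := by
  rw [En, ← I_smul]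
  exact I_mono (hf.test.sq.itg t) ((itg_enF hf t).smul 2) fun x => by
    rw [smul_ap, pow_ap]; exact sq_le_enF hf.test t x

theorem I_wt_D_sq_le (c : ℝ) {f : Fld} (hf : IsDiv f) (a : Fin 3) (t : ℝ) :
    I t (wt c * D a f ^ 2) ≤ 2 * XX c t f := by
  rw [XX, ← I_smul]
  refine I_mono (((hf.D a).test.sq.mul_left _).itg t) ((itg_wt_thirdSq hf c t).smul 2) fun x => ?_
  rw [smul_ap, mul_ap, mul_ap, pow_ap]
  have := mul_le_mul_of_nonneg_left (D_sq_le_thirdSq hf.test a t x) (wt_pos c t x).le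
  linarith

theorem sq_le_of_Sobolev {f : Fld} (hf : Test f) (t : ℝ) (x : Plane) : f t x ^ 2 ≤
    I t (f ^ 2) + I t (D 1 f ^ 2) + I t (D 2 f ^ 2) + I t (D 1 (D 2 f) ^ 2) := by
  have h := abs_le_integral_D_D hf.sq t x
  rw [pow_ap, abs_of_nonneg (sq_nonneg _)] at h
  have i1 := (hf.D 1).sq.itg t
  have i2 := (hf.D 2).sq.itg t
  have i3 := ((hf.D 2).D 1).sq.itg t
  rw [← I_add (hf.sq.itg t) i1, ← I_add ((hf.sq.itg t).add i1) i2,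
    ← I_add (((hf.sq.itg t).add i1).add i2) i3]
  refine h.trans (integral_abs_le ((hf.sq.D 2).D 1 |>.itg t)
    ((((hf.sq.itg t).add i1).add i2).add i3) fun y => ?_)
  simp only [pow_two, D_mul, map_add, add_ap, mul_ap]
  rw [abs_le]
  constructor <;> nlinarith [sq_nonneg (D 1 f t y + D 2 f t y), sq_nonneg (D 1 f t y - D 2 f t y),
    sq_nonneg (f t y + D 1 (D 2 f) t y), sq_nonneg (f t y - D 1 (D 2 f) t y)]

theorem itg_wt_sq (c : ℝ) {u : Fld} (hu : Test u) (t : ℝ) : Itg t (wt c * u ^ 2) :=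
  (hu.sq.mul_left _).itg t

/-- The Sobolev inequality for `sqrtWt c * g`. -/
theorem weight_mul_sq_le (c : ℝ) {g : Fld} (hg : Test g) (t : ℝ) (x : Plane) :
    wt c t x * g t x ^ 2 ≤ 42 * (I t (wt c * g ^ 2) + I t (wt c * D 1 g ^ 2)
      + I t (wt c * D 2 g ^ 2) + I t (wt c * D 1 (D 2 g) ^ 2)) := by
  have h := sq_le_of_Sobolev (hg.mul_left (sqrtWt c)) t x
  rw [mul_ap, mul_pow, sqrtWt_sq] at h
  have i0 := itg_wt_sq c hg t
  have i1 := itg_wt_sq c (hg.D 1) t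
  have i2 := itg_wt_sq c (hg.D 2) t
  have i3 := itg_wt_sq c ((hg.D 2).D 1) t
  have hσ := hg.mul_left (sqrtWt c)
  have j0 := hσ.sq.itg t
  have j1 := (hσ.D 1).sq.itg t
  have j2 := (hσ.D 2).sq.itg t
  have j3 := ((hσ.D 2).D 1).sq.itg t
  rw [← I_add j0 j1, ← I_add (j0.add j1) j2, ← I_add ((j0.add j1).add j2) j3] at h
  rw [← I_add i0 i1, ← I_add (i0.add i1) i2, ← I_add ((i0.add i1).add i2) i3, ← I_smul]
  refine h.trans (I_mono (((j0.add j1).add j2).add j3) ((((i0.add i1).add i2).add i3).smul 42)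
    fun y => ?_)
  have q0 : sqrtWt c t y ^ 2 = wt c t y := sqrtWt_sq c t y
  have w1 := one_le_wt c t y
  have a1 : D 1 (sqrtWt c) t y ^ 2 ≤ 1 := by
    rw [← sq_abs]; exact pow_le_one₀ (abs_nonneg _) (abs_D_sqrtWt_le c t y 0)
  have a2 : D 2 (sqrtWt c) t y ^ 2 ≤ 1 := by
    rw [← sq_abs]; exact pow_le_one₀ (abs_nonneg _) (abs_D_sqrtWt_le c t y 1)
  have a3 : D 1 (D 2 (sqrtWt c)) t y ^ 2 ≤ 9 := by
    rw [← sq_abs]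
    have := pow_le_pow_left₀ (abs_nonneg _) (abs_D_D_sqrtWt_le c t y) 2
    linarith
  simp only [D_mul, map_add, add_ap, mul_ap, pow_ap, smul_ap]
  generalize sqrtWt c t y = σ at *
  generalize D 1 (sqrtWt c) t y = s1 at *
  generalize D 2 (sqrtWt c) t y = s2 at *
  generalize D 1 (D 2 (sqrtWt c)) t y = s3 at *
  generalize g t y = g0
  generalize D 1 g t y = g1
  generalize D 2 g t y = g2
  generalize D 1 (D 2 g) t y = g3
  have e : ∀ {s M b : ℝ}, s ^ 2 ≤ M → 0 ≤ M → (b * s) ^ 2 ≤ M * (wt c t y * b ^ 2) :=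
    fun {s M b} h hM => by
      rw [mul_pow, mul_comm]
      refine mul_le_mul h ?_ (sq_nonneg _) hM
      nlinarith [sq_nonneg b]
  have e' : ∀ b : ℝ, (σ * b) ^ 2 = wt c t y * b ^ 2 := fun b => by rw [mul_pow, q0]
  have t1 := add_sq_le (a := σ * g1) (b := g0 * s1)
  have t2 := add_sq_le (a := σ * g2) (b := g0 * s2)
  have t3 := add_sq_le (a := σ * g3 + g2 * s1) (b := g0 * s3 + s2 * g1)
  have t4 := add_sq_le (a := σ * g3) (b := g2 * s1)
  have t5 := add_sq_le (a := g0 * s3) (b := g1 * s2)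
  rw [e'] at t1 t2 t4
  rw [mul_comm g1 s2] at t5
  have f1 := e (b := g0) a1 zero_le_one
  have f2 := e (b := g0) a2 zero_le_one
  have f3 := e (b := g2) a1 zero_le_one
  have f4 := e (b := g1) a2 zero_le_one
  have f5 := e (b := g0) a3 (by norm_num)
  rw [mul_comm g1 s2] at f4
  rw [e']
  have p0 : 0 ≤ wt c t y * g0 ^ 2 := mul_nonneg (by linarith) (sq_nonneg _)
  have p1 : 0 ≤ wt c t y * g1 ^ 2 := mul_nonneg (by linarith) (sq_nonneg _)
  have p2 : 0 ≤ wt c t y * g2 ^ 2 := mul_nonneg (by linarith) (sq_nonneg _)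
  have p3 : 0 ≤ wt c t y * g3 ^ 2 := mul_nonneg (by linarith) (sq_nonneg _)
  linarith

theorem norm_mul_weight_le_aux {s w p q p1 q1 s1 : ℝ} (hw : s ^ 2 = w)
    (h1 : |s1| ≤ 1) : |s * (p * q1 + q * p1) + p * q * s1| ≤
      2 * (p ^ 2 + q ^ 2) + w * p1 ^ 2 + w * q1 ^ 2 := by
  have e1 : |p * q * s1| ≤ (p ^ 2 + q ^ 2) / 2 := by
    rw [abs_mul]
    refine (mul_le_of_le_one_right (abs_nonneg _) h1).trans ?_
    rw [abs_le]; constructor <;> nlinarith [sq_nonneg (p + q), sq_nonneg (p - q)]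
  have e2 : |s * (p * q1 + q * p1)| ≤ (p ^ 2 + q ^ 2) / 2 + (w * p1 ^ 2 + w * q1 ^ 2) / 2 := by
    rw [← hw, abs_le]
    constructor <;> nlinarith [sq_nonneg (p + s * q1), sq_nonneg (p - s * q1),
      sq_nonneg (q + s * p1), sq_nonneg (q - s * p1)]
  have p0 : 0 ≤ w * p1 ^ 2 := by rw [← hw]; positivity
  have p1' : 0 ≤ w * q1 ^ 2 := by rw [← hw]; positivity
  refine (abs_add_le _ _).trans ?_
  nlinarith [sq_nonneg p, sq_nonneg q]

/-- The radial Sobolev inequality with the weight `⟨c t - r⟩^{1/2}`. -/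
theorem norm_mul_weight_le (c : ℝ) {f : Fld} (hf : Test f) (t : ℝ) (x : Plane) :
    ‖x‖ * (sqrtWt c t x * f t x ^ 2) ≤ 20 * (I t (f ^ 2) + I t (Om f ^ 2)
      + I t (wt c * D 1 f ^ 2) + I t (wt c * D 2 f ^ 2)
      + I t (wt c * D 1 (Om f) ^ 2) + I t (wt c * D 2 (Om f) ^ 2)) := by
  have hF : Test (sqrtWt c * f ^ 2) := hf.sq.mul_left _
  have h := norm_mul_abs_le hF t x
  have hpos : 0 ≤ (sqrtWt c * f ^ 2) t x := by
    rw [mul_ap, pow_ap]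
    exact mul_nonneg (zero_le_one.trans (one_le_sqrtWt c t x)) (sq_nonneg _)
  rw [abs_of_nonneg hpos, mul_ap, pow_ap] at h
  have i0 := hf.sq.itg t
  have i1 := hf.Om.sq.itg t
  have i2 := itg_wt_sq c (hf.D 1) t
  have i3 := itg_wt_sq c (hf.D 2) t
  have i4 := itg_wt_sq c (hf.Om.D 1) t
  have i5 := itg_wt_sq c (hf.Om.D 2) t
  have i6 := ((((i0.add i1).add i2).add i3).add i4).add i5
  rw [← I_add i0 i1, ← I_add (i0.add i1) i2, ← I_add ((i0.add i1).add i2) i3,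
    ← I_add (((i0.add i1).add i2).add i3) i4, ← I_add ((((i0.add i1).add i2).add i3).add i4) i5]
  refine h.trans ?_
  have e : Om (sqrtWt c * f ^ 2) = 2 * (sqrtWt c * (f * Om f)) := by
    rw [Derivation.leibniz, Om_sqrtWt, smul_zero, add_zero, pow_two, Derivation.leibniz]
    simp only [smul_eq_mul]; ring
  have hσ := fun y => zero_le_one.trans (one_le_sqrtWt c t y)
  have b1 : ∫ y : Plane, (|D 1 (sqrtWt c * f ^ 2) t y| + |D 2 (sqrtWt c * f ^ 2) t y|) ≤
      8 * I t (f ^ 2 + Om f ^ 2 + wt c * D 1 f ^ 2 + wt c * D 2 f ^ 2 + wt c * D 1 (Om f) ^ 2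
        + wt c * D 2 (Om f) ^ 2) := by
    rw [← I_smul]
    refine integral_mono (((hF.D 1).itg t).abs.add ((hF.D 2).itg t).abs) (i6.smul 8) fun y => ?_
    have k1 := norm_mul_weight_le_aux (p := f t y) (q := f t y) (p1 := D 1 f t y)
      (q1 := D 1 f t y) (sqrtWt_sq c t y) (abs_D_sqrtWt_le c t y 0)
    have k2 := norm_mul_weight_le_aux (p := f t y) (q := f t y) (p1 := D 2 f t y)
      (q1 := D 2 f t y) (sqrtWt_sq c t y) (abs_D_sqrtWt_le c t y 1)
    have p1 : 0 ≤ wt c t y * D 1 (Om f) t y ^ 2 := mul_nonneg (wt_pos c t y).le (sq_nonneg _)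
    have p2 : 0 ≤ wt c t y * D 2 (Om f) t y ^ 2 := mul_nonneg (wt_pos c t y).le (sq_nonneg _)
    have p3 : 0 ≤ wt c t y * D 1 f t y ^ 2 := mul_nonneg (wt_pos c t y).le (sq_nonneg _)
    have p4 : 0 ≤ wt c t y * D 2 f t y ^ 2 := mul_nonneg (wt_pos c t y).le (sq_nonneg _)
    simp only [pow_two (a := f), D_mul, add_ap, mul_ap, smul_ap, pow_ap] at *
    rw [← pow_two] at *
    have z1 : (0 : Fin 2).succ = (1 : Fin 3) := rfl
    have z2 : (1 : Fin 2).succ = (2 : Fin 3) := rfl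
    rw [z1] at k1
    rw [z2] at k2
    linarith [sq_nonneg (Om f t y), sq_nonneg (f t y)]
  have b2 : ∫ y : Plane, (|D 1 (Om (sqrtWt c * f ^ 2)) t y| + |D 2 (Om (sqrtWt c * f ^ 2)) t y|) ≤
      8 * I t (f ^ 2 + Om f ^ 2 + wt c * D 1 f ^ 2 + wt c * D 2 f ^ 2 + wt c * D 1 (Om f) ^ 2
        + wt c * D 2 (Om f) ^ 2) := by
    rw [← I_smul]
    refine integral_mono (((hF.Om.D 1).itg t).abs.add ((hF.Om.D 2).itg t).abs) (i6.smul 8) fun y => ?_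
    have k1 := norm_mul_weight_le_aux (p := f t y) (q := Om f t y) (p1 := D 1 f t y)
      (q1 := D 1 (Om f) t y) (sqrtWt_sq c t y) (abs_D_sqrtWt_le c t y 0)
    have k2 := norm_mul_weight_le_aux (p := f t y) (q := Om f t y) (p1 := D 2 f t y)
      (q1 := D 2 (Om f) t y) (sqrtWt_sq c t y) (abs_D_sqrtWt_le c t y 1)
    have p1 : 0 ≤ wt c t y * D 1 (Om f) t y ^ 2 := mul_nonneg (wt_pos c t y).le (sq_nonneg _)
    have p2 : 0 ≤ wt c t y * D 2 (Om f) t y ^ 2 := mul_nonneg (wt_pos c t y).le (sq_nonneg _)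
    have p3 : 0 ≤ wt c t y * D 1 f t y ^ 2 := mul_nonneg (wt_pos c t y).le (sq_nonneg _)
    have p4 : 0 ≤ wt c t y * D 2 f t y ^ 2 := mul_nonneg (wt_pos c t y).le (sq_nonneg _)
    have z1 : (0 : Fin 2).succ = (1 : Fin 3) := rfl
    have z2 : (1 : Fin 2).succ = (2 : Fin 3) := rfl
    rw [z1] at k1
    rw [z2] at k2
    simp only [e, D_mul, D_ofNat, mul_zero, add_zero, add_ap, mul_ap, smul_ap, pow_ap, ofNat_ap,
      abs_mul (2:ℝ), abs_two] at *
    linarith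
  have n0 : 0 ≤ I t (f ^ 2 + Om f ^ 2 + wt c * D 1 f ^ 2 + wt c * D 2 f ^ 2 + wt c * D 1 (Om f) ^ 2
        + wt c * D 2 (Om f) ^ 2) := I_nonneg fun y => by
    have := wt_pos c t y
    simp only [add_ap, mul_ap, pow_ap]; positivity
  linarith

/-- The Sobolev inequality with the weight `⟨c t - r⟩^{1/2}`. -/
theorem sqrtWeight_mul_sq_le (c : ℝ) {f : Fld} (hf : Test f) (t : ℝ) (x : Plane) :
    sqrtWt c t x * f t x ^ 2 ≤ 6 * (I t (f ^ 2)
      + I t (wt c * D 1 f ^ 2) + I t (wt c * D 2 f ^ 2) + I t (wt c * D 1 (D 2 f) ^ 2)) := by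
  have hF : Test (sqrtWt c * f ^ 2) := hf.sq.mul_left _
  have h := abs_le_integral_D_D hF t x
  have hpos : 0 ≤ (sqrtWt c * f ^ 2) t x := by
    rw [mul_ap, pow_ap]
    exact mul_nonneg (zero_le_one.trans (one_le_sqrtWt c t x)) (sq_nonneg _)
  rw [abs_of_nonneg hpos, mul_ap, pow_ap] at h
  have i0 := hf.sq.itg t
  have i1 := itg_wt_sq c (hf.D 1) t
  have i2 := itg_wt_sq c (hf.D 2) t
  have i3 := itg_wt_sq c ((hf.D 2).D 1) t
  have i6 := ((i0.add i1).add i2).add i3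
  rw [← I_add i0 i1, ← I_add (i0.add i1) i2, ← I_add ((i0.add i1).add i2) i3, ← I_smul]
  refine h.trans (integral_abs_le (((hF.D 2).D 1).itg t) (i6.smul 6) fun y => ?_)
  have q0 : sqrtWt c t y ^ 2 = wt c t y := sqrtWt_sq c t y
  have qp := one_le_sqrtWt c t y
  have a1 : |D 1 (sqrtWt c) t y| ≤ 1 := abs_D_sqrtWt_le c t y 0
  have a2 : |D 2 (sqrtWt c) t y| ≤ 1 := abs_D_sqrtWt_le c t y 1
  have a3 := abs_D_D_sqrtWt_le c t y
  simp only [pow_two (a := f), D_mul, map_add, add_ap, mul_ap, pow_ap, smul_ap]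
  rw [← q0]
  generalize sqrtWt c t y = σ at *
  generalize D 1 (sqrtWt c) t y = s1 at *
  generalize D 2 (sqrtWt c) t y = s2 at *
  generalize D 1 (D 2 (sqrtWt c)) t y = s3 at *
  generalize f t y = g0
  generalize D 1 f t y = g1
  generalize D 2 f t y = g2
  generalize D 1 (D 2 f) t y = g3
  have m : ∀ {s p q M : ℝ}, |s| ≤ M → 0 ≤ M → |s * (p * q)| ≤ M * ((p ^ 2 + q ^ 2) / 2) :=
    fun {s p q M} h hM => by
      rw [abs_mul]
      refine mul_le_mul h ?_ (abs_nonneg _) hM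
      rw [abs_le]; constructor <;> nlinarith [sq_nonneg (p + q), sq_nonneg (p - q)]
  have m1 := m (p := g0) (q := g0) a3 (by norm_num)
  have m2 := m (p := g0) (q := g1) a2 zero_le_one
  have m3 := m (p := g0) (q := g2) a1 zero_le_one
  have m4 : |σ * (g1 * g2)| ≤ (σ ^ 2 * g1 ^ 2 + σ ^ 2 * g2 ^ 2) / 2 := by
    have := m (s := 1) (p := σ * g1) (q := g2) (M := 1) (by simp) zero_le_one
    have hm : g2 ^ 2 ≤ σ ^ 2 * g2 ^ 2 := le_mul_of_one_le_left (sq_nonneg _) (by nlinarith)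
    rw [one_mul, one_mul, mul_pow, mul_assoc] at this
    linarith
  have m5 : |σ * (g0 * g3)| ≤ (g0 ^ 2 + σ ^ 2 * g3 ^ 2) / 2 := by
    have := m (s := 1) (p := g0) (q := σ * g3) (M := 1) (by simp) zero_le_one
    rw [one_mul, one_mul, mul_pow, mul_left_comm] at this
    linarith
  have h1 : g1 ^ 2 ≤ σ ^ 2 * g1 ^ 2 := le_mul_of_one_le_left (sq_nonneg _) (by nlinarith)
  have h2 : g2 ^ 2 ≤ σ ^ 2 * g2 ^ 2 := le_mul_of_one_le_left (sq_nonneg _) (by nlinarith)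
  have h3 : 0 ≤ σ ^ 2 * g3 ^ 2 := by positivity
  rw [abs_le] at *
  constructor <;> nlinarith [sq_nonneg g0]

theorem sq_le_En {f : Fld} (hf : IsDiv f) (t : ℝ) (x : Plane) :
    f t x ^ 2 ≤ 2 * (En t f + En t (D 1 f) + En t (D 2 f) + En t (D 1 (D 2 f))) := by
  have h := sq_le_of_Sobolev hf.test t x
  linarith [I_sq_le hf t, I_sq_le (hf.D 1) t, I_sq_le (hf.D 2) t, I_sq_le ((hf.D 2).D 1) t]

theorem radial_weight_le (c : ℝ) {f : Fld} (hf : IsDiv f) (t : ℝ) (x : Plane) :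
    (1 + ‖x‖) * (sqrtWt c t x * f t x ^ 2) ≤ 104 * (En t f + En t (Om f) + XX c t f
      + XX c t (Om f) + XX c t (D 2 f)) := by
  have h1 := norm_mul_weight_le c hf.test t x
  have h2 := sqrtWeight_mul_sq_le c hf.test t x
  linarith [I_sq_le hf t, I_sq_le hf.Om t, I_wt_D_sq_le c hf 1 t, I_wt_D_sq_le c hf 2 t,
    I_wt_D_sq_le c hf.Om 1 t, I_wt_D_sq_le c hf.Om 2 t, I_wt_D_sq_le c (hf.D 2) 1 t,
    En_nonneg f t, En_nonneg (Om f) t, XX_nonneg c f t, XX_nonneg c (Om f) t,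
    XX_nonneg c (D 2 f) t]

theorem weight_D_sq_le (c : ℝ) {f : Fld} (hf : IsDiv f) (a : Fin 3) (t : ℝ) (x : Plane) :
    wt c t x * D a f t x ^ 2 ≤ 84 * (XX c t f + XX c t (D 1 f) + XX c t (D 2 f)
      + XX c t (D 1 (D 2 f))) := by
  have h := weight_mul_sq_le c (hf.D a).test t x
  rw [D_comm 2 a, D_comm 1 a, D_comm 1 a] at h
  linarith [I_wt_D_sq_le c hf a t, I_wt_D_sq_le c (hf.D 1) a t, I_wt_D_sq_le c (hf.D 2) a t,
    I_wt_D_sq_le c ((hf.D 2).D 1) a t]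

/-- Points of space-time together with a divergence. -/
abbrev DivPoint : Type := {p : (ℝ × Plane) × Fld // IsDiv p.2}

theorem D_D_Z_mem (a b : Fin 3) {β : Fin 5 → ℕ} {k : ℕ} (h : ord β ≤ k) :
    (fun u => D a (D b (Z β u))) ∈ ZSpan (k + 2) :=
  ZSpan_mono (by omega) (field_ZSpan_mem (.D a) (field_Z_mem (.D b) β))

theorem nn_le_EN (k : ℕ) : ∃ C : ℝ, 0 ≤ C ∧ ∀ t x f, IsDiv f →
    nn k f t x ≤ C * EN (k + 2) t f := by
  obtain ⟨C, h0, h⟩ := exists_bound_sum (multiIndices k)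
    (fun β (p : DivPoint) => Z β p.1.2 p.1.1.1 p.1.1.2 ^ 2) (fun p => EN (k + 2) p.1.1.1 p.1.2)
    fun β hβ => by
      have hb := mem_multiIndices.1 hβ
      obtain ⟨C0, p0, h0⟩ := En_span (Z_mem (k := k + 2) (β := β) (by omega))
      obtain ⟨C1, p1, h1⟩ := En_span (ZSpan_mono (by omega : _ ≤ k + 2) (field_Z_mem (.D 1) β))
      obtain ⟨C2, p2, h2⟩ := En_span (ZSpan_mono (by omega : _ ≤ k + 2) (field_Z_mem (.D 2) β))
      obtain ⟨C3, p3, h3⟩ := En_span (D_D_Z_mem 1 2 hb)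
      refine ⟨2 * (C0 + C1 + C2 + C3), by positivity, fun ⟨((t, x), f), hf⟩ => ?_⟩
      refine (sq_le_En (Z_isDiv β hf) t x).trans ?_
      rw [mul_assoc]
      linarith [h0 t f hf, h1 t f hf, h2 t f hf, h3 t f hf]
  exact ⟨C, h0, fun t x f hf => h ⟨((t, x), f), hf⟩⟩

theorem radial_weight_nn_le (c : ℝ) (k : ℕ) : ∃ C : ℝ, 0 ≤ C ∧ ∀ t x f, IsDiv f →
    (1 + ‖x‖) * (sqrtWt c t x * nn k f t x) ≤ C * (EN (k + 1) t f + XN c (k + 1) t f) := by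
  obtain ⟨C, h0, h⟩ := exists_bound_sum (multiIndices k)
    (fun β (p : DivPoint) => (1 + ‖p.1.1.2‖) * (sqrtWt c p.1.1.1 p.1.1.2
      * Z β p.1.2 p.1.1.1 p.1.1.2 ^ 2))
    (fun p => EN (k + 1) p.1.1.1 p.1.2 + XN c (k + 1) p.1.1.1 p.1.2)
    fun β hβ => by
      have hb := mem_multiIndices.1 hβ
      have m0 := Z_mem (k := k + 1) (β := β) (by omega)
      have m1 := ZSpan_mono (by omega : _ ≤ k + 1) (field_Z_mem .Om β)
      obtain ⟨C0, p0, h0⟩ := En_span m0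
      obtain ⟨C1, p1, h1⟩ := En_span m1
      obtain ⟨C2, p2, h2⟩ := XX_span c m0
      obtain ⟨C3, p3, h3⟩ := XX_span c m1
      obtain ⟨C4, p4, h4⟩ := XX_span c (ZSpan_mono (by omega : _ ≤ k + 1) (field_Z_mem (.D 2) β))
      refine ⟨104 * (C0 + C1 + C2 + C3 + C4), by positivity, fun ⟨((t, x), f), hf⟩ => ?_⟩
      refine (radial_weight_le c (Z_isDiv β hf) t x).trans ?_
      rw [mul_assoc]
      have e1 := mul_nonneg (by positivity : 0 ≤ C2 + C3 + C4) (EN_nonneg (k + 1) t f)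
      have e2 := mul_nonneg (by positivity : 0 ≤ C0 + C1) (XN_nonneg c (k + 1) t f)
      dsimp only
      linarith [h0 t f hf, h1 t f hf, h2 t f hf, h3 t f hf, h4 t f hf]
  refine ⟨C, h0, fun t x f hf => ?_⟩
  have := h ⟨((t, x), f), hf⟩
  simp only [← Finset.mul_sum] at this
  exact this

theorem weight_dd_le (c : ℝ) (k : ℕ) : ∃ C : ℝ, 0 ≤ C ∧ ∀ t x f, IsDiv f →
    wt c t x * dd k f t x ≤ C * XN c (k + 2) t f := by
  obtain ⟨C, h0, h⟩ := exists_bound_sum (multiIndices k)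
    (fun β (p : DivPoint) => wt c p.1.1.1 p.1.1.2 * (D 1 (Z β p.1.2) p.1.1.1 p.1.1.2 ^ 2
      + D 2 (Z β p.1.2) p.1.1.1 p.1.1.2 ^ 2))
    (fun p => XN c (k + 2) p.1.1.1 p.1.2)
    fun β hβ => by
      have hb := mem_multiIndices.1 hβ
      obtain ⟨C0, p0, h0⟩ := XX_span c (Z_mem (k := k + 2) (β := β) (by omega))
      obtain ⟨C1, p1, h1⟩ := XX_span c (ZSpan_mono (by omega : _ ≤ k + 2) (field_Z_mem (.D 1) β))
      obtain ⟨C2, p2, h2⟩ := XX_span c (ZSpan_mono (by omega : _ ≤ k + 2) (field_Z_mem (.D 2) β))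
      obtain ⟨C3, p3, h3⟩ := XX_span c (D_D_Z_mem 1 2 hb)
      refine ⟨168 * (C0 + C1 + C2 + C3), by positivity, fun ⟨((t, x), f), hf⟩ => ?_⟩
      have k1 := weight_D_sq_le c (Z_isDiv β hf) 1 t x
      have k2 := weight_D_sq_le c (Z_isDiv β hf) 2 t x
      dsimp only
      rw [mul_assoc]
      linarith [h0 t f hf, h1 t f hf, h2 t f hf, h3 t f hf]
  refine ⟨C, h0, fun t x f hf => ?_⟩
  have := h ⟨((t, x), f), hf⟩
  simp only [← Finset.mul_sum] at this
  exact this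

theorem dd_le_nn (k : ℕ) : ∃ C : ℝ, 0 ≤ C ∧ ∀ f t x, dd k f t x ≤ C * nn (k + 1) f t x := by
  obtain ⟨C, h0, h⟩ := exists_bound_sum (multiIndices k)
    (fun β (p : Fld × ℝ × Plane) => D 1 (Z β p.1) p.2.1 p.2.2 ^ 2 + D 2 (Z β p.1) p.2.1 p.2.2 ^ 2)
    (fun p => nn (k + 1) p.1 p.2.1 p.2.2) fun β hβ => by
      have hb := mem_multiIndices.1 hβ
      obtain ⟨β₁, o1, e1⟩ := D_Z 1 β
      obtain ⟨β₂, o2, e2⟩ := D_Z 2 β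
      refine ⟨2, by norm_num, fun ⟨f, t, x⟩ => ?_⟩
      dsimp only
      rw [e1, e2]
      linarith [sq_le_nn (by omega : ord β₁ ≤ k + 1) f t x,
        sq_le_nn (by omega : ord β₂ ≤ k + 1) f t x]
  exact ⟨C, h0, fun f t x => h (f, t, x)⟩

/-- Inside the slower cone the weight of the faster cone is of size `1 + t`. -/
theorem one_add_le_sqrtWt {c₁ c₂ : ℝ} (hc : c₂ < c₁) : ∃ C > 0, ∀ t (x : Plane),
    0 ≤ t → ‖x‖ ≤ c₂ * t + 1 → 1 + t ≤ C * sqrtWt c₁ t x := by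
  have h0 : 0 < c₁ - c₂ := by linarith
  refine ⟨2 + 3 / (c₁ - c₂), by positivity, fun t x ht hx => ?_⟩
  have h1 := le_wt c₁ t x
  rw [← sqrtWt_sq] at h1
  have h2 := one_le_sqrtWt c₁ t x
  have h3 : c₁ * t - ‖x‖ ≤ 2 * sqrtWt c₁ t x := by
    by_contra! h
    nlinarith
  have h4 : t * (c₁ - c₂) ≤ 3 * sqrtWt c₁ t x := by nlinarith
  have h5 : t ≤ 3 * sqrtWt c₁ t x / (c₁ - c₂) := (le_div_iff₀ h0).2 h4
  have e : (2 + 3 / (c₁ - c₂)) * sqrtWt c₁ t x =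
    2 * sqrtWt c₁ t x + 3 * sqrtWt c₁ t x / (c₁ - c₂) := by ring
  rw [e]
  linarith

theorem one_add_le_radial_sqrtWt {c : ℝ} (hc : 0 < c) : ∃ C > 0, ∀ t (x : Plane),
    0 ≤ t → 1 + t ≤ C * ((1 + ‖x‖) * sqrtWt c t x) := by
  refine ⟨3 * (1 + 1 / c), by positivity, fun t x ht => ?_⟩
  have h1 := le_wt c t x
  rw [← sqrtWt_sq] at h1
  have h2 := one_le_sqrtWt c t x
  have h3 : c * t - ‖x‖ ≤ 2 * sqrtWt c t x := by
    by_contra! h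
    nlinarith
  have hr := norm_nonneg x
  have h4 : 1 + c * t ≤ 3 * ((1 + ‖x‖) * sqrtWt c t x) := by
    nlinarith [mul_nonneg hr (by linarith : 0 ≤ sqrtWt c t x - 1)]
  have h6 : 1 + t ≤ (1 + 1 / c) * (1 + c * t) := by
    have : (1 + 1 / c) * (1 + c * t) = 1 + t + (c * t + 1 / c) := by field_simp; ring
    rw [this]
    have : 0 ≤ c * t + 1 / c := by positivity
    linarith
  have h7 := mul_le_mul_of_nonneg_left h4 (by positivity : 0 ≤ 1 + 1 / c)
  linarith

/-! ### The pointwise estimate of the nonlinearity -/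

theorem Z_add (β : Fin 5 → ℕ) (u v : Fld) : Z β (u + v) = Z β u + Z β v := by
  simp only [Z_def, iterate_map_add]

theorem Z_smul (β : Fin 5 → ℕ) (c : ℝ) (u : Fld) : Z β (c • u) = c • Z β u := by
  simp only [Z_def]
  rw [Function.Semiconj.iterate_right (f := fun u : Fld => c • u) (fun u => (Om.map_smul c u).symm) _ u |>.symm,
    Function.Semiconj.iterate_right (f := fun u : Fld => c • u) (fun u => (S.map_smul c u).symm) _ _ |>.symm,
    D_iterate_smul, D_iterate_smul, D_iterate_smul]

theorem nn_add_le (k : ℕ) (u v : Fld) (t : ℝ) (x : Plane) :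
    nn k (u + v) t x ≤ 2 * nn k u t x + 2 * nn k v t x := by
  simp only [nn, Finset.mul_sum]
  rw [← Finset.sum_add_distrib]
  refine Finset.sum_le_sum fun β _ => ?_
  rw [Z_add, add_ap]
  linarith [add_sq_le (a := Z β u t x) (b := Z β v t x)]

theorem dd_add_le (k : ℕ) (u v : Fld) (t : ℝ) (x : Plane) :
    dd k (u + v) t x ≤ 2 * dd k u t x + 2 * dd k v t x := by
  simp only [dd, Finset.mul_sum]
  rw [← Finset.sum_add_distrib]
  refine Finset.sum_le_sum fun β _ => ?_
  rw [Z_add, map_add, map_add, add_ap, add_ap]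
  linarith [add_sq_le (a := D 1 (Z β u) t x) (b := D 1 (Z β v) t x),
    add_sq_le (a := D 2 (Z β u) t x) (b := D 2 (Z β v) t x)]

theorem nn_smul (k : ℕ) (c : ℝ) (u : Fld) (t : ℝ) (x : Plane) :
    nn k (c • u) t x = c ^ 2 * nn k u t x := by
  simp only [nn, Finset.mul_sum, Z_smul, smul_ap, mul_pow]

theorem dd_smul (k : ℕ) (c : ℝ) (u : Fld) (t : ℝ) (x : Plane) :
    dd k (c • u) t x = c ^ 2 * dd k u t x := by
  simp only [dd, Finset.mul_sum, Z_smul, Derivation.map_smul, smul_ap, mul_pow, mul_add]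

/-- The size of the coefficients of the nonlinearity. -/
def coeffSize (g : Fin 3 → ℝ) (h : Fin 4 → ℝ) : ℝ := 4 * (g 1 ^ 2 + h 1 ^ 2 + h 2 ^ 2 + h 3 ^ 2)

theorem coeffSize_nonneg (g : Fin 3 → ℝ) (h : Fin 4 → ℝ) : 0 ≤ coeffSize g h := by
  rw [coeffSize]; positivity

theorem coeff_sum_le {a b c d p q r s : ℝ} (hp : 0 ≤ p) (hq : 0 ≤ q) (hr : 0 ≤ r) (hs : 0 ≤ s) :
    2 * (2 * (a ^ 2 * p) + 2 * (b ^ 2 * q)) + 2 * (2 * (c ^ 2 * r) + 2 * (d ^ 2 * s)) ≤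
      4 * (a ^ 2 + b ^ 2 + c ^ 2 + d ^ 2) * (p + (q + r + s)) := by
  have : 0 ≤ 4 * (a ^ 2 * (q + r + s) + b ^ 2 * (p + r + s) + c ^ 2 * (p + q + s)
    + d ^ 2 * (p + q + r)) := by positivity
  linarith

theorem nn_nonlinFactor_le (g : Fin 3 → ℝ) (h : Fin 4 → ℝ) (k : ℕ) (v w : Fld) (t : ℝ) (x : Plane) :
    nn k (nonlinFactor g h v w) t x ≤ coeffSize g h * (nn k v t x + (nn k (v * v) t x
      + nn k (v * w) t x + nn k (w * w) t x)) := by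
  refine le_trans ?_ (coeff_sum_le (nn_nonneg k v t x) (nn_nonneg k (v * v) t x)
    (nn_nonneg k (v * w) t x) (nn_nonneg k (w * w) t x))
  rw [← nn_smul, ← nn_smul, ← nn_smul, ← nn_smul]
  refine (nn_add_le _ _ _ _ _).trans ?_
  linarith [nn_add_le k (g 1 • v) (h 1 • (v * v)) t x,
    nn_add_le k (h 2 • (v * w)) (h 3 • (w * w)) t x]

theorem dd_nonlinFactor_le (g : Fin 3 → ℝ) (h : Fin 4 → ℝ) (k : ℕ) (v w : Fld) (t : ℝ) (x : Plane) :
    dd k (nonlinFactor g h v w) t x ≤ coeffSize g h * (dd k v t x + (dd k (v * v) t x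
      + dd k (v * w) t x + dd k (w * w) t x)) := by
  refine le_trans ?_ (coeff_sum_le (dd_nonneg k v t x) (dd_nonneg k (v * v) t x)
    (dd_nonneg k (v * w) t x) (dd_nonneg k (w * w) t x))
  rw [← dd_smul, ← dd_smul, ← dd_smul, ← dd_smul]
  refine (dd_add_le _ _ _ _ _).trans ?_
  linarith [dd_add_le k (g 1 • v) (h 1 • (v * v)) t x,
    dd_add_le k (h 2 • (v * w)) (h 3 • (w * w)) t x]

theorem le_const_mul_of_sum {K C m X Y₀ Y₁ Y₂ Y₃ W₁ W₂ W₃ R : ℝ} (hK : 0 ≤ K) (hC : 0 ≤ C)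
    (h : X ≤ K * (Y₀ + (Y₁ + Y₂ + Y₃))) (e₁ : Y₁ ≤ C * W₁) (e₂ : Y₂ ≤ C * W₂) (e₃ : Y₃ ≤ C * W₃)
    (h0 : Y₀ ≤ R) (h1 : W₁ + W₂ + W₃ ≤ m * R) : X ≤ K * (1 + m * C) * R := by
  refine h.trans ?_
  rw [mul_assoc]
  refine mul_le_mul_of_nonneg_left ?_ hK
  have := mul_le_mul_of_nonneg_left h1 hC
  linarith

set_option maxHeartbeats 1000000 in
/-- The size of `w * nonlinFactor g h v w` and its derivatives, where `P` dominates `w` and its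
derivatives of low order. Every term has a factor `w`; either it carries at most `L` fields, and is
bounded by `P`, or all the other factors do. -/
theorem dd_nonlin_le {n L : ℕ} (hL : n ≤ 2 * L + 1) (g : Fin 3 → ℝ) (h : Fin 4 → ℝ) :
    ∃ C : ℝ, 0 ≤ C ∧ ∀ (v w : Fld) (t : ℝ) (x : Plane) (P : ℝ), nn L v t x ≤ 1 → dd L v t x ≤ 1 →
      nn L w t x ≤ P → dd L w t x ≤ P → P ≤ 1 →
      dd n (w * nonlinFactor g h v w) t x ≤
        C * ((dd n w t x + nn n w t x) * (nn L v t x + dd L v t x + P ^ 2)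
          + P * (nn n v t x + dd n v t x)) := by
  obtain ⟨C₁, p1, h1⟩ := nn_mul_low L
  obtain ⟨C₂, p2, h2⟩ := dd_mul_low L
  obtain ⟨C₃, p3, h3⟩ := nn_mul_high hL
  obtain ⟨C₄, p4, h4⟩ := dd_mul_high hL
  set K := coeffSize g h with hK
  have hK0 : 0 ≤ K := coeffSize_nonneg g h
  set M := K * (1 + 3 * C₁) + K * (1 + 5 * C₂) + K * (1 + 5 * C₃) + K * (1 + 6 * C₄) with hM
  have hM0 : 0 ≤ M := by positivity
  refine ⟨C₄ * (M * 5), by positivity, fun v w t x P hV hQ hp hq hP => ?_⟩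
  set F := nonlinFactor g h v w with hF
  have f1 := nn_nonlinFactor_le g h L v w t x
  have f2 := dd_nonlinFactor_le g h L v w t x
  have f3 := nn_nonlinFactor_le g h n v w t x
  have f4 := dd_nonlinFactor_le g h n v w t x
  have k := h4 w F t x
  rw [← hF, ← hK] at f1 f2 f3 f4
  have V0 := nn_nonneg L v t x
  have Q0 := dd_nonneg L v t x
  have p0 := nn_nonneg L w t x
  have q0 := dd_nonneg L w t x
  have a0 := nn_nonneg n w t x
  have b0 := dd_nonneg n w t x
  have c0 := nn_nonneg n v t x
  have d0 := dd_nonneg n v t x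
  have y1 := h1 v v t x
  have y2 := h1 v w t x
  have y3 := h1 w w t x
  have y4 := h2 v v t x
  have y5 := h2 v w t x
  have y6 := h2 w w t x
  have y7 := h3 v v t x
  have y8 := h3 v w t x
  have y9 := h3 w w t x
  have y10 := h4 v v t x
  have y11 := h4 v w t x
  have y12 := h4 w w t x
  generalize nn L v t x = V at *
  generalize dd L v t x = Q at *
  generalize nn L w t x = p at *
  generalize dd L w t x = q at *
  generalize nn n w t x = a at *
  generalize dd n w t x = b at *
  generalize nn n v t x = c at *
  generalize dd n v t x = d at *
  have P0 : 0 ≤ P := p0.trans hp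
  have mulP : ∀ {y : ℝ}, 0 ≤ y → y * p ≤ y * P := fun hy => mul_le_mul_of_nonneg_left hp hy
  have mulQ : ∀ {y : ℝ}, 0 ≤ y → y * q ≤ y * P := fun hy => mul_le_mul_of_nonneg_left hq hy
  have mul1 : ∀ {y z : ℝ}, 0 ≤ y → z ≤ 1 → y * z ≤ y := fun hy hz => mul_le_of_le_one_right hy hz
  have g1 : nn L F t x ≤ K * (1 + 3 * C₁) * (V + P ^ 2) := by
    refine le_const_mul_of_sum hK0 p1 f1 y1 y2 y3 (le_add_of_nonneg_right (sq_nonneg P)) ?_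
    have := mul1 V0 hV
    have := mul1 V0 (hp.trans hP)
    have : p * p ≤ P ^ 2 := by rw [pow_two]; exact mul_le_mul hp hp p0 P0
    linarith [sq_nonneg P]
  have g2 : dd L F t x ≤ K * (1 + 5 * C₂) * (Q + V * P + P ^ 2) := by
    refine le_const_mul_of_sum hK0 p2 f2 y4 y5 y6 (by linarith [mul_nonneg V0 P0, sq_nonneg P]) ?_
    have e1 := mul1 Q0 hV
    have e2 := mul1 Q0 (hp.trans hP)
    have e3 := mulQ V0
    have e4 : q * p ≤ P ^ 2 := by rw [pow_two]; exact mul_le_mul hq hp p0 P0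
    linarith [sq_nonneg P, mul_nonneg V0 P0]
  have g3 : nn n F t x ≤ K * (1 + 5 * C₃) * (c + (V + P) * a) := by
    refine le_const_mul_of_sum hK0 p3 f3 y7 y8 y9 (by linarith [mul_nonneg V0 a0, mul_nonneg P0 a0]) ?_
    have e1 := mul1 c0 hV
    have e2 := mul1 c0 (hp.trans hP)
    have e3 := mulP a0
    linarith [mul_nonneg V0 a0, mul_nonneg P0 a0]
  have g4 : dd n F t x ≤ K * (1 + 6 * C₄) * (d + c + (Q + P) * a + (V + P) * b) := by
    refine le_const_mul_of_sum hK0 p4 f4 y10 y11 y12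
      (by linarith [mul_nonneg V0 b0, mul_nonneg P0 b0, mul_nonneg Q0 a0, mul_nonneg P0 a0]) ?_
    have e1 := mul1 d0 hV
    have e2 := mul1 c0 hQ
    have e3 := mul1 d0 (hp.trans hP)
    have e4 := mul1 c0 (hq.trans hP)
    have e5 := mulP b0
    have e6 := mulQ a0
    linarith [mul_nonneg V0 b0, mul_nonneg P0 b0, mul_nonneg Q0 a0, mul_nonneg P0 a0]
  have toM : ∀ {Y Z m : ℝ}, 0 ≤ Z → m ≤ M → Y ≤ m * Z → Y ≤ M * Z := fun hZ hm h =>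
    h.trans (mul_le_mul_of_nonneg_right hm hZ)
  have n1 : 0 ≤ K * (1 + 3 * C₁) := by positivity
  have n2 : 0 ≤ K * (1 + 5 * C₂) := by positivity
  have n3 : 0 ≤ K * (1 + 5 * C₃) := by positivity
  have n4 : 0 ≤ K * (1 + 6 * C₄) := by positivity
  replace g1 := toM (by positivity) (by linarith) g1
  replace g2 := toM (by positivity) (by linarith) g2
  replace g3 := toM (by positivity) (by linarith) g3
  replace g4 := toM (by positivity) (by linarith) g4
  have nF := nn_nonneg n F t x
  have dF := dd_nonneg n F t x
  have r1 := mul_le_mul_of_nonneg_left g1 b0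
  have r2 := mul_le_mul_of_nonneg_left g2 a0
  have r3 := mul_le_mul hq g3 nF P0
  have r4 := mul_le_mul hp g4 dF P0
  refine k.trans ?_
  rw [mul_assoc]
  refine mul_le_mul_of_nonneg_left ?_ p4
  have s1 : b * (V + P ^ 2) + a * (Q + V * P + P ^ 2) + P * (c + (V + P) * a)
      + P * (d + c + (Q + P) * a + (V + P) * b) ≤ 5 * ((b + a) * (V + Q + P ^ 2) + P * (c + d)) := by
    have e1 := mul1 (mul_nonneg a0 V0) hP
    have e2 := mul1 (mul_nonneg a0 Q0) hP
    have e3 := mul1 (mul_nonneg b0 V0) hP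
    have := mul_nonneg a0 V0
    have := mul_nonneg a0 Q0
    have := mul_nonneg b0 V0
    have := mul_nonneg b0 Q0
    have := mul_nonneg a0 (sq_nonneg P)
    have := mul_nonneg b0 (sq_nonneg P)
    have := mul_nonneg P0 c0
    have := mul_nonneg P0 d0
    linarith
  have s2 := mul_le_mul_of_nonneg_left s1 hM0
  linarith

/-! ### The integrated estimate of the nonlinearity -/

theorem Reduced.isDiv_v {c₁ c₂ T : ℝ} {g : Fin 3 → ℝ} {h : Fin 4 → ℝ} {a b v w : Fld}
    (H : Reduced c₁ c₂ g h T a b v w) : IsDiv v :=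
  ⟨a, b, H.testa, H.testb, H.v_eq.symm⟩

theorem Reduced.isDiv_w {c₁ c₂ T : ℝ} {g : Fin 3 → ℝ} {h : Fin 4 → ℝ} {a b v w : Fld}
    (H : Reduced c₁ c₂ g h T a b v w) : IsDiv w :=
  ⟨-b, a, H.testb.neg, H.testa, by rw [← H.w_eq, map_neg]; ring⟩

theorem test_zero : Test 0 := test_iff.2 ⟨0, fun _ _ _ => rfl⟩

/-- For a free wave, the weighted norms are bounded by the energy. -/
theorem XN_slow_le {c₂ : ℝ} (hc₂ : 0 < c₂) (k : ℕ) : ∃ C : ℝ, 0 ≤ C ∧ ∀ T t w, 0 < T → IsDiv w →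
    Van T univ (Box c₂ w - Lap 0) → t ∈ Icc 0 T → XN c₂ k t w ≤ C * EN (k + 1) t w := by
  obtain ⟨C, h0, h⟩ := XN_le hc₂ k
  refine ⟨C, h0, fun T t w hT hw hv ht => (h t w hw ht.1).trans (le_of_eq ?_)⟩
  have e : ∀ β, I t (dot (Box c₂ (Pot (Z β w))) (Box c₂ (Pot (Z β w)))) = 0 := fun β => by
    have h1 := van_Box_sub_Lap hT hv β
    have h2 : Z β 0 = 0 := by have := Z_smul β 0 0; rwa [zero_smul, zero_smul] at this
    rw [h2] at h1
    rw [I_dot_Box_Pot (Z_isDiv β hw) test_zero h1 ht]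
    simp [dot, I]
  rw [Finset.sum_congr rfl fun β _ => e β]
  simp

/-- The pointwise decay of the low order derivatives of a solution. -/
theorem low_order_decay {c₁ c₂ : ℝ} (hc₂ : 0 < c₂) (hc : c₂ < c₁) (L : ℕ) : ∃ C : ℝ, 0 < C ∧
    ∀ T t g h a b v w, 0 < T → Reduced c₁ c₂ g h T a b v w → t ∈ Icc 0 T → ∀ x : Plane,
      nn L v t x + dd L v t x ≤ C * EN (L + 5) t v ∧
      (1 + t) * (nn L w t x + dd L w t x) ≤ C * EN (L + 5) t w ∧
      (‖x‖ ≤ c₂ * t + 1 → (1 + t) * (1 + ‖x‖) * (nn L v t x + dd L v t x) ≤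
        C * (EN (L + 5) t v + XN c₁ (L + 4) t v)) := by
  obtain ⟨A₀, z0, a0⟩ := dd_le_nn L
  obtain ⟨A₁, z1, a1⟩ := nn_le_EN (L + 1)
  obtain ⟨A₂, z2, a2⟩ := radial_weight_nn_le c₂ (L + 1)
  obtain ⟨A₃, z3, a3⟩ := XN_slow_le hc₂ (L + 2)
  obtain ⟨A₄, z4, a4⟩ := one_add_le_radial_sqrtWt hc₂
  obtain ⟨A₅, z5, a5⟩ := radial_weight_nn_le c₁ L
  obtain ⟨A₆, z6, a6⟩ := weight_dd_le c₁ L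
  obtain ⟨A₇, z7, a7⟩ := one_add_le_sqrtWt hc
  have y1 : 0 ≤ (1 + A₀) * A₁ := by positivity
  have y2 : 0 ≤ (1 + A₀) * (A₄ * (A₂ * (1 + A₃))) := by positivity
  have y3 : 0 ≤ A₇ * A₅ := by positivity
  have y4 : 0 ≤ (c₂ + 2) * (A₇ ^ 2 * A₆) := by positivity
  refine ⟨(1 + A₀) * A₁ + (1 + A₀) * (A₄ * (A₂ * (1 + A₃))) + A₇ * A₅
    + (c₂ + 2) * (A₇ ^ 2 * A₆) + 1, by positivity, fun T t g h a b v w hT H ht x => ?_⟩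
  set C := (1 + A₀) * A₁ + (1 + A₀) * (A₄ * (A₂ * (1 + A₃))) + A₇ * A₅
    + (c₂ + 2) * (A₇ ^ 2 * A₆) + 1 with hC
  have ht0 : 0 ≤ t := ht.1
  have split : ∀ f, nn L f t x + dd L f t x ≤ (1 + A₀) * nn (L + 1) f t x := fun f => by
    linarith [a0 f t x, nn_mono (Nat.le_succ L) f t x]
  have hv := H.isDiv_v
  have hw := H.isDiv_w
  refine ⟨?_, ?_, fun hx => ?_⟩
  · refine (split v).trans ?_
    have h1 := (a1 t x v hv).trans (mul_le_mul_of_nonneg_left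
      (EN_mono (by omega : L + 1 + 2 ≤ L + 5) t v) z1)
    have h2 := mul_le_mul_of_nonneg_left h1 (by positivity : 0 ≤ 1 + A₀)
    refine h2.trans ?_
    rw [← mul_assoc]
    exact mul_le_mul_of_nonneg_right (by linarith) (EN_nonneg _ _ _)
  · have h1 := a2 t x w hw
    have h2 := a3 T t w hT hw H.eqw ht
    have h3 := EN_mono (by omega : L + 1 + 1 ≤ L + 5) t w
    have h4 := EN_mono (by omega : L + 2 + 1 ≤ L + 5) t w
    have h5 : (1 + ‖x‖) * (sqrtWt c₂ t x * nn (L + 1) w t x) ≤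
        A₂ * ((1 + A₃) * EN (L + 5) t w) := h1.trans (mul_le_mul_of_nonneg_left
          (by linarith [mul_le_mul_of_nonneg_left h4 z3]) z2)
    have h6 := mul_le_mul_of_nonneg_right (a4 t x ht0) (nn_nonneg (L + 1) w t x)
    have h7 : (1 + t) * nn (L + 1) w t x ≤ A₄ * (A₂ * ((1 + A₃) * EN (L + 5) t w)) := by
      refine h6.trans ?_
      have := mul_le_mul_of_nonneg_left h5 z4.le
      linarith
    have h8 := mul_le_mul_of_nonneg_left (split w) (by linarith : 0 ≤ 1 + t)
    have h9 := mul_le_mul_of_nonneg_left h7 (by positivity : 0 ≤ 1 + A₀)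
    have h10 : (1 + A₀) * (A₄ * (A₂ * (1 + A₃))) * EN (L + 5) t w ≤ C * EN (L + 5) t w :=
      mul_le_mul_of_nonneg_right (by linarith) (EN_nonneg _ _ _)
    linarith
  · have hr := norm_nonneg x
    have h1 := a5 t x v hv
    have h2 := a6 t x v hv
    have h3 := a7 t x ht0 hx
    have h4 : (1 + t) ^ 2 ≤ A₇ ^ 2 * wt c₁ t x := by
      rw [← sqrtWt_sq, ← mul_pow]; exact pow_le_pow_left₀ (by linarith) h3 2
    set Y := EN (L + 5) t v + XN c₁ (L + 4) t v with hY
    have Y0 : 0 ≤ Y := add_nonneg (EN_nonneg _ _ _) (XN_nonneg _ _ _ _)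
    have h5 : (1 + ‖x‖) * (sqrtWt c₁ t x * nn L v t x) ≤ A₅ * Y := h1.trans
      (mul_le_mul_of_nonneg_left (add_le_add (EN_mono (by omega) t v) (XN_mono (by omega) c₁ t v)) z5)
    have h6 : wt c₁ t x * dd L v t x ≤ A₆ * Y := h2.trans (mul_le_mul_of_nonneg_left
      ((XN_mono (by omega) c₁ t v).trans (le_add_of_nonneg_left (EN_nonneg _ _ _))) z6)
    have h7 : (1 + t) * (1 + ‖x‖) * nn L v t x ≤ A₇ * (A₅ * Y) := by
      have e1 := mul_le_mul_of_nonneg_right h3 (mul_nonneg (by linarith : 0 ≤ 1 + ‖x‖) (nn_nonneg L v t x))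
      have e2 := mul_le_mul_of_nonneg_left h5 z7.le
      linarith
    have h8 : (1 + t) * (1 + ‖x‖) * dd L v t x ≤ (c₂ + 2) * (A₇ ^ 2 * (A₆ * Y)) := by
      have e0 : 1 + ‖x‖ ≤ (c₂ + 2) * (1 + t) := by nlinarith
      have e1 := mul_le_mul_of_nonneg_left e0 (by linarith : 0 ≤ 1 + t)
      have e2 := mul_le_mul_of_nonneg_right e1 (dd_nonneg L v t x)
      have e3 := mul_le_mul_of_nonneg_right h4 (dd_nonneg L v t x)
      have e4 := mul_le_mul_of_nonneg_left h6 (by positivity : 0 ≤ A₇ ^ 2)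
      have e5 : (1 + t) ^ 2 * dd L v t x ≤ A₇ ^ 2 * (A₆ * Y) := by linarith
      have e6 := mul_le_mul_of_nonneg_left e5 (by linarith : 0 ≤ c₂ + 2)
      linarith
    have h9 : (A₇ * A₅ + (c₂ + 2) * (A₇ ^ 2 * A₆)) * Y ≤ C * Y :=
      mul_le_mul_of_nonneg_right (by linarith) Y0
    linarith

/-- `∑_{|β| ≤ k} (Z^β f)²`. -/
def nnFld (k : ℕ) (f : Fld) : Fld := ∑ β ∈ multiIndices k, Z β f ^ 2

/-- `∑_{|β| ≤ k} |∇Z^β f|²`. -/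
def ddFld (k : ℕ) (f : Fld) : Fld := ∑ β ∈ multiIndices k, (D 1 (Z β f) ^ 2 + D 2 (Z β f) ^ 2)

theorem nnFld_ap (k : ℕ) (f : Fld) (t : ℝ) (x : Plane) : nnFld k f t x = nn k f t x := by
  simp only [nnFld, nn, sum_ap, pow_ap]

theorem ddFld_ap (k : ℕ) (f : Fld) (t : ℝ) (x : Plane) : ddFld k f t x = dd k f t x := by
  simp only [ddFld, dd, sum_ap, add_ap, pow_ap]

theorem test_sum {ι : Type} (s : Finset ι) {u : ι → Fld} (h : ∀ i ∈ s, Test (u i)) :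
    Test (∑ i ∈ s, u i) := by
  induction s using Finset.cons_induction with
  | empty => exact test_zero
  | cons a s ha ih =>
    rw [Finset.sum_cons]
    exact (h a (Finset.mem_cons_self _ _)).add (ih fun i hi => h i (Finset.mem_cons_of_mem hi))

theorem test_nnFld (k : ℕ) {f : Fld} (hf : IsDiv f) : Test (nnFld k f) :=
  test_sum _ fun β _ => (Z_isDiv β hf).test.sq

theorem test_ddFld (k : ℕ) {f : Fld} (hf : IsDiv f) : Test (ddFld k f) :=
  test_sum _ fun β _ => ((Z_isDiv β hf).test.D 1).sq.add ((Z_isDiv β hf).test.D 2).sq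

theorem I_nnFld_le (k : ℕ) {f : Fld} (hf : IsDiv f) (t : ℝ) : I t (nnFld k f) ≤ 2 * EN k t f := by
  rw [nnFld, (I_sum _ fun β _ => (Z_isDiv β hf).test.sq.itg t).1, EN, Finset.mul_sum]
  exact Finset.sum_le_sum fun β _ => I_sq_le (Z_isDiv β hf) t

theorem I_wt_ddFld_le (c : ℝ) (k : ℕ) {f : Fld} (hf : IsDiv f) (t : ℝ) :
    I t (wt c * ddFld k f) ≤ 4 * XN c k t f := by
  have i1 : ∀ β (a : Fin 3), Itg t (wt c * D a (Z β f) ^ 2) := fun β a =>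
    itg_wt_sq c ((Z_isDiv β hf).test.D a) t
  simp only [ddFld, Finset.mul_sum, mul_add]
  rw [(I_sum _ fun β _ => (i1 β 1).add (i1 β 2)).1, XN, Finset.mul_sum]
  refine Finset.sum_le_sum fun β _ => ?_
  rw [I_add (i1 β 1) (i1 β 2)]
  linarith [I_wt_D_sq_le c (Z_isDiv β hf) 1 t, I_wt_D_sq_le c (Z_isDiv β hf) 2 t]

theorem itg_MN (c t : ℝ) (k : ℕ) {f : Fld} (hf : IsDiv f) : Itg t (MN c t k f) :=
  (I_sum _ fun β _ => itg_MD (Z_isDiv β hf).test c t).2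

theorem itg_MDN (c t : ℝ) (k : ℕ) {f : Fld} (hf : IsDiv f) : Itg t (MDN c t k f) :=
  (I_sum _ fun β _ => (itg_MD (Z_isDiv β hf).test c t).add
    ((itg_MD ((Z_isDiv β hf).D 1).test c t).add (itg_MD ((Z_isDiv β hf).D 2).test c t))).2

theorem MN_nonneg {c t T : ℝ} (hc : 0 < c) (hT : 0 < T) {f : Fld} (h : Van T (outer c) f)
    (ht : t ∈ Icc 0 T) (k : ℕ) (x : Plane) : 0 ≤ MN c t k f t x := by
  rw [MN, sum_ap]
  exact Finset.sum_nonneg fun β _ => MD_nonneg hc (h.Z hT (isOpen_outer c) β) ht x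

theorem MDN_nonneg {c t T : ℝ} (hc : 0 < c) (hT : 0 < T) {f : Fld} (h : Van T (outer c) f)
    (ht : t ∈ Icc 0 T) (k : ℕ) (x : Plane) : 0 ≤ MDN c t k f t x := by
  rw [MDN, sum_ap]
  refine Finset.sum_nonneg fun β _ => ?_
  have h1 := h.Z hT (isOpen_outer c) β
  rw [add_ap, add_ap]
  exact add_nonneg (MD_nonneg hc h1 ht x) (add_nonneg
    (MD_nonneg hc (h1.D hT (isOpen_outer c) 1) ht x) (MD_nonneg hc (h1.D hT (isOpen_outer c) 2) ht x))

theorem fast_nn_le_MN {c₁ c₂ : ℝ} (hc₂ : 0 < c₂) (hc : c₂ < c₁) (k : ℕ) : ∃ C > 0, ∀ (t : ℝ) (f : Fld)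
    (x : Plane), 0 ≤ t → ‖x‖ ≤ c₂ * t + 1 → (1 + t) * nn k f t x ≤ C * MN c₁ t k f t x := by
  obtain ⟨C, h0, h⟩ := fast_le_MD hc₂ hc
  refine ⟨C, h0, fun t f x ht hx => ?_⟩
  rw [nn, MN, sum_ap, Finset.mul_sum, Finset.mul_sum]
  exact Finset.sum_le_sum fun β _ => h t _ x ht hx

theorem slow_nn_dd_le_MDN {c : ℝ} (hc : 0 < c) (k : ℕ) : ∃ C > 0, ∀ (t : ℝ) (f : Fld)
    (x : Plane), 0 ≤ t → ‖x‖ ≤ c * t + 1 →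
      (1 + t) * (dd k f t x + nn k f t x) ≤ C * ((1 + ‖x‖) * MDN c t k f t x) := by
  obtain ⟨C, h0, h⟩ := slow_le_MD hc
  refine ⟨C, h0, fun t f x ht hx => ?_⟩
  rw [dd, nn, MDN, sum_ap, ← Finset.sum_add_distrib, Finset.mul_sum, Finset.mul_sum, Finset.mul_sum]
  refine Finset.sum_le_sum fun β _ => ?_
  rw [add_ap, add_ap]
  linarith [h t (Z β f) x ht hx, h t (D 1 (Z β f)) x ht hx, h t (D 2 (Z β f)) x ht hx]

/-- The weights `s` and `1 + r` are distributed over the bound `k` of a product. In the application `s`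
is `1 + t`, and each of the resulting four terms is the density of an energy. -/
theorem weighted_product_le {C₀ C₁ C₂ C₃ C₄ C₅ s r B hw P E Y nv dv M D N W X : ℝ}
    (k : X ≤ C₀ * (hw * (B + P ^ 2) + P * (nv + dv))) (hs : 1 ≤ s)
    (p0 : 0 ≤ C₀) (p1 : 0 ≤ C₁) (p2 : 0 ≤ C₂) (hM : 0 ≤ M) (hdv : 0 ≤ dv) (hhw : 0 ≤ hw)
    (hB0 : 0 ≤ B) (hE : 0 ≤ E)
    (hP : s * P = C₁ * E) (hP1 : C₁ * E ≤ 1) (hB : s * (1 + r) * B ≤ C₁ * Y)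
    (hh : s * hw ≤ C₂ * ((1 + r) * M)) (hD : hw ≤ C₃ * D) (hN : s * nv ≤ C₄ * N)
    (hW : s ^ 2 * dv ≤ C₅ * W) :
    s ^ 2 * X ≤ C₀ * (C₂ * (C₁ * Y) * M + C₃ * D + C₁ * E * (C₄ * N) + C₁ * E * (C₅ * W)) := by
  have e1 : s ^ 2 * X ≤ C₀ * ((s * hw) * (s * B) + hw * (s * P) ^ 2 + (s * P) * (s * nv)
      + (s * P) * (s * dv)) := by
    have := mul_le_mul_of_nonneg_left k (sq_nonneg s)
    linarith
  refine e1.trans (mul_le_mul_of_nonneg_left ?_ p0)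
  have q0 : 0 ≤ C₁ * E := mul_nonneg p1 hE
  have t1 : s * hw * (s * B) ≤ C₂ * (C₁ * Y) * M := by
    have f1 := mul_le_mul_of_nonneg_right hh (mul_nonneg (by linarith : 0 ≤ s) hB0)
    have f2 := mul_le_mul_of_nonneg_left hB (mul_nonneg p2 hM)
    linarith
  have t2 : hw * (s * P) ^ 2 ≤ C₃ * D := by
    rw [hP]
    exact (mul_le_of_le_one_right hhw (pow_le_one₀ q0 hP1)).trans hD
  have t3 : s * P * (s * nv) ≤ C₁ * E * (C₄ * N) := by
    rw [hP]; exact mul_le_mul_of_nonneg_left hN q0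
  have t4 : s * P * (s * dv) ≤ C₁ * E * (C₅ * W) := by
    rw [hP]
    refine mul_le_mul_of_nonneg_left (le_trans ?_ hW) q0
    have : s ≤ s ^ 2 := by nlinarith
    exact mul_le_mul_of_nonneg_right this hdv
  linarith

theorem dot_self_ap (u : Fld) (t : ℝ) (x : Plane) :
    dot u u t x = D 1 u t x ^ 2 + D 2 u t x ^ 2 := by
  simp only [dot, add_ap, mul_ap, pow_two]

set_option maxHeartbeats 1000000 in
/-- The source of the wave equation for `(-Δ)⁻¹v` is controlled, up to a small multiple of the
weighted norm of `v`, by the energies and the Morawetz energies. -/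
theorem source_le {c₁ c₂ : ℝ} (hc₂ : 0 < c₂) (hc : c₂ < c₁) (g : Fin 3 → ℝ) (h : Fin 4 → ℝ)
    {n L : ℕ} (hL : n ≤ 2 * L + 1) : ∃ C > 0, ∃ δ > 0, ∀ T t a b v w, 0 < T →
      Reduced c₁ c₂ g h T a b v w → t ∈ Icc 0 T → EN (L + 5) t v + EN (L + 5) t w ≤ δ →
      t ^ 2 * ∑ β ∈ multiIndices n, I t (dot (Z β (w * nonlinFactor g h v w))
        (Z β (w * nonlinFactor g h v w))) ≤
      C * ((EN (L + 5) t v + XN c₁ (L + 4) t v) * I t (MDN c₂ t n w) + EN (n + 1) t w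
        + EN (L + 5) t w * I t (MN c₁ t n v) + EN (L + 5) t w * XN c₁ n t v) := by
  have hc₁ := hc₂.trans hc
  obtain ⟨C₀, p0, k0⟩ := dd_nonlin_le hL g h
  obtain ⟨C₁, p1, k1⟩ := low_order_decay hc₂ hc L
  obtain ⟨C₂, p2, k2⟩ := slow_nn_dd_le_MDN hc₂ n
  obtain ⟨A₃, p3, k3⟩ := dd_le_nn n
  obtain ⟨C₄, p4, k4⟩ := fast_nn_le_MN hc₂ hc n
  obtain ⟨A₅, p5, k5⟩ := one_add_le_sqrtWt hc
  set M := C₂ * C₁ + 2 * (A₃ + 1) + C₁ * C₄ + 4 * (C₁ * A₅ ^ 2) with hM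
  refine ⟨C₀ * M + 1, by positivity, 1 / C₁, by positivity, fun T t a b v w hT H ht hE => ?_⟩
  set N := w * nonlinFactor g h v w with hN
  set E := EN (L + 5) t w with hEw
  set Y := EN (L + 5) t v + XN c₁ (L + 4) t v with hY
  have E0 : 0 ≤ E := EN_nonneg _ _ _
  have Ev0 : 0 ≤ EN (L + 5) t v := EN_nonneg _ _ _
  have Y0 : 0 ≤ Y := add_nonneg Ev0 (XN_nonneg _ _ _ _)
  have ht0 : 0 ≤ t := ht.1
  have hv := H.isDiv_v
  have hw := H.isDiv_w
  have small : ∀ {e : ℝ}, e ≤ 1 / C₁ → C₁ * e ≤ 1 := fun he => by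
    have := mul_le_mul_of_nonneg_left he p1.le
    rwa [mul_one_div_cancel p1.ne'] at this
  have hE1 : C₁ * E ≤ 1 := small (by linarith)
  have hEv1 : C₁ * EN (L + 5) t v ≤ 1 := small (by linarith)
  set G : Fld := (C₂ * (C₁ * Y)) • MDN c₂ t n w + (A₃ + 1) • nnFld (n + 1) w
    + (C₁ * E * C₄) • MN c₁ t n v + (C₁ * E * A₅ ^ 2) • (wt c₁ * ddFld n v) with hG
  have vanN : Van T (outer c₂) N := by rw [hN, mul_comm]; exact H.suppw.mul_left _
  have iN : ∀ β, Itg t (dot (Z β N) (Z β N)) := fun β => by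
    have h1 : Test N := by rw [hN, mul_comm]; exact hw.test.mul_left _
    have h2 : Test (Z β N) := Z_ind (P := Test) (fun a _ hf => hf.D a) (fun _ hf => hf.S)
      (fun _ hf => hf.Om) β h1
    rw [dot]
    exact (((h2.D 1).mul_left _).add ((h2.D 2).mul_left _)).itg t
  have i1 := itg_MDN c₂ t n hw
  have i2 := (test_nnFld (n + 1) hw).itg t
  have i3 := itg_MN c₁ t n hv
  have i4 := ((test_ddFld n hv).mul_left (wt c₁)).itg t
  have iG : Itg t G := (((i1.smul _).add (i2.smul _)).add (i3.smul _)).add (i4.smul _)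
  have nMDN := MDN_nonneg hc₂ hT H.suppw ht n
  have nMN := MN_nonneg hc₁ hT H.suppv ht n
  have pt : ∀ x, t ^ 2 * dd n N t x ≤ C₀ * G t x := fun x => by
    have wd : 0 ≤ wt c₁ t x * dd n v t x := mul_nonneg (wt_pos _ _ _).le (dd_nonneg _ _ _ _)
    simp only [hG, add_ap, smul_ap, mul_ap, nnFld_ap, ddFld_ap]
    -- outside the cone of the slow wave, `N` vanishes by finite speed of propagation
    by_cases hx : ‖x‖ ≤ c₂ * t + 1
    · obtain ⟨l1, l2, l3⟩ := k1 T t g h a b v w hT H ht x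
      have l3 := l3 hx
      have hs : 1 ≤ 1 + t := by linarith
      have hs0 : 0 < 1 + t := by linarith
      have nv0 := nn_nonneg L v t x
      have dv0 := dd_nonneg L v t x
      have nw0 := nn_nonneg L w t x
      have dw0 := dd_nonneg L w t x
      set P := C₁ * E / (1 + t) with hP
      have hsP : (1 + t) * P = C₁ * E := mul_div_cancel₀ _ hs0.ne'
      have hPw : nn L w t x + dd L w t x ≤ P := (le_div_iff₀ hs0).2 (by linarith)
      have hP1 : P ≤ 1 := (div_le_one hs0).2 (by linarith)
      have kk := k0 v w t x P (by linarith) (by linarith) (by linarith) (by linarith) hP1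
      have hD : dd n w t x + nn n w t x ≤ (A₃ + 1) * nn (n + 1) w t x := by
        linarith [k3 w t x, nn_mono (Nat.le_succ n) w t x]
      have hW : (1 + t) ^ 2 * dd n v t x ≤ A₅ ^ 2 * (wt c₁ t x * dd n v t x) := by
        have h1 := pow_le_pow_left₀ (by linarith) (k5 t x ht0 hx) 2
        rw [mul_pow, sqrtWt_sq] at h1
        rw [← mul_assoc]
        exact mul_le_mul_of_nonneg_right h1 (dd_nonneg _ _ _ _)
      have fin := weighted_product_le kk hs p0 p1.le p2.le (nMDN x) (dd_nonneg n v t x)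
        (add_nonneg (dd_nonneg n w t x) (nn_nonneg n w t x)) (add_nonneg nv0 dv0) E0 hsP hE1 l3
        (k2 t w x ht0 hx) hD (k4 t v x ht0 hx) hW
      have h1 : t ^ 2 * dd n N t x ≤ (1 + t) ^ 2 * dd n N t x :=
        mul_le_mul_of_nonneg_right (pow_le_pow_left₀ ht0 (by linarith) 2) (dd_nonneg _ _ _ _)
      refine h1.trans (fin.trans (le_of_eq ?_))
      ring
    · have hz : dd n N t x = 0 := Finset.sum_eq_zero fun β _ => by
        have h1 := vanN.Z hT (isOpen_outer c₂) β
        rw [h1.D hT (isOpen_outer c₂) 1 t ht x (not_le.1 hx),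
          h1.D hT (isOpen_outer c₂) 2 t ht x (not_le.1 hx)]
        norm_num
      rw [hz, mul_zero]
      have z1 : 0 ≤ C₂ * (C₁ * Y) := mul_nonneg p2.le (mul_nonneg p1.le Y0)
      have z2 : 0 ≤ C₁ * E := mul_nonneg p1.le E0
      exact mul_nonneg p0 (add_nonneg (add_nonneg (add_nonneg (mul_nonneg z1 (nMDN x))
        (mul_nonneg (by linarith) (nn_nonneg (n + 1) w t x)))
        (mul_nonneg (mul_nonneg z2 p4.le) (nMN x))) (mul_nonneg (mul_nonneg z2 (sq_nonneg _)) wd))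
  have hI : t ^ 2 * ∑ β ∈ multiIndices n, I t (dot (Z β N) (Z β N)) ≤ C₀ * I t G := by
    rw [← (I_sum _ fun β _ => iN β).1, ← I_smul, ← I_smul]
    refine I_mono ((I_sum _ fun β _ => iN β).2.smul _) (iG.smul _) fun x => ?_
    rw [smul_ap, smul_ap, sum_ap]
    simp only [dot_self_ap]
    exact pt x
  refine hI.trans ?_
  have eG : I t G = C₂ * (C₁ * Y) * I t (MDN c₂ t n w) + (A₃ + 1) * I t (nnFld (n + 1) w)
      + C₁ * E * C₄ * I t (MN c₁ t n v) + C₁ * E * A₅ ^ 2 * I t (wt c₁ * ddFld n v) := by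
    rw [hG, I_add (((i1.smul _).add (i2.smul _)).add (i3.smul _)) (i4.smul _),
      I_add ((i1.smul _).add (i2.smul _)) (i3.smul _), I_add (i1.smul _) (i2.smul _)]
    simp only [I_smul]
  have b2 := mul_le_mul_of_nonneg_left (I_nnFld_le (n + 1) hw t) (by linarith : 0 ≤ A₃ + 1)
  have b4 := mul_le_mul_of_nonneg_left (I_wt_ddFld_le c₁ n hv t)
    (by positivity : 0 ≤ C₁ * E * A₅ ^ 2)
  have n1 : 0 ≤ Y * I t (MDN c₂ t n w) := mul_nonneg Y0 (I_nonneg nMDN)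
  have n2 : 0 ≤ EN (n + 1) t w := EN_nonneg _ _ _
  have n3 : 0 ≤ E * I t (MN c₁ t n v) := mul_nonneg E0 (I_nonneg nMN)
  have n4 : 0 ≤ E * XN c₁ n t v := mul_nonneg E0 (XN_nonneg _ _ _ _)
  generalize I t (MDN c₂ t n w) = J₁ at *
  generalize I t (MN c₁ t n v) = J₃ at *
  generalize XN c₁ n t v = J₄ at *
  generalize EN (n + 1) t w = J₂ at *
  have a1 : 0 ≤ C₂ * C₁ := by positivity
  have a2 : 0 ≤ 2 * (A₃ + 1) := by positivity
  have a3 : 0 ≤ C₁ * C₄ := by positivity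
  have a4 : 0 ≤ 4 * (C₁ * A₅ ^ 2) := by positivity
  have m : ∀ {x y : ℝ}, 0 ≤ y → x ≤ M → x * y ≤ M * y := fun hy hx => mul_le_mul_of_nonneg_right hx hy
  have m1 := m n1 (by linarith : C₂ * C₁ ≤ M)
  have m2 := m n2 (by linarith : 2 * (A₃ + 1) ≤ M)
  have m3 := m n3 (by linarith : C₁ * C₄ ≤ M)
  have m4 := m n4 (by linarith : 4 * (C₁ * A₅ ^ 2) ≤ M)
  have hGM : I t G ≤ M * (Y * J₁ + J₂ + E * J₃ + E * J₄) := by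
    rw [eG]; linarith
  have := mul_le_mul_of_nonneg_left hGM p0
  have n5 : 0 ≤ Y * J₁ + J₂ + E * J₃ + E * J₄ := by positivity
  linarith

theorem I_MN_mono {c t T : ℝ} (hc : 0 < c) (hT : 0 < T) {f : Fld} (hf : IsDiv f)
    (h : Van T (outer c) f) (ht : t ∈ Icc 0 T) {k l : ℕ} (hkl : k ≤ l) :
    I t (MN c t k f) ≤ I t (MN c t l f) :=
  I_mono (itg_MN c t k hf) (itg_MN c t l hf) fun x => by
    rw [MN, MN, sum_ap, sum_ap]
    exact Finset.sum_le_sum_of_subset_of_nonneg (multiIndices_mono hkl)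
      fun β _ _ => MD_nonneg hc (h.Z hT (isOpen_outer c) β) ht x

/-- The weighted norm of the fast part, in terms of the energies. -/
theorem XN_fast_le {c₁ c₂ : ℝ} (hc₂ : 0 < c₂) (hc : c₂ < c₁) (g : Fin 3 → ℝ) (h : Fin 4 → ℝ)
    {n L : ℕ} (hL : n ≤ 2 * L + 1) : ∃ C > 0, ∃ δ > 0, ∀ T t a b v w, 0 < T →
      Reduced c₁ c₂ g h T a b v w → t ∈ Icc 0 T → EN (L + 5) t v + EN (L + 5) t w ≤ δ →
      XN c₁ n t v ≤ C * (EN (n + 1) t v + EN (n + 1) t w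
        + (EN (L + 5) t v + XN c₁ (L + 4) t v) * I t (MDN c₂ t n w)
        + EN (L + 5) t w * I t (MN c₁ t n v)) := by
  have hc₁ := hc₂.trans hc
  obtain ⟨C₁, p1, δ, hδ, h1⟩ := source_le hc₂ hc g h hL
  obtain ⟨C₂, p2, h2⟩ := XN_le hc₁ n
  refine ⟨2 * C₂ * (1 + C₁) + 1, by positivity, min δ (1 / (2 * (C₂ * C₁) + 1)), by positivity,
    fun T t a b v w hT H ht hE => ?_⟩
  have hv := H.isDiv_v
  have hw := H.isDiv_w
  have k1 := h1 T t a b v w hT H ht (hE.trans (min_le_left _ _))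
  have k2 := h2 t v hv ht.1
  have hN : Test (w * nonlinFactor g h v w) := by rw [mul_comm]; exact hw.test.mul_left _
  rw [Finset.sum_congr rfl fun β _ => I_dot_Box_Pot (Z_isDiv β hv) (Z_ind (P := Test)
    (fun a _ hf => hf.D a) (fun _ hf => hf.S) (fun _ hf => hf.Om) β hN)
    (van_Box_sub_Lap hT H.eqv β) ht] at k2
  have e1 : EN (L + 5) t w ≤ 1 / (2 * (C₂ * C₁) + 1) := by
    have := hE.trans (min_le_right _ _)
    linarith [EN_nonneg (L + 5) t v]
  have E0 := EN_nonneg (L + 5) t w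
  have X0 := XN_nonneg c₁ n t v
  have n1 : 0 ≤ (EN (L + 5) t v + XN c₁ (L + 4) t v) * I t (MDN c₂ t n w) :=
    mul_nonneg (add_nonneg (EN_nonneg _ _ _) (XN_nonneg _ _ _ _))
      (I_nonneg (MDN_nonneg hc₂ hT H.suppw ht n))
  have n3 : 0 ≤ EN (L + 5) t w * I t (MN c₁ t n v) :=
    mul_nonneg E0 (I_nonneg (MN_nonneg hc₁ hT H.suppv ht n))
  have n4 := EN_nonneg (n + 1) t v
  have n5 := EN_nonneg (n + 1) t w
  -- The last term of the source is absorbed in the left-hand side.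
  have absorb : C₂ * C₁ * (EN (L + 5) t w * XN c₁ n t v) ≤ XN c₁ n t v / 2 := by
    have hp : 0 < 2 * (C₂ * C₁) + 1 := by positivity
    have h3 : EN (L + 5) t w * (2 * (C₂ * C₁) + 1) ≤ 1 := (le_div_iff₀ hp).1 e1
    have h4 : 2 * (C₂ * C₁) * EN (L + 5) t w ≤ 1 := by linarith
    have := mul_le_mul_of_nonneg_right h4 X0
    linarith
  have k3 := mul_le_mul_of_nonneg_left k1 p2
  have q1 := mul_nonneg (mul_nonneg p2 p1.le) n4
  have q2 := mul_nonneg p2 n5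
  have q3 := mul_nonneg p2 n1
  have q4 := mul_nonneg p2 n3
  linarith

/-! ### Conclusion -/

theorem le_sqrt_mul_of_sq_le {a C b : ℝ} (hC : 0 ≤ C) (h : a ^ 2 ≤ C * b) : a ≤ √C * √b := by
  rw [← Real.sqrt_mul hC]; exact Real.le_sqrt_of_sq_le h

theorem sqrt_le_of_terms {E M e x F N : ℝ} (hE : 0 ≤ E) (hM : 0 ≤ M) (he : 0 ≤ e) (hx : 0 ≤ x)
    (hF : 0 ≤ F) (hN : 0 ≤ N) :
    √(E + M * (e + x ^ 2) + F * N) ≤ √E + √M * (√e + x) + √F * √N := by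
  refine Real.sqrt_le_iff.2 ⟨by positivity, ?_⟩
  have h1 := Real.sq_sqrt hE
  have h2 := Real.sq_sqrt hM
  have h3 := Real.sq_sqrt he
  have h4 := Real.sq_sqrt hF
  have h5 := Real.sq_sqrt hN
  have n1 := Real.sqrt_nonneg E
  have n2 := Real.sqrt_nonneg M
  have n3 := Real.sqrt_nonneg e
  have n4 := Real.sqrt_nonneg F
  have n5 := Real.sqrt_nonneg N
  generalize √E = E' at *
  generalize √M = M' at *
  generalize √e = e' at *
  generalize √F = F' at *
  generalize √N = N' at *
  subst h1 h2 h3 h4 h5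
  have : 0 ≤ 2 * (M' ^ 2 * (e' * x)) + 2 * (E' * (M' * (e' + x))) + 2 * (E' * (F' * N'))
    + 2 * (M' * (e' + x) * (F' * N')) := by positivity
  linarith

/-- The bounds for the squared weighted norms are collected in the shape of the theorem. -/
theorem chi_combine {A₁ A₂ B₁ B₂ q K K' χ₁ χ₂ χm E Em Edf Mdf Mcf X₁ X₂ Xm ev ew fv fw J₁ J₃ : ℝ}
    (hA₁ : 0 ≤ A₁) (hA₂ : 0 ≤ A₂) (hB₁ : 0 ≤ B₁) (hB₂ : 0 ≤ B₂) (hK : 0 ≤ K) (hK' : 0 ≤ K')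
    (c1 : χ₁ ^ 2 ≤ A₁ * X₁) (c2 : χ₂ ^ 2 ≤ A₂ * X₂) (x2 : X₂ ≤ B₂ * ew)
    (x1 : X₁ ≤ B₁ * (ev + ew + (fv + Xm) * J₁ + fw * J₃)) (hxm : Xm ≤ 3 * χm ^ 2)
    (he : ev + ew ≤ K * E) (hf : fv + fw ≤ K * Em) (hg : fw ≤ K' * Edf) (j1 : J₁ ≤ Mdf)
    (j3 : J₃ ≤ Mcf) (ev0 : 0 ≤ ev) (fw0 : 0 ≤ fw)
    (J0 : 0 ≤ J₁) (J0' : 0 ≤ J₃) (E0 : 0 ≤ E) (Em0 : 0 ≤ Em) (Ed0 : 0 ≤ Edf)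
    (χm0 : 0 ≤ χm) (hq : A₁ * (B₁ * (K + 3 + K')) + A₂ * (B₂ * K) ≤ q) :
    χ₁ + χ₂ ≤ 2 * √q * (√E + √Mdf * (√Em + χm) + √Edf * √Mcf) := by
  have Md0 : 0 ≤ Mdf := J0.trans j1
  have Mc0 : 0 ≤ Mcf := J0'.trans j3
  set R := E + Mdf * (Em + χm ^ 2) + Edf * Mcf with hR
  have r1 : 0 ≤ Mdf * (Em + χm ^ 2) := by positivity
  have r2 : 0 ≤ Edf * Mcf := by positivity
  have R0 : 0 ≤ R := by positivity
  have q0 : 0 ≤ q := le_trans (by positivity) hq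
  have t1 : (fv + Xm) * J₁ ≤ (K + 3) * (Mdf * (Em + χm ^ 2)) := by
    have h1 : fv + Xm ≤ (K + 3) * (Em + χm ^ 2) := by
      have := mul_nonneg hK (sq_nonneg χm)
      linarith
    have := mul_le_mul h1 j1 J0 (by positivity)
    linarith
  have t2 : fw * J₃ ≤ K' * (Edf * Mcf) := by
    have := mul_le_mul hg j3 J0' (by positivity)
    linarith
  have t3 : ev + ew + (fv + Xm) * J₁ + fw * J₃ ≤ (K + 3 + K') * R := by
    have e1 := mul_nonneg (by linarith : 0 ≤ 3 + K') E0
    have e2 := mul_nonneg hK' r1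
    have e3 := mul_nonneg (by linarith : 0 ≤ K + 3) r2
    linarith
  have s1 : χ₁ ^ 2 ≤ q * R := by
    refine c1.trans ?_
    have h1 := mul_le_mul_of_nonneg_left (x1.trans (mul_le_mul_of_nonneg_left t3 hB₁)) hA₁
    have h2 := mul_le_mul_of_nonneg_right hq R0
    have h3 : 0 ≤ A₂ * (B₂ * K) * R := by positivity
    linarith
  have s2 : χ₂ ^ 2 ≤ q * R := by
    refine c2.trans ?_
    have h0 : ew ≤ K * R := by
      have := mul_nonneg hK (add_nonneg r1 r2)
      linarith
    have h1 := mul_le_mul_of_nonneg_left (x2.trans (mul_le_mul_of_nonneg_left h0 hB₂)) hA₂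
    have h2 := mul_le_mul_of_nonneg_right hq R0
    have h3 : 0 ≤ A₁ * (B₁ * (K + 3 + K')) * R := by positivity
    linarith
  have f1 := le_sqrt_mul_of_sq_le q0 s1
  have f2 := le_sqrt_mul_of_sq_le q0 s2
  have f3 := mul_le_mul_of_nonneg_left (sqrt_le_of_terms E0 Md0 Em0 χm0 Ed0 Mc0) (Real.sqrt_nonneg q)
  linarith

end ElasticWave

end

open ElasticWave in
theorem lemma6p9 (κ : ℕ) (hκ : 14 < κ) (c₁ c₂ : ℝ) (hc₂ : 0 < c₂) (hc : c₂ < c₁)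
    (g : Fin 3 → ℝ) (h : Fin 4 → ℝ) (hg0 : g 0 = 0) (hg2 : g 2 = 0) (hh0 : h 0 = 0) :
    ∃ δ > 0, ∃ C > 0, ∀ (T : ℝ) (U : ElasticWave.VField), 0 < T →
      ElasticWave.IsSolution c₁ c₂ g h T U →
      ∀ t ∈ Set.Icc 0 T, ElasticWave.energy c₁ c₂ (κ / 2 + 5) U t ≤ δ →
        ElasticWave.chi c₁ c₂ κ U t ≤
          C * (√(ElasticWave.energy c₁ c₂ κ U t)
            + √(ElasticWave.morawetzDf c₂ κ (ElasticWave.df U) t)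
                * (√(ElasticWave.energy c₁ c₂ (κ / 2 + 5) U t)
                  + ElasticWave.chi c₁ c₂ (κ / 2 + 5) U t)
            + √(ElasticWave.energyDf c₂ (κ / 2 + 5) (ElasticWave.df U) t)
                * √(ElasticWave.morawetzCf c₁ κ (ElasticWave.cf U) t))
        ∧ ElasticWave.chiPart c₂ κ (ElasticWave.df U) t ≤
            C * √(ElasticWave.energyDf c₂ κ (ElasticWave.df U) t) := by
  have hc₁ := hc₂.trans hc
  obtain ⟨B₁, p1, δ, hδ, h1⟩ := XN_fast_le hc₂ hc g h
    (show κ - 2 ≤ 2 * (κ / 2 - 1) + 1 by omega)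
  obtain ⟨B₂, p2, h2⟩ := XN_slow_le hc₂ (κ - 2)
  set A : ℝ := 3 * (multiIndices (κ - 2)).card with hA
  have A0 : 0 ≤ A := by positivity
  set K := 4 * (1 + 2 / c₂ ^ 2) with hK
  have K0 : 0 < K := by positivity
  set K' := 2 * (1 + 1 / c₂ ^ 2) with hK'
  have K0' : 0 < K' := by positivity
  set q := A * (B₁ * (K + 3 + K')) + A * (B₂ * K) with hq
  refine ⟨δ / K, by positivity, 2 * √q + √(A * (B₂ * K')) + 1, by positivity,
    fun T U hT hU t ht hE => ?_⟩
  obtain ⟨a, b, v, w, rfl, H⟩ := hU.reduced hc₂ hc hT hg0 hg2 hh0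
  have hv := H.isDiv_v
  have hw := H.isDiv_w
  have ecf : cf (vec a b) = cfOf v := by
    have := cf_vec (a := a) (b := b) (by rw [H.v_eq]; exact hv.test)
    rwa [H.v_eq] at this
  have edf : df (vec a b) = dfOf w := by
    have := df_vec (a := a) (b := b) (by rw [H.w_eq]; exact hw.test)
    rwa [H.w_eq] at this
  have en := fun k => EN_add_EN_le_energy hc₂ hc H.testa H.testb k t
  simp only [H.v_eq, H.w_eq, ← hK] at en
  have ed := fun k => EN_le_energyDf hc₂ hw k t
  simp only [← hK'] at ed
  have i1 : κ - 2 + 1 = κ - 1 := by omega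
  have i2 : κ / 2 - 1 + 5 = κ / 2 + 5 - 1 := by omega
  have i3 : κ / 2 - 1 + 4 = κ / 2 + 5 - 2 := by omega
  rw [i1, i2, i3] at h1
  rw [i1] at h2
  have hsmall : EN (κ / 2 + 5 - 1) t v + EN (κ / 2 + 5 - 1) t w ≤ δ := by
    refine (en (κ / 2 + 5)).trans ?_
    have := mul_le_mul_of_nonneg_left hE K0.le
    rwa [mul_div_cancel₀ _ K0.ne'] at this
  have x1 := h1 T t a b v w hT H ht hsmall
  have x2 := h2 T t w hT hw H.eqw ht
  have pos : ∀ {y z s : ℝ}, 0 < s → 0 ≤ y → y ≤ s * z → 0 ≤ z := fun hs hy h =>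
    nonneg_of_mul_nonneg_right (hy.trans h) hs
  have nE := fun k => pos K0 (add_nonneg (EN_nonneg (k - 1) t v) (EN_nonneg (k - 1) t w)) (en k)
  have nD := fun k => pos K0' (EN_nonneg (k - 1) t w) (ed k)
  have c1 := sq_le_XN hv c₁ (κ - 2) t
  have c2 := sq_le_XN hw c₂ (κ - 2) t
  rw [← hA, ← chiPart_cfOf hv c₁ κ t] at c1
  rw [← hA, ← chiPart_dfOf hw c₂ κ t] at c2
  have xm := XN_le_sq hv c₁ (κ / 2 + 5 - 2) t
  rw [← chiPart_cfOf hv c₁ (κ / 2 + 5) t] at xm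
  have n1 : 0 ≤ chiPart c₁ (κ / 2 + 5) (cfOf v) t := Finset.sum_nonneg fun _ _ => Real.sqrt_nonneg _
  have n2 : 0 ≤ chiPart c₂ (κ / 2 + 5) (dfOf w) t := Finset.sum_nonneg fun _ _ => Real.sqrt_nonneg _
  rw [chi, chi, ecf, edf]
  have xm' : XN c₁ (κ / 2 + 5 - 2) t v ≤ 3 * (chiPart c₁ (κ / 2 + 5) (cfOf v) t
      + chiPart c₂ (κ / 2 + 5) (dfOf w) t) ^ 2 := xm.trans (mul_le_mul_of_nonneg_left
    (pow_le_pow_left₀ n1 (le_add_of_nonneg_right n2) 2) (by norm_num))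
  have main := chi_combine A0 A0 p1.le p2 K0.le K0'.le c1 c2 x2 x1 xm' (en κ) (en (κ / 2 + 5))
    (ed (κ / 2 + 5)) (I_MDN_le hc₂ hw hT H.suppw ht κ)
    ((I_MN_mono hc₁ hT hv H.suppv ht (by omega)).trans (I_MN_le hc₁ hv hT H.suppv ht κ))
    (EN_nonneg _ _ _) (EN_nonneg _ _ _)
    (I_nonneg (MDN_nonneg hc₂ hT H.suppw ht _)) (I_nonneg (MN_nonneg hc₁ hT H.suppv ht _))
    (nE κ) (nE (κ / 2 + 5)) (nD (κ / 2 + 5)) (add_nonneg n1 n2) hq.ge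
  refine ⟨main.trans (mul_le_mul_of_nonneg_right ?_ ?_), ?_⟩
  · linarith [Real.sqrt_nonneg (A * (B₂ * K'))]
  · positivity
  · have s : chiPart c₂ κ (dfOf w) t ^ 2 ≤ A * (B₂ * K') * energyDf c₂ κ (dfOf w) t := by
      refine c2.trans ?_
      have := mul_le_mul_of_nonneg_left (x2.trans (mul_le_mul_of_nonneg_left (ed κ) p2)) A0
      linarith
    refine (le_sqrt_mul_of_sq_le (by positivity) s).trans (mul_le_mul_of_nonneg_right ?_
      (Real.sqrt_nonneg _))
    linarith [Real.sqrt_nonneg q]
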